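/- Let $m>0$, $\beta\in\mathbb R\setminus\{0\}$, $Q_\pm\in\mathbb Z$, $\gamma=\beta^2/16$. At a fixed position let $(\varphi,\Pi)$ be smooth real functions of $t\in\mathbb R$ with $\varphi(t)\to 2\pi Q_\pm/\beta$ as $t\to\pm\infty$ and $\Pi(t)\to0$ as $|t|\to\infty$, the limits being approached in the Schwartz sense. The bracket of functionals of $(\varphi,\Pi)$ is $$\{F,G\}_T=\int_{\mathbb R}\Big(\frac{\delta F}{\delta\varphi(s)}\frac{\delta G}{\delta\Pi(s)}-\frac{\delta F}{\delta\Pi(s)}\frac{\delta G}{\delta\varphi(s)}\Big)ds ,$$ i.e. $\{\varphi(t),\Pi(\tau)\}_T=\delta(t-\tau)$. Let $\sigma_1,\sigma_2,\sigma_3$ be the Pauli matrices, $k_0(\lambda)=\frac m4(\lambda+\lambda^{-1})$, $k_1(\lambda)=\frac m4(\lambda-\lambda^{-1})$, $$V(t,\lambda)=\tfrac{i\beta}{4}\Pi\,\sigma_3-ik_1(\lambda)\sin\tfrac{\beta\varphi}{2}\,\sigma_1-ik_0(\lambda)\cos\tfrac{\beta\varphi}{2}\,\sigma_2 ,$$ and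 let $\mathcal T(t,\tau,\lambda)$ solve $\partial_t\mathcal T=V\mathcal T$, $\mathcal T(\tau,\tau,\lambda)=\mathbf 1$. Put $N=\frac1{\sqrt2}(\mathbf 1+i\sigma_1)$, $\mathcal E_\pm(t,\lambda)=e^{\frac{i\pi}{2}Q_\pm\sigma_3}Ne^{-ik_0(\lambda)t\sigma_3}$ and, for real $\lambda\ne0$, $$\mathcal T(\lambda)=\lim_{t\to\infty,\ \tau\to-\infty}\mathcal E_+(t,\lambda)^{-1}\,\mathcal T(t,\tau,\lambda)\,\mathcal E_-(\tau,\lambda),\qquad \mathfrak a(\lambda)=\mathcal T(\lambda)_{11}.$$ Write $A_1=A\otimes\mathbf 1$, $A_2=\mathbf 1\otimes A$, let $\{A_1,B_2\}_T$ be the matrix of brackets of entries, $(\{A_1,B_2\}_T)_{(i,k),(j,l)}=\{A_{ij},B_{kl}\}_T$, and $$r(\lambda,\mu)=-\gamma\frac{\lambda^2+\mu^2}{\lambda^2-\mu^2}(\mathbf 1\otimes\mathbf 1-\sigma_3\otimes\sigma_3)+2\gamma\frac{\lambda\mu}{\lambda^2-\mu^2}(\sigma_1\otimes\sigma_1+\sigma_2\otimes\sigma_2).$$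 Then the solution $\mathcal T(t,\tau,\lambda)$ exists for all complex $\lambda\neq0$, the limit $\mathcal T(\lambda)$ exists for all real $\lambda\ne0$, and the following hold. 1. For $\tau<t$ and all nonzero $\lambda,\mu\in\mathbb C$ with $\lambda^2\neq\mu^2$, $$\{\mathcal T_1(t,\tau,\lambda),\mathcal T_2(t,\tau,\mu)\}_T=-[\,r(\lambda,\mu),\ \mathcal T(t,\tau,\lambda)\otimes\mathcal T(t,\tau,\mu)\,].$$ 2. As distributions in real $(\lambda,\mu)$ with $\lambda\mu>0$ (the integral over $s$ in the bracket being the distributional limit of $\int_{T'}^{T}$ as $T\to\infty$, $T'\to-\infty$), $$\{\mathcal T_1(\lambda),\mathcal T_2(\mu)\}_T=-r_+(\lambda,\mu)\,\mathcal T_1(\lambda)\mathcal T_2(\mu)+\mathcal T_1(\lambda)\mathcal T_2(\mu)\,r_-(\lambda,\mu),$$ where, with $\epsilon(\lambda)=\operatorname{sgn}(\lambda^2-1)$ (the sign of $k_0'(\lambda)$), $$r_\pm(\lambda,\mu)=-\gamma\begin{pmatrix}\frac{\lambda-\mu}{\lambda+\mu}&0&0&0\\0&\mathrm{p.v.}\frac{\lambda+\mu}{\lambda-\mu}&\mp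 i\pi\epsilon(\lambda)(\lambda+\mu)\delta(\lambda-\mu)&0\\0&\pm i\pi\epsilon(\lambda)(\lambda+\mu)\delta(\lambda-\mu)&\mathrm{p.v.}\frac{\lambda+\mu}{\lambda-\mu}&0\\0&0&0&\frac{\lambda-\mu}{\lambda+\mu}\end{pmatrix}.$$ 3. As distributions in real nonzero $\lambda,\mu$ (in the same sense), $\{\mathfrak a(\lambda),\mathfrak a(\mu)\}_T=0$. 4. Let $\gamma_0=i\sigma_1$ and, for $n\ge0$, $$\gamma_{n+1}=-\tfrac{2i}{m}\,\partial_t\gamma_n\,\sigma_3-\tfrac{\beta}{m}(\varphi_t-\Pi)\gamma_n+\tfrac i2\sigma_1e^{i\beta\varphi\sigma_3}\delta_{n,1}+\tfrac i2\Big(\sum_{p=1}^{n}\gamma_p\sigma_1\gamma_{n+1-p}+\sum_{p=0}^{n-1}\gamma_p\sigma_1e^{i\beta\varphi\sigma_3}\gamma_{n-1-p}\Big)$$ (equivalently, $\sum_n\gamma_n\lambda^{-n}$ is the formal solution of the time Riccati equation of the auxiliary problem), let $J_n$, $n\ge1$, be the $(1,1)$ entry of $$-\tfrac m4\int_{\mathbb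 R}\sigma_2\big(\gamma_{n+1}+e^{i\beta\varphi\sigma_3}\gamma_{n-1}-i\sigma_1\delta_{n,1}\big)dt ,$$ $J_0=-\frac\beta2\int_{\mathbb R}\varphi_t\,dt$, and $J_{-n}[\varphi,\Pi]=J_n[-\varphi,\Pi]$ for $n\ge1$. The integrals converge absolutely and $\{J_n,J_{n'}\}_T=0$ for all $n,n'\in\mathbb Z$. -/

import Mathlib

open scoped Matrix Kronecker ContDiff Topology
open Filter MeasureTheory

noncomputable section

namespace SineGordon

/-! ### Fields at a fixed position -/

/-- A pair `(φ, Π)` of real functions of the time variable, at a fixed position. -/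
abbrev Fields : Type := (ℝ → ℝ) × (ℝ → ℝ)

/-- The phase space with charges `Qm`, `Qp`: smooth fields such that `φ → 2π Qp / β` as `t → +∞`,
`φ → 2π Qm / β` as `t → -∞` and `Π → 0` as `|t| → ∞`, the boundary values being approached in the
Schwartz sense. -/
structure IsPhasePoint (β : ℝ) (Qm Qp : ℤ) (p : Fields) : Prop where
  smooth_phi : ContDiff ℝ ∞ p.1
  smooth_Pi : ContDiff ℝ ∞ p.2
  decay_phi_right : ∀ k n : ℕ, ∃ C : ℝ, ∀ t : ℝ, 0 ≤ t →
    |t| ^ k * |iteratedDeriv n (fun s => p.1 s - 2 * Real.pi * Qp / β) t| ≤ C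
  decay_phi_left : ∀ k n : ℕ, ∃ C : ℝ, ∀ t : ℝ, t ≤ 0 →
    |t| ^ k * |iteratedDeriv n (fun s => p.1 s - 2 * Real.pi * Qm / β) t| ≤ C
  decay_Pi : ∀ k n : ℕ, ∃ C : ℝ, ∀ t : ℝ, |t| ^ k * |iteratedDeriv n p.2 t| ≤ C

/-! ### The equal-space Poisson bracket `{φ(t), Π(τ)} = δ(t - τ)` -/

/-- `a = δF/δφ` and `b = δF/δΠ` at `p`: for all test functions `u`, `v`, the derivative of
`F (φ + ε u, Π + ε v)` at `ε = 0` is `∫ (a u + b v)`. Such `a`, `b` are unique almost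
everywhere. -/
def HasFunctionalDeriv (F : Fields → ℂ) (p : Fields) (a b : ℝ → ℂ) : Prop :=
  LocallyIntegrable a ∧ LocallyIntegrable b ∧
    ∀ u v : ℝ → ℝ, ContDiff ℝ ∞ u → HasCompactSupport u → ContDiff ℝ ∞ v → HasCompactSupport v →
      HasDerivAt (fun ε : ℝ => F (fun s => p.1 s + ε * u s, fun s => p.2 s + ε * v s))
        (∫ s, (a s * (u s : ℂ) + b s * (v s : ℂ))) 0

/-- The bracket `{F, G}_T` exists at `p`, as an absolutely convergent integral
`∫ (δF/δφ δG/δΠ - δF/δΠ δG/δφ) ds`, and equals `c`. -/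
def HasPoissonBracket (F G : Fields → ℂ) (p : Fields) (c : ℂ) : Prop :=
  ∃ a b a' b' : ℝ → ℂ, HasFunctionalDeriv F p a b ∧ HasFunctionalDeriv G p a' b' ∧
    Integrable (fun s => a s * b' s - b s * a' s) ∧
    ∫ s, (a s * b' s - b s * a' s) = c

/-- Smooth, compactly supported test functions of `(λ, μ)` with support in `S`. -/
def IsTestOn (S : Set (ℝ × ℝ)) (h : ℝ × ℝ → ℂ) : Prop :=
  ContDiff ℝ ∞ h ∧ HasCompactSupport h ∧ tsupport h ⊆ S

/-- For two families of functionals depending on a nonzero real spectral parameter, the bracket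
`{F (λ), G (μ)}_T` as a distribution in `(λ, μ) ∈ S`: all functional derivatives exist, and
`∫_{T'}^{T} (δF(λ)/δφ(s) δG(μ)/δΠ(s) - δF(λ)/δΠ(s) δG(μ)/δφ(s)) ds`, paired with any test function
`h` supported in `S`, converges to `D h` as `T → +∞`, `T' → -∞`. -/
def HasPoissonBracketDistrib (F G : ℝ → Fields → ℂ) (p : Fields) (S : Set (ℝ × ℝ))
    (D : (ℝ × ℝ → ℂ) → ℂ) : Prop :=
  ∃ a b a' b' : ℝ → ℝ → ℂ,
    (∀ x : ℝ, x ≠ 0 → HasFunctionalDeriv (F x) p (a x) (b x)) ∧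
    (∀ y : ℝ, y ≠ 0 → HasFunctionalDeriv (G y) p (a' y) (b' y)) ∧
    (∀ x y : ℝ, x ≠ 0 → y ≠ 0 → LocallyIntegrable (fun s => a x s * b' y s - b x s * a' y s)) ∧
    ∀ h : ℝ × ℝ → ℂ, IsTestOn S h →
      (∀ T T' : ℝ, Integrable (fun z : ℝ × ℝ =>
        h z * ∫ s in T'..T, (a z.1 s * b' z.2 s - b z.1 s * a' z.2 s))) ∧
      Tendsto (fun w : ℝ × ℝ => ∫ z : ℝ × ℝ,
          h z * ∫ s in w.2..w.1, (a z.1 s * b' z.2 s - b z.1 s * a' z.2 s))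
        (atTop ×ˢ atBot) (𝓝 (D h))

/-! ### Lax matrix, transition matrix and monodromy matrix in time -/

def σ₁ : Matrix (Fin 2) (Fin 2) ℂ := !![0, 1; 1, 0]
def σ₂ : Matrix (Fin 2) (Fin 2) ℂ := !![0, -Complex.I; Complex.I, 0]
def σ₃ : Matrix (Fin 2) (Fin 2) ℂ := !![1, 0; 0, -1]

/-- The matrix `exp (z σ₃)`. -/
def expσ₃ (z : ℂ) : Matrix (Fin 2) (Fin 2) ℂ := !![Complex.exp z, 0; 0, Complex.exp (-z)]

def k₀ (m : ℝ) (l : ℂ) : ℂ := (m : ℂ) / 4 * (l + 1 / l)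
def k₁ (m : ℝ) (l : ℂ) : ℂ := (m : ℂ) / 4 * (l - 1 / l)

/-- The time Lax matrix `V (t, λ)`. -/
def laxV (m β : ℝ) (p : Fields) (l : ℂ) (t : ℝ) : Matrix (Fin 2) (Fin 2) ℂ :=
  (Complex.I * (β / 4 * p.2 t : ℝ)) • σ₃
    - (Complex.I * k₁ m l * (Real.sin (β * p.1 t / 2) : ℝ)) • σ₁
    - (Complex.I * k₀ m l * (Real.cos (β * p.1 t / 2) : ℝ)) • σ₂

/-- `Ψ` solves `Ψ_t = V Ψ` on the whole line with `Ψ (τ) = 1`. -/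
def IsTransition (m β : ℝ) (p : Fields) (l : ℂ) (τ : ℝ) (Ψ : ℝ → Matrix (Fin 2) (Fin 2) ℂ) :
    Prop :=
  (∀ t i j, HasDerivAt (fun s => Ψ s i j) ((laxV m β p l t * Ψ t) i j) t) ∧ Ψ τ = 1

open Classical in
/-- The time transition matrix `𝒯 (t, τ, λ)`: the solution of `Ψ_t = V Ψ`, `Ψ (τ) = 1`, at `t`. -/
def transition (m β : ℝ) (p : Fields) (t τ : ℝ) (l : ℂ) : Matrix (Fin 2) (Fin 2) ℂ :=
  if h : ∃ Ψ, IsTransition m β p l τ Ψ then Classical.choose h t else 0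

/-- `N = (1 + i σ₁) / √2`. -/
def matN : Matrix (Fin 2) (Fin 2) ℂ :=
  ((1 / Real.sqrt 2 : ℝ) : ℂ) • (1 + Complex.I • σ₁)

/-- `ℰ (t, λ) = exp (i π Q σ₃ / 2) N exp (-i k₀(λ) t σ₃)`, for a charge `Q`. -/
def asymE (m : ℝ) (Q : ℤ) (t : ℝ) (l : ℂ) : Matrix (Fin 2) (Fin 2) ℂ :=
  expσ₃ (Complex.I * Real.pi / 2 * Q) * matN * expσ₃ (-(Complex.I * k₀ m l * t))

/-- `ℰ₊(t, λ)⁻¹ 𝒯(t, τ, λ) ℰ₋(τ, λ)`. -/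
def preMonodromy (m β : ℝ) (Qm Qp : ℤ) (p : Fields) (l : ℂ) (w : ℝ × ℝ) :
    Matrix (Fin 2) (Fin 2) ℂ :=
  (asymE m Qp w.1 l)⁻¹ * transition m β p w.1 w.2 l * asymE m Qm w.2 l

/-- The time monodromy matrix `𝒯 (λ)`, the limit `t → +∞`, `τ → -∞` of
`ℰ₊(t, λ)⁻¹ 𝒯(t, τ, λ) ℰ₋(τ, λ)`. -/
def monodromy (m β : ℝ) (Qm Qp : ℤ) (p : Fields) (x : ℝ) : Matrix (Fin 2) (Fin 2) ℂ :=
  limUnder (atTop ×ˢ atBot) (preMonodromy m β Qm Qp p (x : ℂ))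

/-- The `(1,1)` entry `𝔞 (λ)` of the time monodromy matrix. -/
def entryA (m β : ℝ) (Qm Qp : ℤ) (p : Fields) (x : ℝ) : ℂ := monodromy m β Qm Qp p x 0 0

/-! ### The classical `r`-matrix and its infinite-volume versions -/

def gam (β : ℝ) : ℂ := ((β ^ 2 / 16 : ℝ) : ℂ)

/-- The classical `r`-matrix `r (λ, μ)`. -/
def rMatrix (β : ℝ) (l n : ℂ) : Matrix (Fin 2 × Fin 2) (Fin 2 × Fin 2) ℂ :=
  (-gam β * ((l ^ 2 + n ^ 2) / (l ^ 2 - n ^ 2))) • (1 - σ₃ ⊗ₖ σ₃)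
    + (2 * gam β * (l * n / (l ^ 2 - n ^ 2))) • (σ₁ ⊗ₖ σ₁ + σ₂ ⊗ₖ σ₂)

/-- `∬_{|λ - μ| > ε} h (λ, μ) / (λ - μ) dλ dμ`. -/
def pvCut (h : ℝ × ℝ → ℂ) (ε : ℝ) : ℂ :=
  ∫ z in {z : ℝ × ℝ | ε < |z.1 - z.2|}, h z / ((z.1 - z.2 : ℝ) : ℂ)

/-- The principal value `p.v. 1 / (λ - μ)` applied to `h`. -/
def pv (h : ℝ × ℝ → ℂ) : ℂ := limUnder (𝓝[>] (0 : ℝ)) (pvCut h)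

/-- `δ (λ - μ)` applied to `h`. -/
def diagDelta (h : ℝ × ℝ → ℂ) : ℂ := ∫ x : ℝ, h (x, x)

/-- The entries of `r_±` (`s = 1` for `r₊`, `s = -1` for `r₋`) as distributions on `λ μ > 0`.
The diagonal is `-γ` times
`((λ-μ)/(λ+μ), p.v. (λ+μ)/(λ-μ), p.v. (λ+μ)/(λ-μ), (λ-μ)/(λ+μ))`, the two entries in the middle
of the antidiagonal are `-γ` times `∓ i π sgn(λ²-1) (λ+μ) δ(λ-μ)` and
`± i π sgn(λ²-1) (λ+μ) δ(λ-μ)`, and all others vanish. Here `sgn(λ²-1)` is the sign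
of `k₀'(λ)`. -/
def rInf (β s : ℝ) (I J : Fin 2 × Fin 2) (h : ℝ × ℝ → ℂ) : ℂ :=
  let dlt : ℂ := diagDelta fun z => ((Real.sign (z.1 ^ 2 - 1) * (z.1 + z.2) : ℝ) : ℂ) * h z
  if I = J then
    if I.1 = I.2 then -gam β * ∫ z : ℝ × ℝ, (((z.1 - z.2) / (z.1 + z.2) : ℝ) : ℂ) * h z
    else -gam β * pv fun z => ((z.1 + z.2 : ℝ) : ℂ) * h z
  else if I = (0, 1) ∧ J = (1, 0) then -gam β * (-(s : ℂ) * Complex.I * Real.pi * dlt)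
  else if I = (1, 0) ∧ J = (0, 1) then -gam β * ((s : ℂ) * Complex.I * Real.pi * dlt)
  else 0

/-- The `(I, J)` entry of the distribution
`-r₊(λ,μ) 𝒯₁(λ) 𝒯₂(μ) + 𝒯₁(λ) 𝒯₂(μ) r₋(λ,μ)` applied to `h`. -/
def monodromyBracket (m β : ℝ) (Qm Qp : ℤ) (p : Fields) (I J : Fin 2 × Fin 2)
    (h : ℝ × ℝ → ℂ) : ℂ :=
  let TT : ℝ × ℝ → Matrix (Fin 2 × Fin 2) (Fin 2 × Fin 2) ℂ :=
    fun z => monodromy m β Qm Qp p z.1 ⊗ₖ monodromy m β Qm Qp p z.2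
  (∑ K, rInf β (-1) K J fun z => TT z I K * h z) - ∑ K, rInf β 1 I K fun z => TT z K J * h z

/-! ### The local conserved quantities `J_n` -/

/-- `exp (i β φ(t) σ₃)`. -/
def expPhi (β : ℝ) (p : Fields) (t : ℝ) : Matrix (Fin 2) (Fin 2) ℂ :=
  expσ₃ (Complex.I * (β * p.1 t : ℝ))

/-- The coefficients `γ_n (t)` of the off-diagonal formal solution `Γ = ∑ γ_n λ⁻ⁿ`, `γ₀ = i σ₁`, of
the time Riccati equation `Γ_t = W_o + W_d Γ - Γ W_d - Γ W_o Γ`, where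
`W_d = -i (β/4) (φ_t - Π) σ₃` and `W_o = -i λ (m/4) σ₂ - i m/(4λ) σ₂ exp(i β φ σ₃)`. -/
def riccati (m β : ℝ) (p : Fields) : ℕ → ℝ → Matrix (Fin 2) (Fin 2) ℂ
  | 0 => fun _ => Complex.I • σ₁
  | n + 1 => fun t =>
      (-(2 * Complex.I / m)) • ((Matrix.of fun i j => deriv (fun s => riccati m β p n s i j) t) * σ₃)
      - ((β / m * (deriv p.1 t - p.2 t) : ℝ) : ℂ) • riccati m β p n t
      + (if n = 1 then (Complex.I / 2) • (σ₁ * expPhi β p t) else 0)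
      + (Complex.I / 2) •
        ((∑ q : Fin n, riccati m β p (q + 1) t * σ₁ * riccati m β p (n - q) t)
          + ∑ q : Fin n, riccati m β p q t * σ₁ * expPhi β p t * riccati m β p (n - 1 - q) t)
  termination_by n => n
  decreasing_by all_goals omega

/-- The density of `J_n`, for `n ≥ 1`: the `(1,1)` entry of
`-(m/4) σ₂ (γ_{n+1} + exp(i β φ σ₃) γ_{n-1} - i σ₁ δ_{n,1})`. -/
def posDensity (m β : ℝ) (n : ℕ) (p : Fields) (t : ℝ) : ℂ :=
  (-(m : ℂ) / 4) * (σ₂ * (riccati m β p (n + 1) t + expPhi β p t * riccati m β p (n - 1) t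
    - if n = 1 then Complex.I • σ₁ else 0)) 0 0

/-- The density of `J_n`, `n ∈ ℤ`; for `n < 0` it is the density of `J_{-n}` with `φ` replaced by
`-φ` and `Π` unchanged. -/
def chargeDensity (m β : ℝ) : ℤ → Fields → ℝ → ℂ
  | Int.ofNat 0, p, t => ((-(β / 2) * deriv p.1 t : ℝ) : ℂ)
  | Int.ofNat (n + 1), p, t => posDensity m β (n + 1) p t
  | Int.negSucc n, p, t => posDensity m β (n + 1) (fun s => -p.1 s, p.2) t

/-- The conserved quantity `J_n`, `n ∈ ℤ`. -/
def charge (m β : ℝ) (n : ℤ) (p : Fields) : ℂ := ∫ t, chargeDensity m β n p t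

end SineGordon

end

open SineGordon

/-! Parts 1–3 rest on one algebraic identity, `rMatrix_commutator`: the commutator of `r(λ,μ)` with
`V(λ) ⊗ 1 + 1 ⊗ V(μ)` is minus the ultralocal bracket of the two Lax matrices. By Duhamel's formula
the gradient at time `s` of an entry of `L 𝒯 R` is a propagator arriving from `s`, times `∂V/∂φ` or
`∂V/∂Π`, times a propagator leading to `s`. The identity then says that the bracket density is minus
the `s`-derivative of `r` conjugated by the propagators (`hasDerivAt_rSandwich`), so a bracket is a
difference of two boundary terms. For the transition matrix this is already the finite-volume
formula.

For real `λ` the Lax matrix is anti-Hermitian and every propagator is unitary. The dressed solutions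
`ℰ⁻¹ 𝒯` obey an equation whose coefficient is `O((1 + t²)⁻¹)`, also after taking differences in `λ`;
hence they converge at both ends and are Lipschitz in `λ` uniformly in `t`. A compactly supported
variation does not touch the propagation outside its support, so the gradient of the monodromy
matrix has the same form, with the Jost matrices as `L` and `R`.

In infinite volume the boundary terms at `T` and `T'` consist of these convergent Lipschitz matrices
placed around a kernel that carries the phases `exp(±2iT(k₀(λ) ∓ k₀(μ)))` (`rSandwich_eq_sum`). Each
term is singular at `λ = μ` although their difference is not. The difference is therefore read as a
symmetrised principal value (`pvSym_sub_mul`), which can be split into the two ends. In the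
coordinates `λμ = r²`, `λ - μ = 2rx` the phase `k₀(λ) - k₀(μ)` is linear in `x`, and the classical
limit `exp(iKx) p.v. 1/x → ±iπ δ(x)` produces the delta terms together with the sign of `k₀'`
(`tendsto_pvSym_phaseDiff`). The phase `k₀(λ) + k₀(μ)` disappears by Riemann–Lebesgue
(`tendsto_integral_phaseSum`).

For `𝔞`, the case `λμ > 0` is one entry of this formula. For opposite signs the symmetry `V(-λ) = σ₃
V(λ) σ₃` turns `𝔞(-μ)` into the lower diagonal entry `𝒯(μ)₂₂`, and in its bracket with `𝒯(λ)₁₁` the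
principal values and the delta terms cancel.

The charges are treated separately, with formal power series in `λ⁻¹`. Let `f` be the series of
lower left entries of the `γ_n`, and `f₋(λ) = -f(-λ)` the second formal solution of the same scalar
Riccati equation. The squared eigenfunctions `h = 1/(f₋ - f)`, `K = f f₋ h`, `S = (f + f₋) h`
satisfy a closed linear system in `t`, and `h` is an integrating factor of the linearised Riccati
equation. This yields the gradients of the `J_n` explicitly in `h`, `K`, `S`
(`hasDerivAt_variation`). A Lenard-type recursion then moves two units of degree from one argument
of the bracket to the other at the cost of a total derivative with equal values at both ends
(`integral_pairing_shift`). Since the gradients vanish in all nonpositive degrees, or in all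
nonnegative ones for the expansion at `λ = 0`, iterating gives zero. `J_0` depends only on the
boundary values of `φ` and has zero gradient. -/

noncomputable section

open scoped Matrix.Norms.Operator

namespace SineGordon

/-! ### Linear ordinary differential equations -/

section LinearODE

variable {𝔸 : Type*} [NormedRing 𝔸] [NormedAlgebra ℝ 𝔸]

/-- The terms of the Dyson series of `Ψ' = A Ψ`, `Ψ τ = 1`. -/
def dyson (A : ℝ → 𝔸) (τ : ℝ) : ℕ → ℝ → 𝔸
  | 0 => fun _ => 1
  | n + 1 => fun t => ∫ s in τ..t, A s * dyson A τ n s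

lemma continuous_dyson {A : ℝ → 𝔸} (hA : Continuous A) (τ : ℝ) (n : ℕ) :
    Continuous (dyson A τ n) := by
  induction n with
  | zero => exact continuous_const
  | succ n ih =>
    exact intervalIntegral.continuous_primitive
      (fun a b => (hA.mul ih).intervalIntegrable a b) τ

/-- The weight `cosh(2K(t - τ))` is chosen because integrating `K cosh(2K ·)` gives `sinh/2 ≤
cosh/2`: every step gains a factor `1/2`. Being even, it serves both sides of `τ` at once, and the
series is dominated by a geometric one. -/
lemma norm_dyson_le {A : ℝ → 𝔸} {τ R K : ℝ} (hK : 0 < K)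
    (hA : ∀ s, |s - τ| ≤ R → ‖A s‖ ≤ K) (n : ℕ) (t : ℝ) (ht : |t - τ| ≤ R) :
    ‖dyson A τ n t‖ ≤ ‖(1 : 𝔸)‖ * (1 / 2) ^ n * Real.cosh (2 * K * (t - τ)) := by
  induction n generalizing t with
  | zero =>
    simpa [dyson] using le_mul_of_one_le_right (norm_nonneg (1 : 𝔸)) (Real.one_le_cosh _)
  | succ n ih =>
    set g : ℝ → ℝ := fun s => ‖(1 : 𝔸)‖ * (1 / 2) ^ n * K * Real.cosh (2 * K * (s - τ))
    have hg : Continuous g := by fun_prop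
    have h1 : ‖∫ s in τ..t, A s * dyson A τ n s‖ ≤ |∫ s in τ..t, g s| := by
      refine intervalIntegral.norm_integral_le_abs_of_norm_le ?_ (hg.intervalIntegrable _ _)
      refine (ae_restrict_iff' measurableSet_uIoc).2 (Eventually.of_forall fun s hs => ?_)
      have hs' : |s - τ| ≤ R := by
        have := Set.abs_sub_left_of_mem_uIcc (Set.uIoc_subset_uIcc hs)
        exact this.trans ht
      calc ‖A s * dyson A τ n s‖ ≤ ‖A s‖ * ‖dyson A τ n s‖ := norm_mul_le _ _
        _ ≤ K * (‖(1 : 𝔸)‖ * (1 / 2) ^ n * Real.cosh (2 * K * (s - τ))) :=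
          mul_le_mul (hA s hs') (ih s hs') (norm_nonneg _) hK.le
        _ = g s := by simp only [g]; ring
    have h2 : ∫ s in τ..t, g s =
        ‖(1 : 𝔸)‖ * (1 / 2) ^ (n + 1) * Real.sinh (2 * K * (t - τ)) := by
      have hd : ∀ s ∈ Set.uIcc τ t, HasDerivAt
          (fun s => ‖(1 : 𝔸)‖ * (1 / 2) ^ (n + 1) * Real.sinh (2 * K * (s - τ))) (g s) s := by
        intro s _
        have := (((hasDerivAt_id s).sub_const τ).const_mul (2 * K)).sinh.const_mul
          (‖(1 : 𝔸)‖ * (1 / 2) ^ (n + 1))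
        refine this.congr_deriv ?_
        simp only [g, id]; ring
      rw [intervalIntegral.integral_eq_sub_of_hasDerivAt hd (hg.intervalIntegrable _ _)]
      simp
    refine h1.trans ?_
    rw [h2, abs_mul, abs_of_nonneg (by positivity : 0 ≤ ‖(1 : 𝔸)‖ * (1 / 2) ^ (n + 1))]
    gcongr
    rw [Real.abs_sinh, ← Real.cosh_abs]
    exact (Real.sinh_lt_cosh _).le

variable [CompleteSpace 𝔸]

lemma hasDerivAt_dyson {A : ℝ → 𝔸} (hA : Continuous A) (τ : ℝ) (n : ℕ) (t : ℝ) :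
    HasDerivAt (dyson A τ (n + 1)) (A t * dyson A τ n t) t :=
  intervalIntegral.integral_hasDerivAt_right
    ((hA.mul (continuous_dyson hA τ n)).intervalIntegrable _ _)
    ((hA.mul (continuous_dyson hA τ n)).stronglyMeasurableAtFilter _ _)
    (hA.mul (continuous_dyson hA τ n)).continuousAt

/-- Global existence for linear equations with continuous coefficients. -/
lemma exists_fundamental_solution {A : ℝ → 𝔸} (hA : Continuous A) (τ : ℝ) :
    ∃ Ψ : ℝ → 𝔸, (∀ t, HasDerivAt Ψ (A t * Ψ t) t) ∧ Ψ τ = 1 := by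
  refine ⟨fun t => ∑' n, dyson A τ n t, fun t => ?_, ?_⟩
  -- The extra `1` puts both `t` and `τ` inside the open ball on which the series is differentiated
  -- termwise.
  · set R := |t - τ| + 1
    obtain ⟨K₀, hK₀⟩ := (isCompact_closedBall τ R).exists_bound_of_continuousOn hA.continuousOn
    set K := max K₀ 1
    have hK : 0 < K := lt_max_of_lt_right one_pos
    have hAK : ∀ s, |s - τ| ≤ R → ‖A s‖ ≤ K := fun s hs =>
      (hK₀ s (by simpa [Real.dist_eq] using hs)).trans (le_max_left _ _)
    set C := ‖(1 : 𝔸)‖ * Real.cosh (2 * K * R)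
    have hb : ∀ n y, |y - τ| ≤ R → ‖dyson A τ n y‖ ≤ C * (1 / 2) ^ n := by
      intro n y hy
      refine (norm_dyson_le hK hAK n y hy).trans ?_
      have : Real.cosh (2 * K * (y - τ)) ≤ Real.cosh (2 * K * R) := by
        rw [Real.cosh_le_cosh, abs_mul (2 * K), abs_mul (2 * K)]
        exact mul_le_mul_of_nonneg_left (hy.trans (le_abs_self _)) (abs_nonneg _)
      calc _ ≤ ‖(1 : 𝔸)‖ * (1 / 2) ^ n * Real.cosh (2 * K * R) := by gcongr
        _ = _ := by ring
    have hsum : ∀ y, |y - τ| ≤ R → Summable fun n => dyson A τ n y := fun y hy =>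
      Summable.of_norm_bounded (summable_geometric_two.mul_left C) fun n => hb n y hy
    -- The derivative of each term is `A` times its predecessor; the case split supplies the value
    -- `0` for the constant term, where `n - 1` would truncate.
    let g' : ℕ → ℝ → 𝔸 := fun n y => A y * (if n = 0 then 0 else dyson A τ (n - 1) y)
    have htR : |t - τ| ≤ R := (lt_add_one _).le
    have hd := hasDerivAt_tsum_of_isPreconnected (g := dyson A τ) (g' := g')
      (u := fun n => K * (C * (2 * (1 / 2) ^ n))) (t := Metric.ball τ R) (y₀ := τ) (y := t)
      (((summable_geometric_two.mul_left 2).mul_left C).mul_left K) Metric.isOpen_ball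
      (convex_ball τ R).isPreconnected ?_ ?_ (by simp [R]; positivity)
      (hsum τ (by simp [R]; positivity)) (by simp [R, Real.dist_eq])
    · refine hd.congr_deriv ?_
      have h1 : Summable fun n => g' n t := by
        rw [← summable_nat_add_iff 1]
        simpa [g'] using (hsum t htR).mul_left (A t)
      rw [h1.tsum_eq_zero_add]
      simp only [g']
      simp only [if_true, mul_zero, zero_add, Nat.add_eq_zero_iff, one_ne_zero, and_false, if_false,
        Nat.add_sub_cancel]
      exact (hsum t htR).tsum_mul_left (A t)
    · rintro (_ | n) y _
      · simpa [g', dyson] using hasDerivAt_const y (1 : 𝔸)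
      · simpa [g'] using hasDerivAt_dyson hA τ n y
    · intro n y hy
      have hy' : |y - τ| ≤ R := by simpa [Real.dist_eq] using (Metric.mem_ball.1 hy).le
      refine (norm_mul_le _ _).trans (mul_le_mul (hAK y hy') ?_ (norm_nonneg _) hK.le)
      rcases n with _ | n
      · simp only [if_true, norm_zero]; positivity
      · simp only [Nat.add_eq_zero_iff, one_ne_zero, and_false, if_false, Nat.add_sub_cancel]
        refine (hb n y hy').trans (le_of_eq ?_)
        ring
  · beta_reduce
    rw [tsum_eq_single 0]
    · rfl
    · rintro (_ | n) hn
      · exact absurd rfl hn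
      · simp [dyson]

end LinearODE

abbrev Mat2 := Matrix (Fin 2) (Fin 2) ℂ

lemma hasDerivAt_matrix {n : Type*} [Fintype n] [DecidableEq n] {f : ℝ → Matrix n n ℂ}
    {f' : Matrix n n ℂ} {t : ℝ} :
    HasDerivAt f f' t ↔ ∀ i j, HasDerivAt (fun s => f s i j) (f' i j) t :=
  ⟨fun h i j => hasDerivAt_pi.1 (hasDerivAt_pi.1 h i) j,
    fun h => hasDerivAt_pi.2 fun i => hasDerivAt_pi.2 fun j => h i j⟩

/-- The inverse of a solution of `Ψ' = A Ψ` with values in invertible matrices. -/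
lemma hasDerivAt_inv_of_isUnit {A Ψ : ℝ → Mat2} (hΨ : ∀ t, HasDerivAt Ψ (A t * Ψ t) t)
    (hu : ∀ t, IsUnit (Ψ t)) (t : ℝ) : HasDerivAt (fun s => (Ψ s)⁻¹) (-((Ψ t)⁻¹ * A t)) t := by
  have h1 : (fun s => (Ψ s)⁻¹) = fun s => Ring.inverse (Ψ s) := by
    funext s; exact Matrix.nonsing_inv_eq_ringInverse (Ψ s)
  obtain ⟨u, hu'⟩ := hu t
  have h2 := (hasFDerivAt_ringInverse (𝕜 := ℝ) u)
  rw [hu'] at h2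
  have h3 := h2.comp_hasDerivAt t (hΨ t)
  rw [h1]
  refine h3.congr_deriv ?_
  have h4 : ((u⁻¹ : Mat2ˣ) : Mat2) = (Ψ t)⁻¹ := by
    rw [← hu', Matrix.nonsing_inv_eq_ringInverse, Ring.inverse_unit]
  have h5 : (Ψ t) * (Ψ t)⁻¹ = 1 :=
    Matrix.mul_nonsing_inv _ ((Matrix.isUnit_iff_isUnit_det _).1 ⟨u, hu'⟩)
  simp [h4, mul_assoc, h5]

/-- A solution `Y` of the adjoint equation `Y' = -Aᵀ Y` with `Y τ = 1` makes `Yᵀ Ψ` constant, so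
`Yᵀ` is a one-sided inverse; for square matrices that is enough. -/
lemma isUnit_of_hasDerivAt {A Ψ : ℝ → Mat2} (hA : Continuous A)
    (hΨ : ∀ t, HasDerivAt Ψ (A t * Ψ t) t) {τ : ℝ} (hu : Ψ τ = 1) (t : ℝ) : IsUnit (Ψ t) := by
  obtain ⟨Y, hY, hY0⟩ := exists_fundamental_solution (𝔸 := Mat2)
    (A := fun s => -(A s)ᵀ) (by fun_prop) τ
  have h : ∀ s, HasDerivAt (fun s => (Y s)ᵀ * Ψ s) 0 s := by
    intro s
    have hYT : HasDerivAt (fun s => (Y s)ᵀ) ((-(A s)ᵀ * Y s)ᵀ) s :=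
      hasDerivAt_matrix.2 fun i j => hasDerivAt_matrix.1 (hY s) j i
    refine (hYT.mul (hΨ s)).congr_deriv ?_
    simp [mul_assoc]
  have hc : (Y t)ᵀ * Ψ t = 1 := by
    have := is_const_of_deriv_eq_zero (fun s => (h s).differentiableAt) (fun s => (h s).deriv) t τ
    simpa [hY0, hu] using this
  exact IsUnit.of_mul_eq_one _ (mul_eq_one_comm.1 hc)

/-- Uniqueness for linear equations. -/
lemma eq_mul_inv_of_hasDerivAt {A Ψ Φ : ℝ → Mat2} (hΨ : ∀ t, HasDerivAt Ψ (A t * Ψ t) t)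
    (hu : ∀ t, IsUnit (Ψ t)) (hΦ : ∀ t, HasDerivAt Φ (A t * Φ t) t) (t τ : ℝ) :
    Φ t = Ψ t * (Ψ τ)⁻¹ * Φ τ := by
  have h : ∀ s, HasDerivAt (fun s => (Ψ s)⁻¹ * Φ s) 0 s := fun s =>
    ((hasDerivAt_inv_of_isUnit hΨ hu s).mul (hΦ s)).congr_deriv (by simp [mul_assoc])
  have hc := is_const_of_deriv_eq_zero (fun s => (h s).differentiableAt) (fun s => (h s).deriv) t τ
  have h5 : Ψ t * (Ψ t)⁻¹ = 1 :=
    Matrix.mul_nonsing_inv _ ((Matrix.isUnit_iff_isUnit_det _).1 (hu t))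
  calc Φ t = Ψ t * ((Ψ t)⁻¹ * Φ t) := by rw [← mul_assoc, h5, one_mul]
    _ = _ := by rw [hc, mul_assoc]

end SineGordon
end


noncomputable section

open scoped Matrix.Norms.Operator

namespace SineGordon

/-! ### Dependence of propagators on a parameter -/

lemma hasDerivAt_zero_of_sq_bound {E : Type*} [NormedAddCommGroup E] [NormedSpace ℝ E]
    {F : ℝ → E} {L : E} {C : ℝ} (h : ∀ ε, |ε| ≤ 1 → ‖F ε - F 0 - ε • L‖ ≤ C * ε ^ 2) :
    HasDerivAt F L 0 := by
  rw [hasDerivAt_iff_isLittleO]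
  have h1 : (fun ε : ℝ => F ε - F 0 - (ε - 0) • L) =O[𝓝 0] fun ε : ℝ => ε ^ 2 := by
    refine Asymptotics.IsBigO.of_bound C ?_
    filter_upwards [Metric.closedBall_mem_nhds (0 : ℝ) one_pos] with ε hε
    simpa using h ε (by simpa using hε)
  refine h1.trans_isLittleO ?_
  simpa using Asymptotics.isLittleO_pow_id (𝕜 := ℝ) (n := 2) one_lt_two

/-- `t ↦ A t * B t⁻¹`-type propagators solve the backward equation in the second variable. -/
lemma hasDerivAt_mul_inv {A U : ℝ → Mat2} (hU : ∀ t, HasDerivAt U (A t * U t) t)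
    (hu : ∀ t, IsUnit (U t)) (M : Mat2) (s : ℝ) :
    HasDerivAt (fun s => M * (U s)⁻¹) (-(M * (U s)⁻¹ * A s)) s :=
  ((hasDerivAt_const s M).mul (hasDerivAt_inv_of_isUnit hU hu s)).congr_deriv (by
    simp [mul_assoc])

lemma mul_inv_self_of_isUnit {M : Mat2} (h : IsUnit M) : M * M⁻¹ = 1 :=
  Matrix.mul_nonsing_inv _ ((Matrix.isUnit_iff_isUnit_det _).1 h)

lemma inv_mul_self_of_isUnit {M : Mat2} (h : IsUnit M) : M⁻¹ * M = 1 :=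
  Matrix.nonsing_inv_mul _ ((Matrix.isUnit_iff_isUnit_det _).1 h)

/-- Grönwall in reversed time: as a function of `x = b - s` the propagator starts at `1` and grows
at a rate at most `K`. A bound that uses only the size of the coefficients is needed because it must
hold uniformly over a family of perturbed equations. -/
lemma norm_propagator_le {A U : ℝ → Mat2} {a b K : ℝ} (hU : ∀ t, HasDerivAt U (A t * U t) t)
    (hu : ∀ t, IsUnit (U t)) (hK : ∀ s ∈ Set.Icc a b, ‖A s‖ ≤ K) {s : ℝ} (hs : s ∈ Set.Icc a b) :
    ‖U b * (U s)⁻¹‖ ≤ Real.exp (K * (b - s)) := by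
  have hd : ∀ x, HasDerivAt (fun x => U b * (U (b - x))⁻¹)
      (U b * (U (b - x))⁻¹ * A (b - x)) x := by
    intro x
    have h1 := (hasDerivAt_mul_inv hU hu (U b) (b - x)).scomp x ((hasDerivAt_id x).const_sub b)
    refine h1.congr_deriv ?_
    simp
  have := norm_le_gronwallBound_of_norm_deriv_right_le (f := fun x => U b * (U (b - x))⁻¹)
    (f' := fun x => U b * (U (b - x))⁻¹ * A (b - x)) (δ := 1) (K := K) (ε := 0) (a := 0)
    (b := b - a) (fun x _ => (hd x).continuousAt.continuousWithinAt)
    (fun x _ => (hd x).hasDerivWithinAt) (by simp [mul_inv_self_of_isUnit (hu b)])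
    (fun x hx => by
      refine (norm_mul_le _ _).trans ?_
      rw [mul_comm, add_zero]
      exact mul_le_mul_of_nonneg_right (hK _ ⟨by linarith [hx.2], by linarith [hx.1]⟩)
        (norm_nonneg _)) (b - s) ⟨by linarith [hs.2], by linarith [hs.1]⟩
  simpa [gronwallBound_ε0] using this

/-- Duhamel's formula. -/
lemma propagator_sub {A A' U U' : ℝ → Mat2} (hA : Continuous A) (hA' : Continuous A')
    (hU : ∀ t, HasDerivAt U (A t * U t) t) (hu : ∀ t, IsUnit (U t))
    (hU' : ∀ t, HasDerivAt U' (A' t * U' t) t) (hu' : ∀ t, IsUnit (U' t)) (b s : ℝ) :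
    U' b * (U' s)⁻¹ - U b * (U s)⁻¹ =
      ∫ r in s..b, U' b * (U' r)⁻¹ * (A' r - A r) * (U r * (U s)⁻¹) := by
  have hc : Continuous U := continuous_iff_continuousAt.2 fun t => (hU t).continuousAt
  have hc' : Continuous fun r => U' b * (U' r)⁻¹ :=
    continuous_iff_continuousAt.2 fun t => (hasDerivAt_mul_inv hU' hu' (U' b) t).continuousAt
  have hd : ∀ r ∈ Set.uIcc s b, HasDerivAt (fun r => -(U' b * (U' r)⁻¹ * (U r * (U s)⁻¹)))
      (U' b * (U' r)⁻¹ * (A' r - A r) * (U r * (U s)⁻¹)) r := by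
    intro r _
    refine ((hasDerivAt_mul_inv hU' hu' (U' b) r).mul
      ((hU r).mul_const ((U s)⁻¹))).neg.congr_deriv ?_
    noncomm_ring
  rw [intervalIntegral.integral_eq_sub_of_hasDerivAt hd
    (Continuous.intervalIntegrable (by fun_prop) _ _)]
  rw [mul_inv_self_of_isUnit (hu' b), ← mul_assoc (U' b * (U' s)⁻¹),
    mul_assoc (U' b * (U' s)⁻¹) (U s), mul_inv_self_of_isUnit (hu s)]
  noncomm_ring

/-- First variation of the propagator over `[a, b]` under a perturbation of the coefficients. -/
lemma hasDerivAt_propagator {A U : ℝ → ℝ → Mat2} {B : ℝ → Mat2} {a b K C : ℝ} (hab : a ≤ b)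
    (hA : ∀ ε, Continuous (A ε)) (hB : Continuous B)
    (hK : ∀ ε, |ε| ≤ 1 → ∀ s ∈ Set.Icc a b, ‖A ε s‖ ≤ K)
    (hC : ∀ ε, |ε| ≤ 1 → ∀ s ∈ Set.Icc a b, ‖A ε s - A 0 s - ε • B s‖ ≤ C * ε ^ 2)
    (hU : ∀ ε t, HasDerivAt (U ε) (A ε t * U ε t) t) (hu : ∀ ε t, IsUnit (U ε t)) :
    HasDerivAt (fun ε => U ε b * (U ε a)⁻¹)
      (∫ s in a..b, U 0 b * (U 0 s)⁻¹ * B s * (U 0 s * (U 0 a)⁻¹)) 0 := by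
  have hc : ∀ ε, Continuous (U ε) := fun ε =>
    continuous_iff_continuousAt.2 fun t => (hU ε t).continuousAt
  have hci : ∀ ε, Continuous fun s => (U ε s)⁻¹ := fun ε =>
    continuous_iff_continuousAt.2 fun t => (hasDerivAt_inv_of_isUnit (hU ε) (hu ε) t).continuousAt
  obtain ⟨M₁, hM₁⟩ := isCompact_Icc.exists_bound_of_continuousOn (s := Set.Icc a b)
    (hc 0).continuousOn
  obtain ⟨M₂, hM₂⟩ := isCompact_Icc.exists_bound_of_continuousOn (s := Set.Icc a b)
    (hci 0).continuousOn
  obtain ⟨M₃, hM₃⟩ := isCompact_Icc.exists_bound_of_continuousOn (s := Set.Icc a b)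
    hB.continuousOn
  have hamem : a ∈ Set.Icc a b := ⟨le_rfl, hab⟩
  have hbmem : b ∈ Set.Icc a b := ⟨hab, le_rfl⟩
  have hM₁0 : 0 ≤ M₁ := (norm_nonneg _).trans (hM₁ a hamem)
  have hM₂0 : 0 ≤ M₂ := (norm_nonneg _).trans (hM₂ a hamem)
  have hM₃0 : 0 ≤ M₃ := (norm_nonneg _).trans (hM₃ a hamem)
  have hK0 : 0 ≤ K := (norm_nonneg _).trans (hK 0 (by simp) a hamem)
  have hC0 : 0 ≤ C := by simpa using (norm_nonneg _).trans (hC 1 (by simp) a hamem)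
  set G := Real.exp (K * (b - a))
  have hG : ∀ ε, |ε| ≤ 1 → ∀ s ∈ Set.Icc a b, ‖U ε b * (U ε s)⁻¹‖ ≤ G := by
    intro ε hε s hs
    refine (norm_propagator_le (hU ε) (hu ε) (hK ε hε) hs).trans (Real.exp_le_exp.2 ?_)
    have := hs.1
    gcongr
  have hM : ∀ r ∈ Set.Icc a b, ∀ s ∈ Set.Icc a b, ‖U 0 r * (U 0 s)⁻¹‖ ≤ M₁ * M₂ :=
    fun r hr s hs => (norm_mul_le _ _).trans (mul_le_mul (hM₁ r hr) (hM₂ s hs) (norm_nonneg _) hM₁0)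
  have hA1 : ∀ ε, |ε| ≤ 1 → ∀ s ∈ Set.Icc a b, ‖A ε s - A 0 s‖ ≤ (C + M₃) * |ε| := by
    intro ε hε s hs
    have h1 : A ε s - A 0 s = (A ε s - A 0 s - ε • B s) + ε • B s := by abel
    rw [h1]
    refine (norm_add_le _ _).trans ?_
    have h2 := hC ε hε s hs
    have h3 : ‖ε • B s‖ ≤ |ε| * M₃ := by
      rw [norm_smul, Real.norm_eq_abs]
      exact mul_le_mul_of_nonneg_left (hM₃ s hs) (abs_nonneg _)
    have h4 : ε ^ 2 ≤ |ε| := by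
      rw [← sq_abs]; nlinarith [abs_nonneg ε]
    nlinarith
  have hdiff : ∀ ε, |ε| ≤ 1 → ∀ s ∈ Set.Icc a b,
      ‖U ε b * (U ε s)⁻¹ - U 0 b * (U 0 s)⁻¹‖ ≤ G * ((C + M₃) * |ε|) * (M₁ * M₂) * (b - a) := by
    intro ε hε s hs
    rw [propagator_sub (hA 0) (hA ε) (hU 0) (hu 0) (hU ε) (hu ε)]
    refine (intervalIntegral.norm_integral_le_of_norm_le_const
      (C := G * ((C + M₃) * |ε|) * (M₁ * M₂)) fun r hr => ?_).trans ?_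
    · rw [Set.uIoc_of_le hs.2] at hr
      have hr' : r ∈ Set.Icc a b := ⟨hs.1.trans hr.1.le, hr.2⟩
      refine (norm_mul_le _ _).trans (mul_le_mul ((norm_mul_le _ _).trans
        (mul_le_mul (hG ε hε r hr') (hA1 ε hε r hr') (norm_nonneg _) (Real.exp_pos _).le))
        (hM r hr' s hs) (norm_nonneg _) (by positivity))
    · rw [abs_of_nonneg (by linarith [hs.2] : 0 ≤ b - s)]
      have := hs.1
      gcongr
  refine hasDerivAt_zero_of_sq_bound (C := (G * (C + M₃) * (M₁ * M₂) * (b - a) * (C + M₃)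
    * (M₁ * M₂) + (M₁ * M₂) * C * (M₁ * M₂)) * (b - a)) fun ε hε => ?_
  rw [propagator_sub (hA 0) (hA ε) (hU 0) (hu 0) (hU ε) (hu ε), ← intervalIntegral.integral_smul,
    ← intervalIntegral.integral_sub]
  · refine (intervalIntegral.norm_integral_le_of_norm_le_const
      (C := (G * (C + M₃) * (M₁ * M₂) * (b - a) * (C + M₃)
    * (M₁ * M₂) + (M₁ * M₂) * C * (M₁ * M₂)) * ε ^ 2) fun r hr => ?_).trans (le_of_eq ?_)
    · rw [Set.uIoc_of_le hab] at hr
      have hr' : r ∈ Set.Icc a b := ⟨hr.1.le, hr.2⟩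
      -- Duhamel's integrand minus its linear part is a product of two factors of order `ε` (change
      -- of propagator, change of coefficient) plus the second-order remainder of the coefficient.
      have h1 : U ε b * (U ε r)⁻¹ * (A ε r - A 0 r) * (U 0 r * (U 0 a)⁻¹)
          - ε • (U 0 b * (U 0 r)⁻¹ * B r * (U 0 r * (U 0 a)⁻¹))
          = (U ε b * (U ε r)⁻¹ - U 0 b * (U 0 r)⁻¹) * (A ε r - A 0 r) * (U 0 r * (U 0 a)⁻¹)
          + U 0 b * (U 0 r)⁻¹ * (A ε r - A 0 r - ε • B r) * (U 0 r * (U 0 a)⁻¹) := by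
        simp only [sub_mul, mul_sub, mul_smul_comm, smul_mul_assoc]
        abel
      rw [h1]
      refine (norm_add_le _ _).trans ?_
      have h2 : ‖(U ε b * (U ε r)⁻¹ - U 0 b * (U 0 r)⁻¹) * (A ε r - A 0 r)
          * (U 0 r * (U 0 a)⁻¹)‖ ≤ G * ((C + M₃) * |ε|) * (M₁ * M₂) * (b - a) * ((C + M₃) * |ε|)
          * (M₁ * M₂) := by
        have hba : 0 ≤ b - a := by linarith
        refine (norm_mul_le _ _).trans (mul_le_mul ((norm_mul_le _ _).trans
          (mul_le_mul (hdiff ε hε r hr') (hA1 ε hε r hr') (norm_nonneg _) (by positivity)))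
          (hM r hr' a hamem) (norm_nonneg _) (by positivity))
      have h3 : ‖U 0 b * (U 0 r)⁻¹ * (A ε r - A 0 r - ε • B r) * (U 0 r * (U 0 a)⁻¹)‖
          ≤ (M₁ * M₂) * (C * ε ^ 2) * (M₁ * M₂) := by
        refine (norm_mul_le _ _).trans (mul_le_mul ((norm_mul_le _ _).trans
          (mul_le_mul (hM b hbmem r hr') (hC ε hε r hr') (norm_nonneg _) (by positivity)))
          (hM r hr' a hamem) (norm_nonneg _) (by positivity))
      refine (add_le_add h2 h3).trans (le_of_eq ?_)
      rw [← sq_abs ε]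
      ring
    · rw [abs_of_nonneg (by linarith)]
      ring
  · refine Continuous.intervalIntegrable ?_ _ _
    have := hc 0; have := hci ε; have := hA ε; have := hA 0
    fun_prop
  · refine Continuous.intervalIntegrable ?_ _ _
    have := hc 0; have := hci 0
    fun_prop

end SineGordon
end


noncomputable section

open scoped Matrix.Norms.Operator

namespace SineGordon

/-! ### The Lax matrix and its variations -/

/-- `∂V/∂φ`. -/
def dVphi (m β : ℝ) (p : Fields) (l : ℂ) (t : ℝ) : Mat2 :=
  -((Complex.I * k₁ m l * (β / 2 * Real.cos (β * p.1 t / 2) : ℝ)) • σ₁)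
    + (Complex.I * k₀ m l * (β / 2 * Real.sin (β * p.1 t / 2) : ℝ)) • σ₂

/-- `∂V/∂Π`. -/
def dVPi (β : ℝ) : Mat2 := (Complex.I * (β / 4 : ℝ)) • σ₃

/-- The fields `(φ + ε u, Π + ε v)`. -/
def perturb (p : Fields) (u v : ℝ → ℝ) (ε : ℝ) : Fields :=
  (fun s => p.1 s + ε * u s, fun s => p.2 s + ε * v s)

lemma perturb_zero (p : Fields) (u v : ℝ → ℝ) : perturb p u v 0 = p := by
  simp [perturb]

section
variable {m β : ℝ} {p : Fields}

lemma continuous_laxV (h1 : Continuous p.1) (h2 : Continuous p.2) (l : ℂ) :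
    Continuous (laxV m β p l) := by
  unfold laxV
  fun_prop

lemma continuous_dVphi (h1 : Continuous p.1) (l : ℂ) : Continuous (dVphi m β p l) := by
  unfold dVphi
  fun_prop

lemma abs_sin_sub_le (y : ℝ) : |Real.sin y - y| ≤ 2 * y ^ 2 := by
  have key : ∀ y : ℝ, 0 ≤ y → |Real.sin y - y| ≤ 2 * y ^ 2 := by
    intro y hy
    rw [abs_sub_comm, abs_of_nonneg (by linarith [Real.sin_le hy])]
    rcases hy.eq_or_lt with rfl | hy
    · simp
    · rcases le_or_gt y 1 with h | h
      · have := Real.sin_gt_sub_cube hy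
        nlinarith [mul_nonneg hy.le (sub_nonneg.2 h), sq_nonneg y,
          mul_nonneg (sq_nonneg y) (sub_nonneg.2 h)]
      · nlinarith [Real.neg_one_le_sin y]
  rcases le_total 0 y with h | h
  · exact key y h
  · have := key (-y) (by linarith)
    rwa [Real.sin_neg, neg_sq, ← abs_neg, show -(-Real.sin y - -y) = Real.sin y - y by ring] at this

lemma abs_cos_sub_le (y : ℝ) : |Real.cos y - 1| ≤ y ^ 2 := by
  rw [abs_sub_comm, abs_of_nonneg (by linarith [Real.cos_le_one y])]
  nlinarith [Real.one_sub_sq_div_two_le_cos (x := y), sq_nonneg y]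

lemma abs_sin_add_sub_le (x y : ℝ) :
    |Real.sin (x + y) - Real.sin x - y * Real.cos x| ≤ 3 * y ^ 2 := by
  rw [Real.sin_add, show Real.sin x * Real.cos y + Real.cos x * Real.sin y - Real.sin x
    - y * Real.cos x = Real.sin x * (Real.cos y - 1) + Real.cos x * (Real.sin y - y) by ring]
  refine (abs_add_le _ _).trans ?_
  rw [abs_mul, abs_mul]
  have h1 := mul_le_mul (Real.abs_sin_le_one x) (abs_cos_sub_le y) (abs_nonneg _) zero_le_one
  have h2 := mul_le_mul (Real.abs_cos_le_one x) (abs_sin_sub_le y) (abs_nonneg _) zero_le_one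
  linarith

lemma abs_cos_add_sub_le (x y : ℝ) :
    |Real.cos (x + y) - Real.cos x + y * Real.sin x| ≤ 3 * y ^ 2 := by
  have := abs_sin_add_sub_le (x + Real.pi / 2) y
  rw [show x + Real.pi / 2 + y = (x + y) + Real.pi / 2 by ring, Real.sin_add_pi_div_two,
    Real.sin_add_pi_div_two, Real.cos_add_pi_div_two] at this
  simpa using this

/-- `Π` enters linearly, so only the Taylor remainders of sine and cosine survive; they are
quadratic in `ε β u / 2`. -/
lemma norm_laxV_perturb_sub_le (u v : ℝ → ℝ) (l : ℂ) (ε s : ℝ) :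
    ‖laxV m β (perturb p u v ε) l s - laxV m β p l s
      - ε • (u s • dVphi m β p l s + v s • dVPi β)‖
      ≤ (‖k₁ m l‖ * ‖σ₁‖ + ‖k₀ m l‖ * ‖σ₂‖) * (3 * (β * u s / 2) ^ 2) * ε ^ 2 := by
  set x := β * p.1 s / 2
  set y := ε * (β * u s / 2)
  have hx : β * (p.1 s + ε * u s) / 2 = x + y := by simp only [x, y]; ring
  have h1 : laxV m β (perturb p u v ε) l s - laxV m β p l s
      - ε • (u s • dVphi m β p l s + v s • dVPi β)
      = -((Complex.I * k₁ m l * (Real.sin (x + y) - Real.sin x - y * Real.cos x : ℝ)) • σ₁)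
        - (Complex.I * k₀ m l * (Real.cos (x + y) - Real.cos x + y * Real.sin x : ℝ)) • σ₂ := by
    have e1 : β * p.1 s / 2 = x := rfl
    simp only [laxV, perturb, dVphi, dVPi, hx, e1]
    ext i j
    fin_cases i <;> fin_cases j <;> simp [σ₁, σ₂, σ₃, y] <;> ring
  rw [h1]
  refine (norm_sub_le _ _).trans ?_
  rw [norm_neg, norm_smul, norm_smul, norm_mul, norm_mul, norm_mul, norm_mul, Complex.norm_I,
    Complex.norm_real, Complex.norm_real, Real.norm_eq_abs, Real.norm_eq_abs, one_mul, one_mul]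
  have h2 := abs_sin_add_sub_le x y
  have h3 := abs_cos_add_sub_le x y
  calc _ ≤ ‖k₁ m l‖ * (3 * y ^ 2) * ‖σ₁‖ + ‖k₀ m l‖ * (3 * y ^ 2) * ‖σ₂‖ := by gcongr
    _ = _ := by simp only [y]; ring

lemma norm_laxV_le (l : ℂ) (s : ℝ) :
    ‖laxV m β p l s‖ ≤ |β / 4 * p.2 s| * ‖σ₃‖ + ‖k₁ m l‖ * ‖σ₁‖ + ‖k₀ m l‖ * ‖σ₂‖ := by
  unfold laxV
  refine (norm_sub_le _ _).trans (add_le_add ((norm_sub_le _ _).trans (add_le_add ?_ ?_)) ?_)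
  · rw [norm_smul, norm_mul, Complex.norm_I, Complex.norm_real, Real.norm_eq_abs, one_mul]
  · rw [norm_smul, norm_mul, norm_mul, Complex.norm_I, Complex.norm_real, Real.norm_eq_abs, one_mul]
    gcongr
    exact mul_le_of_le_one_right (norm_nonneg _) (Real.abs_sin_le_one _)
  · rw [norm_smul, norm_mul, norm_mul, Complex.norm_I, Complex.norm_real, Real.norm_eq_abs, one_mul]
    gcongr
    exact mul_le_of_le_one_right (norm_nonneg _) (Real.abs_cos_le_one _)

/-! ### The transition matrix -/

lemma isTransition_transition (h1 : Continuous p.1) (h2 : Continuous p.2) (l : ℂ) (τ : ℝ) :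
    IsTransition m β p l τ (fun t => transition m β p t τ l) := by
  have hex : ∃ Ψ, IsTransition m β p l τ Ψ := by
    obtain ⟨Ψ, hΨ, h0⟩ := exists_fundamental_solution
      (continuous_laxV (m := m) (β := β) h1 h2 l) τ
    exact ⟨Ψ, fun t => hasDerivAt_matrix.1 (hΨ t), h0⟩
  have : (fun t => transition m β p t τ l) = Classical.choose hex := by
    funext t
    simp only [transition, dif_pos hex]
  rw [this]
  exact Classical.choose_spec hex

/-- The fundamental solution normalised at `0`. -/
def fund (m β : ℝ) (p : Fields) (l : ℂ) (t : ℝ) : Mat2 := transition m β p t 0 l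

lemma hasDerivAt_fund (h1 : Continuous p.1) (h2 : Continuous p.2) (l : ℂ) (t : ℝ) :
    HasDerivAt (fund m β p l) (laxV m β p l t * fund m β p l t) t :=
  hasDerivAt_matrix.2 ((isTransition_transition h1 h2 l 0).1 t)

lemma fund_zero (h1 : Continuous p.1) (h2 : Continuous p.2) (l : ℂ) : fund m β p l 0 = 1 :=
  (isTransition_transition h1 h2 l 0).2

lemma isUnit_fund (h1 : Continuous p.1) (h2 : Continuous p.2) (l : ℂ) (t : ℝ) :
    IsUnit (fund m β p l t) :=
  isUnit_of_hasDerivAt (continuous_laxV h1 h2 l) (hasDerivAt_fund h1 h2 l) (fund_zero h1 h2 l) t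

lemma continuous_fund (h1 : Continuous p.1) (h2 : Continuous p.2) (l : ℂ) :
    Continuous (fund m β p l) :=
  continuous_iff_continuousAt.2 fun t => (hasDerivAt_fund h1 h2 l t).continuousAt

lemma hasDerivAt_mul_fund_inv (h1 : Continuous p.1) (h2 : Continuous p.2) (l : ℂ) (M : Mat2)
    (s : ℝ) : HasDerivAt (fun s => M * (fund m β p l s)⁻¹)
      (-(M * (fund m β p l s)⁻¹ * laxV m β p l s)) s :=
  hasDerivAt_mul_inv (hasDerivAt_fund h1 h2 l) (isUnit_fund h1 h2 l) M s

lemma hasDerivAt_fund_mul (h1 : Continuous p.1) (h2 : Continuous p.2) (l : ℂ) (M : Mat2)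
    (s : ℝ) : HasDerivAt (fun s => fund m β p l s * M)
      (laxV m β p l s * (fund m β p l s * M)) s :=
  ((hasDerivAt_fund h1 h2 l s).mul_const M).congr_deriv (mul_assoc _ _ _)

lemma continuous_fund_inv (h1 : Continuous p.1) (h2 : Continuous p.2) (l : ℂ) :
    Continuous fun s => (fund m β p l s)⁻¹ := by
  have h := continuous_iff_continuousAt.2 fun t =>
    (hasDerivAt_mul_fund_inv (m := m) (β := β) h1 h2 l 1 t).continuousAt
  simp only [one_mul] at h
  exact h

/-- Reduces every transition matrix to a single fundamental solution, so that the dependence on both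
end points becomes explicit. -/
lemma transition_eq (h1 : Continuous p.1) (h2 : Continuous p.2) (l : ℂ) (t τ : ℝ) :
    transition m β p t τ l = fund m β p l t * (fund m β p l τ)⁻¹ := by
  have h := isTransition_transition (m := m) (β := β) h1 h2 l τ
  have := eq_mul_inv_of_hasDerivAt (hasDerivAt_fund h1 h2 l) (isUnit_fund h1 h2 l)
    (fun t => hasDerivAt_matrix.2 (h.1 t)) t τ
  have h0 : transition m β p τ τ l = 1 := h.2
  rw [this, h0, mul_one]

lemma hasDerivAt_transition_perturb (h1 : Continuous p.1) (h2 : Continuous p.2)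
    {u v : ℝ → ℝ} (hu : Continuous u) (hv : Continuous v) (l : ℂ) {a b : ℝ} (hab : a ≤ b) :
    HasDerivAt (fun ε => transition m β (perturb p u v ε) b a l)
      (∫ s in a..b, fund m β p l b * (fund m β p l s)⁻¹ * (u s • dVphi m β p l s + v s • dVPi β)
        * (fund m β p l s * (fund m β p l a)⁻¹)) 0 := by
  have hp1 : ∀ ε, Continuous (perturb p u v ε).1 := fun ε => by unfold perturb; fun_prop
  have hp2 : ∀ ε, Continuous (perturb p u v ε).2 := fun ε => by unfold perturb; fun_prop
  obtain ⟨Mu, hMu⟩ := isCompact_Icc.exists_bound_of_continuousOn (s := Set.Icc a b) hu.continuousOn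
  obtain ⟨Mv, hMv⟩ := isCompact_Icc.exists_bound_of_continuousOn (s := Set.Icc a b) hv.continuousOn
  obtain ⟨Mp, hMp⟩ := isCompact_Icc.exists_bound_of_continuousOn (s := Set.Icc a b) h2.continuousOn
  have hB : Continuous fun s => u s • dVphi m β p l s + v s • dVPi β := by
    have := continuous_dVphi (m := m) (β := β) h1 l
    fun_prop
  have key := hasDerivAt_propagator (A := fun ε => laxV m β (perturb p u v ε) l)
    (U := fun ε => fund m β (perturb p u v ε) l) (a := a) (b := b)
    (B := fun s => u s • dVphi m β p l s + v s • dVPi β)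
    (K := |β / 4| * (Mp + Mv) * ‖σ₃‖ + ‖k₁ m l‖ * ‖σ₁‖ + ‖k₀ m l‖ * ‖σ₂‖)
    (C := (‖k₁ m l‖ * ‖σ₁‖ + ‖k₀ m l‖ * ‖σ₂‖) * (3 * (β * Mu / 2) ^ 2))
    hab (fun ε => continuous_laxV (hp1 ε) (hp2 ε) l) hB ?_ ?_
    (fun ε => hasDerivAt_fund (hp1 ε) (hp2 ε) l) (fun ε => isUnit_fund (hp1 ε) (hp2 ε) l)
  · simp only [perturb_zero] at key
    convert! key using 2 with ε
    exact transition_eq (hp1 ε) (hp2 ε) l b a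
  -- The constant `K` works for all `|ε| ≤ 1` because sine and cosine are bounded whatever `φ` is;
  -- only `Π + ε v` has to be controlled on `[a, b]`.
  · intro ε hε s hs
    refine (norm_laxV_le l s).trans ?_
    gcongr
    rw [abs_mul]
    gcongr
    refine (abs_add_le _ _).trans (add_le_add (hMp s hs) ?_)
    rw [abs_mul]
    calc |ε| * |v s| ≤ 1 * Mv := mul_le_mul hε (hMv s hs) (abs_nonneg _) zero_le_one
      _ = Mv := one_mul _
  · intro ε _ s hs
    simp only [perturb_zero]
    refine (norm_laxV_perturb_sub_le u v l ε s).trans ?_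
    have h3 : (β * u s / 2) ^ 2 ≤ (β * Mu / 2) ^ 2 := by
      have : (u s) ^ 2 ≤ Mu ^ 2 := by
        rw [← sq_abs]
        exact pow_le_pow_left₀ (abs_nonneg _) (hMu s hs) 2
      nlinarith [mul_le_mul_of_nonneg_left this (sq_nonneg β)]
    gcongr

/-- The variation of a functional `L 𝒯 R` with respect to `φ(s)`. -/
def varPhi (m β : ℝ) (p : Fields) (l : ℂ) (L R : Mat2) (s : ℝ) : Mat2 :=
  L * (fund m β p l s)⁻¹ * dVphi m β p l s * (fund m β p l s * R)

/-- The variation of a functional `L 𝒯 R` with respect to `Π(s)`. -/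
def varPi (m β : ℝ) (p : Fields) (l : ℂ) (L R : Mat2) (s : ℝ) : Mat2 :=
  L * (fund m β p l s)⁻¹ * dVPi β * (fund m β p l s * R)

lemma continuous_varPhi (h1 : Continuous p.1) (h2 : Continuous p.2) (l : ℂ) (L R : Mat2) :
    Continuous (varPhi m β p l L R) := by
  have := continuous_dVphi (m := m) (β := β) h1 l
  have := continuous_fund (m := m) (β := β) h1 h2 l
  have := continuous_fund_inv (m := m) (β := β) h1 h2 l
  unfold varPhi
  fun_prop

lemma continuous_varPi (h1 : Continuous p.1) (h2 : Continuous p.2) (l : ℂ) (L R : Mat2) :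
    Continuous (varPi m β p l L R) := by
  have := continuous_fund (m := m) (β := β) h1 h2 l
  have := continuous_fund_inv (m := m) (β := β) h1 h2 l
  unfold varPi
  fun_prop

/-- `M ↦ (L M R)_{ij}`. -/
def sandwich (L R : Mat2) (i j : Fin 2) : Mat2 →L[ℝ] ℂ :=
  LinearMap.toContinuousLinearMap
    { toFun := fun M => (L * M * R) i j
      map_add' := fun M N => by simp [mul_add, add_mul]
      map_smul' := fun c M => by simp }

/-- First variation of `(L 𝒯(b, a) R)_{ij}`. -/
lemma hasDerivAt_sandwich_transition (h1 : Continuous p.1) (h2 : Continuous p.2)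
    {u v : ℝ → ℝ} (hu : Continuous u) (hv : Continuous v) (l : ℂ) {a b : ℝ} (hab : a ≤ b)
    (L R : Mat2) (i j : Fin 2) :
    HasDerivAt (fun ε => (L * transition m β (perturb p u v ε) b a l * R) i j)
      (∫ s in a..b, (varPhi m β p l (L * fund m β p l b) ((fund m β p l a)⁻¹ * R) s i j * (u s : ℂ)
        + varPi m β p l (L * fund m β p l b) ((fund m β p l a)⁻¹ * R) s i j * (v s : ℂ))) 0 := by
  have h := (sandwich L R i j).hasFDerivAt.comp_hasDerivAt (0 : ℝ)
    (hasDerivAt_transition_perturb (m := m) (β := β) h1 h2 hu hv l hab)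
  refine h.congr_deriv ?_
  refine (ContinuousLinearMap.intervalIntegral_comp_comm (sandwich L R i j) ?_).symm.trans ?_
  rotate_left
  · congr 1
    funext s
    have : L * (fund m β p l b * (fund m β p l s)⁻¹ * (u s • dVphi m β p l s + v s • dVPi β)
        * (fund m β p l s * (fund m β p l a)⁻¹)) * R
        = u s • varPhi m β p l (L * fund m β p l b) ((fund m β p l a)⁻¹ * R) s
        + v s • varPi m β p l (L * fund m β p l b) ((fund m β p l a)⁻¹ * R) s := by
      simp only [varPhi, varPi, mul_add, add_mul, mul_smul_comm, smul_mul_assoc, mul_assoc]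
    change (L * (fund m β p l b * (fund m β p l s)⁻¹ * (u s • dVphi m β p l s + v s • dVPi β)
        * (fund m β p l s * (fund m β p l a)⁻¹)) * R) i j = _
    rw [this, Matrix.add_apply, Matrix.smul_apply, Matrix.smul_apply, Complex.real_smul,
      Complex.real_smul, mul_comm, mul_comm (v s : ℂ)]
  · refine Continuous.intervalIntegrable ?_ _ _
    have := continuous_dVphi (m := m) (β := β) h1 l
    have := continuous_fund (m := m) (β := β) h1 h2 l
    have := continuous_fund_inv (m := m) (β := β) h1 h2 l
    fun_prop

/-! ### The `r`-matrix relation -/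

/-- The fundamental Poisson relation of the Lax matrix in linear form. The `Π` term drops out on the
left since `r` commutes with `σ₃ ⊗ 1 + 1 ⊗ σ₃`; what remains is linear in the sine and cosine of
`βφ/2`, so these can be treated as free symbols and the sixteen entries are identities of rational
functions in `λ` and `μ`. -/
lemma rMatrix_commutator (m : ℝ) {l n : ℂ} (hl : l ≠ 0) (hn : n ≠ 0) (hln : l ^ 2 ≠ n ^ 2) (s : ℝ) :
    rMatrix β l n * (laxV m β p l s ⊗ₖ 1 + 1 ⊗ₖ laxV m β p n s)
      - (laxV m β p l s ⊗ₖ 1 + 1 ⊗ₖ laxV m β p n s) * rMatrix β l n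
      = -(dVphi m β p l s ⊗ₖ dVPi β - dVPi β ⊗ₖ dVphi m β p n s) := by
  have hd : l ^ 2 - n ^ 2 ≠ 0 := sub_ne_zero.2 hln
  ext ⟨i, k⟩ ⟨j, q⟩
  fin_cases i <;> fin_cases k <;> fin_cases j <;> fin_cases q <;>
  simp [rMatrix, laxV, dVphi, dVPi, σ₁, σ₂, σ₃, Matrix.mul_apply, Fintype.sum_prod_type,
    Matrix.one_apply, gam, k₀, k₁] <;>
  generalize Complex.sin (↑β * ↑(p.1 s) / 2) = S <;>
  generalize Complex.cos (↑β * ↑(p.1 s) / 2) = C <;>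
  field_simp <;> ring_nf <;> simp only [Complex.I_sq] <;> ring

end

end SineGordon
end


/-! ### The bracket density as a total derivative, and the finite-volume bracket -/

noncomputable section

open scoped Matrix.Norms.Operator

namespace SineGordon

lemma hasDerivAt_kronecker {A B : ℝ → Mat2} {A' B' : Mat2} {t : ℝ} (hA : HasDerivAt A A' t)
    (hB : HasDerivAt B B' t) :
    HasDerivAt (fun s => A s ⊗ₖ B s) (A' ⊗ₖ B t + A t ⊗ₖ B') t :=
  hasDerivAt_matrix.2 fun I J =>
    (hasDerivAt_matrix.1 hA I.1 J.1).mul (hasDerivAt_matrix.1 hB I.2 J.2)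

section
variable {m β : ℝ} {p : Fields}

/-- The primitive of the bracket density. -/
def rSandwich (m β : ℝ) (p : Fields) (l n : ℂ) (L R L' R' : Mat2) (s : ℝ) :
    Matrix (Fin 2 × Fin 2) (Fin 2 × Fin 2) ℂ :=
  ((L * (fund m β p l s)⁻¹) ⊗ₖ (L' * (fund m β p n s)⁻¹)) * rMatrix β l n
    * ((fund m β p l s * R) ⊗ₖ (fund m β p n s * R'))

/-- The factors on the left of `r` solve the backward equation and those on its right the forward
equation, so differentiation inserts the commutator of `r` with `V(λ) ⊗ 1 + 1 ⊗ V(μ)`;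
`rMatrix_commutator` replaces it by the bracket of the Lax matrices. -/
lemma hasDerivAt_rSandwich (h1 : Continuous p.1) (h2 : Continuous p.2) {l n : ℂ} (hl : l ≠ 0)
    (hn : n ≠ 0) (hln : l ^ 2 ≠ n ^ 2) (L R L' R' : Mat2) (s : ℝ) :
    HasDerivAt (rSandwich m β p l n L R L' R')
      (-(varPhi m β p l L R s ⊗ₖ varPi m β p n L' R' s
        - varPi m β p l L R s ⊗ₖ varPhi m β p n L' R' s)) s := by
  have hZ := hasDerivAt_kronecker (hasDerivAt_mul_fund_inv (m := m) (β := β) h1 h2 l L s)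
    (hasDerivAt_mul_fund_inv (m := m) (β := β) h1 h2 n L' s)
  have hX := hasDerivAt_kronecker (hasDerivAt_fund_mul (m := m) (β := β) h1 h2 l R s)
    (hasDerivAt_fund_mul (m := m) (β := β) h1 h2 n R' s)
  refine ((hZ.mul_const (rMatrix β l n)).mul hX).congr_deriv ?_
  have hr := rMatrix_commutator (β := β) (p := p) m hl hn hln s
  have e1 : (varPhi m β p l L R s ⊗ₖ varPi m β p n L' R' s
        - varPi m β p l L R s ⊗ₖ varPhi m β p n L' R' s)
      = ((L * (fund m β p l s)⁻¹) ⊗ₖ (L' * (fund m β p n s)⁻¹)) *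
        (dVphi m β p l s ⊗ₖ dVPi β - dVPi β ⊗ₖ dVphi m β p n s)
        * ((fund m β p l s * R) ⊗ₖ (fund m β p n s * R')) := by
    simp only [varPhi, varPi, Matrix.mul_kronecker_mul, mul_sub, sub_mul]
  rw [e1, ← neg_eq_iff_eq_neg.2 hr]
  set Z := (L * (fund m β p l s)⁻¹)
  set Z' := (L' * (fund m β p n s)⁻¹)
  set X := fund m β p l s * R
  set X' := fund m β p n s * R'
  set V := laxV m β p l s
  set V' := laxV m β p n s
  have e2 : (-(Z * V)) ⊗ₖ Z' = -((Z ⊗ₖ Z') * (V ⊗ₖ 1)) := by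
    rw [← Matrix.mul_kronecker_mul, mul_one]
    ext I J
    simp
  have e3 : Z ⊗ₖ (-(Z' * V')) = -((Z ⊗ₖ Z') * (1 ⊗ₖ V')) := by
    rw [← Matrix.mul_kronecker_mul, mul_one]
    ext I J
    simp
  have e4 : (V * X) ⊗ₖ X' = (V ⊗ₖ 1) * (X ⊗ₖ X') := by
    rw [← Matrix.mul_kronecker_mul, one_mul]
  have e5 : X ⊗ₖ (V' * X') = (1 ⊗ₖ V') * (X ⊗ₖ X') := by
    rw [← Matrix.mul_kronecker_mul, one_mul]
  rw [e2, e3, e4, e5]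
  noncomm_ring

lemma continuous_bracket_density (h1 : Continuous p.1) (h2 : Continuous p.2) (l n : ℂ)
    (L R L' R' : Mat2) (i j k q : Fin 2) :
    Continuous fun s => varPhi m β p l L R s i j * varPi m β p n L' R' s k q
        - varPi m β p l L R s i j * varPhi m β p n L' R' s k q :=
  (((continuous_varPhi h1 h2 l L R).matrix_elem i j).mul
    ((continuous_varPi h1 h2 n L' R').matrix_elem k q)).sub
  (((continuous_varPi h1 h2 l L R).matrix_elem i j).mul
    ((continuous_varPhi h1 h2 n L' R').matrix_elem k q))

/-- The bracket density integrates to a boundary term. -/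
lemma integral_bracket (h1 : Continuous p.1) (h2 : Continuous p.2) {l n : ℂ} (hl : l ≠ 0)
    (hn : n ≠ 0) (hln : l ^ 2 ≠ n ^ 2) (L R L' R' : Mat2) (a b : ℝ) (i j k q : Fin 2) :
    ∫ s in a..b, (varPhi m β p l L R s i j * varPi m β p n L' R' s k q
        - varPi m β p l L R s i j * varPhi m β p n L' R' s k q)
      = rSandwich m β p l n L R L' R' a (i, k) (j, q)
        - rSandwich m β p l n L R L' R' b (i, k) (j, q) := by
  have hd : ∀ s ∈ Set.uIcc a b, HasDerivAt (fun s => -rSandwich m β p l n L R L' R' s (i, k) (j, q))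
      (varPhi m β p l L R s i j * varPi m β p n L' R' s k q
        - varPi m β p l L R s i j * varPhi m β p n L' R' s k q) s := by
    intro s _
    refine (hasDerivAt_matrix.1 (hasDerivAt_rSandwich h1 h2 hl hn hln L R L' R' s)
      (i, k) (j, q)).neg.congr_deriv ?_
    simp
  rw [intervalIntegral.integral_eq_sub_of_hasDerivAt hd]
  · ring
  · exact (continuous_bracket_density h1 h2 l n L R L' R' i j k q).intervalIntegrable _ _

/-! ### The finite-volume bracket -/

/-- The matrix only sees the fields between `τ` and `t`, hence the cut-off by an indicator. -/
lemma hasFunctionalDeriv_transition (h1 : Continuous p.1) (h2 : Continuous p.2) (l : ℂ)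
    {τ t : ℝ} (hτ : τ ≤ t) (i j : Fin 2) :
    HasFunctionalDeriv (fun f => transition m β f t τ l i j) p
      ((Set.Ioc τ t).indicator fun s =>
        varPhi m β p l (fund m β p l t) (fund m β p l τ)⁻¹ s i j)
      ((Set.Ioc τ t).indicator fun s =>
        varPi m β p l (fund m β p l t) (fund m β p l τ)⁻¹ s i j) := by
  have c1 := continuous_varPhi (m := m) (β := β) h1 h2 l (fund m β p l t) (fund m β p l τ)⁻¹
  have c2 := continuous_varPi (m := m) (β := β) h1 h2 l (fund m β p l t) (fund m β p l τ)⁻¹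
  refine ⟨(Continuous.locallyIntegrable (by fun_prop)).indicator measurableSet_Ioc,
    (Continuous.locallyIntegrable (by fun_prop)).indicator measurableSet_Ioc, ?_⟩
  intro u v hu _ hv _
  have h := hasDerivAt_sandwich_transition (m := m) (β := β) h1 h2 hu.continuous hv.continuous l hτ
    1 1 i j
  simp only [one_mul, mul_one] at h
  refine h.congr_deriv ?_
  rw [intervalIntegral.integral_of_le hτ, ← integral_indicator measurableSet_Ioc]
  congr 1
  funext s
  by_cases hs : s ∈ Set.Ioc τ t <;> simp [hs]

/-- At `s = τ` the factors to the right of `r` are the identity, at `s = t` those to its left. The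
two boundary terms are therefore `(𝒯 ⊗ 𝒯) r` and `r (𝒯 ⊗ 𝒯)`. -/
lemma hasPoissonBracket_transition (h1 : Continuous p.1) (h2 : Continuous p.2) {l n : ℂ}
    (hl : l ≠ 0) (hn : n ≠ 0) (hln : l ^ 2 ≠ n ^ 2) {τ t : ℝ} (hτ : τ ≤ t) (i j k q : Fin 2) :
    HasPoissonBracket (fun f => transition m β f t τ l i j) (fun f => transition m β f t τ n k q) p
      ((-(rMatrix β l n * (transition m β p t τ l ⊗ₖ transition m β p t τ n)
        - (transition m β p t τ l ⊗ₖ transition m β p t τ n) * rMatrix β l n)) (i, k) (j, q)) := by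
  refine ⟨_, _, _, _, hasFunctionalDeriv_transition h1 h2 l hτ i j,
    hasFunctionalDeriv_transition h1 h2 n hτ k q, ?_⟩
  have e : (fun s => (Set.Ioc τ t).indicator (fun s =>
        varPhi m β p l (fund m β p l t) (fund m β p l τ)⁻¹ s i j) s *
      (Set.Ioc τ t).indicator (fun s =>
        varPi m β p n (fund m β p n t) (fund m β p n τ)⁻¹ s k q) s -
      (Set.Ioc τ t).indicator (fun s =>
        varPi m β p l (fund m β p l t) (fund m β p l τ)⁻¹ s i j) s *
      (Set.Ioc τ t).indicator (fun s =>
        varPhi m β p n (fund m β p n t) (fund m β p n τ)⁻¹ s k q) s)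
      = (Set.Ioc τ t).indicator fun s =>
        varPhi m β p l (fund m β p l t) (fund m β p l τ)⁻¹ s i j *
        varPi m β p n (fund m β p n t) (fund m β p n τ)⁻¹ s k q -
        varPi m β p l (fund m β p l t) (fund m β p l τ)⁻¹ s i j *
        varPhi m β p n (fund m β p n t) (fund m β p n τ)⁻¹ s k q := by
    funext s
    by_cases hs : s ∈ Set.Ioc τ t <;> simp [hs]
  rw [e]
  constructor
  · refine IntegrableOn.integrable_indicator ?_ measurableSet_Ioc
    exact (continuous_bracket_density h1 h2 l n _ _ _ _ i j k q).integrableOn_Icc.mono_set Set.Ioc_subset_Icc_self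
  · rw [integral_indicator measurableSet_Ioc, ← intervalIntegral.integral_of_le hτ,
      integral_bracket h1 h2 hl hn hln, transition_eq h1 h2, transition_eq h1 h2]
    have e1 := fun x => mul_inv_self_of_isUnit (isUnit_fund (m := m) (β := β) h1 h2 l x)
    have e2 := fun x => mul_inv_self_of_isUnit (isUnit_fund (m := m) (β := β) h1 h2 n x)
    simp only [rSandwich, e1, e2]
    simp only [Matrix.one_kronecker_one, one_mul, mul_one, Matrix.neg_apply, Matrix.sub_apply]
    ring

end

end SineGordon
end


noncomputable section

open scoped Matrix.Norms.Operator

namespace SineGordon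

/-! ### Unitarity for real spectral parameter -/

/-- The norm in force is the maximal row sum, for which a unitary matrix need not have norm one. Any
universal constant suffices here: two entries per row, each of modulus at most one. -/
lemma norm_le_two_of_unitary {M : Mat2} (h : M ∈ Matrix.unitaryGroup (Fin 2) ℂ) : ‖M‖ ≤ 2 := by
  rw [Matrix.linfty_opNorm_def]
  have : (Finset.univ : Finset (Fin 2)).sup (fun i => ∑ j, ‖M i j‖₊) ≤ 2 := by
    refine Finset.sup_le fun i _ => ?_
    have h1 := fun j => entry_norm_bound_of_unitary h i j
    rw [Fin.sum_univ_two, ← NNReal.coe_le_coe]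
    push_cast
    linarith [h1 0, h1 1]
  exact_mod_cast this

lemma norm_entry_le_norm (M : Mat2) (i j : Fin 2) : ‖M i j‖ ≤ ‖M‖ := by
  rw [Matrix.linfty_opNorm_def]
  have h1 : ‖M i j‖₊ ≤ ∑ j, ‖M i j‖₊ :=
    Finset.single_le_sum (f := fun j => ‖M i j‖₊) (fun _ _ => zero_le) (Finset.mem_univ j)
  have h2 := Finset.le_sup (f := fun i => ∑ j, ‖M i j‖₊) (Finset.mem_univ i)
  exact_mod_cast h1.trans h2

lemma inv_eq_conjTranspose {M : Mat2} (h : M ∈ Matrix.unitaryGroup (Fin 2) ℂ) : M⁻¹ = Mᴴ :=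
  Matrix.inv_eq_left_inv (Matrix.mem_unitaryGroup_iff'.1 h)

lemma inv_mem_unitary {M : Mat2} (h : M ∈ Matrix.unitaryGroup (Fin 2) ℂ) :
    M⁻¹ ∈ Matrix.unitaryGroup (Fin 2) ℂ := by
  rw [inv_eq_conjTranspose h]
  exact Unitary.star_mem h

lemma isUnit_of_unitary {M : Mat2} (h : M ∈ Matrix.unitaryGroup (Fin 2) ℂ) : IsUnit M :=
  IsUnit.of_mul_eq_one _ (Matrix.mem_unitaryGroup_iff.1 h)

lemma inv_sub_inv_eq {M N : Mat2} (hM : IsUnit M) (hN : IsUnit N) :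
    M⁻¹ - N⁻¹ = M⁻¹ * (N - M) * N⁻¹ := by
  rw [mul_sub, sub_mul, mul_assoc, mul_inv_self_of_isUnit hN, inv_mul_self_of_isUnit hM]
  simp

lemma norm_inv_sub_inv_le {M N : Mat2} (hM : M ∈ Matrix.unitaryGroup (Fin 2) ℂ)
    (hN : N ∈ Matrix.unitaryGroup (Fin 2) ℂ) : ‖M⁻¹ - N⁻¹‖ ≤ 4 * ‖M - N‖ := by
  rw [inv_sub_inv_eq (isUnit_of_unitary hM) (isUnit_of_unitary hN)]
  have h1 := norm_le_two_of_unitary (inv_mem_unitary hM)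
  have h2 := norm_le_two_of_unitary (inv_mem_unitary hN)
  calc _ ≤ ‖M⁻¹‖ * ‖N - M‖ * ‖N⁻¹‖ :=
        (norm_mul_le _ _).trans (mul_le_mul_of_nonneg_right (norm_mul_le _ _) (norm_nonneg _))
    _ ≤ 2 * ‖N - M‖ * 2 := by gcongr
    _ = _ := by rw [norm_sub_rev]; ring

lemma unitary_of_tendsto {ι : Type*} {l : Filter ι} [l.NeBot] {F : ι → Mat2} {M : Mat2}
    (h : Tendsto F l (𝓝 M)) (hF : ∀ i, F i ∈ Matrix.unitaryGroup (Fin 2) ℂ) :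
    M ∈ Matrix.unitaryGroup (Fin 2) ℂ := by
  rw [Matrix.mem_unitaryGroup_iff]
  have hc : Continuous fun M : Mat2 => M * star M := by fun_prop
  have h1 := (hc.tendsto M).comp h
  have h2 : (fun M : Mat2 => M * star M) ∘ F = fun _ => 1 :=
    funext fun i => Matrix.mem_unitaryGroup_iff.1 (hF i)
  rw [h2] at h1
  exact (tendsto_nhds_unique h1 tendsto_const_nhds)

lemma tendsto_inv_of_unitary {ι : Type*} {l : Filter ι} [l.NeBot] {F : ι → Mat2} {M : Mat2}
    (h : Tendsto F l (𝓝 M)) (hF : ∀ i, F i ∈ Matrix.unitaryGroup (Fin 2) ℂ) :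
    Tendsto (fun i => (F i)⁻¹) l (𝓝 M⁻¹) := by
  rw [inv_eq_conjTranspose (unitary_of_tendsto h hF),
    show (fun i => (F i)⁻¹) = fun i => (F i)ᴴ from funext fun i => inv_eq_conjTranspose (hF i)]
  have hc : Continuous fun M : Mat2 => Mᴴ := by fun_prop
  exact (hc.tendsto M).comp h

lemma k₀_ofReal (m x : ℝ) : k₀ m (x : ℂ) = ((m / 4 * (x + 1 / x) : ℝ) : ℂ) := by
  simp [k₀]

lemma k₁_ofReal (m x : ℝ) : k₁ m (x : ℂ) = ((m / 4 * (x - 1 / x) : ℝ) : ℂ) := by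
  simp [k₁]

lemma expσ₃_unitary (y : ℝ) : expσ₃ (Complex.I * y) ∈ Matrix.unitaryGroup (Fin 2) ℂ := by
  rw [Matrix.mem_unitaryGroup_iff']
  ext i j
  fin_cases i <;> fin_cases j <;>
  simp [expσ₃, Matrix.mul_apply, ← Complex.exp_conj, ← Complex.exp_add]

lemma sqrt_two_inv_sq : (((1 / Real.sqrt 2 : ℝ) : ℂ)) * ((1 / Real.sqrt 2 : ℝ) : ℂ) = 1 / 2 := by
  rw [← Complex.ofReal_mul, div_mul_div_comm, one_mul, Real.mul_self_sqrt zero_le_two]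
  simp

lemma matN_eq : matN = ((1 / Real.sqrt 2 : ℝ) : ℂ) • !![1, Complex.I; Complex.I, 1] := by
  unfold matN
  congr 1
  ext i j
  fin_cases i <;> fin_cases j <;> simp [σ₁]

lemma matN_unitary : matN ∈ Matrix.unitaryGroup (Fin 2) ℂ := by
  rw [Matrix.mem_unitaryGroup_iff', matN_eq]
  have h := sqrt_two_inv_sq
  have hcc : (starRingEnd ℂ) ((1 / Real.sqrt 2 : ℝ) : ℂ) = ((1 / Real.sqrt 2 : ℝ) : ℂ) :=
    Complex.conj_ofReal _
  generalize ((1 / Real.sqrt 2 : ℝ) : ℂ) = c at h hcc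
  ext i j
  fin_cases i <;> fin_cases j <;> simp [Matrix.mul_apply, hcc] <;>
  first
  | ring1
  | linear_combination (2 : ℂ) * h - c * c * Complex.I_sq

lemma asymE_eq (m : ℝ) (Q : ℤ) (t x : ℝ) : asymE m Q t x
    = expσ₃ (Complex.I * (Real.pi / 2 * Q : ℝ)) * matN
      * expσ₃ (Complex.I * (-(m / 4 * (x + 1 / x) * t) : ℝ)) := by
  unfold asymE
  rw [k₀_ofReal]
  have e1 : Complex.I * Real.pi / 2 * Q = Complex.I * (Real.pi / 2 * Q : ℝ) := by push_cast; ring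
  have e2 : -(Complex.I * (m / 4 * (x + 1 / x) : ℝ) * t)
      = Complex.I * (-(m / 4 * (x + 1 / x) * t) : ℝ) := by push_cast; ring
  rw [e1, e2]

lemma asymE_unitary (m : ℝ) (Q : ℤ) (t x : ℝ) :
    asymE m Q t x ∈ Matrix.unitaryGroup (Fin 2) ℂ := by
  rw [asymE_eq]
  exact mul_mem (mul_mem (expσ₃_unitary _) matN_unitary) (expσ₃_unitary _)

section
variable {m β : ℝ} {p : Fields}

/-- For real `λ` both `k₀` and `k₁` are real, so `V` is `i` times a real combination of Pauli
matrices. This is the source of unitarity, and of the bounds on propagators that hold uniformly over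
the whole time axis. -/
lemma laxV_conjTranspose (x t : ℝ) : (laxV m β p x t)ᴴ = -laxV m β p x t := by
  unfold laxV
  rw [k₀_ofReal, k₁_ofReal]
  ext i j
  fin_cases i <;> fin_cases j <;> simp [σ₁, σ₂, σ₃, ← Complex.sin_conj, ← Complex.cos_conj]
  all_goals
    simp only [map_ofNat]
    ring

lemma fund_unitary (h1 : Continuous p.1) (h2 : Continuous p.2) (x t : ℝ) :
    fund m β p x t ∈ Matrix.unitaryGroup (Fin 2) ℂ := by
  rw [Matrix.mem_unitaryGroup_iff', Matrix.star_eq_conjTranspose]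
  have h : ∀ s, HasDerivAt (fun s => (fund m β p x s)ᴴ * fund m β p x s) 0 s := by
    intro s
    have hd := hasDerivAt_fund (m := m) (β := β) h1 h2 x s
    have hH : HasDerivAt (fun s => (fund m β p x s)ᴴ) ((laxV m β p x s * fund m β p x s)ᴴ) s :=
      hasDerivAt_matrix.2 fun i j => (hasDerivAt_matrix.1 hd j i).star
    refine (hH.mul hd).congr_deriv ?_
    rw [Matrix.conjTranspose_mul, laxV_conjTranspose]
    noncomm_ring
  have hc := is_const_of_deriv_eq_zero (fun s => (h s).differentiableAt) (fun s => (h s).deriv) t 0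
  simpa [fund_zero h1 h2] using hc

end

end SineGordon
end


noncomputable section

open scoped Matrix.Norms.Operator

namespace SineGordon

/-! ### Asymptotics of the solutions -/

lemma exp_pi_mul_int (Q : ℤ) : Complex.exp (Complex.I * Real.pi / 2 * Q)
    = Real.cos (Real.pi * Q) * Complex.exp (-(Complex.I * Real.pi / 2 * Q)) := by
  have h1 : Complex.exp (Complex.I * Real.pi * Q) = Real.cos (Real.pi * Q) := by
    have : Complex.I * Real.pi * Q = ((Real.pi * Q : ℝ) : ℂ) * Complex.I := by push_cast; ring
    rw [this, Complex.exp_mul_I, ← Complex.ofReal_cos, ← Complex.ofReal_sin, mul_comm Real.pi,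
      Real.sin_int_mul_pi]
    simp
  rw [← h1, ← Complex.exp_add]
  congr 1
  ring

/-- The limit of the Lax matrix where `β φ / 2 = π Q`, `Π = 0`. -/
def limV (m : ℝ) (Q : ℤ) (l : ℂ) : Mat2 := -((Complex.I * k₀ m l * (Real.cos (Real.pi * Q) : ℝ)) • σ₂)

lemma cos_pi_mul_int_sq (Q : ℤ) :
    ((Real.cos (Real.pi * Q) : ℝ) : ℂ) * ((Real.cos (Real.pi * Q) : ℝ) : ℂ) = 1 := by
  have := Real.sin_sq_add_cos_sq (Real.pi * Q)
  rw [mul_comm Real.pi, Real.sin_int_mul_pi] at this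
  rw [← Complex.ofReal_mul, mul_comm Real.pi]
  norm_cast
  linarith

/-- `N` diagonalises `σ₂`, and conjugating `σ₂` by `exp(iπQσ₃/2)` multiplies it by `(-1)^Q = cos
πQ`. Thus `ℰ` solves the vacuum equation of charge `Q` exactly. -/
lemma expσ₃_mul_matN_mul_σ₃ (Q : ℤ) :
    expσ₃ (Complex.I * Real.pi / 2 * Q) * matN * σ₃
      = (Real.cos (Real.pi * Q) : ℂ) • (σ₂ * (expσ₃ (Complex.I * Real.pi / 2 * Q) * matN)) := by
  have h := exp_pi_mul_int Q
  have h2 := cos_pi_mul_int_sq Q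
  rw [matN_eq]
  simp only [expσ₃, h]
  generalize Complex.exp (-(Complex.I * Real.pi / 2 * Q)) = e
  generalize ((Real.cos (Real.pi * Q) : ℝ) : ℂ) = s at h2
  ext i j
  fin_cases i <;> fin_cases j <;> simp [σ₂, σ₃, Matrix.mul_apply]
  · linear_combination s * e * (Real.sqrt 2 : ℂ)⁻¹ * Complex.I_sq
  · ring
  · linear_combination -(e * (Real.sqrt 2 : ℂ)⁻¹ * Complex.I) * h2
  · linear_combination
      e * (Real.sqrt 2 : ℂ)⁻¹ * h2 - e * (Real.sqrt 2 : ℂ)⁻¹ * (s * s) * Complex.I_sq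

lemma hasDerivAt_expσ₃ (k : ℂ) (t : ℝ) :
    HasDerivAt (fun t : ℝ => expσ₃ (-(Complex.I * k * t)))
      (expσ₃ (-(Complex.I * k * t)) * (-(Complex.I * k) • σ₃)) t := by
  have h1 : ∀ c : ℂ, HasDerivAt (fun t : ℝ => Complex.exp (c * t)) (Complex.exp (c * t) * c) t := by
    intro c
    have := ((hasDerivAt_id (t : ℂ)).const_mul c).cexp.comp_ofReal
    simpa using this
  refine hasDerivAt_matrix.2 fun i j => ?_
  have ha := h1 (-(Complex.I * k))
  have hb := h1 (Complex.I * k)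
  fin_cases i <;> fin_cases j
  · simpa [expσ₃, σ₃, Matrix.mul_apply] using ha
  · simpa [expσ₃, σ₃, Matrix.mul_apply] using hasDerivAt_const t (0 : ℂ)
  · simpa [expσ₃, σ₃, Matrix.mul_apply] using hasDerivAt_const t (0 : ℂ)
  · simpa [expσ₃, σ₃, Matrix.mul_apply] using hb

lemma hasDerivAt_asymE (m : ℝ) (Q : ℤ) (l : ℂ) (t : ℝ) :
    HasDerivAt (fun t => asymE m Q t l) (limV m Q l * asymE m Q t l) t := by
  refine ((hasDerivAt_expσ₃ (k₀ m l) t).const_mul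
    (expσ₃ (Complex.I * Real.pi / 2 * Q) * matN)).congr_deriv ?_
  have hcomm : expσ₃ (-(Complex.I * k₀ m l * t)) * σ₃ = σ₃ * expσ₃ (-(Complex.I * k₀ m l * t)) := by
    ext i j
    fin_cases i <;> fin_cases j <;> simp [expσ₃, σ₃, Matrix.mul_apply]
  rw [mul_smul_comm, hcomm, mul_smul_comm, ← mul_assoc, expσ₃_mul_matN_mul_σ₃]
  simp only [limV, asymE, smul_mul_assoc, neg_mul, neg_smul, smul_smul, mul_assoc]

/-- `ℰ(t)⁻¹ 𝒯(t, 0)`. -/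
def dressed (m β : ℝ) (Q : ℤ) (p : Fields) (x t : ℝ) : Mat2 :=
  (asymE m Q t x)⁻¹ * fund m β p x t

/-- The coefficient of the equation for `dressed`. -/
def dressedCoeff (m β : ℝ) (Q : ℤ) (p : Fields) (x t : ℝ) : Mat2 :=
  (asymE m Q t x)⁻¹ * (laxV m β p x t - limV m Q x) * asymE m Q t x

section
variable {m β : ℝ} {Q : ℤ} {p : Fields}

lemma dressed_unitary (h1 : Continuous p.1) (h2 : Continuous p.2) (x t : ℝ) :
    dressed m β Q p x t ∈ Matrix.unitaryGroup (Fin 2) ℂ :=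
  mul_mem (inv_mem_unitary (asymE_unitary m Q t x)) (fund_unitary h1 h2 x t)

lemma asymE_mul_dressed (x t : ℝ) : asymE m Q t x * dressed m β Q p x t = fund m β p x t := by
  rw [dressed, ← mul_assoc, mul_inv_self_of_isUnit (isUnit_of_unitary (asymE_unitary m Q t x)),
    one_mul]

lemma hasDerivAt_asymE_inv (x t : ℝ) : HasDerivAt (fun t => (asymE m Q t x)⁻¹)
    (-((asymE m Q t x)⁻¹ * limV m Q x)) t :=
  hasDerivAt_inv_of_isUnit (A := fun _ => limV m Q x) (hasDerivAt_asymE m Q x)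
    (fun t => isUnit_of_unitary (asymE_unitary m Q t x)) t

lemma hasDerivAt_dressed (h1 : Continuous p.1) (h2 : Continuous p.2) (x t : ℝ) :
    HasDerivAt (dressed m β Q p x) (dressedCoeff m β Q p x t * dressed m β Q p x t) t := by
  refine ((hasDerivAt_asymE_inv x t).mul (hasDerivAt_fund h1 h2 x t)).congr_deriv ?_
  rw [dressedCoeff, mul_assoc _ (asymE m Q t x), asymE_mul_dressed]
  noncomm_ring

lemma continuous_dressedCoeff (h1 : Continuous p.1) (h2 : Continuous p.2) (x : ℝ) :
    Continuous (dressedCoeff m β Q p x) := by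
  have hE : Continuous fun t => asymE m Q t x :=
    continuous_iff_continuousAt.2 fun t => (hasDerivAt_asymE m Q x t).continuousAt
  have hE' : Continuous fun t => (asymE m Q t x)⁻¹ :=
    continuous_iff_continuousAt.2 fun t => (hasDerivAt_asymE_inv x t).continuousAt
  have hV := continuous_laxV (m := m) (β := β) h1 h2 x
  unfold dressedCoeff
  fun_prop

/-! ### Estimates, locally uniform in the spectral parameter -/

/-- The compact set `δ ≤ |x| ≤ δ⁻¹`. -/
def annulus (δ : ℝ) : Set ℝ := {x | δ ≤ |x| ∧ |x| ≤ δ⁻¹}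

lemma exists_bound_k (m : ℝ) {δ : ℝ} (hδ : 0 < δ) : ∃ C : ℝ, 0 ≤ C ∧
    (∀ x ∈ annulus δ, 1 + ‖k₀ m (x : ℂ)‖ + ‖k₁ m (x : ℂ)‖ ≤ C) ∧
    ∀ x ∈ annulus δ, ∀ y ∈ annulus δ, ‖k₀ m (x : ℂ) - k₀ m (y : ℂ)‖ ≤ C * |x - y| ∧
      ‖k₁ m (x : ℂ) - k₁ m (y : ℂ)‖ ≤ C * |x - y| := by
  have hx1 : ∀ x ∈ annulus δ, |1 / x| ≤ δ⁻¹ := by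
    intro x hx
    rw [abs_div, abs_one, one_div]
    exact inv_anti₀ hδ hx.1
  have hδ' : 0 < δ⁻¹ := inv_pos.2 hδ
  have hM : 0 ≤ |m / 4| := abs_nonneg _
  refine ⟨max (1 + 4 * (|m / 4| * δ⁻¹)) (|m / 4| * (1 + δ⁻¹ * δ⁻¹)), by positivity, ?_, ?_⟩
  · intro x hx
    refine le_max_of_le_left ?_
    rw [k₀_ofReal, k₁_ofReal, Complex.norm_real, Complex.norm_real, Real.norm_eq_abs,
      Real.norm_eq_abs, abs_mul, abs_mul]
    have h1 : |x + 1 / x| ≤ 2 * δ⁻¹ := (abs_add_le _ _).trans (by linarith [hx1 x hx, hx.2])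
    have h2 : |x - 1 / x| ≤ 2 * δ⁻¹ := (abs_sub _ _).trans (by linarith [hx1 x hx, hx.2])
    nlinarith [mul_le_mul_of_nonneg_left h1 hM, mul_le_mul_of_nonneg_left h2 hM]
  · intro x hx y hy
    have hx0 : x ≠ 0 := abs_pos.1 (hδ.trans_le hx.1)
    have hy0 : y ≠ 0 := abs_pos.1 (hδ.trans_le hy.1)
    have hxy : |1 / x * (1 / y)| ≤ δ⁻¹ * δ⁻¹ := by
      rw [abs_mul]
      exact mul_le_mul (hx1 x hx) (hx1 y hy) (abs_nonneg _) hδ'.le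
    rw [k₀_ofReal, k₁_ofReal, k₀_ofReal, k₁_ofReal, ← Complex.ofReal_sub, ← Complex.ofReal_sub,
      Complex.norm_real, Complex.norm_real, Real.norm_eq_abs, Real.norm_eq_abs]
    have e0 : m / 4 * (x + 1 / x) - m / 4 * (y + 1 / y)
        = m / 4 * (1 - 1 / x * (1 / y)) * (x - y) := by field_simp; ring
    have e1 : m / 4 * (x - 1 / x) - m / 4 * (y - 1 / y)
        = m / 4 * (1 + 1 / x * (1 / y)) * (x - y) := by field_simp; ring
    rw [e0, e1, abs_mul _ (x - y), abs_mul _ (x - y), abs_mul (m / 4), abs_mul (m / 4)]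
    have h1 : |1 - 1 / x * (1 / y)| ≤ 1 + δ⁻¹ * δ⁻¹ :=
      (abs_sub _ _).trans (by rw [abs_one]; linarith)
    have h2 : |1 + 1 / x * (1 / y)| ≤ 1 + δ⁻¹ * δ⁻¹ :=
      (abs_add_le _ _).trans (by rw [abs_one]; linarith)
    constructor
    · refine mul_le_mul_of_nonneg_right (le_max_of_le_right ?_) (abs_nonneg _)
      exact mul_le_mul_of_nonneg_left h1 hM
    · refine mul_le_mul_of_nonneg_right (le_max_of_le_right ?_) (abs_nonneg _)
      exact mul_le_mul_of_nonneg_left h2 hM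

/-- Distance of the fields from the vacuum with charge `Q`. -/
def vacDist (β : ℝ) (Q : ℤ) (p : Fields) (t : ℝ) : ℝ := |p.2 t| + |p.1 t - 2 * Real.pi * Q / β|

lemma vacDist_nonneg (t : ℝ) : 0 ≤ vacDist β Q p t := by unfold vacDist; positivity

lemma abs_sin_le_vacDist (hβ : β ≠ 0) (t : ℝ) :
    |Real.sin (β * p.1 t / 2)| ≤ |β| * vacDist β Q p t := by
  have h1 : |Real.sin (β * p.1 t / 2) - Real.sin (Q * Real.pi)|
      ≤ |β * p.1 t / 2 - Q * Real.pi| := by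
    simpa [Real.dist_eq] using Real.lipschitzWith_sin.dist_le_mul (β * p.1 t / 2) (Q * Real.pi)
  rw [Real.sin_int_mul_pi, sub_zero] at h1
  refine h1.trans ?_
  have e : β * p.1 t / 2 - Q * Real.pi = β / 2 * (p.1 t - 2 * Real.pi * Q / β) := by
    field_simp
  rw [e, abs_mul, abs_div, abs_two, vacDist]
  have := abs_nonneg (p.2 t)
  have := abs_nonneg β
  have := abs_nonneg (p.1 t - 2 * Real.pi * Q / β)
  nlinarith [mul_nonneg (abs_nonneg β) (abs_nonneg (p.2 t)),
    mul_nonneg (abs_nonneg β) (abs_nonneg (p.1 t - 2 * Real.pi * Q / β))]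

lemma abs_cos_sub_le_vacDist (hβ : β ≠ 0) (t : ℝ) :
    |Real.cos (β * p.1 t / 2) - Real.cos (Real.pi * Q)| ≤ |β| * vacDist β Q p t := by
  have h1 : |Real.cos (β * p.1 t / 2) - Real.cos (Real.pi * Q)|
      ≤ |β * p.1 t / 2 - Real.pi * Q| := by
    simpa [Real.dist_eq] using Real.lipschitzWith_cos.dist_le_mul (β * p.1 t / 2) (Real.pi * Q)
  refine h1.trans ?_
  have e : β * p.1 t / 2 - Real.pi * Q = β / 2 * (p.1 t - 2 * Real.pi * Q / β) := by
    field_simp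
  rw [e, abs_mul, abs_div, abs_two, vacDist]
  nlinarith [mul_nonneg (abs_nonneg β) (abs_nonneg (p.2 t)),
    mul_nonneg (abs_nonneg β) (abs_nonneg (p.1 t - 2 * Real.pi * Q / β))]

lemma laxV_sub_limV (l : ℂ) (t : ℝ) : laxV m β p l t - limV m Q l
    = (Complex.I * (β / 4 * p.2 t : ℝ)) • σ₃
      - (Complex.I * k₁ m l * (Real.sin (β * p.1 t / 2) : ℝ)) • σ₁
      - (Complex.I * k₀ m l * (Real.cos (β * p.1 t / 2) - Real.cos (Real.pi * Q) : ℝ)) • σ₂ := by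
  simp only [laxV, limV, Complex.ofReal_sub, mul_sub, sub_smul]
  abel

lemma norm_laxV_sub_limV_le (hβ : β ≠ 0) (l : ℂ) (t : ℝ) : ‖laxV m β p l t - limV m Q l‖
    ≤ |β| * (‖σ₁‖ + ‖σ₂‖ + ‖σ₃‖) * (1 + ‖k₀ m l‖ + ‖k₁ m l‖) * vacDist β Q p t := by
  rw [laxV_sub_limV]
  refine (norm_sub_le _ _).trans ((add_le_add_left (norm_sub_le _ _) _).trans ?_)
  rw [norm_smul, norm_smul, norm_smul, norm_mul, norm_mul, norm_mul, norm_mul, norm_mul,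
    Complex.norm_I, Complex.norm_real, Complex.norm_real, Complex.norm_real, Real.norm_eq_abs,
    Real.norm_eq_abs, Real.norm_eq_abs, one_mul, one_mul, one_mul]
  have hs := abs_sin_le_vacDist (p := p) (Q := Q) hβ t
  have hc := abs_cos_sub_le_vacDist (p := p) (Q := Q) hβ t
  have hP : |β / 4 * p.2 t| ≤ |β| * vacDist β Q p t := by
    rw [abs_mul, abs_div, vacDist, show |(4 : ℝ)| = 4 by norm_num]
    nlinarith [mul_nonneg (abs_nonneg β) (abs_nonneg (p.2 t)),
      mul_nonneg (abs_nonneg β) (abs_nonneg (p.1 t - 2 * Real.pi * Q / β))]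
  have hV := vacDist_nonneg (β := β) (Q := Q) (p := p) t
  calc _ ≤ |β| * vacDist β Q p t * ‖σ₃‖ + ‖k₁ m l‖ * (|β| * vacDist β Q p t) * ‖σ₁‖
        + ‖k₀ m l‖ * (|β| * vacDist β Q p t) * ‖σ₂‖ := by gcongr
    _ = |β| * vacDist β Q p t * (1 * ‖σ₃‖ + ‖k₁ m l‖ * ‖σ₁‖ + ‖k₀ m l‖ * ‖σ₂‖) := by ring
    _ ≤ |β| * vacDist β Q p t * ((1 + ‖k₀ m l‖ + ‖k₁ m l‖) * (‖σ₁‖ + ‖σ₂‖ + ‖σ₃‖)) := by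
      gcongr
      nlinarith [norm_nonneg σ₁, norm_nonneg σ₂, norm_nonneg σ₃, norm_nonneg (k₀ m l),
        norm_nonneg (k₁ m l), mul_nonneg (norm_nonneg (k₀ m l)) (norm_nonneg σ₁),
        mul_nonneg (norm_nonneg (k₀ m l)) (norm_nonneg σ₃),
        mul_nonneg (norm_nonneg (k₁ m l)) (norm_nonneg σ₂),
        mul_nonneg (norm_nonneg (k₁ m l)) (norm_nonneg σ₃)]
    _ = _ := by ring

/-- The `Π` term does not depend on the spectral parameter and cancels, so only differences of `k₀`
and `k₁` enter. -/
lemma norm_laxV_sub_limV_sub_le (hβ : β ≠ 0) (l n : ℂ) (t : ℝ) :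
    ‖(laxV m β p l t - limV m Q l) - (laxV m β p n t - limV m Q n)‖
    ≤ |β| * (‖σ₁‖ + ‖σ₂‖) * (‖k₀ m l - k₀ m n‖ + ‖k₁ m l - k₁ m n‖) * vacDist β Q p t := by
  have e : (laxV m β p l t - limV m Q l) - (laxV m β p n t - limV m Q n)
      = -((Complex.I * (k₁ m l - k₁ m n) * (Real.sin (β * p.1 t / 2) : ℝ)) • σ₁)
      - (Complex.I * (k₀ m l - k₀ m n) *
        (Real.cos (β * p.1 t / 2) - Real.cos (Real.pi * Q) : ℝ)) • σ₂ := by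
    rw [laxV_sub_limV, laxV_sub_limV]
    simp only [mul_sub, sub_mul, sub_smul]
    abel
  rw [e]
  refine (norm_sub_le _ _).trans ?_
  rw [norm_neg, norm_smul, norm_smul, norm_mul, norm_mul, norm_mul, norm_mul,
    Complex.norm_I, Complex.norm_real, Complex.norm_real, Real.norm_eq_abs,
    Real.norm_eq_abs, one_mul, one_mul]
  have hs := abs_sin_le_vacDist (p := p) (Q := Q) hβ t
  have hc := abs_cos_sub_le_vacDist (p := p) (Q := Q) hβ t
  have hV := vacDist_nonneg (β := β) (Q := Q) (p := p) t
  set a := ‖k₁ m l - k₁ m n‖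
  set b := ‖k₀ m l - k₀ m n‖
  have ha : 0 ≤ a := norm_nonneg _
  have hb : 0 ≤ b := norm_nonneg _
  calc _ ≤ a * (|β| * vacDist β Q p t) * ‖σ₁‖ + b * (|β| * vacDist β Q p t) * ‖σ₂‖ := by gcongr
    _ = |β| * vacDist β Q p t * (a * ‖σ₁‖ + b * ‖σ₂‖) := by ring
    _ ≤ |β| * vacDist β Q p t * ((b + a) * (‖σ₁‖ + ‖σ₂‖)) := by
      gcongr
      nlinarith [mul_nonneg ha (norm_nonneg σ₂), mul_nonneg hb (norm_nonneg σ₁)]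
    _ = _ := by ring

lemma norm_exp_I_sub_le (a b : ℝ) :
    ‖Complex.exp (Complex.I * a) - Complex.exp (Complex.I * b)‖ ≤ |a - b| := by
  have e : Complex.exp (Complex.I * a) - Complex.exp (Complex.I * b)
      = Complex.exp (Complex.I * b) * (Complex.exp (Complex.I * (a - b : ℝ)) - 1) := by
    rw [mul_sub, ← Complex.exp_add, mul_one]
    congr 2
    push_cast; ring
  rw [e, norm_mul, mul_comm Complex.I, Complex.norm_exp_ofReal_mul_I, one_mul]
  exact Real.norm_exp_I_mul_ofReal_sub_one_le

lemma norm_expσ₃_sub_le (a b : ℝ) :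
    ‖expσ₃ (Complex.I * a) - expσ₃ (Complex.I * b)‖ ≤ |a - b| := by
  have e : expσ₃ (Complex.I * a) - expσ₃ (Complex.I * b) = Matrix.diagonal
      ![Complex.exp (Complex.I * a) - Complex.exp (Complex.I * b),
        Complex.exp (Complex.I * (-a : ℝ)) - Complex.exp (Complex.I * (-b : ℝ))] := by
    ext i j
    fin_cases i <;> fin_cases j <;> simp [expσ₃]
  rw [e, Matrix.linfty_opNorm_diagonal]
  refine (pi_norm_le_iff_of_nonneg (abs_nonneg _)).2 fun i => ?_
  fin_cases i
  · exact norm_exp_I_sub_le a b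
  · refine (norm_exp_I_sub_le (-a) (-b)).trans (le_of_eq ?_)
    rw [← abs_neg]; congr 1; ring

lemma norm_asymE_sub_le (x y t : ℝ) : ‖asymE m Q t x - asymE m Q t y‖
    ≤ 4 * (‖k₀ m (x : ℂ) - k₀ m (y : ℂ)‖ * |t|) := by
  rw [asymE_eq, asymE_eq, ← mul_sub]
  refine (norm_mul_le _ _).trans ?_
  have h1 : ‖expσ₃ (Complex.I * (Real.pi / 2 * Q : ℝ)) * matN‖ ≤ 2 :=
    norm_le_two_of_unitary (mul_mem (expσ₃_unitary _) matN_unitary)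
  refine (mul_le_mul h1 (norm_expσ₃_sub_le _ _) (norm_nonneg _) zero_le_two).trans ?_
  rw [k₀_ofReal, k₀_ofReal, ← Complex.ofReal_sub, Complex.norm_real, Real.norm_eq_abs, ← abs_mul,
    ← abs_neg]
  rw [show -(-(m / 4 * (x + 1 / x) * t) - -(m / 4 * (y + 1 / y) * t))
    = (m / 4 * (x + 1 / x) - m / 4 * (y + 1 / y)) * t by ring]
  have := abs_nonneg ((m / 4 * (x + 1 / x) - m / 4 * (y + 1 / y)) * t)
  linarith

/-- Decay of the fields to the vacuum with charge `Q`, on the set `I`. -/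
def DecayOn (β : ℝ) (Q : ℤ) (p : Fields) (I : Set ℝ) : Prop :=
  ∃ C, ∀ t ∈ I, (1 + |t|) * vacDist β Q p t ≤ C * (1 + t ^ 2)⁻¹

/-- Conjugation by the unitary `ℰ` preserves the decay of the fields, but varying `λ` inside its
oscillating factor brings down a power of `|t|`. This is why `DecayOn` carries the weight `1 + |t|`.
-/
lemma exists_bound_dressedCoeff (hβ : β ≠ 0) {I : Set ℝ} (hd : DecayOn β Q p I) {δ : ℝ}
    (hδ : 0 < δ) : ∃ C : ℝ, 0 ≤ C ∧ ∀ t ∈ I,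
      (∀ x ∈ annulus δ, ‖dressedCoeff m β Q p x t‖ ≤ C * (1 + t ^ 2)⁻¹) ∧
      ∀ x ∈ annulus δ, ∀ y ∈ annulus δ,
        ‖dressedCoeff m β Q p x t - dressedCoeff m β Q p y t‖ ≤ C * (1 + t ^ 2)⁻¹ * |x - y| := by
  obtain ⟨Ck, hCk0, hCk, hCl⟩ := exists_bound_k m hδ
  obtain ⟨Cd, hCd⟩ := hd
  set S := ‖σ₁‖ + ‖σ₂‖ + ‖σ₃‖
  have hS : 0 ≤ S := by positivity
  have hD : ∀ t ∈ I, (1 + |t|) * vacDist β Q p t ≤ |Cd| * (1 + t ^ 2)⁻¹ := fun t ht =>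
    (hCd t ht).trans (mul_le_mul_of_nonneg_right (le_abs_self _) (by positivity))
  set B := |β| * S * Ck with hB
  have hB0 : 0 ≤ B := by positivity
  refine ⟨4 * B * |Cd| + (2 * B * 4 * Ck * 4 + 2 * B * 4 * Ck + 8 * B) * |Cd|, by positivity,
    fun t ht => ?_⟩
  have hV := vacDist_nonneg (β := β) (Q := Q) (p := p) t
  have ht0 := abs_nonneg t
  have hV1 : vacDist β Q p t ≤ |Cd| * (1 + t ^ 2)⁻¹ :=
    le_trans (by nlinarith [mul_nonneg ht0 hV]) (hD t ht)
  have hW : ∀ x ∈ annulus δ, ‖laxV m β p x t - limV m Q x‖ ≤ B * vacDist β Q p t := by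
    intro x hx
    refine (norm_laxV_sub_limV_le hβ x t).trans ?_
    rw [hB]
    gcongr
    exact hCk x hx
  have hE : ∀ x : ℝ, ‖asymE m Q t x‖ ≤ 2 := fun x => norm_le_two_of_unitary (asymE_unitary m Q t x)
  have hE' : ∀ x : ℝ, ‖(asymE m Q t x)⁻¹‖ ≤ 2 := fun x =>
    norm_le_two_of_unitary (inv_mem_unitary (asymE_unitary m Q t x))
  have hq : (0 : ℝ) ≤ (1 + t ^ 2)⁻¹ := by positivity
  constructor
  · intro x hx
    calc ‖dressedCoeff m β Q p x t‖
        ≤ 2 * (B * vacDist β Q p t) * 2 := by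
          refine (norm_mul_le _ _).trans (mul_le_mul ((norm_mul_le _ _).trans
            (mul_le_mul (hE' x) (hW x hx) (norm_nonneg _) zero_le_two)) (hE x) (norm_nonneg _)
            (by positivity))
      _ = 4 * B * vacDist β Q p t := by ring
      _ ≤ 4 * B * (|Cd| * (1 + t ^ 2)⁻¹) := by gcongr
      _ = (4 * B * |Cd|) * (1 + t ^ 2)⁻¹ := by ring
      _ ≤ _ := by
        refine mul_le_mul_of_nonneg_right ?_ hq
        have : 0 ≤ (2 * B * 4 * Ck * 4 + 2 * B * 4 * Ck + 8 * B) * |Cd| := by positivity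
        linarith
  · intro x hx y hy
    -- The loss of one power of `t` happens here.
    have hL : ‖asymE m Q t x - asymE m Q t y‖ ≤ 4 * Ck * |t| * |x - y| := by
      refine (norm_asymE_sub_le x y t).trans ?_
      have := (hCl x hx y hy).1
      nlinarith [mul_le_mul_of_nonneg_right this ht0]
    have hL' : ‖(asymE m Q t x)⁻¹ - (asymE m Q t y)⁻¹‖ ≤ 4 * (4 * Ck * |t| * |x - y|) :=
      (norm_inv_sub_inv_le (asymE_unitary m Q t x) (asymE_unitary m Q t y)).trans (by linarith)
    have hWd : ‖(laxV m β p x t - limV m Q x) - (laxV m β p y t - limV m Q y)‖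
        ≤ 2 * B * |x - y| * vacDist β Q p t := by
      refine (norm_laxV_sub_limV_sub_le hβ x y t).trans ?_
      have h1 := (hCl x hx y hy)
      have h2 : ‖k₀ m (x : ℂ) - k₀ m (y : ℂ)‖ + ‖k₁ m (x : ℂ) - k₁ m (y : ℂ)‖ ≤ 2 * (Ck * |x - y|) := by
        linarith [h1.1, h1.2]
      calc _ ≤ |β| * S * (2 * (Ck * |x - y|)) * vacDist β Q p t := by
            gcongr
            simp only [S]
            linarith [norm_nonneg σ₃]
        _ = _ := by rw [hB]; ring
    have e : dressedCoeff m β Q p x t - dressedCoeff m β Q p y t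
        = ((asymE m Q t x)⁻¹ - (asymE m Q t y)⁻¹) * (laxV m β p x t - limV m Q x) * asymE m Q t x
        + (asymE m Q t y)⁻¹ * ((laxV m β p x t - limV m Q x) - (laxV m β p y t - limV m Q y))
            * asymE m Q t x
        + (asymE m Q t y)⁻¹ * (laxV m β p y t - limV m Q y) * (asymE m Q t x - asymE m Q t y) := by
      unfold dressedCoeff
      noncomm_ring
    have hxy := abs_nonneg (x - y)
    have hmul : ∀ {A B C : Mat2} {a b c : ℝ}, ‖A‖ ≤ a → ‖B‖ ≤ b → ‖C‖ ≤ c →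
        ‖A * B * C‖ ≤ a * b * c := by
      intro A B C a b c ha hb hc
      have ha0 := (norm_nonneg _).trans ha
      have hb0 := (norm_nonneg _).trans hb
      exact (norm_mul_le _ _).trans (mul_le_mul ((norm_mul_le _ _).trans
        (mul_le_mul ha hb (norm_nonneg _) ha0)) hc (norm_nonneg _) (by positivity))
    rw [e]
    calc _ ≤ 4 * (4 * Ck * |t| * |x - y|) * (B * vacDist β Q p t) * 2
          + 2 * (2 * B * |x - y| * vacDist β Q p t) * 2
          + 2 * (B * vacDist β Q p t) * (4 * Ck * |t| * |x - y|) :=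
          (norm_add_le _ _).trans (add_le_add ((norm_add_le _ _).trans
            (add_le_add (hmul hL' (hW x hx) (hE x)) (hmul (hE' y) hWd (hE x))))
            (hmul (hE' y) (hW y hy) hL))
      _ = (2 * B * 4 * Ck * 4 + 2 * B * 4 * Ck) * (|t| * vacDist β Q p t) * |x - y|
          + 8 * B * vacDist β Q p t * |x - y| := by ring
      _ ≤ (2 * B * 4 * Ck * 4 + 2 * B * 4 * Ck) * (|Cd| * (1 + t ^ 2)⁻¹) * |x - y|
          + 8 * B * (|Cd| * (1 + t ^ 2)⁻¹) * |x - y| := by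
        have : |t| * vacDist β Q p t ≤ |Cd| * (1 + t ^ 2)⁻¹ := le_trans (by nlinarith) (hD t ht)
        gcongr
      _ = ((2 * B * 4 * Ck * 4 + 2 * B * 4 * Ck + 8 * B) * |Cd|) * (1 + t ^ 2)⁻¹ * |x - y| := by
        ring
      _ ≤ _ := by
        refine mul_le_mul_of_nonneg_right (mul_le_mul_of_nonneg_right ?_ hq) hxy
        have : 0 ≤ 4 * B * |Cd| := by positivity
        linarith

end

end SineGordon
end


noncomputable section

open scoped Matrix.Norms.Operator

namespace SineGordon

/-! ### Jost solutions and the monodromy matrix -/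

/-- Continuous fields decaying to the vacua with charges `Qm`, `Qp`. -/
structure IsAsymptotic (β : ℝ) (Qm Qp : ℤ) (p : Fields) : Prop where
  cont_phi : Continuous p.1
  cont_Pi : Continuous p.2
  right : DecayOn β Qp p (Set.Ici 0)
  left : DecayOn β Qm p (Set.Iic 0)

/-- `lim_{t → ∞} ℰ₊(t)⁻¹ 𝒯(t, 0)`. -/
def jostP (m β : ℝ) (Qp : ℤ) (p : Fields) (x : ℝ) : Mat2 := limUnder atTop (dressed m β Qp p x)

/-- `lim_{t → -∞} ℰ₋(t)⁻¹ 𝒯(t, 0)`. -/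
def jostM (m β : ℝ) (Qm : ℤ) (p : Fields) (x : ℝ) : Mat2 := limUnder atBot (dressed m β Qm p x)

lemma exists_mem_annulus {x : ℝ} (hx : x ≠ 0) : ∃ δ, 0 < δ ∧ x ∈ annulus δ := by
  have h := abs_pos.2 hx
  refine ⟨min |x| |x|⁻¹, lt_min h (inv_pos.2 h), min_le_left _ _, ?_⟩
  have := inv_anti₀ (lt_min h (inv_pos.2 h)) (min_le_right |x| |x|⁻¹)
  rwa [inv_inv] at this

section
variable {m β : ℝ} {Q Qm Qp : ℤ} {p : Fields}

/-- An integrable derivative forces convergence at the end of the half-line: the coefficient is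
`O((1 + t²)⁻¹)` and the solution is unitary. -/
lemma integrableOn_dressed_deriv (m : ℝ) (hβ : β ≠ 0) (h1 : Continuous p.1) (h2 : Continuous p.2)
    {I : Set ℝ} (hI : MeasurableSet I) (hd : DecayOn β Q p I) {x : ℝ} (hx : x ≠ 0) (i j : Fin 2) :
    IntegrableOn (fun t => (dressedCoeff m β Q p x t * dressed m β Q p x t) i j) I := by
  obtain ⟨δ, hδ, hxδ⟩ := exists_mem_annulus hx
  obtain ⟨C, hC0, hC⟩ := exists_bound_dressedCoeff (m := m) hβ hd hδ
  have hcd : Continuous (dressed m β Q p x) :=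
    continuous_iff_continuousAt.2 fun t => (hasDerivAt_dressed h1 h2 x t).continuousAt
  have hcc := continuous_dressedCoeff (m := m) (β := β) (Q := Q) h1 h2 x
  have hc : Continuous fun t => (dressedCoeff m β Q p x t * dressed m β Q p x t) i j :=
    (hcc.mul hcd).matrix_elem i j
  refine Integrable.mono' ((integrable_inv_one_add_sq.const_mul (C * 2)).integrableOn)
    hc.aestronglyMeasurable ?_
  refine (ae_restrict_iff' hI).2 (Eventually.of_forall fun t ht => ?_)
  calc _ ≤ (C * (1 + t ^ 2)⁻¹) * 2 := (norm_entry_le_norm _ i j).trans ((norm_mul_le _ _).trans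
        (mul_le_mul ((hC t ht).1 x hxδ) (norm_le_two_of_unitary (dressed_unitary h1 h2 x t))
          (norm_nonneg _) (by positivity)))
    _ = _ := by ring

lemma tendsto_limUnder_of_entries {l : Filter ℝ} {F : ℝ → Mat2}
    (h : ∀ i j, ∃ c, Tendsto (fun t => F t i j) l (𝓝 c)) : Tendsto F l (𝓝 (limUnder l F)) := by
  choose c hc using h
  exact tendsto_nhds_limUnder ⟨Matrix.of c, tendsto_pi_nhds.2 fun i => tendsto_pi_nhds.2 fun j =>
    hc i j⟩

lemma IsAsymptotic.tendsto_dressed_atTop (h : IsAsymptotic β Qm Qp p) (hβ : β ≠ 0) {x : ℝ}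
    (hx : x ≠ 0) : Tendsto (dressed m β Qp p x) atTop (𝓝 (jostP m β Qp p x)) :=
  tendsto_limUnder_of_entries fun i j => ⟨_, tendsto_limUnder_of_hasDerivAt_of_integrableOn_Ioi
    (a := 0) (fun t _ => hasDerivAt_matrix.1 (hasDerivAt_dressed h.cont_phi h.cont_Pi x t) i j)
    ((integrableOn_dressed_deriv m hβ h.cont_phi h.cont_Pi measurableSet_Ici h.right hx
      i j).mono_set Set.Ioi_subset_Ici_self)⟩

lemma IsAsymptotic.tendsto_dressed_atBot (h : IsAsymptotic β Qm Qp p) (hβ : β ≠ 0) {x : ℝ}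
    (hx : x ≠ 0) : Tendsto (dressed m β Qm p x) atBot (𝓝 (jostM m β Qm p x)) :=
  tendsto_limUnder_of_entries fun i j => ⟨_, tendsto_limUnder_of_hasDerivAt_of_integrableOn_Iic
    (a := 0) (fun t _ => hasDerivAt_matrix.1 (hasDerivAt_dressed h.cont_phi h.cont_Pi x t) i j)
    (integrableOn_dressed_deriv m hβ h.cont_phi h.cont_Pi measurableSet_Iic h.left hx i j)⟩

lemma IsAsymptotic.jostP_unitary (h : IsAsymptotic β Qm Qp p) (hβ : β ≠ 0) {x : ℝ}
    (hx : x ≠ 0) : jostP m β Qp p x ∈ Matrix.unitaryGroup (Fin 2) ℂ :=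
  unitary_of_tendsto (h.tendsto_dressed_atTop hβ hx) (dressed_unitary h.cont_phi h.cont_Pi x)

lemma IsAsymptotic.jostM_unitary (h : IsAsymptotic β Qm Qp p) (hβ : β ≠ 0) {x : ℝ}
    (hx : x ≠ 0) : jostM m β Qm p x ∈ Matrix.unitaryGroup (Fin 2) ℂ :=
  unitary_of_tendsto (h.tendsto_dressed_atBot hβ hx) (dressed_unitary h.cont_phi h.cont_Pi x)

/-- The two variables separate, so the joint limit is the product of two independent limits. -/
lemma preMonodromy_eq (h1 : Continuous p.1) (h2 : Continuous p.2) (x : ℝ) (w : ℝ × ℝ) :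
    preMonodromy m β Qm Qp p x w = dressed m β Qp p x w.1 * (dressed m β Qm p x w.2)⁻¹ := by
  rw [preMonodromy, transition_eq h1 h2, dressed, dressed, Matrix.mul_inv_rev,
    Matrix.nonsing_inv_nonsing_inv _
      ((Matrix.isUnit_iff_isUnit_det _).1 (isUnit_of_unitary (asymE_unitary m Qm w.2 x)))]
  noncomm_ring

lemma IsAsymptotic.tendsto_preMonodromy' (h : IsAsymptotic β Qm Qp p) (hβ : β ≠ 0) {x : ℝ}
    (hx : x ≠ 0) : Tendsto (preMonodromy m β Qm Qp p x) (atTop ×ˢ atBot)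
      (𝓝 (jostP m β Qp p x * (jostM m β Qm p x)⁻¹)) := by
  rw [show preMonodromy m β Qm Qp p x = fun w : ℝ × ℝ =>
    dressed m β Qp p x w.1 * (dressed m β Qm p x w.2)⁻¹ from
    funext (preMonodromy_eq h.cont_phi h.cont_Pi x)]
  exact ((h.tendsto_dressed_atTop hβ hx).comp tendsto_fst).mul
    ((tendsto_inv_of_unitary (h.tendsto_dressed_atBot hβ hx)
      (dressed_unitary h.cont_phi h.cont_Pi x)).comp tendsto_snd)

lemma IsAsymptotic.monodromy_eq (h : IsAsymptotic β Qm Qp p) (hβ : β ≠ 0) {x : ℝ}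
    (hx : x ≠ 0) : monodromy m β Qm Qp p x = jostP m β Qp p x * (jostM m β Qm p x)⁻¹ :=
  (h.tendsto_preMonodromy' hβ hx).limUnder_eq

lemma IsAsymptotic.tendsto_preMonodromy (h : IsAsymptotic β Qm Qp p) (hβ : β ≠ 0) {x : ℝ}
    (hx : x ≠ 0) : Tendsto (preMonodromy m β Qm Qp p x) (atTop ×ˢ atBot)
      (𝓝 (monodromy m β Qm Qp p x)) := by
  rw [h.monodromy_eq hβ hx]
  exact h.tendsto_preMonodromy' hβ hx

/-! ### Lipschitz dependence on the spectral parameter -/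

/-- Duhamel's formula comparing two spectral parameters: the propagators are unitary, the difference
of the coefficients is `O(|x - y| (1 + r²)⁻¹)`, and this weight has a finite integral. The constant
is therefore uniform in `t`. -/
lemma exists_lipschitz_dressed (hβ : β ≠ 0) (h1 : Continuous p.1) (h2 : Continuous p.2)
    {I : Set ℝ} (hI : ∀ b ∈ I, Set.uIoc 0 b ⊆ I) (hd : DecayOn β Q p I) {δ : ℝ} (hδ : 0 < δ) :
    ∃ C : ℝ, ∀ t ∈ I, ∀ x ∈ annulus δ, ∀ y ∈ annulus δ,
      ‖dressed m β Q p x t - dressed m β Q p y t‖ ≤ C * |x - y| := by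
  obtain ⟨C, hC0, hC⟩ := exists_bound_dressedCoeff (m := m) hβ hd hδ
  refine ⟨32 * C * 2, fun t ht x hx y hy => ?_⟩
  set U := dressed m β Q p x
  set W := dressed m β Q p y
  have hU : ∀ s, U s ∈ Matrix.unitaryGroup (Fin 2) ℂ := dressed_unitary h1 h2 x
  have hW : ∀ s, W s ∈ Matrix.unitaryGroup (Fin 2) ℂ := dressed_unitary h1 h2 y
  -- At `t = 0` the oscillating factor of `ℰ` is trivial, so the initial values do not depend on the
  -- spectral parameter.
  have h0 : U 0 = W 0 := by
    simp [U, W, dressed, asymE, fund_zero h1 h2]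
  have key := propagator_sub (continuous_dressedCoeff (m := m) (β := β) (Q := Q) h1 h2 y)
    (continuous_dressedCoeff (m := m) (β := β) (Q := Q) h1 h2 x) (hasDerivAt_dressed h1 h2 y)
    (fun t => isUnit_of_unitary (hW t)) (hasDerivAt_dressed h1 h2 x)
    (fun t => isUnit_of_unitary (hU t)) t 0
  have e : U t - W t = (U t * (U 0)⁻¹ - W t * (W 0)⁻¹) * U 0 := by
    rw [h0, sub_mul, mul_assoc, mul_assoc, inv_mul_self_of_isUnit (isUnit_of_unitary (hW 0))]
    simp
  rw [e, key]
  have hint : ‖∫ r in (0 : ℝ)..t, U t * (U r)⁻¹ * (dressedCoeff m β Q p x r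
      - dressedCoeff m β Q p y r) * (W r * (W 0)⁻¹)‖ ≤ 8 * C * |x - y| * 2 := by
    refine (intervalIntegral.norm_integral_le_abs_of_norm_le
      (g := fun r => 4 * C * |x - y| * (1 + r ^ 2)⁻¹) ?_
      (integrable_inv_one_add_sq.const_mul _).intervalIntegrable).trans ?_
    · refine (ae_restrict_iff' measurableSet_uIoc).2 (Eventually.of_forall fun r hr => ?_)
      have hr' := hI t ht hr
      have a1 := norm_le_two_of_unitary (mul_mem (hU t) (inv_mem_unitary (hU r)))
      have a2 := norm_le_two_of_unitary (mul_mem (hW r) (inv_mem_unitary (hW 0)))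
      have a3 := (hC r hr').2 x hx y hy
      calc _ ≤ 2 * (C * (1 + r ^ 2)⁻¹ * |x - y|) * 2 :=
            (norm_mul_le _ _).trans (mul_le_mul ((norm_mul_le _ _).trans
              (mul_le_mul a1 a3 (norm_nonneg _) zero_le_two)) a2 (norm_nonneg _) (by positivity))
        _ = _ := by ring
    · rw [intervalIntegral.integral_const_mul, integral_inv_one_add_sq, Real.arctan_zero, sub_zero,
        abs_mul, abs_of_nonneg (by positivity : 0 ≤ 4 * C * |x - y|)]
      have : |Real.arctan t| ≤ 4 := by
        rw [abs_le]
        constructor <;> linarith [Real.neg_pi_div_two_lt_arctan t, Real.arctan_lt_pi_div_two t,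
          Real.pi_le_four]
      nlinarith [mul_nonneg hC0 (abs_nonneg (x - y))]
  calc _ ≤ 8 * C * |x - y| * 2 * 2 := (norm_mul_le _ _).trans
        (mul_le_mul hint (norm_le_two_of_unitary (hU 0)) (norm_nonneg _) (by positivity))
    _ ≤ _ := by nlinarith [mul_nonneg hC0 (abs_nonneg (x - y))]

lemma annulus_ne_zero {δ x : ℝ} (hδ : 0 < δ) (hx : x ∈ annulus δ) : x ≠ 0 :=
  abs_pos.1 (hδ.trans_le hx.1)

/-- Uniform Lipschitz bounds for all the matrices entering the boundary terms. -/
lemma IsAsymptotic.exists_lipschitz (h : IsAsymptotic β Qm Qp p) (hβ : β ≠ 0) {δ : ℝ}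
    (hδ : 0 < δ) : ∃ C : ℝ, 0 ≤ C ∧ ∀ x ∈ annulus δ, ∀ y ∈ annulus δ,
      (∀ t, 0 ≤ t → ‖dressed m β Qp p x t - dressed m β Qp p y t‖ ≤ C * |x - y|) ∧
      (∀ t, t ≤ 0 → ‖dressed m β Qm p x t - dressed m β Qm p y t‖ ≤ C * |x - y|) ∧
      ‖jostP m β Qp p x - jostP m β Qp p y‖ ≤ C * |x - y| ∧
      ‖jostM m β Qm p x - jostM m β Qm p y‖ ≤ C * |x - y| := by
  obtain ⟨C₁, hC₁⟩ := exists_lipschitz_dressed (m := m) hβ h.cont_phi h.cont_Pi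
    (fun b hb r hr => by rw [Set.uIoc_of_le hb] at hr; exact hr.1.le) h.right hδ
  obtain ⟨C₂, hC₂⟩ := exists_lipschitz_dressed (m := m) hβ h.cont_phi h.cont_Pi
    (fun b hb r hr => by rw [Set.uIoc_of_ge hb] at hr; exact hr.2) h.left hδ
  refine ⟨max 0 (max C₁ C₂), le_max_left _ _, fun x hx y hy => ?_⟩
  have hx0 := annulus_ne_zero hδ hx
  have hy0 := annulus_ne_zero hδ hy
  have i1 : C₁ * |x - y| ≤ max 0 (max C₁ C₂) * |x - y| :=
    mul_le_mul_of_nonneg_right ((le_max_left _ _).trans (le_max_right _ _)) (abs_nonneg _)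
  have i2 : C₂ * |x - y| ≤ max 0 (max C₁ C₂) * |x - y| :=
    mul_le_mul_of_nonneg_right ((le_max_right _ _).trans (le_max_right _ _)) (abs_nonneg _)
  refine ⟨fun t ht => (hC₁ t ht x hx y hy).trans i1, fun t ht => (hC₂ t ht x hx y hy).trans i2,
    ?_, ?_⟩
  · refine le_trans (le_of_tendsto ((h.tendsto_dressed_atTop hβ hx0).sub
      (h.tendsto_dressed_atTop hβ hy0)).norm ?_) i1
    filter_upwards [eventually_ge_atTop (0 : ℝ)] with t ht using hC₁ t ht x hx y hy
  · refine le_trans (le_of_tendsto ((h.tendsto_dressed_atBot hβ hx0).sub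
      (h.tendsto_dressed_atBot hβ hy0)).norm ?_) i2
    filter_upwards [eventually_le_atBot (0 : ℝ)] with t ht using hC₂ t ht x hx y hy

/-! ### Functional derivative of the monodromy matrix -/

lemma decayOn_perturb {u v : ℝ → ℝ} (hu : Continuous u) (hu' : HasCompactSupport u)
    (hv : Continuous v) (hv' : HasCompactSupport v) {I : Set ℝ} (hd : DecayOn β Q p I) (ε : ℝ) :
    DecayOn β Q (perturb p u v ε) I := by
  obtain ⟨C, hC⟩ := hd
  have hs : HasCompactSupport fun t => (1 + t ^ 2) * ((1 + |t|) * (|u t| + |v t|)) :=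
    HasCompactSupport.mul_left (HasCompactSupport.mul_left (hu'.abs.add hv'.abs))
  obtain ⟨D, hD⟩ := hs.exists_bound_of_continuous (by fun_prop)
  refine ⟨C + |ε| * D, fun t ht => ?_⟩
  have h1 := hC t ht
  have h2 : (1 + t ^ 2) * ((1 + |t|) * (|u t| + |v t|)) ≤ D := (le_abs_self _).trans (hD t)
  have h3 : (1 + |t|) * (|u t| + |v t|) ≤ D * (1 + t ^ 2)⁻¹ := by
    rw [← div_eq_mul_inv, le_div_iff₀ (by positivity)]
    linarith
  have h4 : vacDist β Q (perturb p u v ε) t ≤ vacDist β Q p t + |ε| * (|u t| + |v t|) := by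
    simp only [vacDist, perturb]
    have a1 := abs_add_le (p.2 t) (ε * v t)
    have a2 := abs_add_le (p.1 t - 2 * Real.pi * Q / β) (ε * u t)
    rw [abs_mul] at a1 a2
    rw [show p.1 t + ε * u t - 2 * Real.pi * Q / β = p.1 t - 2 * Real.pi * Q / β + ε * u t by ring]
    linarith
  calc _ ≤ (1 + |t|) * (vacDist β Q p t + |ε| * (|u t| + |v t|)) := by gcongr
    _ = (1 + |t|) * vacDist β Q p t + |ε| * ((1 + |t|) * (|u t| + |v t|)) := by ring
    _ ≤ C * (1 + t ^ 2)⁻¹ + |ε| * (D * (1 + t ^ 2)⁻¹) := by gcongr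
    _ = _ := by ring

lemma IsAsymptotic.perturb (h : IsAsymptotic β Qm Qp p) {u v : ℝ → ℝ} (hu : Continuous u)
    (hu' : HasCompactSupport u) (hv : Continuous v) (hv' : HasCompactSupport v) (ε : ℝ) :
    IsAsymptotic β Qm Qp (perturb p u v ε) where
  cont_phi := by have := h.cont_phi; unfold SineGordon.perturb; fun_prop
  cont_Pi := by have := h.cont_Pi; unfold SineGordon.perturb; fun_prop
  right := decayOn_perturb hu hu' hv hv' h.right ε
  left := decayOn_perturb hu hu' hv hv' h.left ε

lemma fund_perturb_eq {p' : Fields} (h1 : Continuous p.1) (h2 : Continuous p.2)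
    (h1' : Continuous p'.1) (h2' : Continuous p'.2) {a b : ℝ} (l : ℂ)
    (he : ∀ s ∈ Set.uIcc a b, p'.1 s = p.1 s ∧ p'.2 s = p.2 s) :
    fund m β p' l b = fund m β p l b * (fund m β p l a)⁻¹ * fund m β p' l a := by
  have key := propagator_sub (continuous_laxV (m := m) (β := β) h1 h2 l)
    (continuous_laxV (m := m) (β := β) h1' h2' l) (hasDerivAt_fund h1 h2 l)
    (isUnit_fund h1 h2 l) (hasDerivAt_fund h1' h2' l) (isUnit_fund h1' h2' l) b a
  rw [intervalIntegral.integral_congr (g := fun _ => 0), intervalIntegral.integral_zero,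
    sub_eq_zero] at key
  · rw [← key, mul_assoc, inv_mul_self_of_isUnit (isUnit_fund h1' h2' l a), mul_one]
  · intro r hr
    have : laxV m β p' l r - laxV m β p l r = 0 := by
      simp [laxV, he r hr]
    simp [this]

lemma exists_radius {u : ℝ → ℝ} (hu : HasCompactSupport u) :
    ∃ R : ℝ, ∀ s, R ≤ |s| → u s = 0 := by
  obtain ⟨R, hR⟩ := hu.isCompact.isBounded.subset_closedBall 0
  refine ⟨R + 1, fun s hs => image_eq_zero_of_notMem_tsupport fun hmem => ?_⟩
  have := hR hmem
  rw [mem_closedBall_zero_iff, Real.norm_eq_abs] at this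
  linarith

/-- If the variation is supported in `[-R, R]`, the perturbed monodromy matrix is the perturbed
transition matrix over `[-R, R]` between factors that do not depend on `ε`. The infinite-volume
gradient is thus a finite-volume one, with no interchange of limits. -/
lemma IsAsymptotic.hasFunctionalDeriv_monodromy (h : IsAsymptotic β Qm Qp p) (hβ : β ≠ 0) {x : ℝ}
    (hx : x ≠ 0) (i j : Fin 2) :
    HasFunctionalDeriv (fun f => monodromy m β Qm Qp f x i j) p
      (fun s => varPhi m β p x (jostP m β Qp p x) (jostM m β Qm p x)⁻¹ s i j)
      (fun s => varPi m β p x (jostP m β Qp p x) (jostM m β Qm p x)⁻¹ s i j) := by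
  have h1 := h.cont_phi
  have h2 := h.cont_Pi
  refine ⟨((continuous_varPhi h1 h2 _ _ _).matrix_elem i j).locallyIntegrable,
    ((continuous_varPi h1 h2 _ _ _).matrix_elem i j).locallyIntegrable, ?_⟩
  intro u v hu hu' hv hv'
  obtain ⟨R₁, hR₁⟩ := exists_radius hu'
  obtain ⟨R₂, hR₂⟩ := exists_radius hv'
  set R := max (max R₁ R₂) 1
  have hR1 : 0 < R := lt_max_of_lt_right one_pos
  have hR : ∀ s, R ≤ |s| → u s = 0 ∧ v s = 0 := fun s hs =>
    ⟨hR₁ s (((le_max_left _ _).trans (le_max_left _ _)).trans hs),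
      hR₂ s (((le_max_right _ _).trans (le_max_left _ _)).trans hs)⟩
  have hab : -R ≤ R := by linarith
  set U := fund m β p x
  have hUu : ∀ t, IsUnit (U t) := isUnit_fund h1 h2 x
  -- The outer factors are chosen so that multiplying them by the fundamental solution at `±R`
  -- leaves the Jost matrices alone; the resulting gradient does not depend on `R`.
  have key := hasDerivAt_sandwich_transition (m := m) (β := β) h1 h2 hu.continuous hv.continuous
    (x : ℂ) hab (jostP m β Qp p x * (U R)⁻¹) (U (-R) * (jostM m β Qm p x)⁻¹) i j
  have eL : jostP m β Qp p x * (U R)⁻¹ * fund m β p x R = jostP m β Qp p x := by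
    rw [mul_assoc, inv_mul_self_of_isUnit (hUu R), mul_one]
  have eR : (fund m β p x (-R))⁻¹ * (U (-R) * (jostM m β Qm p x)⁻¹) = (jostM m β Qm p x)⁻¹ := by
    rw [← mul_assoc, inv_mul_self_of_isUnit (hUu (-R)), one_mul]
  rw [eL, eR] at key
  have hF : (fun ε : ℝ => monodromy m β Qm Qp (fun s => p.1 s + ε * u s, fun s => p.2 s + ε * v s) x
      i j) = fun ε => (jostP m β Qp p x * (U R)⁻¹ * transition m β (SineGordon.perturb p u v ε) R
        (-R) x * (U (-R) * (jostM m β Qm p x)⁻¹)) i j := by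
    funext ε
    have hε := h.perturb hu.continuous hu' hv.continuous hv' ε
    have e0 : ((fun s => p.1 s + ε * u s, fun s => p.2 s + ε * v s) : Fields)
      = SineGordon.perturb p u v ε := rfl
    rw [e0]
    set q := SineGordon.perturb p u v ε
    have hq : ∀ s, R ≤ |s| → q.1 s = p.1 s ∧ q.2 s = p.2 s := fun s hs => by
      simp [q, SineGordon.perturb, hR s hs]
    have eP : jostP m β Qp q x = jostP m β Qp p x * ((U R)⁻¹ * fund m β q x R) := by
      refine tendsto_nhds_unique (hε.tendsto_dressed_atTop hβ hx)
        (((h.tendsto_dressed_atTop hβ hx).mul_const _).congr' ?_)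
      filter_upwards [eventually_ge_atTop R] with t ht
      rw [dressed, dressed, fund_perturb_eq h1 h2 hε.cont_phi hε.cont_Pi (a := R) (b := t)]
      · simp only [U, mul_assoc]
      · intro s hs
        rw [Set.uIcc_of_le ht] at hs
        exact hq s (hs.1.trans (le_abs_self s))
    have eM : jostM m β Qm q x = jostM m β Qm p x * ((U (-R))⁻¹ * fund m β q x (-R)) := by
      refine tendsto_nhds_unique (hε.tendsto_dressed_atBot hβ hx)
        (((h.tendsto_dressed_atBot hβ hx).mul_const _).congr' ?_)
      filter_upwards [eventually_le_atBot (-R)] with t ht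
      rw [dressed, dressed, fund_perturb_eq h1 h2 hε.cont_phi hε.cont_Pi (a := -R) (b := t)]
      · simp only [U, mul_assoc]
      · intro s hs
        rw [Set.uIcc_of_ge ht] at hs
        exact hq s (by have := neg_abs_le s; linarith [hs.2])
    rw [hε.monodromy_eq hβ hx, eP, eM, transition_eq hε.cont_phi hε.cont_Pi, Matrix.mul_inv_rev,
      Matrix.mul_inv_rev, Matrix.nonsing_inv_nonsing_inv _
      ((Matrix.isUnit_iff_isUnit_det _).1 (hUu (-R)))]
    simp only [mul_assoc]
  rw [hF]
  refine key.congr_deriv (intervalIntegral.integral_eq_integral_of_support_subset ?_)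
  intro s hs
  by_contra hns
  refine hs ?_
  have : R ≤ |s| := by
    by_contra hlt
    rw [not_le, abs_lt] at hlt
    exact hns ⟨hlt.1, hlt.2.le⟩
  simp [hR s this]

end

end SineGordon
end


noncomputable section

open scoped Matrix.Norms.Operator

namespace SineGordon

/-! ### A Dirichlet-type integral -/

lemma norm_exp_I_mul (a : ℝ) : ‖Complex.exp (Complex.I * a)‖ = 1 := by
  rw [mul_comm, Complex.norm_exp_ofReal_mul_I]

/-- The Riemann-Lebesgue lemma with the phase `exp (i K x)`. -/
lemma tendsto_integral_exp_mul (g : ℝ → ℂ) :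
    Tendsto (fun K : ℝ => ∫ x, Complex.exp (Complex.I * (K * x : ℝ)) * g x) atTop (𝓝 0) := by
  have h2 : Tendsto (fun K : ℝ => -K / (2 * Real.pi)) atTop atBot := by
    have := tendsto_neg_atTop_atBot.atBot_div_const (r := 2 * Real.pi) (by positivity)
      (l := (atTop : Filter ℝ)) (f := fun K : ℝ => -K)
    exact this
  have h3 := ((Real.tendsto_integral_exp_smul_cocompact g).mono_left atBot_le_cocompact).comp h2
  refine h3.congr fun K => ?_
  simp only [Function.comp]
  congr 1
  funext x
  rw [Circle.smul_def, Real.fourierChar_apply, smul_eq_mul]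
  congr 2
  push_cast
  field_simp

/-- The regularised Dirichlet integrand. -/
def gaussSin (K : ℝ) (x : ℝ) : ℂ :=
  (Complex.exp (Complex.I * (K * x : ℝ)) - Complex.exp (Complex.I * (-(K * x) : ℝ))) / x
    * Complex.exp (-x ^ 2)

lemma integrable_cexp_neg_sq : Integrable fun x : ℝ => Complex.exp (-(x : ℂ) ^ 2) := by
  simpa using integrable_cexp_neg_mul_sq (b := 1) (by simp)

lemma norm_cexp_neg_sq (x : ℝ) : ‖Complex.exp (-(x : ℂ) ^ 2)‖ = Real.exp (-x ^ 2) := by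
  rw [← Complex.ofReal_pow, ← Complex.ofReal_neg, Complex.norm_exp_ofReal]

lemma norm_gaussSin_le (K x : ℝ) : ‖gaussSin K x‖ ≤ 2 * |K| * Real.exp (-x ^ 2) := by
  rw [gaussSin, norm_mul, norm_cexp_neg_sq, norm_div, Complex.norm_real, Real.norm_eq_abs]
  gcongr
  rcases eq_or_ne x 0 with rfl | hx
  · simp
  · rw [div_le_iff₀ (abs_pos.2 hx)]
    refine (norm_exp_I_sub_le _ _).trans (le_of_eq ?_)
    rw [show K * x - -(K * x) = 2 * (K * x) by ring, abs_mul, abs_mul, abs_two]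
    ring

lemma measurable_gaussSin (K : ℝ) : Measurable (gaussSin K) := by
  unfold gaussSin
  fun_prop

lemma integrable_gaussSin (K : ℝ) : Integrable (gaussSin K) := by
  refine Integrable.mono' (g := fun x => 2 * |K| * Real.exp (-x ^ 2)) ?_
    (measurable_gaussSin K).aestronglyMeasurable (Eventually.of_forall (norm_gaussSin_le K))
  have := (integrable_exp_neg_mul_sq (b := 1) one_pos).const_mul (2 * |K|)
  simpa using this

/-- Differentiation in `K` removes the factor `1/x` and leaves the Fourier transform of a Gaussian.
-/
lemma hasDerivAt_integral_gaussSin (K : ℝ) :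
    HasDerivAt (fun K => ∫ x, gaussSin K x)
      (2 * Complex.I * (Real.sqrt Real.pi * Real.exp (-K ^ 2 / 4) : ℝ)) K := by
  have hd : ∀ x K : ℝ, x ≠ 0 → HasDerivAt (fun K => gaussSin K x)
      (Complex.I * (Complex.exp (Complex.I * (K * x : ℝ)) +
        Complex.exp (Complex.I * (-(K * x) : ℝ))) * Complex.exp (-x ^ 2)) K := by
    intro x K hx
    have h1 : ∀ c : ℂ, HasDerivAt (fun K : ℝ => Complex.exp (c * K)) (Complex.exp (c * K) * c) K := by
      intro c
      have := ((hasDerivAt_id (K : ℂ)).const_mul c).cexp.comp_ofReal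
      simpa using this
    have h2 := (((h1 (Complex.I * x)).sub (h1 (-(Complex.I * x)))).div_const (x : ℂ)).mul_const
      (Complex.exp (-x ^ 2))
    have hx' : (x : ℂ) ≠ 0 := by exact_mod_cast hx
    convert! h2 using 1
    · funext K
      simp only [gaussSin, Pi.sub_apply]
      push_cast
      congr 4 <;> ring_nf
    · push_cast
      rw [show Complex.I * (K * x : ℂ) = Complex.I * x * K by ring,
        show Complex.I * (-(K * x) : ℂ) = -(Complex.I * x) * K by ring]
      field_simp
      ring
  have key := hasDerivAt_integral_of_dominated_loc_of_deriv_le (μ := volume)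
    (F := gaussSin) (x₀ := K) (s := Set.univ) (bound := fun x => 2 * Real.exp (-x ^ 2))
    (F' := fun K x => Complex.I * (Complex.exp (Complex.I * (K * x : ℝ)) +
        Complex.exp (Complex.I * (-(K * x) : ℝ))) * Complex.exp (-x ^ 2)) univ_mem
    (Eventually.of_forall fun K => (measurable_gaussSin K).aestronglyMeasurable)
    (integrable_gaussSin K) (Measurable.aestronglyMeasurable (by fun_prop)) ?_ ?_ ?_
  · refine key.2.congr_deriv ?_
    have e1 := fourierIntegral_gaussian (b := 1) (by simp) (K : ℂ)
    have e2 := fourierIntegral_gaussian (b := 1) (by simp) (-K : ℂ)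
    have i1 : ∀ c : ℝ, Integrable fun x : ℝ =>
        Complex.exp (Complex.I * (c : ℂ) * x) * Complex.exp (-1 * (x : ℂ) ^ 2) := by
      intro c
      refine Integrable.mono' (g := fun x => ‖Complex.exp (-(x : ℂ) ^ 2)‖)
        integrable_cexp_neg_sq.norm (Measurable.aestronglyMeasurable (by fun_prop))
        (Eventually.of_forall fun x => ?_)
      rw [norm_mul, show Complex.I * (c : ℂ) * x = Complex.I * (c * x : ℝ) by push_cast; ring,
        norm_exp_I_mul]
      simp
    have i2 := i1 (-K)
    push_cast at i2
    have e3 : (fun x : ℝ => Complex.I * (Complex.exp (Complex.I * (K * x : ℝ)) +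
        Complex.exp (Complex.I * (-(K * x) : ℝ))) * Complex.exp (-x ^ 2))
        = fun x : ℝ => Complex.I *
          (Complex.exp (Complex.I * (K : ℂ) * x) * Complex.exp (-1 * (x : ℂ) ^ 2)
          + Complex.exp (Complex.I * (-K : ℂ) * x) * Complex.exp (-1 * (x : ℂ) ^ 2)) := by
      funext x
      push_cast
      rw [show Complex.I * (K * x : ℂ) = Complex.I * K * x by ring,
        show Complex.I * (-(K * x) : ℂ) = Complex.I * (-K) * x by ring, neg_one_mul]
      ring
    rw [e3, integral_const_mul, integral_add (i1 K) i2, e1, e2]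
    have e4 : ((Real.pi : ℂ) / 1) ^ (1 / 2 : ℂ) = (Real.sqrt Real.pi : ℝ) := by
      rw [div_one, Real.sqrt_eq_rpow, Complex.ofReal_cpow Real.pi_pos.le]
      norm_num
    rw [e4]
    push_cast
    rw [neg_sq, mul_one]
    ring
  · refine Eventually.of_forall fun x K _ => ?_
    rw [norm_mul, norm_mul, norm_cexp_neg_sq, Complex.norm_I, one_mul]
    gcongr
    refine (norm_add_le _ _).trans ?_
    rw [norm_exp_I_mul, norm_exp_I_mul]
    norm_num
  · have := (integrable_exp_neg_mul_sq (b := 1) one_pos).const_mul 2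
    simpa using this
  · filter_upwards [compl_mem_ae_iff.2 (measure_singleton (0 : ℝ))] with x hx K _
    exact hd x K hx

lemma integrable_gauss_quarter : Integrable fun K : ℝ =>
    (2 * Complex.I * (Real.sqrt Real.pi * Real.exp (-K ^ 2 / 4) : ℝ)) := by
  have := (integrable_exp_neg_mul_sq (b := 1 / 4) (by norm_num)).const_mul (Real.sqrt Real.pi)
  have h2 := (this.ofReal (𝕜 := ℂ)).const_mul (2 * Complex.I)
  refine h2.congr (Eventually.of_forall fun K => ?_)
  change 2 * Complex.I * ((Real.sqrt Real.pi * Real.exp (-(1 / 4) * K ^ 2) : ℝ) : ℂ) = _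
  rw [show -(1 / 4) * K ^ 2 = -K ^ 2 / 4 by ring]

lemma integral_gaussSin_eq (K : ℝ) : ∫ x, gaussSin K x
    = ∫ k in (0 : ℝ)..K, 2 * Complex.I * (Real.sqrt Real.pi * Real.exp (-k ^ 2 / 4) : ℝ) := by
  rw [intervalIntegral.integral_eq_sub_of_hasDerivAt
    (fun k _ => hasDerivAt_integral_gaussSin k) integrable_gauss_quarter.intervalIntegrable]
  simp [gaussSin]

lemma exists_bound_integral_gaussSin : ∃ C, ∀ K, ‖∫ x, gaussSin K x‖ ≤ C := by
  refine ⟨∫ k : ℝ, ‖2 * Complex.I * ((Real.sqrt Real.pi * Real.exp (-k ^ 2 / 4) : ℝ) : ℂ)‖,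
    fun K => ?_⟩
  rw [integral_gaussSin_eq]
  refine (intervalIntegral.norm_integral_le_integral_norm_uIoc).trans ?_
  exact setIntegral_le_integral integrable_gauss_quarter.norm
    (Eventually.of_forall fun k => norm_nonneg _)

/-- The limit is `2i √π ∫₀^∞ exp(-k²/4) dk`, and the last integral equals `√π`. -/
lemma tendsto_integral_gaussSin :
    Tendsto (fun K => ∫ x, gaussSin K x) atTop (𝓝 (2 * Complex.I * Real.pi)) := by
  have h := intervalIntegral_tendsto_integral_Ioi (μ := volume) 0
    integrable_gauss_quarter.integrableOn tendsto_id
  simp only [id] at h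
  simp_rw [integral_gaussSin_eq]
  convert! h using 2
  rw [integral_const_mul, integral_complex_ofReal, integral_const_mul]
  have := integral_gaussian_Ioi (1 / 4)
  have e : (fun x : ℝ => Real.exp (-(1 / 4) * x ^ 2)) = fun x => Real.exp (-x ^ 2 / 4) := by
    funext x; congr 1; ring
  rw [e] at this
  rw [this]
  congr 2
  rw [show Real.pi / (1 / 4) = 2 ^ 2 * Real.pi by ring, Real.sqrt_mul (by positivity),
    Real.sqrt_sq zero_le_two]
  have := Real.mul_self_sqrt Real.pi_pos.le
  linarith

end SineGordon
end


noncomputable section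

open scoped Matrix.Norms.Operator

namespace SineGordon

/-- Twice the principal value of `∫ exp (i K x) f x / x`. -/
def dirichlet (K : ℝ) (f : ℝ → ℂ) : ℂ :=
  ∫ x : ℝ, (Complex.exp (Complex.I * (K * x : ℝ)) * f x
    - Complex.exp (Complex.I * (-(K * x) : ℝ)) * f (-x)) / x

/-- `f` is `L`-Lipschitz and vanishes outside `[-a, a]`. -/
structure LipSupp (L a : ℝ) (f : ℝ → ℂ) : Prop where
  lip : ∀ x y, ‖f x - f y‖ ≤ L * |x - y|
  supp : ∀ x, f x ≠ 0 → |x| ≤ a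

/-- The difference quotient left after removing a Gaussian. -/
def gaussRem (f : ℝ → ℂ) (x : ℝ) : ℂ := (f x - f 0 * Complex.exp (-x ^ 2)) / x

/-- An integrable bound for `gaussRem`. -/
def gaussRemBound (L a x : ℝ) : ℝ :=
  (Set.Icc (-a) a).indicator (fun _ => L + L * (2 * a) * a) x + L * (2 * a) / a * Real.exp (-x ^ 2)

lemma integrable_gaussRemBound (L a : ℝ) : Integrable (gaussRemBound L a) := by
  refine Integrable.add ?_ ?_
  · rw [integrable_indicator_iff measurableSet_Icc]
    exact integrableOn_const (by simp)
  · have := (integrable_exp_neg_mul_sq (b := 1) one_pos).const_mul (L * (2 * a) / a)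
    simpa using this

namespace LipSupp

variable {L a : ℝ} {f : ℝ → ℂ}

lemma nonneg (h : LipSupp L a f) : 0 ≤ L := by
  have := (norm_nonneg _).trans (h.lip 1 0)
  simpa using this

lemma continuous (h : LipSupp L a f) : Continuous f := by
  refine (LipschitzWith.of_dist_le_mul (K := ⟨L, h.nonneg⟩) fun x y => ?_).continuous
  rw [dist_eq_norm, Real.dist_eq]
  exact h.lip x y

lemma norm_zero_le (h : LipSupp L a f) (ha : 0 < a) : ‖f 0‖ ≤ L * (2 * a) := by
  -- The point `2a` lies outside the support, so the Lipschitz bound controls the value at the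
  -- origin.
  have h0 : f (2 * a) = 0 := by
    by_contra hne
    have := h.supp _ hne
    rw [abs_of_pos (by linarith)] at this
    linarith
  have := h.lip 0 (2 * a)
  rw [h0, sub_zero, zero_sub, abs_neg, abs_of_pos (by linarith)] at this
  exact this

/-- Inside `[-a, a]` the numerator is `O(|x|)`, from the Lipschitz bound and `1 - exp(-x²) ≤ x² ≤
a|x|`. Outside, `f` vanishes and `1/|x| ≤ 1/a`. The bound depends on `f` only through `L` and `a`.
-/
lemma norm_gaussRem_le (h : LipSupp L a f) (ha : 0 < a) (x : ℝ) :
    ‖gaussRem f x‖ ≤ gaussRemBound L a x := by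
  have hL := h.nonneg
  have h0 := h.norm_zero_le ha
  have hpos : 0 ≤ L * (2 * a) / a * Real.exp (-x ^ 2) := by positivity
  by_cases hx : x ∈ Set.Icc (-a) a
  · rw [gaussRemBound, Set.indicator_of_mem hx]
    refine le_trans ?_ (le_add_of_nonneg_right hpos)
    rw [gaussRem, norm_div, Complex.norm_real, Real.norm_eq_abs]
    have hxa : |x| ≤ a := abs_le.2 hx
    refine div_le_of_le_mul₀ (abs_nonneg x) (by positivity) ?_
    have e : f x - f 0 * Complex.exp (-x ^ 2) = (f x - f 0) + f 0 * (1 - Real.exp (-x ^ 2) : ℝ) := by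
      push_cast; ring
    rw [e]
    refine (norm_add_le _ _).trans ?_
    rw [norm_mul, Complex.norm_real, Real.norm_eq_abs]
    have h1 := h.lip x 0
    rw [sub_zero] at h1
    have h2 : |1 - Real.exp (-x ^ 2)| ≤ a * |x| := by
      have h3 := Real.add_one_le_exp (-x ^ 2)
      have h4 : Real.exp (-x ^ 2) ≤ 1 := Real.exp_le_one_iff.2 (by nlinarith)
      rw [abs_of_nonneg (by linarith)]
      have : x ^ 2 = |x| * |x| := by rw [← sq, sq_abs]
      nlinarith [mul_le_mul_of_nonneg_right hxa (abs_nonneg x)]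
    calc _ ≤ L * |x| + L * (2 * a) * (a * |x|) := by gcongr
      _ = _ := by ring
  · rw [gaussRemBound, Set.indicator_of_notMem hx, zero_add]
    have hxa : a < |x| := by
      by_contra hle
      exact hx (abs_le.1 (not_lt.1 hle))
    have hfx : f x = 0 := by
      by_contra hne
      exact absurd (h.supp x hne) (not_le.2 hxa)
    rw [gaussRem, hfx, zero_sub, norm_div, norm_neg, norm_mul, norm_cexp_neg_sq, Complex.norm_real,
      Real.norm_eq_abs, div_mul_eq_mul_div]
    gcongr

lemma aestronglyMeasurable_gaussRem (h : LipSupp L a f) :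
    AEStronglyMeasurable (gaussRem f) volume := by
  have := h.continuous.measurable
  refine Measurable.aestronglyMeasurable ?_
  unfold gaussRem
  fun_prop

lemma integrable_gaussRem (h : LipSupp L a f) (ha : 0 < a) : Integrable (gaussRem f) :=
  Integrable.mono' (integrable_gaussRemBound L a) h.aestronglyMeasurable_gaussRem
    (Eventually.of_forall (h.norm_gaussRem_le ha))

lemma integrable_exp_mul {g : ℝ → ℂ} (hg : Integrable g) (K : ℝ) :
    Integrable fun x => Complex.exp (Complex.I * (K * x : ℝ)) * g x := by
  refine hg.bdd_mul (c := 1) (Continuous.aestronglyMeasurable (by fun_prop))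
    (Eventually.of_forall fun x => (norm_exp_I_mul _).le)

/-- Split `f` into `f(0) exp(-x²)` and a remainder divisible by `x`. The first part is explicit; in
the second the reflection `x ↦ -x` makes both exponentials contribute equally. -/
lemma dirichlet_eq (h : LipSupp L a f) (ha : 0 < a) (K : ℝ) : dirichlet K f
    = f 0 * (∫ x, gaussSin K x)
      + 2 * ∫ x, Complex.exp (Complex.I * (K * x : ℝ)) * gaussRem f x := by
  have i1 := integrable_exp_mul (h.integrable_gaussRem ha) K
  have i2 : Integrable fun x : ℝ => Complex.exp (Complex.I * (-(K * x) : ℝ)) * gaussRem f (-x) := by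
    have := i1.comp_neg
    simpa using this
  have e : (fun x : ℝ => (Complex.exp (Complex.I * (K * x : ℝ)) * f x
    - Complex.exp (Complex.I * (-(K * x) : ℝ)) * f (-x)) / x)
    = fun x => f 0 * gaussSin K x + (Complex.exp (Complex.I * (K * x : ℝ)) * gaussRem f x
      + Complex.exp (Complex.I * (-(K * x) : ℝ)) * gaussRem f (-x)) := by
    funext x
    simp only [gaussSin, gaussRem]
    push_cast
    rw [neg_sq, div_neg]
    ring
  have i3 : Integrable fun x : ℝ => Complex.exp (Complex.I * (K * x : ℝ)) * gaussRem f x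
      + Complex.exp (Complex.I * (-(K * x) : ℝ)) * gaussRem f (-x) := i1.add i2
  rw [dirichlet, e, integral_add ((integrable_gaussSin K).const_mul _) i3,
    integral_add i1 i2, integral_const_mul]
  have e2 := integral_neg_eq_self
    (fun x : ℝ => Complex.exp (Complex.I * (K * x : ℝ)) * gaussRem f x) volume
  simp only [mul_neg] at e2
  rw [e2]
  ring

end LipSupp

/-- Uniformity in both `f` and `K` is what later allows dominated convergence in the remaining
variable `r`. -/
lemma exists_bound_dirichlet (L : ℝ) {a : ℝ} (ha : 0 < a) :
    ∃ C, ∀ f, LipSupp L a f → ∀ K, ‖dirichlet K f‖ ≤ C := by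
  obtain ⟨C, hC⟩ := exists_bound_integral_gaussSin
  refine ⟨L * (2 * a) * C + 2 * ∫ x, gaussRemBound L a x, fun f h K => ?_⟩
  rw [h.dirichlet_eq ha]
  have hL := h.nonneg
  refine (norm_add_le _ _).trans (add_le_add ?_ ?_)
  · rw [norm_mul]
    exact mul_le_mul (h.norm_zero_le ha) (hC K) (norm_nonneg _) (by positivity)
  · rw [norm_mul, RCLike.norm_ofNat]
    gcongr
    refine norm_integral_le_of_norm_le (integrable_gaussRemBound L a)
      (Eventually.of_forall fun x => ?_)
    rw [norm_mul, norm_exp_I_mul, one_mul]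
    exact h.norm_gaussRem_le ha x

lemma LipSupp.of_tendsto {ι : Type*} {l : Filter ι} [l.NeBot] {L a : ℝ} {f : ι → ℝ → ℂ}
    {f₀ : ℝ → ℂ} (h : ∀ᶠ i in l, LipSupp L a (f i)) (ht : ∀ x, Tendsto (fun i => f i x) l (𝓝 (f₀ x))) :
    LipSupp L a f₀ where
  lip x y := le_of_tendsto ((ht x).sub (ht y)).norm (h.mono fun i hi => hi.lip x y)
  supp x hx := by
    have h1 := (ht x).eventually_ne hx
    obtain ⟨i, hi, hi'⟩ := (h1.and h).exists
    exact hi'.supp x hi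

/-- Frequency and amplitude move together. The remainders converge in `L¹` by dominated convergence,
so Riemann–Lebesgue is needed only for the fixed limiting amplitude. -/
lemma tendsto_dirichlet {ι : Type*} {l : Filter ι} [l.NeBot] [l.IsCountablyGenerated] {L a : ℝ}
    (ha : 0 < a) {f : ι → ℝ → ℂ} {f₀ : ℝ → ℂ} {K : ι → ℝ} (h : ∀ᶠ i in l, LipSupp L a (f i))
    (ht : ∀ x, Tendsto (fun i => f i x) l (𝓝 (f₀ x))) (hK : Tendsto K l atTop) :
    Tendsto (fun i => dirichlet (K i) (f i)) l (𝓝 (2 * Complex.I * Real.pi * f₀ 0)) := by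
  have h₀ := LipSupp.of_tendsto h ht
  have hr : Tendsto (fun i => ∫ x, ‖gaussRem (f i) x - gaussRem f₀ x‖) l (𝓝 0) := by
    rw [show (0 : ℝ) = ∫ x : ℝ, (0 : ℝ) by simp]
    refine tendsto_integral_filter_of_dominated_convergence (fun x => gaussRemBound L a x
      + gaussRemBound L a x) ?_ ?_ ((integrable_gaussRemBound L a).add
        (integrable_gaussRemBound L a)) ?_
    · filter_upwards [h] with i hi using
        (hi.aestronglyMeasurable_gaussRem.sub h₀.aestronglyMeasurable_gaussRem).norm
    · filter_upwards [h] with i hi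
      refine Eventually.of_forall fun x => ?_
      rw [norm_norm]
      exact (norm_sub_le _ _).trans (add_le_add (hi.norm_gaussRem_le ha x)
        (h₀.norm_gaussRem_le ha x))
    · refine Eventually.of_forall fun x => ?_
      have : Tendsto (fun i => gaussRem (f i) x) l (𝓝 (gaussRem f₀ x)) :=
        ((ht x).sub ((ht 0).mul_const _)).div_const _
      simpa using (this.sub_const (gaussRem f₀ x)).norm
  have hR : Tendsto (fun i => ∫ x, Complex.exp (Complex.I * (K i * x : ℝ)) * gaussRem (f i) x) l
      (𝓝 0) := by
    have h1 := (tendsto_integral_exp_mul (gaussRem f₀)).comp hK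
    have h2 : Tendsto (fun i => ∫ x, Complex.exp (Complex.I * (K i * x : ℝ))
        * (gaussRem (f i) x - gaussRem f₀ x)) l (𝓝 0) := by
      refine squeeze_zero_norm (fun i => ?_) hr
      refine (norm_integral_le_integral_norm _).trans (le_of_eq ?_)
      simp only [norm_mul, norm_exp_I_mul, one_mul]
    have h3 := h2.add h1
    rw [add_zero] at h3
    refine h3.congr' ?_
    filter_upwards [h] with i hi
    simp only [Function.comp, mul_sub]
    rw [integral_sub (LipSupp.integrable_exp_mul (hi.integrable_gaussRem ha) _)
      (LipSupp.integrable_exp_mul (h₀.integrable_gaussRem ha) _)]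
    ring
  have h4 := ((ht 0).mul (tendsto_integral_gaussSin.comp hK)).add (hR.const_mul 2)
  rw [mul_zero, add_zero, mul_comm (f₀ 0)] at h4
  refine h4.congr' ?_
  filter_upwards [h] with i hi
  rw [hi.dirichlet_eq ha]
  rfl

lemma LipSupp.comp_neg {L a : ℝ} {f : ℝ → ℂ} (h : LipSupp L a f) : LipSupp L a fun x => f (-x) where
  lip x y := by
    have := h.lip (-x) (-y)
    rwa [show -x - -y = -(x - y) by ring, abs_neg] at this
  supp x hx := by simpa using h.supp (-x) hx

lemma dirichlet_neg (K : ℝ) (f : ℝ → ℂ) :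
    dirichlet (-K) f = -dirichlet K fun x => f (-x) := by
  rw [dirichlet, dirichlet, ← integral_neg]
  congr 1
  funext x
  rw [neg_mul, neg_neg, neg_neg]
  ring

lemma tendsto_dirichlet_atBot {ι : Type*} {l : Filter ι} [l.NeBot] [l.IsCountablyGenerated]
    {L a : ℝ} (ha : 0 < a) {f : ι → ℝ → ℂ} {f₀ : ℝ → ℂ} {K : ι → ℝ}
    (h : ∀ᶠ i in l, LipSupp L a (f i))
    (ht : ∀ x, Tendsto (fun i => f i x) l (𝓝 (f₀ x))) (hK : Tendsto K l atBot) :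
    Tendsto (fun i => dirichlet (K i) (f i)) l (𝓝 (-(2 * Complex.I * Real.pi * f₀ 0))) := by
  have := (tendsto_dirichlet ha (f := fun i x => f i (-x)) (f₀ := fun x => f₀ (-x))
    (h.mono fun i hi => hi.comp_neg) (fun x => ht (-x)) (tendsto_neg_atBot_atTop.comp hK)).neg
  simp only [neg_zero] at this
  refine this.congr fun i => ?_
  have := dirichlet_neg (-K i) (f i)
  rw [neg_neg] at this
  simp only [Function.comp]
  rw [this]

end SineGordon
end


/-! ### Principal values along the diagonal, and Lipschitz test functions -/

noncomputable section

open scoped Matrix.Norms.Operator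

namespace SineGordon

/-- The symmetrised form of the principal value of `∬ H (λ, μ) / (λ - μ)`. -/
def pvSym (H : ℝ × ℝ → ℂ) : ℂ :=
  ∫ z : ℝ × ℝ, (H z - H z.swap) / (2 * ((z.1 - z.2 : ℝ) : ℂ))

/-- Bounded measurable functions supported in a square whose antisymmetric part is `O(λ - μ)`. -/
structure AntiLip (R C : ℝ) (H : ℝ × ℝ → ℂ) : Prop where
  meas : Measurable H
  bound : ∀ z, ‖H z‖ ≤ C
  supp : ∀ z, H z ≠ 0 → |z.1| ≤ R ∧ |z.2| ≤ R
  anti : ∀ z, ‖H z - H z.swap‖ ≤ C * |z.1 - z.2|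

/-- The square `[-R, R] × [-R, R]`. -/
def square (R : ℝ) : Set (ℝ × ℝ) := Set.Icc (-R) R ×ˢ Set.Icc (-R) R

lemma mem_square {R : ℝ} {z : ℝ × ℝ} : z ∈ square R ↔ |z.1| ≤ R ∧ |z.2| ≤ R := by
  simp only [square, Set.mem_prod, Set.mem_Icc, abs_le]

lemma integrable_square_indicator (R C : ℝ) :
    Integrable ((square R).indicator fun _ => C : ℝ × ℝ → ℝ) := by
  have hS : MeasurableSet (square R) := measurableSet_Icc.prod measurableSet_Icc
  rw [integrable_indicator_iff hS]
  refine integrableOn_const ?_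
  exact (isCompact_Icc.prod isCompact_Icc).measure_lt_top.ne

lemma integral_swap (f : ℝ × ℝ → ℂ) : ∫ z : ℝ × ℝ, f z.swap = ∫ z, f z := by
  rw [Measure.volume_eq_prod]
  exact integral_prod_swap f

lemma integrable_comp_swap {f : ℝ × ℝ → ℂ} (hf : Integrable f) :
    Integrable fun z : ℝ × ℝ => f z.swap := by
  rw [Measure.volume_eq_prod] at hf ⊢
  exact hf.swap

lemma ae_ne_diag : ∀ᵐ z : ℝ × ℝ, z.1 ≠ z.2 := by
  have h : MeasurableSet {z : ℝ × ℝ | z.1 ≠ z.2} :=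
    (measurableSet_eq_fun measurable_fst measurable_snd).compl
  rw [Measure.volume_eq_prod]
  refine (Measure.ae_prod_iff_ae_ae h).2 (Eventually.of_forall fun x => ?_)
  filter_upwards [(Set.countable_singleton x).ae_notMem volume] with y hy
  exact fun h => hy h.symm

namespace AntiLip

variable {R C : ℝ} {H : ℝ × ℝ → ℂ}

lemma integrable (h : AntiLip R C H) : Integrable H := by
  refine (integrable_square_indicator R C).mono' h.meas.aestronglyMeasurable
    (Eventually.of_forall fun z => ?_)
  by_cases hz : H z = 0
  · rw [hz, norm_zero]
    exact Set.indicator_nonneg (fun _ _ => (norm_nonneg _).trans (h.bound z)) _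
  · rw [Set.indicator_of_mem (mem_square.2 (h.supp z hz))]
    exact h.bound z

lemma measurable_quot (h : AntiLip R C H) :
    Measurable fun z : ℝ × ℝ => (H z - H z.swap) / (2 * ((z.1 - z.2 : ℝ) : ℂ)) := by
  have := h.meas
  have h2 : Measurable fun z : ℝ × ℝ => H z.swap := this.comp measurable_swap
  fun_prop

lemma norm_quot_le (h : AntiLip R C H) (z : ℝ × ℝ) :
    ‖(H z - H z.swap) / (2 * ((z.1 - z.2 : ℝ) : ℂ))‖ ≤ (square R).indicator (fun _ => C) z := by
  have hC : 0 ≤ C := (norm_nonneg _).trans (h.bound z)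
  by_cases hz : z ∈ square R
  · rw [Set.indicator_of_mem hz, norm_div, norm_mul, Complex.norm_real, RCLike.norm_ofNat,
      Real.norm_eq_abs]
    refine div_le_of_le_mul₀ (by positivity) hC ?_
    nlinarith [h.anti z, mul_nonneg hC (abs_nonneg (z.1 - z.2))]
  · have h1 : H z = 0 := by
      by_contra hne
      exact hz (mem_square.2 (h.supp z hne))
    have h2 : H z.swap = 0 := by
      by_contra hne
      exact hz (mem_square.2 (h.supp _ hne).symm)
    rw [h1, h2, Set.indicator_of_notMem hz]
    simp

lemma integrable_quot (h : AntiLip R C H) :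
    Integrable fun z : ℝ × ℝ => (H z - H z.swap) / (2 * ((z.1 - z.2 : ℝ) : ℂ)) :=
  (integrable_square_indicator R C).mono' h.measurable_quot.aestronglyMeasurable
    (Eventually.of_forall h.norm_quot_le)

/-- The cut `|λ - μ| > ε` is symmetric and `1/(λ - μ)` antisymmetric under the swap, so averaging
over the swap leaves a quotient that stays bounded up to the diagonal. -/
lemma pvCut_eq (h : AntiLip R C H) {ε : ℝ} (hε : 0 < ε) : pvCut H ε
    = ∫ z : ℝ × ℝ, {z : ℝ × ℝ | ε < |z.1 - z.2|}.indicator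
        (fun z => (H z - H z.swap) / (2 * ((z.1 - z.2 : ℝ) : ℂ))) z := by
  set S : Set (ℝ × ℝ) := {z | ε < |z.1 - z.2|} with hS
  have mS : MeasurableSet S := measurableSet_lt measurable_const (by fun_prop)
  set g : ℝ × ℝ → ℂ := S.indicator fun z => H z / ((z.1 - z.2 : ℝ) : ℂ) with hg
  have hgi : Integrable g := by
    refine ((h.integrable.norm).const_mul ε⁻¹).mono' ?_ (Eventually.of_forall fun z => ?_)
    · have := h.meas
      exact (Measurable.indicator (by fun_prop) mS).aestronglyMeasurable
    · by_cases hz : z ∈ S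
      · rw [hg, Set.indicator_of_mem hz, norm_div, Complex.norm_real, Real.norm_eq_abs,
          div_eq_inv_mul]
        gcongr
        exact le_of_lt hz
      · rw [hg, Set.indicator_of_notMem hz, norm_zero]
        positivity
  have e1 : pvCut H ε = ∫ z, g z := by rw [pvCut, hg, integral_indicator mS]
  have e2 : ∫ z, g z = ∫ z : ℝ × ℝ, (1 / 2 : ℂ) * (g z + g z.swap) := by
    rw [integral_const_mul, integral_add hgi (integrable_comp_swap hgi), integral_swap]
    ring
  rw [e1, e2]
  refine integral_congr_ae (Eventually.of_forall fun z => ?_)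
  have hsw : z.swap ∈ S ↔ z ∈ S := by
    simp only [hS, Set.mem_ofPred_eq, Prod.fst_swap, Prod.snd_swap, abs_sub_comm]
  by_cases hz : z ∈ S
  · simp only [hg, Set.indicator_of_mem hz, Set.indicator_of_mem (hsw.2 hz), Prod.fst_swap,
      Prod.snd_swap]
    rw [show ((z.2 - z.1 : ℝ) : ℂ) = -((z.1 - z.2 : ℝ) : ℂ) by push_cast; ring, div_neg]
    ring
  · simp only [hg, Set.indicator_of_notMem hz, Set.indicator_of_notMem (fun h => hz (hsw.1 h))]
    simp

lemma tendsto_pvCut (h : AntiLip R C H) : Tendsto (pvCut H) (𝓝[>] 0) (𝓝 (pvSym H)) := by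
  have : Tendsto (fun ε : ℝ => ∫ z : ℝ × ℝ, {z : ℝ × ℝ | ε < |z.1 - z.2|}.indicator
        (fun z => (H z - H z.swap) / (2 * ((z.1 - z.2 : ℝ) : ℂ))) z) (𝓝[>] 0) (𝓝 (pvSym H)) := by
    refine tendsto_integral_filter_of_dominated_convergence
      ((square R).indicator fun _ => C) ?_ ?_ (integrable_square_indicator R C) ?_
    · refine Eventually.of_forall fun ε => ?_
      exact (h.measurable_quot.indicator
        (measurableSet_lt measurable_const (by fun_prop))).aestronglyMeasurable
    · refine Eventually.of_forall fun ε => Eventually.of_forall fun z => ?_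
      exact (norm_indicator_le_norm_self _ _).trans (h.norm_quot_le z)
    · filter_upwards [ae_ne_diag] with z hz
      refine tendsto_const_nhds.congr' ?_
      have : (0 : ℝ) < |z.1 - z.2| := abs_pos.2 (sub_ne_zero.2 hz)
      filter_upwards [nhdsWithin_le_nhds (eventually_lt_nhds this)] with ε hε
      rw [Set.indicator_of_mem (by exact hε)]
  refine this.congr' ?_
  filter_upwards [self_mem_nhdsWithin] with ε hε
  rw [h.pvCut_eq hε]

lemma pv_eq (h : AntiLip R C H) : pv H = pvSym H := h.tendsto_pvCut.limUnder_eq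

end AntiLip

lemma tendsto_pvSym {l : Filter ℝ} [l.IsCountablyGenerated] {R C : ℝ} {H : ℝ → ℝ × ℝ → ℂ}
    {H₀ : ℝ × ℝ → ℂ} (h : ∀ᶠ T in l, AntiLip R C (H T))
    (ht : ∀ z, Tendsto (fun T => H T z) l (𝓝 (H₀ z))) :
    Tendsto (fun T => pvSym (H T)) l (𝓝 (pvSym H₀)) := by
  refine tendsto_integral_filter_of_dominated_convergence
      ((square R).indicator fun _ => C) ?_ ?_ (integrable_square_indicator R C) ?_
  · exact h.mono fun T hT => hT.measurable_quot.aestronglyMeasurable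
  · exact h.mono fun T hT => Eventually.of_forall hT.norm_quot_le
  · exact Eventually.of_forall fun z => ((ht z).sub (ht z.swap)).div_const _

/-- The device that allows a regular integral to be cut into singular pieces: an integrable `g`
equals a principal value of `(λ - μ) g`, and `(λ - μ) g` may then be split into terms that do not
vanish on the diagonal. -/
lemma pvSym_sub_mul {g : ℝ × ℝ → ℂ} (hg : Integrable g) :
    pvSym (fun z => ((z.1 - z.2 : ℝ) : ℂ) * g z) = ∫ z, g z := by
  have e2 : ∫ z, g z = ∫ z : ℝ × ℝ, (1 / 2 : ℂ) * (g z + g z.swap) := by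
    rw [integral_const_mul, integral_add hg (integrable_comp_swap hg), integral_swap]
    ring
  rw [e2, pvSym]
  refine integral_congr_ae ?_
  filter_upwards [ae_ne_diag] with z hz
  have h0 : ((z.1 - z.2 : ℝ) : ℂ) ≠ 0 := Complex.ofReal_ne_zero.2 (sub_ne_zero.2 hz)
  simp only [Prod.fst_swap, Prod.snd_swap]
  rw [show ((z.2 - z.1 : ℝ) : ℂ) = -((z.1 - z.2 : ℝ) : ℂ) by push_cast; ring]
  field_simp
  ring

lemma pvSym_congr {H H' : ℝ × ℝ → ℂ} (h : ∀ z : ℝ × ℝ, z.1 ≠ z.2 → H z = H' z) :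
    pvSym H = pvSym H' := by
  refine integral_congr_ae ?_
  filter_upwards [ae_ne_diag] with z hz
  rw [h z hz, h z.swap (fun hh => hz hh.symm)]

lemma pvSym_const_mul (c : ℂ) (H : ℝ × ℝ → ℂ) :
    pvSym (fun z => c * H z) = c * pvSym H := by
  rw [pvSym, pvSym, ← integral_const_mul]
  refine integral_congr_ae (Eventually.of_forall fun z => ?_)
  ring

/-- `L`-Lipschitz functions of `(λ, μ)` supported in `λ μ > 0`, away from zero and infinity. -/
structure TestLip (δ L : ℝ) (F : ℝ × ℝ → ℂ) : Prop where
  lip : ∀ z w, ‖F z - F w‖ ≤ L * dist z w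
  supp : ∀ z, F z ≠ 0 → z.1 ∈ annulus δ ∧ z.2 ∈ annulus δ ∧ 0 < z.1 * z.2

namespace TestLip

variable {δ L : ℝ} {F : ℝ × ℝ → ℂ}

lemma nonneg (h : TestLip δ L F) : 0 ≤ L := by
  have := (norm_nonneg _).trans (h.lip (1, 1) (0, 0))
  have h2 : dist ((1 : ℝ), (1 : ℝ)) ((0 : ℝ), (0 : ℝ)) = 1 := by simp [Prod.dist_eq]
  rwa [h2, mul_one] at this

lemma continuous (h : TestLip δ L F) : Continuous F := by
  refine (LipschitzWith.of_dist_le_mul (K := ⟨L, h.nonneg⟩) fun x y => ?_).continuous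
  rw [dist_eq_norm]
  exact h.lip x y

lemma norm_le (h : TestLip δ L F) (hδ : 0 < δ) (z : ℝ × ℝ) : ‖F z‖ ≤ L * δ⁻¹ := by
  have hL := h.nonneg
  by_cases hz : F z = 0
  · rw [hz, norm_zero]; positivity
  -- The origin does not satisfy `λμ > 0`, and on the support the sup distance to it is at most
  -- `δ⁻¹`.
  · have h0 : F 0 = 0 := by
      by_contra hne
      have := (h.supp _ hne).2.2
      simp at this
    have h1 := h.lip z 0
    rw [h0, sub_zero] at h1
    refine h1.trans ?_
    gcongr
    rw [dist_zero_right, Prod.norm_def]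
    exact max_le (h.supp z hz).1.2 (h.supp z hz).2.1.2

lemma norm_sub_swap_le (h : TestLip δ L F) (z : ℝ × ℝ) : ‖F z - F z.swap‖ ≤ L * |z.1 - z.2| := by
  refine (h.lip z z.swap).trans (le_of_eq ?_)
  rw [Prod.dist_eq]
  simp only [Prod.fst_swap, Prod.snd_swap, Real.dist_eq]
  rw [abs_sub_comm z.2 z.1, max_self]

lemma swap_supp (h : TestLip δ L F) (z : ℝ × ℝ) (hz : F z.swap ≠ 0) :
    z.1 ∈ annulus δ ∧ z.2 ∈ annulus δ ∧ 0 < z.1 * z.2 := by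
  obtain ⟨h1, h2, h3⟩ := h.supp _ hz
  exact ⟨h2, h1, by rw [mul_comm]; exact h3⟩

lemma of_tendsto {l : Filter ℝ} [l.NeBot] {F : ℝ → ℝ × ℝ → ℂ} {F₀ : ℝ × ℝ → ℂ}
    (h : ∀ᶠ T in l, TestLip δ L (F T)) (ht : ∀ z, Tendsto (fun T => F T z) l (𝓝 (F₀ z))) :
    TestLip δ L F₀ where
  lip z w := le_of_tendsto ((ht z).sub (ht w)).norm (h.mono fun i hi => hi.lip z w)
  supp z hz := by
    obtain ⟨i, hi, hi'⟩ := (((ht z).eventually_ne hz).and h).exists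
    exact hi'.supp z hi

/-- Multiplication by a bounded measurable function that is Lipschitz across the diagonal. -/
lemma antiLip_mul (h : TestLip δ L F) (hδ : 0 < δ) {g : ℝ × ℝ → ℂ} (hg : Measurable g) {B : ℝ}
    (hB : 0 ≤ B)
    (hb : ∀ z : ℝ × ℝ, z.1 ∈ annulus δ → z.2 ∈ annulus δ → 0 < z.1 * z.2 → ‖g z‖ ≤ B)
    (hl : ∀ z : ℝ × ℝ, z.1 ∈ annulus δ → z.2 ∈ annulus δ → 0 < z.1 * z.2 →
      ‖g z - g z.swap‖ ≤ B * |z.1 - z.2|) :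
    AntiLip δ⁻¹ (B * L + B * (L * δ⁻¹)) fun z => g z * F z where
  meas := hg.mul h.continuous.measurable
  bound z := by
    have hL := h.nonneg
    by_cases hz : F z = 0
    · rw [hz, mul_zero, norm_zero]; positivity
    · obtain ⟨h1, h2, h3⟩ := h.supp z hz
      rw [norm_mul]
      have := mul_le_mul (hb z h1 h2 h3) (h.norm_le hδ z) (norm_nonneg _) hB
      nlinarith [mul_nonneg hB hL]
  supp z hz := by
    obtain ⟨h1, h2, h3⟩ := h.supp z (right_ne_zero_of_mul hz)
    exact ⟨h1.2, h2.2⟩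
  anti z := by
    have hL := h.nonneg
    by_cases hz : z.1 ∈ annulus δ ∧ z.2 ∈ annulus δ ∧ 0 < z.1 * z.2
    · obtain ⟨h1, h2, h3⟩ := hz
      have e : g z * F z - g z.swap * F z.swap
        = g z.swap * (F z - F z.swap) + (g z - g z.swap) * F z := by ring
      rw [e]
      refine (norm_add_le _ _).trans ?_
      rw [norm_mul, norm_mul, add_mul]
      refine add_le_add ?_ ?_
      · have := mul_le_mul (hb z.swap h2 h1 (by rw [mul_comm]; exact h3)) (h.norm_sub_swap_le z)
          (norm_nonneg _) hB
        linarith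
      · have := mul_le_mul (hl z h1 h2 h3) (h.norm_le hδ z) (norm_nonneg _) (by positivity)
        linarith
    · have h1 : F z = 0 := by
        by_contra hne
        exact hz (h.supp z hne)
      have h2 : F z.swap = 0 := by
        by_contra hne
        exact hz (h.swap_supp z hne)
      rw [h1, h2, mul_zero, mul_zero, sub_zero, norm_zero]
      positivity

end TestLip

end SineGordon
end


/-! ### Oscillatory limits in hyperbolic coordinates -/

noncomputable section

open scoped Matrix.Norms.Operator

namespace SineGordon

/-- Hyperbolic coordinates on `λ μ > 0`: `λ μ = r²`, `λ - μ = 2 r x`. -/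
def hyp (w : ℝ × ℝ) : ℝ × ℝ :=
  (w.1 * (Real.sqrt (1 + w.2 ^ 2) + w.2), w.1 * (Real.sqrt (1 + w.2 ^ 2) - w.2))

lemma sqrt_one_add_sq_pos (x : ℝ) : 0 < Real.sqrt (1 + x ^ 2) := Real.sqrt_pos.2 (by positivity)

lemma sq_sqrt_one_add_sq (x : ℝ) : Real.sqrt (1 + x ^ 2) ^ 2 = 1 + x ^ 2 :=
  Real.sq_sqrt (by positivity)

lemma hyp_mul (w : ℝ × ℝ) : (hyp w).1 * (hyp w).2 = w.1 ^ 2 := by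
  have := sq_sqrt_one_add_sq w.2
  simp only [hyp]
  linear_combination w.1 ^ 2 * this

lemma hyp_sub (w : ℝ × ℝ) : (hyp w).1 - (hyp w).2 = 2 * w.1 * w.2 := by
  simp only [hyp]; ring

lemma hyp_add (w : ℝ × ℝ) : (hyp w).1 + (hyp w).2 = 2 * w.1 * Real.sqrt (1 + w.2 ^ 2) := by
  simp only [hyp]; ring

lemma hyp_swap (r x : ℝ) : (hyp (r, x)).swap = hyp (r, -x) := by
  simp only [hyp, Prod.swap_prod_mk, neg_sq]
  ext <;> ring

lemma hyp_zero (r : ℝ) : hyp (r, 0) = (r, r) := by simp [hyp]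

/-- The derivative of `hyp`. -/
def fderivHyp (w : ℝ × ℝ) : ℝ × ℝ →L[ℝ] ℝ × ℝ :=
  (Matrix.toLin (.finTwoProd ℝ) (.finTwoProd ℝ)
    !![Real.sqrt (1 + w.2 ^ 2) + w.2, w.1 * (w.2 / Real.sqrt (1 + w.2 ^ 2) + 1);
      Real.sqrt (1 + w.2 ^ 2) - w.2, w.1 * (w.2 / Real.sqrt (1 + w.2 ^ 2) - 1)]).toContinuousLinearMap

lemma hasDerivAt_sqrt_one_add_sq (x : ℝ) :
    HasDerivAt (fun x : ℝ => Real.sqrt (1 + x ^ 2)) (x / Real.sqrt (1 + x ^ 2)) x := by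
  have h := (((hasDerivAt_id x).pow 2).const_add 1).sqrt (by simp; positivity)
  refine h.congr_deriv ?_
  have := (sqrt_one_add_sq_pos x).ne'
  simp
  field_simp

lemma hasFDerivAt_hyp (w : ℝ × ℝ) : HasFDerivAt hyp (fderivHyp w) w := by
  unfold fderivHyp
  rw [Matrix.toLin_finTwoProd_toContinuousLinearMap]
  have h1 := (hasDerivAt_sqrt_one_add_sq w.2).add (hasDerivAt_id w.2)
  have h2 := (hasDerivAt_sqrt_one_add_sq w.2).sub (hasDerivAt_id w.2)
  convert! HasFDerivAt.prodMk (𝕜 := ℝ)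
      (hasFDerivAt_fst.mul (h1.comp_hasFDerivAt w hasFDerivAt_snd))
      (hasFDerivAt_fst.mul (h2.comp_hasFDerivAt w hasFDerivAt_snd)) using 2 <;>
  simp [smul_smul, add_comm]

lemma abs_det_fderivHyp (w : ℝ × ℝ) :
    |(fderivHyp w).det| = 2 * |w.1| / Real.sqrt (1 + w.2 ^ 2) := by
  have h0 := sqrt_one_add_sq_pos w.2
  have e : (fderivHyp w).det = -(2 * w.1 / Real.sqrt (1 + w.2 ^ 2)) := by
    unfold fderivHyp
    simp only [LinearMap.det_toContinuousLinearMap, LinearMap.det_toLin, Matrix.det_fin_two_of]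
    field_simp
    linear_combination (-2 * w.1) * sq_sqrt_one_add_sq w.2
  rw [e, abs_neg, abs_div, abs_mul, abs_of_pos h0, abs_two]

/-- `λμ = r²` fixes `r` up to sign, `λ + μ = 2r √(1 + x²)` fixes the sign, and `λ - μ` then gives
`x`. -/
lemma injOn_hyp : Set.InjOn hyp {w | w.1 ≠ 0} := by
  intro w hw v hv h
  have h1 : w.1 ^ 2 = v.1 ^ 2 := by rw [← hyp_mul, ← hyp_mul, h]
  have h2 : w.1 * w.2 = v.1 * v.2 := by
    have := hyp_sub w
    rw [h, hyp_sub] at this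
    linarith
  have h3 : w.1 * Real.sqrt (1 + w.2 ^ 2) = v.1 * Real.sqrt (1 + v.2 ^ 2) := by
    have := hyp_add w
    rw [h, hyp_add] at this
    linarith
  have h4 : w.1 = v.1 := by
    rcases sq_eq_sq_iff_eq_or_eq_neg.1 h1 with h | h
    · exact h
    · exfalso
      rw [h] at h3
      have : v.1 * (Real.sqrt (1 + w.2 ^ 2) + Real.sqrt (1 + v.2 ^ 2)) = 0 := by linarith
      rcases mul_eq_zero.1 this with h5 | h5
      · exact hv h5
      · have := sqrt_one_add_sq_pos w.2
        have := sqrt_one_add_sq_pos v.2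
        linarith
  rw [h4] at h2
  exact Prod.ext h4 (mul_left_cancel₀ hv h2)

lemma image_hyp : hyp '' {w | w.1 ≠ 0} = {z | 0 < z.1 * z.2} := by
  ext z
  constructor
  · rintro ⟨w, hw, rfl⟩
    change 0 < (hyp w).1 * (hyp w).2
    rw [hyp_mul]
    exact sq_pos_of_ne_zero hw
  · intro hz
    change 0 < z.1 * z.2 at hz
    set q := Real.sqrt (z.1 * z.2) with hq
    have hq0 : 0 < q := Real.sqrt_pos.2 hz
    have hq2 : q ^ 2 = z.1 * z.2 := Real.sq_sqrt hz.le
    -- Of the two roots of `r² = λμ`, the one with the sign of `λ + μ` is needed, so that `(λ +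
    -- μ)/(2r)` is the positive root `√(1 + x²)`.
    have key : ∀ r : ℝ, r ≠ 0 → r ^ 2 = z.1 * z.2 → 0 < r * (z.1 + z.2) →
        hyp (r, (z.1 - z.2) / (2 * r)) = z := by
      intro r hr hr2 hpos
      have hs : Real.sqrt (1 + ((z.1 - z.2) / (2 * r)) ^ 2) = (z.1 + z.2) / (2 * r) := by
        rw [Real.sqrt_eq_iff_mul_self_eq (by positivity)]
        · field_simp
          linear_combination 4 * hr2
        · rw [show (z.1 + z.2) / (2 * r) = r * (z.1 + z.2) / (2 * r ^ 2) by field_simp]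
          positivity
      simp only [hyp, hs]
      ext <;> field_simp <;> ring
    rcases pos_and_pos_or_neg_and_neg_of_mul_pos hz with ⟨h1, h2⟩ | ⟨h1, h2⟩
    · exact ⟨_, hq0.ne', key q hq0.ne' hq2 (by positivity)⟩
    · exact ⟨_, (neg_lt_zero.2 hq0).ne, key (-q) (neg_lt_zero.2 hq0).ne (by rw [neg_sq, hq2])
        (by nlinarith)⟩

lemma measurableSet_fst_ne_zero : MeasurableSet {w : ℝ × ℝ | w.1 ≠ 0} :=
  (measurableSet_eq_fun measurable_fst measurable_const).compl

lemma integral_eq_integral_hyp {g : ℝ × ℝ → ℂ} (hg : ∀ z, g z ≠ 0 → 0 < z.1 * z.2) :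
    ∫ z, g z = ∫ w : ℝ × ℝ, ((2 * |w.1| / Real.sqrt (1 + w.2 ^ 2) : ℝ) : ℂ) * g (hyp w) := by
  rw [← setIntegral_eq_integral_of_forall_compl_eq_zero (s := {z : ℝ × ℝ | 0 < z.1 * z.2})
      (f := g) (fun z hz => by
        by_contra h
        exact hz (hg z h)), ← image_hyp,
    integral_image_eq_integral_abs_det_fderiv_smul volume measurableSet_fst_ne_zero
      (fun w _ => (hasFDerivAt_hyp w).hasFDerivWithinAt) injOn_hyp g]
  simp only [abs_det_fderivHyp, Complex.real_smul]
  refine setIntegral_eq_integral_of_forall_compl_eq_zero fun w hw => ?_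
  have : w.1 = 0 := not_not.1 hw
  simp [this]

lemma integrable_hyp {g : ℝ × ℝ → ℂ} (hg : Integrable g) :
    Integrable fun w : ℝ × ℝ => ((2 * |w.1| / Real.sqrt (1 + w.2 ^ 2) : ℝ) : ℂ) * g (hyp w) := by
  have h1 := (integrableOn_image_iff_integrableOn_abs_det_fderiv_smul volume
    measurableSet_fst_ne_zero (fun w _ => (hasFDerivAt_hyp w).hasFDerivWithinAt) injOn_hyp g).1
    hg.integrableOn
  simp only [abs_det_fderivHyp, Complex.real_smul] at h1
  refine (integrableOn_iff_integrable_of_support_subset ?_).1 h1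
  intro w hw hw0
  have : w.1 = 0 := hw0
  exact hw (by simp [this])

/-- `k₀` on the real axis. -/
def kReal (m x : ℝ) : ℝ := m / 4 * (x + 1 / x)

/-- `exp (i θ (k₀(λ) - k₀(μ)))`. -/
def phaseDiff (m θ : ℝ) (z : ℝ × ℝ) : ℂ :=
  Complex.exp (Complex.I * (θ * (kReal m z.1 - kReal m z.2) : ℝ))

/-- `exp (i θ (k₀(λ) + k₀(μ)))`. -/
def phaseSum (m θ : ℝ) (z : ℝ × ℝ) : ℂ :=
  Complex.exp (Complex.I * (θ * (kReal m z.1 + kReal m z.2) : ℝ))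

lemma measurable_phaseDiff (m θ : ℝ) : Measurable (phaseDiff m θ) := by
  unfold phaseDiff kReal; fun_prop

lemma measurable_phaseSum (m θ : ℝ) : Measurable (phaseSum m θ) := by
  unfold phaseSum kReal; fun_prop

lemma norm_phaseDiff (m θ : ℝ) (z : ℝ × ℝ) : ‖phaseDiff m θ z‖ = 1 := norm_exp_I_mul _

lemma norm_phaseSum (m θ : ℝ) (z : ℝ × ℝ) : ‖phaseSum m θ z‖ = 1 := norm_exp_I_mul _

lemma hyp_fst_ne_zero {w : ℝ × ℝ} (hw : w.1 ≠ 0) : (hyp w).1 ≠ 0 ∧ (hyp w).2 ≠ 0 := by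
  have := hyp_mul w
  have h2 : (hyp w).1 * (hyp w).2 ≠ 0 := by rw [this]; exact pow_ne_zero 2 hw
  exact ⟨left_ne_zero_of_mul h2, right_ne_zero_of_mul h2⟩

/-- The reason for these coordinates: along a hyperbola `λμ = r²` the phase is exactly linear in
`x`, with a slope that has the sign of `k₀'(r)`. -/
lemma kReal_hyp_sub (m : ℝ) {w : ℝ × ℝ} (hw : w.1 ≠ 0) :
    kReal m (hyp w).1 - kReal m (hyp w).2 = m / 2 * (w.1 - 1 / w.1) * w.2 := by
  obtain ⟨h1, h2⟩ := hyp_fst_ne_zero hw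
  have e : kReal m (hyp w).1 - kReal m (hyp w).2
      = m / 4 * ((hyp w).1 - (hyp w).2) * (1 - 1 / ((hyp w).1 * (hyp w).2)) := by
    unfold kReal; field_simp; ring
  rw [e, hyp_mul, hyp_sub]
  field_simp
  ring

/-- Along a hyperbola this phase depends on `x` only through `√(1 + x²)`, and its coefficient
vanishes for no `r ≠ 0`. -/
lemma kReal_hyp_add (m : ℝ) {w : ℝ × ℝ} (hw : w.1 ≠ 0) :
    kReal m (hyp w).1 + kReal m (hyp w).2
      = m / 2 * (w.1 + 1 / w.1) * Real.sqrt (1 + w.2 ^ 2) := by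
  obtain ⟨h1, h2⟩ := hyp_fst_ne_zero hw
  have e : kReal m (hyp w).1 + kReal m (hyp w).2
      = m / 4 * ((hyp w).1 + (hyp w).2) * (1 + 1 / ((hyp w).1 * (hyp w).2)) := by
    unfold kReal; field_simp; ring
  rw [e, hyp_mul, hyp_add]
  field_simp
  ring

/-- The constant grows with `|θ|`, so for moving `θ` this only gives integrability at each fixed
value; the uniform estimate comes from `exists_bound_dirichlet`. -/
lemma exists_antiLip_phaseDiff (m θ : ℝ) {δ : ℝ} (hδ : 0 < δ) (L : ℝ) :
    ∃ C, ∀ F, TestLip δ L F →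
      AntiLip δ⁻¹ C fun z => (phaseDiff m θ z * ((z.1 + z.2 : ℝ) : ℂ)) * F z := by
  obtain ⟨C, hC0, -, hC⟩ := exists_bound_k m hδ
  have hδ' : 0 < δ⁻¹ := inv_pos.2 hδ
  set B := 2 * δ⁻¹ + 2 * δ⁻¹ * (2 * (|θ| * C)) with hB
  refine ⟨B * L + B * (L * δ⁻¹), fun F hF => hF.antiLip_mul hδ
    (g := fun z => phaseDiff m θ z * ((z.1 + z.2 : ℝ) : ℂ))
    ((measurable_phaseDiff m θ).mul (by fun_prop)) (B := B) (by positivity) ?_ ?_⟩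
  · intro z h1 h2 _
    rw [norm_mul, norm_phaseDiff, one_mul, Complex.norm_real, Real.norm_eq_abs]
    have := abs_add_le z.1 z.2
    have h3 := h1.2
    have h4 := h2.2
    have : 0 ≤ 2 * δ⁻¹ * (2 * (|θ| * C)) := by positivity
    linarith
  · intro z h1 h2 _
    simp only [Prod.fst_swap, Prod.snd_swap]
    rw [add_comm z.2 z.1, ← sub_mul, norm_mul, Complex.norm_real, Real.norm_eq_abs]
    have h5 : |z.1 + z.2| ≤ 2 * δ⁻¹ := by
      have := abs_add_le z.1 z.2
      have h3 := h1.2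
      have h4 := h2.2
      linarith
    have h6 : ‖phaseDiff m θ z - phaseDiff m θ z.swap‖ ≤ 2 * (|θ| * C) * |z.1 - z.2| := by
      refine (norm_exp_I_sub_le _ _).trans ?_
      simp only [Prod.fst_swap, Prod.snd_swap]
      rw [show θ * (kReal m z.1 - kReal m z.2) - θ * (kReal m z.2 - kReal m z.1)
        = 2 * (θ * (kReal m z.1 - kReal m z.2)) by ring, abs_mul, abs_mul, abs_two]
      have := (hC z.1 h1 z.2 h2).1
      rw [k₀_ofReal, k₀_ofReal, ← Complex.ofReal_sub, Complex.norm_real, Real.norm_eq_abs] at this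
      calc _ ≤ 2 * (|θ| * (C * |z.1 - z.2|)) := by
            gcongr
            exact this
        _ = _ := by ring
    have h7 := mul_le_mul h6 h5 (abs_nonneg _) (by positivity)
    have : 0 ≤ 2 * δ⁻¹ * |z.1 - z.2| := by positivity
    rw [hB]
    nlinarith

section kernel

variable {m δ L : ℝ} {F : ℝ × ℝ → ℂ}

/-- The Jacobian `2|r|/√(1 + x²)`, the factor `λ + μ = 2r √(1 + x²)` and the denominator `2(λ - μ) =
4rx` combine to `|r|/x`, which is the Dirichlet integrand. At `r = 0` and `x = 0` both sides agree
by the convention on division by zero. -/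
lemma quot_hyp (θ : ℝ) (w : ℝ × ℝ) :
    ((2 * |w.1| / Real.sqrt (1 + w.2 ^ 2) : ℝ) : ℂ) *
      (((phaseDiff m θ (hyp w) * (((hyp w).1 + (hyp w).2 : ℝ) : ℂ)) * F (hyp w)
        - (phaseDiff m θ (hyp w).swap * (((hyp w).swap.1 + (hyp w).swap.2 : ℝ) : ℂ))
          * F (hyp w).swap) / (2 * (((hyp w).1 - (hyp w).2 : ℝ) : ℂ)))
    = ((|w.1| : ℝ) : ℂ) * ((Complex.exp (Complex.I * (θ * (m / 2 * (w.1 - 1 / w.1)) * w.2 : ℝ))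
        * F (hyp (w.1, w.2))
      - Complex.exp (Complex.I * (-(θ * (m / 2 * (w.1 - 1 / w.1)) * w.2) : ℝ))
        * F (hyp (w.1, -w.2))) / w.2) := by
  by_cases hw : w.1 = 0
  · simp [hw]
  · have hs := sqrt_one_add_sq_pos w.2
    have e1 : phaseDiff m θ (hyp w)
        = Complex.exp (Complex.I * (θ * (m / 2 * (w.1 - 1 / w.1)) * w.2 : ℝ)) := by
      rw [phaseDiff, kReal_hyp_sub m hw]
      congr 3
      ring
    have e2 : phaseDiff m θ (hyp w).swap
        = Complex.exp (Complex.I * (-(θ * (m / 2 * (w.1 - 1 / w.1)) * w.2) : ℝ)) := by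
      rw [phaseDiff, Prod.fst_swap, Prod.snd_swap, ← neg_sub (kReal m (hyp w).1),
        kReal_hyp_sub m hw]
      congr 3
      ring
    have e3 : (hyp w).swap = hyp (w.1, -w.2) := hyp_swap w.1 w.2
    rw [e1, e2, Prod.fst_swap, Prod.snd_swap, add_comm (hyp w).2, hyp_add, hyp_sub, e3]
    have hs' : ((Real.sqrt (1 + w.2 ^ 2) : ℝ) : ℂ) ≠ 0 := Complex.ofReal_ne_zero.2 hs.ne'
    have hw' : (w.1 : ℂ) ≠ 0 := Complex.ofReal_ne_zero.2 hw
    by_cases hx : w.2 = 0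
    · simp [hx]
    · have hx' : (w.2 : ℂ) ≠ 0 := Complex.ofReal_ne_zero.2 hx
      push_cast
      field_simp

lemma abs_sqrt_one_add_sq_sub_le (x y : ℝ) :
    |Real.sqrt (1 + x ^ 2) - Real.sqrt (1 + y ^ 2)| ≤ |x - y| := by
  have h1 := sqrt_one_add_sq_pos x
  have h2 := sqrt_one_add_sq_pos y
  have hx : |x| ≤ Real.sqrt (1 + x ^ 2) := by
    rw [← Real.sqrt_sq_eq_abs]
    exact Real.sqrt_le_sqrt (by linarith)
  have hy : |y| ≤ Real.sqrt (1 + y ^ 2) := by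
    rw [← Real.sqrt_sq_eq_abs]
    exact Real.sqrt_le_sqrt (by linarith)
  have e : (Real.sqrt (1 + x ^ 2) - Real.sqrt (1 + y ^ 2))
      * (Real.sqrt (1 + x ^ 2) + Real.sqrt (1 + y ^ 2)) = (x - y) * (x + y) := by
    linear_combination sq_sqrt_one_add_sq x - sq_sqrt_one_add_sq y
  have e2 := congrArg abs e
  rw [abs_mul, abs_mul, abs_of_pos (add_pos h1 h2)] at e2
  have h3 : |x + y| ≤ Real.sqrt (1 + x ^ 2) + Real.sqrt (1 + y ^ 2) :=
    (abs_add_le x y).trans (add_le_add hx hy)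
  have h4 := mul_le_mul_of_nonneg_left h3 (abs_nonneg (x - y))
  rw [← e2] at h4
  exact le_of_mul_le_mul_right h4 (add_pos h1 h2)

lemma TestLip.abs_fst_le (h : TestLip δ L F) (hδ : 0 < δ) {w : ℝ × ℝ} (hw : F (hyp w) ≠ 0) :
    δ ≤ |w.1| ∧ |w.1| ≤ δ⁻¹ := by
  obtain ⟨h1, h2, -⟩ := h.supp _ hw
  have e : |(hyp w).1| * |(hyp w).2| = |w.1| ^ 2 := by rw [← abs_mul, hyp_mul, abs_pow]
  constructor
  · refine le_of_sq_le_sq ?_ (abs_nonneg _)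
    rw [← e, sq]
    exact mul_le_mul h1.1 h2.1 hδ.le (abs_nonneg _)
  · refine le_of_sq_le_sq ?_ (inv_nonneg.2 hδ.le)
    rw [← e, sq]
    exact mul_le_mul h1.2 h2.2 (abs_nonneg _) (inv_nonneg.2 hδ.le)

/-- On the support `|r| ≥ δ` and `2|r||x| = |λ - μ| ≤ 2δ⁻¹`, which confines `x` to `|x| ≤ δ⁻²`. The
constants do not depend on `r`. -/
lemma TestLip.lipSupp (h : TestLip δ L F) (hδ : 0 < δ) (r : ℝ) :
    LipSupp (L * (2 * δ⁻¹)) (δ⁻¹ * δ⁻¹) fun x => F (hyp (r, x)) where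
  lip x y := by
    have hL := h.nonneg
    by_cases hr : |r| ≤ δ⁻¹
    · refine (h.lip _ _).trans ?_
      rw [mul_assoc]
      refine mul_le_mul_of_nonneg_left ?_ hL
      have hd := abs_sqrt_one_add_sq_sub_le x y
      rw [Prod.dist_eq]
      simp only [hyp, Real.dist_eq]
      refine max_le ?_ ?_
      · rw [show r * (Real.sqrt (1 + x ^ 2) + x) - r * (Real.sqrt (1 + y ^ 2) + y)
          = r * ((Real.sqrt (1 + x ^ 2) - Real.sqrt (1 + y ^ 2)) + (x - y)) by ring, abs_mul]
        have := (abs_add_le (Real.sqrt (1 + x ^ 2) - Real.sqrt (1 + y ^ 2)) (x - y)).trans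
          (add_le_add_left hd _)
        calc _ ≤ δ⁻¹ * (|x - y| + |x - y|) := mul_le_mul hr this (abs_nonneg _) (by positivity)
          _ = _ := by ring
      · rw [show r * (Real.sqrt (1 + x ^ 2) - x) - r * (Real.sqrt (1 + y ^ 2) - y)
          = r * ((Real.sqrt (1 + x ^ 2) - Real.sqrt (1 + y ^ 2)) - (x - y)) by ring, abs_mul]
        have := (abs_sub (Real.sqrt (1 + x ^ 2) - Real.sqrt (1 + y ^ 2)) (x - y)).trans
          (add_le_add_left hd _)
        calc _ ≤ δ⁻¹ * (|x - y| + |x - y|) := mul_le_mul hr this (abs_nonneg _) (by positivity)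
          _ = _ := by ring
    · have h0 : ∀ x, F (hyp (r, x)) = 0 := fun x => by
        by_contra hne
        exact hr (h.abs_fst_le hδ hne).2
      rw [h0, h0, sub_zero, norm_zero]
      positivity
  supp x hx := by
    have h1 := (h.abs_fst_le hδ hx).1
    obtain ⟨h2, h3, -⟩ := h.supp _ hx
    have e := congrArg abs (hyp_sub (r, x))
    rw [abs_mul, abs_mul, abs_two] at e
    have h4 : |(hyp (r, x)).1 - (hyp (r, x)).2| ≤ δ⁻¹ + δ⁻¹ :=
      (abs_sub _ _).trans (add_le_add h2.2 h3.2)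
    rw [e] at h4
    simp only at h4 h1
    have h5 : δ * |x| ≤ δ⁻¹ := by nlinarith [mul_le_mul_of_nonneg_right h1 (abs_nonneg x)]
    rw [← div_eq_mul_inv δ⁻¹ δ, le_div_iff₀ hδ]
    linarith

/-- Fubini in hyperbolic coordinates: the planar principal value becomes an integral over `r` of
one-dimensional Dirichlet integrals whose frequency is `θ` times the slope of the phase. -/
lemma TestLip.pvSym_phaseDiff (h : TestLip δ L F) (hδ : 0 < δ) (m θ : ℝ) :
    Integrable (fun r : ℝ => ((|r| : ℝ) : ℂ)
      * dirichlet (θ * (m / 2 * (r - 1 / r))) fun x => F (hyp (r, x))) ∧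
    pvSym (fun z => (phaseDiff m θ z * ((z.1 + z.2 : ℝ) : ℂ)) * F z)
      = ∫ r : ℝ, ((|r| : ℝ) : ℂ) * dirichlet (θ * (m / 2 * (r - 1 / r))) fun x => F (hyp (r, x)) := by
  obtain ⟨C, hC⟩ := exists_antiLip_phaseDiff m θ hδ L
  have hA := hC F h
  have hi := hA.integrable_quot
  have hs : ∀ z : ℝ × ℝ, ((phaseDiff m θ z * ((z.1 + z.2 : ℝ) : ℂ)) * F z
      - (phaseDiff m θ z.swap * ((z.swap.1 + z.swap.2 : ℝ) : ℂ)) * F z.swap)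
        / (2 * ((z.1 - z.2 : ℝ) : ℂ)) ≠ 0 → 0 < z.1 * z.2 := by
    intro z hz
    by_contra hn
    have h1 : F z = 0 := by
      by_contra hne
      exact hn (h.supp z hne).2.2
    have h2 : F z.swap = 0 := by
      by_contra hne
      exact hn (h.swap_supp z hne).2.2
    rw [h1, h2] at hz
    simp at hz
  have h1 := integral_eq_integral_hyp hs
  have h2 := integrable_hyp hi
  simp only [quot_hyp] at h1 h2
  rw [Measure.volume_eq_prod] at h2
  have h3 := h2.integral_prod_left
  have h4 := integral_prod _ h2
  simp only [integral_const_mul] at h3 h4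
  refine ⟨h3, ?_⟩
  rw [pvSym, h1, Measure.volume_eq_prod, h4]
  rfl

end kernel

/-- `θ` tends to `+∞` with `s = 1` or to `-∞` with `s = -1`. -/
def TendstoSign (θ : ℝ → ℝ) (l : Filter ℝ) (s : ℝ) : Prop :=
  (Tendsto θ l atTop ∧ s = 1) ∨ (Tendsto θ l atBot ∧ s = -1)

lemma TendstoSign.dirichlet {l : Filter ℝ} [l.NeBot] [l.IsCountablyGenerated] {θ : ℝ → ℝ} {s : ℝ}
    (hθ : TendstoSign θ l s) {L a : ℝ} (ha : 0 < a) {f : ℝ → ℝ → ℂ} {f₀ : ℝ → ℂ}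
    (h : ∀ᶠ i in l, LipSupp L a (f i)) (ht : ∀ x, Tendsto (fun i => f i x) l (𝓝 (f₀ x)))
    {c : ℝ} (hc : c ≠ 0) :
    Tendsto (fun i => dirichlet (θ i * c) (f i)) l
      (𝓝 ((s * Real.sign c : ℝ) * (2 * Complex.I * Real.pi * f₀ 0))) := by
  rcases hθ with ⟨hθ, rfl⟩ | ⟨hθ, rfl⟩ <;> rcases lt_or_gt_of_ne hc with hc | hc
  · have := tendsto_dirichlet_atBot ha h ht (hθ.atTop_mul_const_of_neg hc)
    simpa [Real.sign_of_neg hc] using this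
  · have := tendsto_dirichlet ha h ht (hθ.atTop_mul_const hc)
    simpa [Real.sign_of_pos hc] using this
  · have := tendsto_dirichlet ha h ht (hθ.atBot_mul_const_of_neg hc)
    simpa [Real.sign_of_neg hc] using this
  · have := tendsto_dirichlet_atBot ha h ht (hθ.atBot_mul_const hc)
    simpa [Real.sign_of_pos hc] using this

/-- Converts the Jacobian factor and the sign of the slope into `r sgn(r² - 1)`, which is half of
`sgn(λ² - 1)(λ + μ)` on the diagonal. -/
lemma abs_mul_sign {m r : ℝ} (hm : 0 < m) (hr : r ≠ 0) :
    |r| * Real.sign (m / 2 * (r - 1 / r)) = r * Real.sign (r ^ 2 - 1) := by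
  have e : m / 2 * (r - 1 / r) = m / 2 * (r ^ 2 - 1) / r := by field_simp
  rw [e]
  rcases lt_or_gt_of_ne hr with h | h <;> rcases lt_trichotomy (r ^ 2 - 1) 0 with h1 | h1 | h1
  · rw [abs_of_neg h, Real.sign_of_neg h1, Real.sign_of_pos]
    · ring
    · exact div_pos_of_neg_of_neg (mul_neg_of_pos_of_neg (by positivity) h1) h
  · simp [h1]
  · rw [abs_of_neg h, Real.sign_of_pos h1, Real.sign_of_neg]
    · ring
    · exact div_neg_of_pos_of_neg (by positivity) h
  · rw [abs_of_pos h, Real.sign_of_neg h1, Real.sign_of_neg]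
    exact div_neg_of_neg_of_pos (mul_neg_of_pos_of_neg (by positivity) h1) h
  · simp [h1]
  · rw [abs_of_pos h, Real.sign_of_pos h1, Real.sign_of_pos]
    positivity

/-- A two-dimensional form of `exp(iKx) p.v. 1/x → ±iπ δ(x)`. For almost every `r` the Dirichlet
integral tends to `±2πi` times the value on the diagonal, with the sign of the slope times that of
`θ`; the bound uniform in frequency passes the limit through the integral over `r`. -/
lemma tendsto_pvSym_phaseDiff {l : Filter ℝ} [l.NeBot] [l.IsCountablyGenerated] {θ : ℝ → ℝ}
    {s m δ L : ℝ} (hm : 0 < m) (hδ : 0 < δ) (hθ : TendstoSign θ l s) {F : ℝ → ℝ × ℝ → ℂ}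
    {F₀ : ℝ × ℝ → ℂ} (h : ∀ᶠ T in l, TestLip δ L (F T))
    (ht : ∀ z, Tendsto (fun T => F T z) l (𝓝 (F₀ z))) :
    Tendsto (fun T => pvSym fun z => (phaseDiff m (θ T) z * ((z.1 + z.2 : ℝ) : ℂ)) * F T z) l
      (𝓝 (s * Complex.I * Real.pi * diagDelta fun z =>
        ((Real.sign (z.1 ^ 2 - 1) * (z.1 + z.2) : ℝ) : ℂ) * F₀ z)) := by
  have h₀ := TestLip.of_tendsto h ht
  have ha : 0 < δ⁻¹ * δ⁻¹ := by positivity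
  obtain ⟨C, hC⟩ := exists_bound_dirichlet (L * (2 * δ⁻¹)) ha
  have hC0 : 0 ≤ C := (norm_nonneg _).trans (hC _ (h₀.lipSupp hδ 0) 0)
  -- At `r = ±1` the slope vanishes, and `r = 0` is the degenerate hyperbola; all three are
  -- negligible.
  have hcount : ∀ᵐ r : ℝ, r ∉ ({0, 1, -1} : Set ℝ) :=
    (Set.Finite.countable (by simp)).ae_notMem volume
  have key : Tendsto (fun T => ∫ r : ℝ, ((|r| : ℝ) : ℂ)
      * dirichlet (θ T * (m / 2 * (r - 1 / r))) fun x => F T (hyp (r, x))) l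
      (𝓝 (∫ r : ℝ, ((|r| : ℝ) : ℂ) * ((s * Real.sign (m / 2 * (r - 1 / r)) : ℝ)
        * (2 * Complex.I * Real.pi * F₀ (hyp (r, 0)))))) := by
    refine tendsto_integral_filter_of_dominated_convergence
      ((Set.Icc (-δ⁻¹) δ⁻¹).indicator fun _ => δ⁻¹ * C) ?_ ?_ ?_ ?_
    · filter_upwards [h] with T hT using (hT.pvSym_phaseDiff hδ m (θ T)).1.aestronglyMeasurable
    · filter_upwards [h] with T hT
      refine Eventually.of_forall fun r => ?_
      by_cases hr : r ∈ Set.Icc (-δ⁻¹) δ⁻¹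
      · rw [Set.indicator_of_mem hr, norm_mul, Complex.norm_real, Real.norm_eq_abs, abs_abs]
        exact mul_le_mul (abs_le.2 hr) (hC _ (hT.lipSupp hδ r) _) (norm_nonneg _) (by positivity)
      · have : ∀ x, F T (hyp (r, x)) = 0 := fun x => by
          by_contra hne
          exact hr (abs_le.1 (hT.abs_fst_le hδ hne).2)
        rw [Set.indicator_of_notMem hr]
        simp [dirichlet, this]
    · rw [integrable_indicator_iff measurableSet_Icc]
      exact integrableOn_const (by simp)
    · filter_upwards [hcount] with r hr
      simp only [Set.mem_insert_iff, Set.mem_singleton_iff, not_or] at hr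
      refine Tendsto.const_mul _ (hθ.dirichlet ha (h.mono fun T hT => hT.lipSupp hδ r)
        (fun x => ht _) ?_)
      refine mul_ne_zero (by positivity) ?_
      rw [sub_ne_zero]
      intro he
      have : r ^ 2 = 1 ^ 2 := by
        have h0 := hr.1
        field_simp at he
        linarith
      rcases sq_eq_sq_iff_eq_or_eq_neg.1 this with h5 | h5
      · exact hr.2.1 h5
      · exact hr.2.2 h5
  have e : (∫ r : ℝ, ((|r| : ℝ) : ℂ) * ((s * Real.sign (m / 2 * (r - 1 / r)) : ℝ)
        * (2 * Complex.I * Real.pi * F₀ (hyp (r, 0)))))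
      = s * Complex.I * Real.pi * diagDelta fun z =>
        ((Real.sign (z.1 ^ 2 - 1) * (z.1 + z.2) : ℝ) : ℂ) * F₀ z := by
    rw [diagDelta, ← integral_const_mul]
    refine integral_congr_ae ?_
    filter_upwards [hcount] with r hr
    simp only [Set.mem_insert_iff, not_or] at hr
    have := congrArg (Complex.ofReal) (abs_mul_sign hm hr.1)
    rw [Complex.ofReal_mul, Complex.ofReal_mul] at this
    rw [hyp_zero]
    push_cast
    linear_combination (2 * s * Complex.I * Real.pi * F₀ (r, r)) * this
  rw [e] at key
  refine key.congr' ?_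
  filter_upwards [h] with T hT
  exact (hT.pvSym_phaseDiff hδ m (θ T)).2.symm

/-! Riemann-Lebesgue for the phase `k₀(λ) + k₀(μ)`. -/

lemma image_sqrt_sq_sub_one : (fun y : ℝ => Real.sqrt (y ^ 2 - 1)) '' Set.Ioi 1 = Set.Ioi 0 := by
  ext x
  constructor
  · rintro ⟨y, hy, rfl⟩
    have : (1 : ℝ) < y := hy
    exact Real.sqrt_pos.2 (by nlinarith)
  · intro hx
    have hx : (0 : ℝ) < x := hx
    refine ⟨Real.sqrt (1 + x ^ 2), ?_, ?_⟩
    · exact Real.lt_sqrt_of_sq_lt (by nlinarith)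
    · simp only [sq_sqrt_one_add_sq, add_sub_cancel_left, Real.sqrt_sq hx.le]

/-- The substitution `y = √(1 + x²)` makes the phase linear; the Jacobian singularity at `y = 1` is
absorbed into the amplitude. -/
lemma tendsto_integral_Ioi_exp_sqrt (g : ℝ → ℂ) : Tendsto (fun K : ℝ => ∫ x in Set.Ioi (0 : ℝ),
    Complex.exp (Complex.I * (K * Real.sqrt (1 + x ^ 2) : ℝ)) * g x) atTop (𝓝 0) := by
  have hd : ∀ y ∈ Set.Ioi (1 : ℝ), HasDerivWithinAt (fun y : ℝ => Real.sqrt (y ^ 2 - 1))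
      (y / Real.sqrt (y ^ 2 - 1)) (Set.Ioi 1) y := by
    intro y hy
    have hy : (1 : ℝ) < y := hy
    have hp : 0 < y ^ 2 - 1 := by nlinarith
    have h := (((hasDerivAt_id y).pow 2).sub_const 1).sqrt (by simpa using hp.ne')
    refine (h.congr_deriv ?_).hasDerivWithinAt
    have := (Real.sqrt_pos.2 hp).ne'
    simp
    field_simp
  have hinj : Set.InjOn (fun y : ℝ => Real.sqrt (y ^ 2 - 1)) (Set.Ioi 1) := by
    intro y hy z hz h
    have hy : (1 : ℝ) < y := hy
    have hz : (1 : ℝ) < z := hz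
    have h2 := congrArg (· ^ 2) h
    simp only at h2
    rw [Real.sq_sqrt (by nlinarith), Real.sq_sqrt (by nlinarith)] at h2
    nlinarith
  have h := tendsto_integral_exp_mul ((Set.Ioi (1 : ℝ)).indicator fun y =>
    ((|y / Real.sqrt (y ^ 2 - 1)| : ℝ) : ℂ) * g (Real.sqrt (y ^ 2 - 1)))
  refine h.congr fun K => ?_
  rw [← image_sqrt_sq_sub_one,
    integral_image_eq_integral_abs_deriv_smul measurableSet_Ioi hd hinj,
    ← integral_indicator measurableSet_Ioi]
  refine integral_congr_ae (Eventually.of_forall fun y => ?_)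
  by_cases hy : y ∈ Set.Ioi (1 : ℝ)
  · have hy' : (1 : ℝ) < y := hy
    simp only [Set.indicator_of_mem hy, Complex.real_smul]
    rw [Real.sq_sqrt (by nlinarith), add_sub_cancel, Real.sqrt_sq (by linarith)]
    ring
  · simp only [Set.indicator_of_notMem hy, mul_zero]

lemma tendsto_integral_exp_sqrt {g : ℝ → ℂ} (hg : Integrable g) : Tendsto (fun K : ℝ => ∫ x : ℝ,
    Complex.exp (Complex.I * (K * Real.sqrt (1 + x ^ 2) : ℝ)) * g x) atTop (𝓝 0) := by
  have h1 := tendsto_integral_Ioi_exp_sqrt g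
  have h2 := tendsto_integral_Ioi_exp_sqrt fun x => g (-x)
  have h3 := h1.add h2
  rw [add_zero] at h3
  refine h3.congr fun K => ?_
  have hi : Integrable fun x : ℝ =>
      Complex.exp (Complex.I * (K * Real.sqrt (1 + x ^ 2) : ℝ)) * g x :=
    hg.bdd_mul (c := 1) (Continuous.aestronglyMeasurable (by fun_prop))
      (Eventually.of_forall fun x => (norm_exp_I_mul _).le)
  have e := integral_comp_neg_Ioi (0 : ℝ) (fun x : ℝ =>
    Complex.exp (Complex.I * (K * Real.sqrt (1 + x ^ 2) : ℝ)) * g x)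
  simp only [neg_sq, neg_zero] at e
  rw [e, add_comm, ← intervalIntegral.integral_Iic_add_Ioi hi.integrableOn hi.integrableOn]

/-- Complex conjugation exchanges the two directions of the frequency. -/
lemma tendsto_integral_exp_sqrt_atBot {g : ℝ → ℂ} (hg : Integrable g) :
    Tendsto (fun K : ℝ => ∫ x : ℝ,
      Complex.exp (Complex.I * (K * Real.sqrt (1 + x ^ 2) : ℝ)) * g x) atBot (𝓝 0) := by
  have h1 := (tendsto_integral_exp_sqrt (g := fun x => (starRingEnd ℂ) (g x))
    (Complex.conjCLE.toContinuousLinearMap.integrable_comp hg)).comp tendsto_neg_atBot_atTop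
  have h2 := (Complex.continuous_conj.tendsto 0).comp h1
  rw [map_zero] at h2
  refine h2.congr fun K => ?_
  simp only [Function.comp]
  rw [← integral_conj]
  refine integral_congr_ae (Eventually.of_forall fun x => ?_)
  simp [← Complex.exp_conj]

/-- Riemann–Lebesgue along almost every hyperbola, then dominated convergence in `r`. Integrability
of the amplitude is enough, since the factor `λ - μ` cancels the singular denominator in these
entries. -/
lemma tendsto_integral_phaseSum {l : Filter ℝ} [l.IsCountablyGenerated] {θ : ℝ → ℝ}
    {s m : ℝ} (hm : 0 < m) (hθ : TendstoSign θ l s) {g : ℝ × ℝ → ℂ} (hg : Integrable g)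
    (hs : ∀ z, g z ≠ 0 → 0 < z.1 * z.2) :
    Tendsto (fun T => ∫ z, phaseSum m (θ T) z * g z) l (𝓝 0) := by
  set G : ℝ × ℝ → ℂ := fun w =>
    ((2 * |w.1| / Real.sqrt (1 + w.2 ^ 2) : ℝ) : ℂ) * g (hyp w) with hG
  have hGi : Integrable G (volume.prod volume) := by
    rw [← Measure.volume_eq_prod]; exact integrable_hyp hg
  have hPi : ∀ T, Integrable (fun w : ℝ × ℝ => Complex.exp (Complex.I
      * (θ T * (m / 2 * (w.1 + 1 / w.1)) * Real.sqrt (1 + w.2 ^ 2) : ℝ)) * G w)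
      (volume.prod volume) := fun T =>
    hGi.bdd_mul (c := 1) (Measurable.aestronglyMeasurable (by fun_prop))
      (Eventually.of_forall fun x => (norm_exp_I_mul _).le)
  have e : ∀ T, ∫ z, phaseSum m (θ T) z * g z = ∫ r : ℝ, ∫ x : ℝ, Complex.exp (Complex.I
      * (θ T * (m / 2 * (r + 1 / r)) * Real.sqrt (1 + x ^ 2) : ℝ)) * G (r, x) := by
    intro T
    rw [integral_eq_integral_hyp (fun z hz => hs z (right_ne_zero_of_mul hz)),
      ← integral_prod _ (hPi T), ← Measure.volume_eq_prod]
    refine integral_congr_ae (Eventually.of_forall fun w => ?_)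
    by_cases hw : w.1 = 0
    · simp [hG, hw]
    · simp only [hG, phaseSum]
      rw [kReal_hyp_add m hw, ← mul_assoc (θ T)]
      ring
  simp only [e]
  rw [show (0 : ℂ) = ∫ r : ℝ, (0 : ℂ) by simp]
  refine tendsto_integral_filter_of_dominated_convergence (fun r => ∫ x : ℝ, ‖G (r, x)‖) ?_ ?_
    hGi.norm.integral_prod_left ?_
  · exact Eventually.of_forall fun T => (hPi T).integral_prod_left.aestronglyMeasurable
  · refine Eventually.of_forall fun T => Eventually.of_forall fun r => ?_
    refine (norm_integral_le_integral_norm _).trans (le_of_eq ?_)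
    simp only [norm_mul, norm_exp_I_mul, one_mul]
  · filter_upwards [hGi.prod_right_ae, (Set.countable_singleton (0 : ℝ)).ae_notMem volume]
      with r hr hr0
    have hr0 : r ≠ 0 := hr0
    have hc : m / 2 * (r + 1 / r) ≠ 0 := by
      refine mul_ne_zero (by positivity) ?_
      rw [show r + 1 / r = (r ^ 2 + 1) / r by field_simp]
      exact div_ne_zero (by positivity) hr0
    have hT : Tendsto (fun T => θ T * (m / 2 * (r + 1 / r))) l atTop
        ∨ Tendsto (fun T => θ T * (m / 2 * (r + 1 / r))) l atBot := by
      rcases hθ with ⟨hθ, rfl⟩ | ⟨hθ, rfl⟩ <;> rcases lt_or_gt_of_ne hc with hc | hc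
      · exact Or.inr (hθ.atTop_mul_const_of_neg hc)
      · exact Or.inl (hθ.atTop_mul_const hc)
      · exact Or.inl (hθ.atBot_mul_const_of_neg hc)
      · exact Or.inr (hθ.atBot_mul_const hc)
    rcases hT with hT | hT
    · exact (tendsto_integral_exp_sqrt hr).comp hT
    · exact (tendsto_integral_exp_sqrt_atBot hr).comp hT

end SineGordon
end


/-! ### The `r`-matrix conjugated by the asymptotic solutions -/

noncomputable section

open scoped Matrix.Norms.Operator

namespace SineGordon

/-- `λ - μ` times the entries of `r` conjugated by the asymptotic solutions, up to the factor
`-γ`. -/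
def rhoKernel (m θ : ℝ) (I J : Fin 2 × Fin 2) (z : ℝ × ℝ) : ℂ :=
  if I = J then
    if I.1 = I.2 then ((z.1 - z.2 : ℝ) : ℂ) * (((z.1 - z.2) / (z.1 + z.2) : ℝ) : ℂ)
    else ((z.1 + z.2 : ℝ) : ℂ)
  else if I = (0, 1) ∧ J = (1, 0) then -(phaseDiff m θ z * ((z.1 + z.2 : ℝ) : ℂ))
  else if I = (1, 0) ∧ J = (0, 1) then -(phaseDiff m (-θ) z * ((z.1 + z.2 : ℝ) : ℂ))
  else if I = (0, 0) ∧ J = (1, 1) then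
    ((z.1 - z.2 : ℝ) : ℂ) * (phaseSum m θ z * (((z.1 - z.2) / (z.1 + z.2) : ℝ) : ℂ))
  else if I = (1, 1) ∧ J = (0, 0) then
    ((z.1 - z.2 : ℝ) : ℂ) * (phaseSum m (-θ) z * (((z.1 - z.2) / (z.1 + z.2) : ℝ) : ℂ))
  else 0

section algebra

/-- `r` preserves the total `σ₃`-weight, so the charge-dependent factor of `ℰ`, the same for `λ` and
`μ`, passes through it: the kernel does not see `Q`. -/
lemma rMatrix_mul_expσ₃ (β : ℝ) (l n c : ℂ) :
    rMatrix β l n * (expσ₃ c ⊗ₖ expσ₃ c) = (expσ₃ c ⊗ₖ expσ₃ c) * rMatrix β l n := by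
  ext ⟨i, k⟩ ⟨j, q⟩
  fin_cases i <;> fin_cases k <;> fin_cases j <;> fin_cases q <;>
  simp [rMatrix, σ₁, σ₂, σ₃, expσ₃, Matrix.mul_apply, Fintype.sum_prod_type] <;> ring

/-- `rhoKernel` without its phases. -/
def rhoZero (z : ℝ × ℝ) : Matrix (Fin 2 × Fin 2) (Fin 2 × Fin 2) ℂ :=
  Matrix.of fun I J => rhoKernel 0 0 I J z

/-- The two nontrivial entries of `r`. -/
lemma rMatrix_eq (β : ℝ) (l n : ℂ) : rMatrix β l n = Matrix.of fun I J =>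
    if I.1 = I.2 then 0
    else if I = J then -2 * gam β * ((l ^ 2 + n ^ 2) / (l ^ 2 - n ^ 2))
    else if I = J.swap then 4 * gam β * (l * n / (l ^ 2 - n ^ 2)) else 0 := by
  ext ⟨i, k⟩ ⟨j, q⟩
  fin_cases i <;> fin_cases k <;> fin_cases j <;> fin_cases q <;>
  simp [rMatrix, σ₁, σ₂, σ₃] <;> ring

lemma rhoZero_eq (z : ℝ × ℝ) : rhoZero z = Matrix.of fun I J =>
    if I.1 = I.2 then
      if J.1 = J.2 then ((z.1 - z.2 : ℝ) : ℂ) * (((z.1 - z.2) / (z.1 + z.2) : ℝ) : ℂ) else 0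
    else if I = J then ((z.1 + z.2 : ℝ) : ℂ)
    else if I = J.swap then -((z.1 + z.2 : ℝ) : ℂ) else 0 := by
  ext ⟨i, k⟩ ⟨j, q⟩
  fin_cases i <;> fin_cases k <;> fin_cases j <;> fin_cases q <;>
  simp [rhoZero, rhoKernel, phaseDiff, phaseSum, kReal]

/-- Conjugation by `N ⊗ N` rotates the distinguished axis of `r` from `σ₃` to `σ₂`, so that the
vacuum evolution becomes diagonal. The factor `λ - μ` clears the pole at `λ = μ`; the one at `λ =
-μ` remains in the entries with ratio `(λ - μ)/(λ + μ)`. -/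
lemma rMatrix_mul_matN (β : ℝ) {x y : ℝ} (hxy : x ^ 2 ≠ y ^ 2) :
    ((x - y : ℝ) : ℂ) • (rMatrix β x y * (matN ⊗ₖ matN))
      = (matN ⊗ₖ matN) * ((-gam β) • rhoZero (x, y)) := by
  have h1 : (x : ℂ) - y ≠ 0 := by
    rw [← Complex.ofReal_sub, Complex.ofReal_ne_zero]
    intro h; apply hxy; rw [show x = y by linarith]
  have h2 : (x : ℂ) + y ≠ 0 := by
    rw [← Complex.ofReal_add, Complex.ofReal_ne_zero]
    intro h; apply hxy; rw [show x = -y by linarith, neg_sq]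
  set N : Mat2 := !![1, Complex.I; Complex.I, 1] with hN
  have eN : matN = ((1 / Real.sqrt 2 : ℝ) : ℂ) • N := by
    rw [matN]
    congr 1
    ext i j
    fin_cases i <;> fin_cases j <;> simp [hN, σ₁]
  have key : ((x - y : ℝ) : ℂ) • (rMatrix β x y * (N ⊗ₖ N))
      = (N ⊗ₖ N) * ((-gam β) • rhoZero (x, y)) := by
    set a : ℂ := ((x : ℂ) ^ 2 + y ^ 2) / (x ^ 2 - y ^ 2) with ha
    set b : ℂ := (x : ℂ) * y / (x ^ 2 - y ^ 2) with hb
    set c : ℂ := (((x - y) / (x + y) : ℝ) : ℂ) with hc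
    have h3 : (x : ℂ) ^ 2 - y ^ 2 ≠ 0 := by
      rw [sq_sub_sq]; exact mul_ne_zero h2 h1
    -- All rational functions are expressed through `b`, which turns the sixteen entries into linear
    -- identities.
    have e1 : ((x : ℂ) - y) * a = (x + y) - 2 * ((x : ℂ) - y) * b := by
      rw [ha, hb]; field_simp; ring
    have e2 : ((x : ℂ) - y) * c = (x + y) - 4 * ((x : ℂ) - y) * b := by
      rw [hc, hb, sq_sub_sq]; push_cast; field_simp; ring
    rw [rMatrix_eq, rhoZero_eq, ← ha, ← hb]
    simp only [← hc]
    ext ⟨i, k⟩ ⟨j, q⟩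
    fin_cases i <;> fin_cases k <;> fin_cases j <;> fin_cases q <;>
    simp [hN, Matrix.mul_apply, Fintype.sum_prod_type] <;>
    first
      | ring1
      | linear_combination (-2 * gam β * Complex.I) * e1 + (2 * gam β * Complex.I) * e2
      | linear_combination (-2 * gam β) * e1
      | linear_combination (2 * gam β) * e1
  rw [eN, Matrix.smul_kronecker, Matrix.kronecker_smul]
  simp only [Matrix.mul_smul, Matrix.smul_mul] at key ⊢
  rw [smul_comm _ (((1 / Real.sqrt 2 : ℝ) : ℂ)), smul_comm _ (((1 / Real.sqrt 2 : ℝ) : ℂ)), key]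
  simp only [smul_comm (-gam β)]

/-- Conjugation by diagonal phases does not change the diagonal; an entry off the diagonal links
opposite weights in both tensor factors, so each spectral parameter contributes its phase twice.
Hence the argument `2 * T`. -/
lemma rhoZero_mul_expσ₃ (m T x y : ℝ) :
    rhoZero (x, y) * (expσ₃ (Complex.I * (-(kReal m x * T) : ℝ))
        ⊗ₖ expσ₃ (Complex.I * (-(kReal m y * T) : ℝ)))
      = (expσ₃ (Complex.I * (-(kReal m x * T) : ℝ)) ⊗ₖ expσ₃ (Complex.I * (-(kReal m y * T) : ℝ)))
        * Matrix.of fun I J => rhoKernel m (2 * T) I J (x, y) := by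
  have d1 : phaseDiff m (2 * T) (x, y)
      = (Complex.exp (Complex.I * (kReal m x * T : ℝ))) ^ 2
        * (Complex.exp (Complex.I * (-(kReal m y * T) : ℝ))) ^ 2 := by
    rw [phaseDiff, ← Complex.exp_nat_mul, ← Complex.exp_nat_mul, ← Complex.exp_add]
    congr 1; push_cast; ring
  have d2 : phaseDiff m (-(2 * T)) (x, y)
      = (Complex.exp (Complex.I * (-(kReal m x * T) : ℝ))) ^ 2
        * (Complex.exp (Complex.I * (kReal m y * T : ℝ))) ^ 2 := by
    rw [phaseDiff, ← Complex.exp_nat_mul, ← Complex.exp_nat_mul, ← Complex.exp_add]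
    congr 1; push_cast; ring
  have d3 : phaseSum m (2 * T) (x, y)
      = (Complex.exp (Complex.I * (kReal m x * T : ℝ))) ^ 2
        * (Complex.exp (Complex.I * (kReal m y * T : ℝ))) ^ 2 := by
    rw [phaseSum, ← Complex.exp_nat_mul, ← Complex.exp_nat_mul, ← Complex.exp_add]
    congr 1; push_cast; ring
  have d4 : phaseSum m (-(2 * T)) (x, y)
      = (Complex.exp (Complex.I * (-(kReal m x * T) : ℝ))) ^ 2
        * (Complex.exp (Complex.I * (-(kReal m y * T) : ℝ))) ^ 2 := by
    rw [phaseSum, ← Complex.exp_nat_mul, ← Complex.exp_nat_mul, ← Complex.exp_add]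
    congr 1; push_cast; ring
  have hm : ∀ c : ℝ, Complex.exp (Complex.I * (-c : ℝ)) * Complex.exp (Complex.I * (c : ℝ)) = 1 := by
    intro c
    rw [← Complex.exp_add, ← Complex.exp_zero]
    congr 1; push_cast; ring
  have hx := hm (kReal m x * T)
  have hy := hm (kReal m y * T)
  have hneg : ∀ c : ℝ, -(Complex.I * ((-c : ℝ) : ℂ)) = Complex.I * (c : ℝ) := by
    intro c; push_cast; ring
  rw [rhoZero_eq]
  simp only [expσ₃, hneg]
  set X := Complex.exp (Complex.I * (kReal m x * T : ℝ))
  set Y := Complex.exp (Complex.I * (kReal m y * T : ℝ))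
  set X' := Complex.exp (Complex.I * (-(kReal m x * T) : ℝ))
  set Y' := Complex.exp (Complex.I * (-(kReal m y * T) : ℝ))
  set c : ℂ := (((x - y) / (x + y) : ℝ) : ℂ) with hc
  ext ⟨i, k⟩ ⟨j, q⟩
  fin_cases i <;> fin_cases k <;> fin_cases j <;> fin_cases q <;>
  simp [Matrix.mul_apply, Fintype.sum_prod_type, rhoKernel, d1, d2, d3, d4, -Complex.ofReal_div,
    ← hc] <;>
  first
    | ring1
    | linear_combination (-((x : ℂ) - y) * c * X * Y) * ((Y' * Y) * hx + hy)
    | linear_combination (((x : ℂ) + y) * X * Y') * ((Y' * Y) * hx + hy)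
    | linear_combination (((x : ℂ) + y) * X' * Y) * ((Y' * Y) * hx + hy)
    | linear_combination (-((x : ℂ) - y) * c * X' * Y') * ((Y' * Y) * hx + hy)

end algebra

section end_terms

variable {m β : ℝ} {Q : ℤ} {p : Fields}

lemma rMatrix_mul_asymE (T : ℝ) {x y : ℝ} (hxy : x ^ 2 ≠ y ^ 2) :
    ((x - y : ℝ) : ℂ) • (rMatrix β x y * (asymE m Q T x ⊗ₖ asymE m Q T y))
      = (asymE m Q T x ⊗ₖ asymE m Q T y)
        * ((-gam β) • Matrix.of fun I J => rhoKernel m (2 * T) I J (x, y)) := by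
  rw [asymE_eq, asymE_eq, Matrix.mul_kronecker_mul, Matrix.mul_kronecker_mul, ← mul_assoc,
    ← mul_assoc, rMatrix_mul_expσ₃]
  have h1 := rMatrix_mul_matN β hxy
  have h2 := rhoZero_mul_expσ₃ m T x y
  simp only [kReal] at h2
  simp only [Matrix.mul_smul] at h1 ⊢
  set P := expσ₃ (Complex.I * (Real.pi / 2 * Q : ℝ)) ⊗ₖ expσ₃ (Complex.I * (Real.pi / 2 * Q : ℝ))
  set D := expσ₃ (Complex.I * (-(m / 4 * (x + 1 / x) * T) : ℝ))
    ⊗ₖ expσ₃ (Complex.I * (-(m / 4 * (y + 1 / y) * T) : ℝ))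
  rw [mul_assoc (P * _) D, ← h2, mul_assoc P, ← Matrix.smul_mul, ← Matrix.mul_smul, h1]
  simp only [Matrix.mul_smul, Matrix.smul_mul, mul_assoc]

/-- Separates the boundary term into matrices that converge as `T` tends to `±∞` and a scalar kernel
that carries the pole and all the oscillation. -/
lemma rSandwich_eq_sum (T : ℝ) {x y : ℝ}
    (hxy : x ^ 2 ≠ y ^ 2) (L R L' R' : Mat2) (I J : Fin 2 × Fin 2) :
    ((x - y : ℝ) : ℂ) * rSandwich m β p x y L R L' R' T I J
      = ∑ K, ∑ K', -gam β * (rhoKernel m (2 * T) K K' (x, y)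
        * (((L * (dressed m β Q p x T)⁻¹) ⊗ₖ (L' * (dressed m β Q p y T)⁻¹)) I K
          * ((dressed m β Q p x T * R) ⊗ₖ (dressed m β Q p y T * R')) K' J)) := by
  have ux := isUnit_of_unitary (asymE_unitary m Q T x)
  have uy := isUnit_of_unitary (asymE_unitary m Q T y)
  have ex := asymE_mul_dressed (m := m) (β := β) (Q := Q) (p := p) x T
  have ey := asymE_mul_dressed (m := m) (β := β) (Q := Q) (p := p) y T
  have key : ((x - y : ℝ) : ℂ) • rSandwich m β p x y L R L' R' T
      = ((L * (dressed m β Q p x T)⁻¹) ⊗ₖ (L' * (dressed m β Q p y T)⁻¹))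
        * ((-gam β) • Matrix.of fun I J => rhoKernel m (2 * T) I J (x, y))
        * ((dressed m β Q p x T * R) ⊗ₖ (dressed m β Q p y T * R')) := by
    rw [rSandwich, ← ex, ← ey, Matrix.mul_inv_rev, Matrix.mul_inv_rev, ← mul_assoc L,
      ← mul_assoc L', mul_assoc (asymE m Q T x), mul_assoc (asymE m Q T y),
      Matrix.mul_kronecker_mul, Matrix.mul_kronecker_mul (asymE m Q T x)]
    simp only [mul_assoc]
    rw [← mul_assoc (rMatrix β x y), ← Matrix.mul_smul, ← Matrix.mul_smul, ← Matrix.smul_mul,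
      rMatrix_mul_asymE T hxy, ← mul_assoc (((asymE m Q T x)⁻¹ ⊗ₖ _)), ← mul_assoc
      (((asymE m Q T x)⁻¹ ⊗ₖ _)), ← Matrix.mul_kronecker_mul, inv_mul_self_of_isUnit ux,
      inv_mul_self_of_isUnit uy, Matrix.one_kronecker_one, one_mul]
  have := congrFun (congrFun key I) J
  rw [Matrix.smul_apply, smul_eq_mul] at this
  rw [this, Matrix.mul_apply, Finset.sum_comm]
  refine Finset.sum_congr rfl fun K' _ => ?_
  rw [Matrix.mul_apply, Finset.sum_mul]
  refine Finset.sum_congr rfl fun K _ => ?_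
  rw [Matrix.smul_apply, Matrix.of_apply, smul_eq_mul]
  ring

end end_terms

end SineGordon
end


/-! ### Limits of the kernel entries as distributions -/

noncomputable section

open scoped Matrix.Norms.Operator

namespace SineGordon

section kernel_limits

variable {m δ L : ℝ} {F : ℝ × ℝ → ℂ}

/-- For `λ`, `μ` of the same sign `|λ - μ| ≤ |λ + μ|`. This is where the restriction `λμ > 0` keeps
the pole at `λ = -μ` away. -/
lemma norm_ratio_le {x y : ℝ} (h : 0 < x * y) : ‖(((x - y) / (x + y) : ℝ) : ℂ)‖ ≤ 1 := by
  rw [Complex.norm_real, Real.norm_eq_abs, abs_div]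
  refine div_le_one_of_le₀ ?_ (abs_nonneg _)
  rw [← sq_le_sq]
  nlinarith

lemma TestLip.integrable_mul (h : TestLip δ L F) (hδ : 0 < δ) {g : ℝ × ℝ → ℂ} (hg : Measurable g)
    (hb : ∀ z : ℝ × ℝ, 0 < z.1 * z.2 → ‖g z‖ ≤ 1) : Integrable fun z => g z * F z := by
  refine (integrable_square_indicator δ⁻¹ (L * δ⁻¹)).mono'
    (hg.mul h.continuous.measurable).aestronglyMeasurable (Eventually.of_forall fun z => ?_)
  have hL := h.nonneg
  by_cases hz : F z = 0
  · rw [hz, mul_zero, norm_zero]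
    exact Set.indicator_nonneg (fun _ _ => by positivity) _
  · obtain ⟨h1, h2, h3⟩ := h.supp z hz
    rw [Set.indicator_of_mem (mem_square.2 ⟨h1.2, h2.2⟩), norm_mul]
    have := mul_le_mul (hb z h3) (h.norm_le hδ z) (norm_nonneg _) zero_le_one
    linarith

lemma measurable_ratio : Measurable fun z : ℝ × ℝ => (((z.1 - z.2) / (z.1 + z.2) : ℝ) : ℂ) := by
  fun_prop

/-- The explicit factor `λ - μ` is itself the required vanishing on the diagonal, so `g` needs no
regularity beyond measurability. -/
lemma TestLip.antiLip_sub_mul (h : TestLip δ L F) (hδ : 0 < δ) {g : ℝ × ℝ → ℂ} (hg : Measurable g)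
    (hb : ∀ z : ℝ × ℝ, 0 < z.1 * z.2 → ‖g z‖ ≤ 1) :
    ∃ C, AntiLip δ⁻¹ C fun z => (((z.1 - z.2 : ℝ) : ℂ) * g z) * F z := by
  have hδ' : 0 < δ⁻¹ := inv_pos.2 hδ
  refine ⟨_, h.antiLip_mul hδ (g := fun z => ((z.1 - z.2 : ℝ) : ℂ) * g z) (by fun_prop)
    (B := 2 * δ⁻¹ + 2) (by positivity) ?_ ?_⟩
  · intro z h1 h2 h3
    rw [norm_mul, Complex.norm_real, Real.norm_eq_abs]
    have h4 : |z.1 - z.2| ≤ δ⁻¹ + δ⁻¹ := (abs_sub _ _).trans (add_le_add h1.2 h2.2)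
    have := mul_le_mul h4 (hb z h3) (norm_nonneg _) (by positivity)
    linarith
  · intro z h1 h2 h3
    simp only [Prod.fst_swap, Prod.snd_swap]
    rw [show ((z.1 - z.2 : ℝ) : ℂ) * g z - ((z.2 - z.1 : ℝ) : ℂ) * g z.swap
      = ((z.1 - z.2 : ℝ) : ℂ) * (g z + g z.swap) by push_cast; ring, norm_mul, Complex.norm_real,
      Real.norm_eq_abs, mul_comm]
    refine mul_le_mul_of_nonneg_right ?_ (abs_nonneg _)
    have h5 := hb z.swap (by rw [Prod.fst_swap, Prod.snd_swap, mul_comm]; exact h3)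
    have := (norm_add_le (g z) (g z.swap)).trans (add_le_add (hb z h3) h5)
    linarith

lemma phaseDiff_zero (m : ℝ) (z : ℝ × ℝ) : phaseDiff m 0 z = 1 := by simp [phaseDiff]

lemma TestLip.neg (h : TestLip δ L F) : TestLip δ L fun z => -F z where
  lip z w := by
    rw [show -F z - -F w = -(F z - F w) by ring, norm_neg]
    exact h.lip z w
  supp z hz := h.supp z (neg_ne_zero.1 hz)

lemma exists_antiLip_add (hδ : 0 < δ) (L : ℝ) :
    ∃ C, ∀ F, TestLip δ L F → AntiLip δ⁻¹ C fun z => ((z.1 + z.2 : ℝ) : ℂ) * F z := by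
  obtain ⟨C, hC⟩ := exists_antiLip_phaseDiff 0 0 hδ L
  refine ⟨C, fun F hF => ?_⟩
  simpa only [phaseDiff_zero, one_mul] using hC F hF

lemma TestLip.exists_antiLip_rhoKernel (h : TestLip δ L F) (hδ : 0 < δ) (m θ : ℝ)
    (I J : Fin 2 × Fin 2) : ∃ C, AntiLip δ⁻¹ C fun z => rhoKernel m θ I J z * F z := by
  unfold rhoKernel
  split_ifs
  · exact h.antiLip_sub_mul hδ measurable_ratio fun z hz => norm_ratio_le hz
  · obtain ⟨C, hC⟩ := exists_antiLip_add hδ L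
    exact ⟨C, hC F h⟩
  · obtain ⟨C, hC⟩ := exists_antiLip_phaseDiff m θ hδ L
    refine ⟨C, ?_⟩
    simpa only [neg_mul, mul_neg] using hC _ h.neg
  · obtain ⟨C, hC⟩ := exists_antiLip_phaseDiff m (-θ) hδ L
    refine ⟨C, ?_⟩
    simpa only [neg_mul, mul_neg] using hC _ h.neg
  · refine h.antiLip_sub_mul hδ (g := fun z => _ * _)
      ((measurable_phaseSum _ _).mul measurable_ratio) fun z hz => ?_
    rw [norm_mul, norm_phaseSum, one_mul]
    exact norm_ratio_le hz
  · refine h.antiLip_sub_mul hδ (g := fun z => _ * _)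
      ((measurable_phaseSum _ _).mul measurable_ratio) fun z hz => ?_
    rw [norm_mul, norm_phaseSum, one_mul]
    exact norm_ratio_le hz
  · simp only [zero_mul]
    exact ⟨0, measurable_const, fun z => by simp, fun z hz => by simp at hz, fun z => by simp⟩

variable {l : Filter ℝ} {θ : ℝ → ℝ} {s : ℝ}
  {F : ℝ → ℝ × ℝ → ℂ} {F₀ : ℝ × ℝ → ℂ}

lemma tendsto_integral_ratio [l.IsCountablyGenerated] (hδ : 0 < δ) (h : ∀ᶠ T in l, TestLip δ L (F T))
    (ht : ∀ z, Tendsto (fun T => F T z) l (𝓝 (F₀ z))) :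
    Tendsto (fun T => pvSym fun z => (((z.1 - z.2 : ℝ) : ℂ)
      * (((z.1 - z.2) / (z.1 + z.2) : ℝ) : ℂ)) * F T z) l
      (𝓝 (∫ z : ℝ × ℝ, (((z.1 - z.2) / (z.1 + z.2) : ℝ) : ℂ) * F₀ z)) := by
  have key : Tendsto (fun T => ∫ z : ℝ × ℝ, (((z.1 - z.2) / (z.1 + z.2) : ℝ) : ℂ) * F T z) l
      (𝓝 (∫ z : ℝ × ℝ, (((z.1 - z.2) / (z.1 + z.2) : ℝ) : ℂ) * F₀ z)) := by
    refine tendsto_integral_filter_of_dominated_convergence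
      ((square δ⁻¹).indicator fun _ => L * δ⁻¹) ?_ ?_ (integrable_square_indicator _ _) ?_
    · filter_upwards [h] with T hT using
        (hT.integrable_mul hδ measurable_ratio fun z hz => norm_ratio_le hz).aestronglyMeasurable
    · filter_upwards [h] with T hT
      refine Eventually.of_forall fun z => ?_
      have hL := hT.nonneg
      by_cases hz : F T z = 0
      · rw [hz, mul_zero, norm_zero]
        exact Set.indicator_nonneg (fun _ _ => by positivity) _
      · obtain ⟨h1, h2, h3⟩ := hT.supp z hz
        rw [Set.indicator_of_mem (mem_square.2 ⟨h1.2, h2.2⟩), norm_mul]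
        have := mul_le_mul (norm_ratio_le h3) (hT.norm_le hδ z) (norm_nonneg _) zero_le_one
        linarith
    · exact Eventually.of_forall fun z => (ht z).const_mul _
  refine key.congr' ?_
  filter_upwards [h] with T hT
  rw [← pvSym_sub_mul (hT.integrable_mul hδ measurable_ratio fun z hz => norm_ratio_le hz)]
  simp only [mul_assoc]

/-- The moving amplitude is first replaced by its limit, at a cost that tends to zero in `L¹`
whatever the phase; the fixed amplitude is then handled by `tendsto_integral_phaseSum`. -/
lemma tendsto_pvSym_phaseSum [l.NeBot] [l.IsCountablyGenerated] (hm : 0 < m) (hδ : 0 < δ) (hθ : TendstoSign θ l s)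
    (h : ∀ᶠ T in l, TestLip δ L (F T)) (ht : ∀ z, Tendsto (fun T => F T z) l (𝓝 (F₀ z))) :
    Tendsto (fun T => pvSym fun z => (((z.1 - z.2 : ℝ) : ℂ)
      * (phaseSum m (θ T) z * (((z.1 - z.2) / (z.1 + z.2) : ℝ) : ℂ))) * F T z) l (𝓝 0) := by
  have h₀ := TestLip.of_tendsto h ht
  have i₀ := h₀.integrable_mul hδ measurable_ratio fun z hz => norm_ratio_le hz
  have h1 := tendsto_integral_phaseSum hm hθ i₀
    (fun z hz => (h₀.supp z (right_ne_zero_of_mul hz)).2.2)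
  have h2 : Tendsto (fun T => ∫ z : ℝ × ℝ, ‖F T z - F₀ z‖) l (𝓝 0) := by
    rw [show (0 : ℝ) = ∫ z : ℝ × ℝ, (0 : ℝ) by simp]
    refine tendsto_integral_filter_of_dominated_convergence
      ((square δ⁻¹).indicator fun _ => L * δ⁻¹ + L * δ⁻¹) ?_ ?_ (integrable_square_indicator _ _) ?_
    · filter_upwards [h] with T hT using
        (hT.continuous.sub h₀.continuous).norm.aestronglyMeasurable
    · filter_upwards [h] with T hT
      refine Eventually.of_forall fun z => ?_
      have hL := hT.nonneg
      rw [norm_norm]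
      by_cases hz : z ∈ square δ⁻¹
      · rw [Set.indicator_of_mem hz]
        exact (norm_sub_le _ _).trans (add_le_add (hT.norm_le hδ z) (h₀.norm_le hδ z))
      · have e1 : F T z = 0 := by
          by_contra hne
          exact hz (mem_square.2 ⟨(hT.supp z hne).1.2, (hT.supp z hne).2.1.2⟩)
        have e2 : F₀ z = 0 := by
          by_contra hne
          exact hz (mem_square.2 ⟨(h₀.supp z hne).1.2, (h₀.supp z hne).2.1.2⟩)
        rw [e1, e2, Set.indicator_of_notMem hz]
        simp
    · refine Eventually.of_forall fun z => ?_
      simpa using ((ht z).sub_const (F₀ z)).norm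
  have hm' : ∀ T, Measurable fun z : ℝ × ℝ =>
      phaseSum m (θ T) z * (((z.1 - z.2) / (z.1 + z.2) : ℝ) : ℂ) := fun T =>
    (measurable_phaseSum _ _).mul measurable_ratio
  have hb : ∀ T, ∀ z : ℝ × ℝ, 0 < z.1 * z.2 →
      ‖phaseSum m (θ T) z * (((z.1 - z.2) / (z.1 + z.2) : ℝ) : ℂ)‖ ≤ 1 := fun T z hz => by
    rw [norm_mul, norm_phaseSum, one_mul]
    exact norm_ratio_le hz
  have h3 : Tendsto (fun T => ∫ z : ℝ × ℝ,
      (phaseSum m (θ T) z * (((z.1 - z.2) / (z.1 + z.2) : ℝ) : ℂ)) * (F T z - F₀ z)) l (𝓝 0) := by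
    refine squeeze_zero_norm' ?_ h2
    filter_upwards [h] with T hT
    refine norm_integral_le_of_norm_le ?_ (Eventually.of_forall fun z => ?_)
    · have := (hT.integrable_mul hδ (g := fun _ => 1) measurable_const (by simp)).sub
        (h₀.integrable_mul hδ (g := fun _ => 1) measurable_const (by simp))
      simpa using this.norm
    · by_cases hz : 0 < z.1 * z.2
      · rw [norm_mul]
        have := mul_le_mul_of_nonneg_right (hb T z hz) (norm_nonneg (F T z - F₀ z))
        linarith
      · have e1 : F T z = 0 := by
          by_contra hne
          exact hz (hT.supp z hne).2.2
        have e2 : F₀ z = 0 := by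
          by_contra hne
          exact hz (h₀.supp z hne).2.2
        simp [e1, e2]
  have h4 := h3.add h1
  rw [add_zero] at h4
  refine h4.congr' ?_
  filter_upwards [h] with T hT
  have i1 := hT.integrable_mul hδ (hm' T) (hb T)
  have i2 := h₀.integrable_mul hδ (hm' T) (hb T)
  have e1 := pvSym_sub_mul i1
  simp only [mul_assoc] at e1 i1 i2 ⊢
  rw [e1]
  simp only [mul_sub]
  rw [integral_sub i1 i2]
  ring

lemma pvSym_neg (H : ℝ × ℝ → ℂ) : pvSym (fun z => -H z) = -pvSym H := by
  have := pvSym_const_mul (-1) H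
  simpa using this

lemma TendstoSign.neg (h : TendstoSign θ l s) : TendstoSign (fun T => -θ T) l (-s) := by
  rcases h with ⟨h, rfl⟩ | ⟨h, rfl⟩
  · exact Or.inr ⟨tendsto_neg_atTop_atBot.comp h, rfl⟩
  · exact Or.inl ⟨tendsto_neg_atBot_atTop.comp h, by simp⟩

/-- Entries without phase keep their form and give the ratio and the principal value; those with
`k₀(λ) - k₀(μ)` become delta functions; those with `k₀(λ) + k₀(μ)` die out. The sign `s` of the end
selects `r₊` or `r₋`. -/
lemma tendsto_rhoKernel [l.NeBot] [l.IsCountablyGenerated] (β : ℝ) (hm : 0 < m) (hδ : 0 < δ) (hθ : TendstoSign θ l s)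
    (h : ∀ᶠ T in l, TestLip δ L (F T)) (ht : ∀ z, Tendsto (fun T => F T z) l (𝓝 (F₀ z)))
    (I J : Fin 2 × Fin 2) :
    Tendsto (fun T => -gam β * pvSym fun z => rhoKernel m (θ T) I J z * F T z) l
      (𝓝 (rInf β s I J F₀)) := by
  have h₀ := TestLip.of_tendsto h ht
  unfold rhoKernel rInf
  split_ifs with h1 h2 h3 h4 h5 h6
  · exact (tendsto_integral_ratio hδ h ht).const_mul _
  · obtain ⟨C, hC⟩ := exists_antiLip_add hδ L
    rw [(hC _ h₀).pv_eq]
    exact (tendsto_pvSym (h.mono fun T hT => hC _ hT) fun z => (ht z).const_mul _).const_mul _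
  · have := (tendsto_pvSym_phaseDiff hm hδ hθ h ht).neg
    simp only [neg_mul, pvSym_neg] at this ⊢
    exact (this.const_mul _).neg
  · have := (tendsto_pvSym_phaseDiff hm hδ hθ.neg h ht).neg
    simp only [neg_mul, pvSym_neg, Complex.ofReal_neg, neg_neg] at this ⊢
    exact (this.const_mul _).neg
  · simpa using (tendsto_pvSym_phaseSum hm hδ hθ h ht).const_mul (-gam β)
  · simpa using (tendsto_pvSym_phaseSum hm hδ hθ.neg h ht).const_mul (-gam β)
  · simp [pvSym]

end kernel_limits

end SineGordon
end


noncomputable section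

open scoped Matrix.Norms.Operator

namespace SineGordon

/-! ### Lipschitz families of matrices -/

/-- `G` is bounded by `B` and `B`-Lipschitz on the product of two annuli. -/
structure BddLip (δ B : ℝ) (G : ℝ × ℝ → ℂ) : Prop where
  nonneg : 0 ≤ B
  bound : ∀ z : ℝ × ℝ, z.1 ∈ annulus δ → z.2 ∈ annulus δ → ‖G z‖ ≤ B
  lip : ∀ z w : ℝ × ℝ, z.1 ∈ annulus δ → z.2 ∈ annulus δ → w.1 ∈ annulus δ → w.2 ∈ annulus δ →
    ‖G z - G w‖ ≤ B * dist z w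

/-- `A` is bounded by `B` and `B`-Lipschitz on an annulus. -/
structure MatLip (δ B : ℝ) (A : ℝ → Mat2) : Prop where
  nonneg : 0 ≤ B
  bound : ∀ x ∈ annulus δ, ‖A x‖ ≤ B
  lip : ∀ x ∈ annulus δ, ∀ y ∈ annulus δ, ‖A x - A y‖ ≤ B * |x - y|

section

variable {δ B B' L : ℝ} {G G' h : ℝ × ℝ → ℂ} {A A' : ℝ → Mat2}

lemma BddLip.mul (hG : BddLip δ B G) (hG' : BddLip δ B' G') :
    BddLip δ (2 * (B * B')) fun z => G z * G' z where
  nonneg := by have := hG.nonneg; have := hG'.nonneg; positivity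
  bound z h1 h2 := by
    rw [norm_mul]
    have := mul_le_mul (hG.bound z h1 h2) (hG'.bound z h1 h2) (norm_nonneg _) hG.nonneg
    nlinarith [mul_nonneg hG.nonneg hG'.nonneg]
  lip z w h1 h2 h3 h4 := by
    rw [show G z * G' z - G w * G' w = (G z - G w) * G' z + G w * (G' z - G' w) by ring]
    refine (norm_add_le _ _).trans ?_
    rw [norm_mul, norm_mul]
    have e1 := mul_le_mul (hG.lip z w h1 h2 h3 h4) (hG'.bound z h1 h2) (norm_nonneg _)
      (mul_nonneg hG.nonneg dist_nonneg)
    have e2 := mul_le_mul (hG.bound w h3 h4) (hG'.lip z w h1 h2 h3 h4) (norm_nonneg _) hG.nonneg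
    linarith

lemma TestLip.bddLip_mul (hδ : 0 < δ) (hG : BddLip δ B G) (h' : TestLip δ L h) :
    TestLip δ (B * L + B * (L * δ⁻¹)) fun z => G z * h z where
  lip z w := by
    have hB := hG.nonneg
    have hL := h'.nonneg
    have aux : ∀ z w : ℝ × ℝ, h w = 0 → ‖G z * h z‖ ≤ (B * L + B * (L * δ⁻¹)) * dist z w := by
      intro z w hw
      by_cases hz : h z = 0
      · rw [hz, mul_zero, norm_zero]; positivity
      · obtain ⟨h1, h2, -⟩ := h'.supp z hz
        have e := h'.lip z w
        rw [hw, sub_zero] at e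
        rw [norm_mul]
        have e2 := mul_le_mul (hG.bound z h1 h2) e (norm_nonneg _) hB
        have : 0 ≤ B * (L * δ⁻¹) * dist z w := by positivity
        linarith
    by_cases hw : h w = 0
    · rw [hw, mul_zero, sub_zero]
      exact aux z w hw
    by_cases hz : h z = 0
    · rw [hz, mul_zero, zero_sub, norm_neg, dist_comm]
      exact aux w z hz
    obtain ⟨h1, h2, -⟩ := h'.supp z hz
    obtain ⟨h3, h4, -⟩ := h'.supp w hw
    rw [show G z * h z - G w * h w = G w * (h z - h w) + (G z - G w) * h z by ring]
    refine (norm_add_le _ _).trans ?_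
    rw [norm_mul, norm_mul]
    have e1 := mul_le_mul (hG.lip z w h1 h2 h3 h4) (h'.norm_le hδ z) (norm_nonneg _)
      (mul_nonneg hB dist_nonneg)
    have e2 := mul_le_mul (hG.bound w h3 h4) (h'.lip z w) (norm_nonneg _) hB
    linarith
  supp z hz := h'.supp z (right_ne_zero_of_mul hz)

lemma MatLip.entry_fst (hA : MatLip δ B A) (i j : Fin 2) : BddLip δ B fun z => A z.1 i j where
  nonneg := hA.nonneg
  bound z h1 _ := (norm_entry_le_norm _ i j).trans (hA.bound _ h1)
  lip z w h1 _ h3 _ := by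
    refine ((norm_entry_le_norm (A z.1 - A w.1) i j).trans (hA.lip _ h1 _ h3)).trans ?_
    exact mul_le_mul_of_nonneg_left (le_max_left _ _) hA.nonneg

lemma MatLip.entry_snd (hA : MatLip δ B A) (i j : Fin 2) : BddLip δ B fun z => A z.2 i j where
  nonneg := hA.nonneg
  bound z _ h2 := (norm_entry_le_norm _ i j).trans (hA.bound _ h2)
  lip z w _ h2 _ h4 := by
    refine ((norm_entry_le_norm (A z.2 - A w.2) i j).trans (hA.lip _ h2 _ h4)).trans ?_
    exact mul_le_mul_of_nonneg_left (le_max_right _ _) hA.nonneg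

lemma MatLip.mul (hA : MatLip δ B A) (hA' : MatLip δ B' A') :
    MatLip δ (2 * (B * B')) fun x => A x * A' x where
  nonneg := by have := hA.nonneg; have := hA'.nonneg; positivity
  bound x hx := by
    refine (norm_mul_le _ _).trans ?_
    have := mul_le_mul (hA.bound x hx) (hA'.bound x hx) (norm_nonneg _) hA.nonneg
    nlinarith [mul_nonneg hA.nonneg hA'.nonneg]
  lip x hx y hy := by
    rw [show A x * A' x - A y * A' y = (A x - A y) * A' x + A y * (A' x - A' y) by noncomm_ring]
    refine (norm_add_le _ _).trans ((add_le_add (norm_mul_le _ _) (norm_mul_le _ _)).trans ?_)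
    have e1 := mul_le_mul (hA.lip x hx y hy) (hA'.bound x hx) (norm_nonneg _)
      (mul_nonneg hA.nonneg (abs_nonneg _))
    have e2 := mul_le_mul (hA.bound y hy) (hA'.lip x hx y hy) (norm_nonneg _) hA.nonneg
    linarith

lemma MatLip.of_unitary {C : ℝ} (hC : 0 ≤ C)
    (hu : ∀ x ∈ annulus δ, A x ∈ Matrix.unitaryGroup (Fin 2) ℂ)
    (hl : ∀ x ∈ annulus δ, ∀ y ∈ annulus δ, ‖A x - A y‖ ≤ C * |x - y|) :
    MatLip δ (2 + 4 * C) A ∧ MatLip δ (2 + 4 * C) fun x => (A x)⁻¹ := by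
  refine ⟨⟨by positivity, fun x hx => ?_, fun x hx y hy => ?_⟩,
    ⟨by positivity, fun x hx => ?_, fun x hx y hy => ?_⟩⟩
  · linarith [norm_le_two_of_unitary (hu x hx)]
  · refine (hl x hx y hy).trans (mul_le_mul_of_nonneg_right (by linarith) (abs_nonneg _))
  · linarith [norm_le_two_of_unitary (inv_mem_unitary (hu x hx))]
  · refine (norm_inv_sub_inv_le (hu x hx) (hu y hy)).trans ?_
    have := hl x hx y hy
    nlinarith [abs_nonneg (x - y)]

/-- The products of matrix entries multiplying the entries of `rhoKernel`. -/
def endF (A A' : ℝ → Mat2) (h : ℝ × ℝ → ℂ) (I J K K' : Fin 2 × Fin 2) (z : ℝ × ℝ) : ℂ :=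
  (A z.1 ⊗ₖ A z.2) I K * (A' z.1 ⊗ₖ A' z.2) K' J * h z

lemma exists_testLip_endF (hδ : 0 < δ) (B B' : ℝ) (h' : TestLip δ L h) :
    ∃ M, ∀ A A', MatLip δ B A → MatLip δ B' A' → ∀ I J K K',
      TestLip δ M (endF A A' h I J K K') :=
  ⟨_, fun _ _ hA hA' I J K K' => h'.bddLip_mul hδ
    (((hA.entry_fst I.1 K.1).mul (hA.entry_snd I.2 K.2)).mul
      ((hA'.entry_fst K'.1 J.1).mul (hA'.entry_snd K'.2 J.2)))⟩

/-- Needs an argument only because the principal value is defined as a chosen limit. -/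
lemma rInf_zero (β s : ℝ) (I J : Fin 2 × Fin 2) : rInf β s I J (fun _ => 0) = 0 := by
  have : pv (fun _ => 0) = 0 := by
    have : pvCut (fun _ => 0) = fun _ => 0 := by
      funext ε
      simp [pvCut]
    rw [pv, this]
    exact tendsto_const_nhds.limUnder_eq
  simp [rInf, diagDelta, this]

/-- The contribution of one end of the time axis to the bracket. -/
def endSum (m β θ : ℝ) (A A' : ℝ → Mat2) (h : ℝ × ℝ → ℂ) (I J : Fin 2 × Fin 2) : ℂ :=
  ∑ K, ∑ K', -gam β * pvSym fun z => rhoKernel m θ K K' z * endF A A' h I J K K' z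

variable {m : ℝ} {l : Filter ℝ} {θ : ℝ → ℝ} {s : ℝ}

/-- The Lipschitz constants are uniform in `T`, so the products of matrix entries with the test
function form an admissible convergent family in each term. -/
lemma tendsto_endSum [l.NeBot] [l.IsCountablyGenerated] (β : ℝ) (hm : 0 < m) (hδ : 0 < δ) (hθ : TendstoSign θ l s)
    {A A' : ℝ → ℝ → Mat2} {A₀ A₀' : ℝ → Mat2} (hA : ∀ᶠ T in l, MatLip δ B (A T))
    (hA' : ∀ᶠ T in l, MatLip δ B' (A' T))
    (h₀ : ∀ x ∈ annulus δ, Tendsto (fun T => A T x) l (𝓝 (A₀ x)))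
    (h₀' : ∀ x ∈ annulus δ, Tendsto (fun T => A' T x) l (𝓝 (A₀' x)))
    (h' : TestLip δ L h) (I J : Fin 2 × Fin 2) :
    Tendsto (fun T => endSum m β (θ T) (A T) (A' T) h I J) l
      (𝓝 (∑ K, ∑ K', rInf β s K K' (endF A₀ A₀' h I J K K'))) := by
  obtain ⟨M, hM⟩ := exists_testLip_endF hδ B B' h'
  refine tendsto_finsetSum _ fun K _ => tendsto_finsetSum _ fun K' _ => ?_
  refine tendsto_rhoKernel β hm hδ hθ (F := fun T => endF (A T) (A' T) h I J K K') (L := M) ?_ ?_ K K'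
  · filter_upwards [hA, hA'] with T h1 h2 using hM _ _ h1 h2 I J K K'
  · intro z
    by_cases hz : h z = 0
    · simp [endF, hz]
    · obtain ⟨h1, h2, -⟩ := h'.supp z hz
      have en : ∀ {A : ℝ → Mat2} {M : Mat2}, Tendsto A l (𝓝 M) → ∀ i j,
          Tendsto (fun T => A T i j) l (𝓝 (M i j)) := fun hA i j =>
        tendsto_pi_nhds.1 (tendsto_pi_nhds.1 hA i) j
      exact ((((en (h₀ _ h1) _ _).mul (en (h₀ _ h2) _ _)).mul
        ((en (h₀' _ h1) _ _).mul (en (h₀' _ h2) _ _))).mul_const _)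

lemma sum_rInf_endF_one_left (β s : ℝ) (A' : ℝ → Mat2) (h : ℝ × ℝ → ℂ) (I J : Fin 2 × Fin 2) :
    ∑ K, ∑ K', rInf β s K K' (endF (fun _ => 1) A' h I J K K')
      = ∑ K', rInf β s I K' fun z => (A' z.1 ⊗ₖ A' z.2) K' J * h z := by
  rw [Finset.sum_eq_single I]
  · refine Finset.sum_congr rfl fun K' _ => ?_
    congr 1
    funext z
    simp [endF]
  · intro K _ hK
    refine Finset.sum_eq_zero fun K' _ => ?_
    have : endF (fun _ => 1) A' h I J K K' = fun _ => 0 := by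
      funext z
      rw [endF, Matrix.one_kronecker_one, Matrix.one_apply_ne hK.symm]
      ring
    rw [this, rInf_zero]
  · simp

lemma sum_rInf_endF_one_right (β s : ℝ) (A : ℝ → Mat2) (h : ℝ × ℝ → ℂ) (I J : Fin 2 × Fin 2) :
    ∑ K, ∑ K', rInf β s K K' (endF A (fun _ => 1) h I J K K')
      = ∑ K, rInf β s K J fun z => (A z.1 ⊗ₖ A z.2) I K * h z := by
  refine Finset.sum_congr rfl fun K _ => ?_
  rw [Finset.sum_eq_single J]
  · congr 1
    funext z
    simp [endF]
  · intro K' _ hK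
    have : endF A (fun _ => 1) h I J K K' = fun _ => 0 := by
      funext z
      rw [endF, Matrix.one_kronecker_one, Matrix.one_apply_ne hK]
      ring
    rw [this, rInf_zero]
  · simp

end

/-! ### Test functions -/

lemma IsTestOn.exists_annulus {S : Set (ℝ × ℝ)} {h : ℝ × ℝ → ℂ} (hh : IsTestOn S h)
    (hS : S ⊆ {z | z.1 ≠ 0 ∧ z.2 ≠ 0}) :
    ∃ δ, 0 < δ ∧ ∀ z ∈ tsupport h, z.1 ∈ annulus δ ∧ z.2 ∈ annulus δ := by
  obtain ⟨-, hc, hs⟩ := hh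
  have hK : IsCompact (tsupport h) := hc
  rcases (tsupport h).eq_empty_or_nonempty with he | hne
  · exact ⟨1, one_pos, fun z hz => by rw [he] at hz; exact hz.elim⟩
  -- The minimum of `|λ|` and `|μ|` is attained on the compact support and is positive there; a
  -- bound on the norm handles infinity.
  have hcont : Continuous fun z : ℝ × ℝ => min |z.1| |z.2| := by fun_prop
  obtain ⟨z₀, hz₀, hmin⟩ := hK.exists_isMinOn hne hcont.continuousOn
  obtain ⟨R, hR⟩ := hK.isBounded.exists_norm_le
  have hc0 : 0 < min |z₀.1| |z₀.2| :=
    lt_min (abs_pos.2 (hS (hs hz₀)).1) (abs_pos.2 (hS (hs hz₀)).2)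
  have hR1 : 0 < |R| + 1 := by positivity
  have hδ : 0 < min (min |z₀.1| |z₀.2|) (|R| + 1)⁻¹ := lt_min hc0 (inv_pos.2 hR1)
  refine ⟨_, hδ, fun z hz => ?_⟩
  have h1 : min |z₀.1| |z₀.2| ≤ min |z.1| |z.2| := hmin hz
  have h2 : ‖z‖ ≤ |R| + 1 := by linarith [hR z hz, le_abs_self R]
  have h3 : |R| + 1 ≤ (min (min |z₀.1| |z₀.2|) (|R| + 1)⁻¹)⁻¹ := by
    have := inv_anti₀ hδ (min_le_right _ _)
    rwa [inv_inv] at this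
  have h4 := min_le_left (min |z₀.1| |z₀.2|) (|R| + 1)⁻¹
  exact ⟨⟨h4.trans (h1.trans (min_le_left _ _)), (norm_fst_le z).trans (h2.trans h3)⟩,
    ⟨h4.trans (h1.trans (min_le_right _ _)), (norm_snd_le z).trans (h2.trans h3)⟩⟩

lemma IsTestOn.exists_testLip {h : ℝ × ℝ → ℂ} (hh : IsTestOn {z | 0 < z.1 * z.2} h) :
    ∃ δ L, 0 < δ ∧ TestLip δ L h := by
  obtain ⟨δ, hδ, hs⟩ := hh.exists_annulus
    (fun z hz => ⟨left_ne_zero_of_mul (ne_of_gt hz), right_ne_zero_of_mul (ne_of_gt hz)⟩)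
  obtain ⟨L, hL⟩ := ContDiff.lipschitzWith_of_hasCompactSupport hh.2.1 hh.1 (by simp)
  refine ⟨δ, L, hδ, fun z w => ?_, fun z hz => ?_⟩
  · rw [← dist_eq_norm]
    exact hL.dist_le_mul z w
  · have hz' := subset_tsupport h hz
    exact ⟨(hs z hz').1, (hs z hz').2, hh.2.2 hz'⟩

end SineGordon
end


/-! ### The infinite-volume bracket of the monodromy matrix -/

noncomputable section

open scoped Matrix.Norms.Operator

namespace SineGordon

variable {m β : ℝ} {Q Qm Qp : ℤ} {p : Fields}

/-- The density of the bracket of two entries of the monodromy matrix. -/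
def monDensity (m β : ℝ) (Qm Qp : ℤ) (p : Fields) (i j k q : Fin 2) (x y s : ℝ) : ℂ :=
  varPhi m β p x (jostP m β Qp p x) (jostM m β Qm p x)⁻¹ s i j
      * varPi m β p y (jostP m β Qp p y) (jostM m β Qm p y)⁻¹ s k q
    - varPi m β p x (jostP m β Qp p x) (jostM m β Qm p x)⁻¹ s i j
      * varPhi m β p y (jostP m β Qp p y) (jostM m β Qm p y)⁻¹ s k q

lemma continuous_monDensity (h : IsAsymptotic β Qm Qp p) (i j k q : Fin 2) (x y : ℝ) :
    Continuous (monDensity m β Qm Qp p i j k q x y) :=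
  continuous_bracket_density h.cont_phi h.cont_Pi _ _ _ _ _ _ i j k q

/-- The left factor at an end of the time axis. -/
def endLeft (m β : ℝ) (Q Qp : ℤ) (p : Fields) (T x : ℝ) : Mat2 :=
  jostP m β Qp p x * (dressed m β Q p x T)⁻¹

/-- The right factor at an end of the time axis. -/
def endRight (m β : ℝ) (Q Qm : ℤ) (p : Fields) (T x : ℝ) : Mat2 :=
  dressed m β Q p x T * (jostM m β Qm p x)⁻¹

lemma exists_matLip (h : IsAsymptotic β Qm Qp p) (hβ : β ≠ 0) (m : ℝ) {δ : ℝ} (hδ : 0 < δ) :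
    ∃ B, (∀ T, 0 ≤ T → MatLip δ B (endLeft m β Qp Qp p T) ∧ MatLip δ B (endRight m β Qp Qm p T)) ∧
      (∀ T, T ≤ 0 → MatLip δ B (endLeft m β Qm Qp p T) ∧ MatLip δ B (endRight m β Qm Qm p T)) ∧
      MatLip δ B (monodromy m β Qm Qp p) := by
  obtain ⟨C, hC, hl⟩ := h.exists_lipschitz (m := m) hβ hδ
  have hP := MatLip.of_unitary hC (A := jostP m β Qp p)
    (fun x hx => h.jostP_unitary hβ (annulus_ne_zero hδ hx))
    (fun x hx y hy => (hl x hx y hy).2.2.1)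
  have hM := MatLip.of_unitary hC (A := jostM m β Qm p)
    (fun x hx => h.jostM_unitary hβ (annulus_ne_zero hδ hx))
    (fun x hx y hy => (hl x hx y hy).2.2.2)
  have h1 : ∀ T : ℝ, 0 ≤ T → _ := fun T hT => MatLip.of_unitary hC
    (A := fun x => dressed m β Qp p x T)
    (fun x _ => dressed_unitary h.cont_phi h.cont_Pi x T)
    (fun x hx y hy => (hl x hx y hy).1 T hT)
  have h2 : ∀ T : ℝ, T ≤ 0 → _ := fun T hT => MatLip.of_unitary hC
    (A := fun x => dressed m β Qm p x T)
    (fun x _ => dressed_unitary h.cont_phi h.cont_Pi x T)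
    (fun x hx y hy => (hl x hx y hy).2.1 T hT)
  refine ⟨_, fun T hT => ⟨hP.1.mul (h1 T hT).2, (h1 T hT).1.mul hM.2⟩,
    fun T hT => ⟨hP.1.mul (h2 T hT).2, (h2 T hT).1.mul hM.2⟩, ?_⟩
  have := hP.1.mul hM.2
  refine ⟨this.nonneg, fun x hx => ?_, fun x hx y hy => ?_⟩
  · rw [h.monodromy_eq hβ (annulus_ne_zero hδ hx)]
    exact this.bound x hx
  · rw [h.monodromy_eq hβ (annulus_ne_zero hδ hx), h.monodromy_eq hβ (annulus_ne_zero hδ hy)]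
    exact this.lip x hx y hy

lemma exists_testLip_monodromy (h : IsAsymptotic β Qm Qp p) (hβ : β ≠ 0) (m : ℝ) {δ L : ℝ}
    (hδ : 0 < δ) {f : ℝ × ℝ → ℂ} (hf : TestLip δ L f) (I J : Fin 2 × Fin 2) :
    ∃ M, TestLip δ M fun z =>
      (monodromy m β Qm Qp p z.1 ⊗ₖ monodromy m β Qm Qp p z.2) I J * f z := by
  obtain ⟨B, -, -, hB⟩ := exists_matLip h hβ m hδ
  exact ⟨_, hf.bddLip_mul hδ ((hB.entry_fst I.1 J.1).mul (hB.entry_snd I.2 J.2))⟩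

/-- The principal values occurring in the infinite-volume bracket exist. -/
lemma exists_tendsto_pvCut (h : IsAsymptotic β Qm Qp p) (hβ : β ≠ 0) {f : ℝ × ℝ → ℂ}
    (hf : IsTestOn {z | 0 < z.1 * z.2} f) (I J : Fin 2 × Fin 2) :
    ∃ c : ℂ, Tendsto (pvCut fun z =>
      (monodromy m β Qm Qp p z.1 ⊗ₖ monodromy m β Qm Qp p z.2) I J * f z) (𝓝[>] 0) (𝓝 c) := by
  obtain ⟨δ, L, hδ, hL⟩ := hf.exists_testLip
  obtain ⟨M, hM⟩ := exists_testLip_monodromy h hβ m hδ hL I J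
  have := hM.antiLip_mul hδ (g := fun _ => 1) measurable_const (B := 1) zero_le_one (by simp)
    (fun z _ _ _ => by simp)
  simp only [one_mul] at this
  exact ⟨_, this.tendsto_pvCut⟩

/-- Unitarity bounds the gradients uniformly in `s`. There is no decay in `s`, which is why the time
integral converges only in the sense of distributions. -/
lemma exists_bound_monDensity (h : IsAsymptotic β Qm Qp p) (hβ : β ≠ 0) (m : ℝ) {δ : ℝ}
    (hδ : 0 < δ) : ∃ C, ∀ i j k q, ∀ x ∈ annulus δ, ∀ y ∈ annulus δ, ∀ s,
      ‖monDensity m β Qm Qp p i j k q x y s‖ ≤ C := by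
  obtain ⟨C, hC0, hC, -⟩ := exists_bound_k m hδ
  have h1 := h.cont_phi
  have h2 := h.cont_Pi
  set D : ℝ := C * |β / 2| * ‖σ₁‖ + C * |β / 2| * ‖σ₂‖ with hD
  have hD0 : 0 ≤ D := by positivity
  have hd : ∀ x ∈ annulus δ, ∀ s, ‖dVphi m β p x s‖ ≤ D := by
    intro x hx s
    have hk := hC x hx
    have hk0 : ‖k₀ m (x : ℂ)‖ ≤ C := by linarith [norm_nonneg (k₁ m (x : ℂ)), norm_nonneg (k₀ m (x : ℂ))]
    have hk1 : ‖k₁ m (x : ℂ)‖ ≤ C := by linarith [norm_nonneg (k₁ m (x : ℂ)), norm_nonneg (k₀ m (x : ℂ))]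
    rw [dVphi]
    refine (norm_add_le _ _).trans ?_
    rw [norm_neg, norm_smul, norm_smul, norm_mul, norm_mul, norm_mul, norm_mul, Complex.norm_I,
      one_mul, one_mul, Complex.norm_real, Complex.norm_real, Real.norm_eq_abs, Real.norm_eq_abs,
      abs_mul, abs_mul, hD]
    have c1 := mul_le_of_le_one_right (abs_nonneg (β / 2)) (Real.abs_cos_le_one (β * p.1 s / 2))
    have c2 := mul_le_of_le_one_right (abs_nonneg (β / 2)) (Real.abs_sin_le_one (β * p.1 s / 2))
    gcongr
  have key : ∀ (V : Mat2) (x : ℝ), x ∈ annulus δ → ∀ s i j,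
      ‖(jostP m β Qp p x * (fund m β p x s)⁻¹ * V * (fund m β p x s * (jostM m β Qm p x)⁻¹)) i j‖
        ≤ 4 * ‖V‖ := by
    intro V x hx s i j
    have hx0 := annulus_ne_zero hδ hx
    have u1 := norm_le_two_of_unitary (mul_mem (h.jostP_unitary (m := m) hβ hx0)
      (inv_mem_unitary (fund_unitary (m := m) (β := β) h1 h2 x s)))
    have u2 := norm_le_two_of_unitary (mul_mem (fund_unitary (m := m) (β := β) h1 h2 x s)
      (inv_mem_unitary (h.jostM_unitary (m := m) hβ hx0)))
    refine (norm_entry_le_norm _ i j).trans ((norm_mul_le _ _).trans ?_)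
    calc _ ≤ (2 * ‖V‖) * 2 := by
          refine mul_le_mul ((norm_mul_le _ _).trans ?_) u2 (norm_nonneg _) (by positivity)
          exact mul_le_mul_of_nonneg_right u1 (norm_nonneg _)
      _ = _ := by ring
  refine ⟨4 * D * (4 * ‖dVPi β‖) + 4 * ‖dVPi β‖ * (4 * D), fun i j k q x hx y hy s => ?_⟩
  refine (norm_sub_le _ _).trans ?_
  rw [norm_mul, norm_mul]
  have a1 := (key (dVphi m β p x s) x hx s i j).trans
    (mul_le_mul_of_nonneg_left (hd x hx s) (by norm_num : (0 : ℝ) ≤ 4))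
  have a2 := (key (dVphi m β p y s) y hy s k q).trans
    (mul_le_mul_of_nonneg_left (hd y hy s) (by norm_num : (0 : ℝ) ≤ 4))
  have b1 := key (dVPi β) x hx s i j
  have b2 := key (dVPi β) y hy s k q
  exact add_le_add (mul_le_mul a1 b2 (norm_nonneg _) (by positivity))
    (mul_le_mul b1 a2 (norm_nonneg _) (by positivity))

/-- The bracket density integrated over `[T', T]` in terms of the contributions of the two ends. -/
lemma sub_mul_integral_monDensity (h : IsAsymptotic β Qm Qp p) (Q Q' : ℤ) (T T' : ℝ)
    {δ L : ℝ} (hδ : 0 < δ) {f : ℝ × ℝ → ℂ} (hf : TestLip δ L f) (i j k q : Fin 2) {z : ℝ × ℝ}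
    (hz : z.1 ≠ z.2) :
    ((z.1 - z.2 : ℝ) : ℂ) * (f z * ∫ s in T'..T, monDensity m β Qm Qp p i j k q z.1 z.2 s)
      = (∑ K, ∑ K', -gam β * (rhoKernel m (2 * T') K K' z
          * endF (endLeft m β Q' Qp p T') (endRight m β Q' Qm p T') f (i, k) (j, q) K K' z))
        - ∑ K, ∑ K', -gam β * (rhoKernel m (2 * T) K K' z
          * endF (endLeft m β Q Qp p T) (endRight m β Q Qm p T) f (i, k) (j, q) K K' z) := by
  by_cases hfz : f z = 0
  · simp [hfz, endF]
  obtain ⟨h1, h2, h3⟩ := hf.supp z hfz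
  have hx := annulus_ne_zero hδ h1
  have hy := annulus_ne_zero hδ h2
  have hxy : z.1 ^ 2 ≠ z.2 ^ 2 := by
    intro he
    rcases sq_eq_sq_iff_eq_or_eq_neg.1 he with h | h
    · exact hz h
    · rw [h] at h3
      nlinarith [sq_nonneg z.2]
  have e := integral_bracket (m := m) (β := β) h.cont_phi h.cont_Pi (l := (z.1 : ℂ))
    (n := (z.2 : ℂ)) (Complex.ofReal_ne_zero.2 hx) (Complex.ofReal_ne_zero.2 hy)
    (by exact_mod_cast hxy) (jostP m β Qp p z.1) (jostM m β Qm p z.1)⁻¹ (jostP m β Qp p z.2)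
    (jostM m β Qm p z.2)⁻¹ T' T i j k q
  have e1 := rSandwich_eq_sum (m := m) (β := β) (Q := Q) (p := p) T hxy (jostP m β Qp p z.1)
    (jostM m β Qm p z.1)⁻¹ (jostP m β Qp p z.2) (jostM m β Qm p z.2)⁻¹ (i, k) (j, q)
  have e2 := rSandwich_eq_sum (m := m) (β := β) (Q := Q') (p := p) T' hxy (jostP m β Qp p z.1)
    (jostM m β Qm p z.1)⁻¹ (jostP m β Qp p z.2) (jostM m β Qm p z.2)⁻¹ (i, k) (j, q)
  simp only [monDensity]
  rw [e, show ((z.1 - z.2 : ℝ) : ℂ) * (f z * (rSandwich m β p z.1 z.2 (jostP m β Qp p z.1)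
    (jostM m β Qm p z.1)⁻¹ (jostP m β Qp p z.2) (jostM m β Qm p z.2)⁻¹ T' (i, k) (j, q)
    - rSandwich m β p z.1 z.2 (jostP m β Qp p z.1)
    (jostM m β Qm p z.1)⁻¹ (jostP m β Qp p z.2) (jostM m β Qm p z.2)⁻¹ T (i, k) (j, q)))
    = f z * (((z.1 - z.2 : ℝ) : ℂ) * rSandwich m β p z.1 z.2 (jostP m β Qp p z.1)
    (jostM m β Qm p z.1)⁻¹ (jostP m β Qp p z.2) (jostM m β Qm p z.2)⁻¹ T' (i, k) (j, q))
    - f z * (((z.1 - z.2 : ℝ) : ℂ) * rSandwich m β p z.1 z.2 (jostP m β Qp p z.1)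
    (jostM m β Qm p z.1)⁻¹ (jostP m β Qp p z.2) (jostM m β Qm p z.2)⁻¹ T (i, k) (j, q)) by ring,
    e1, e2, Finset.mul_sum, Finset.mul_sum]
  congr 1 <;> refine Finset.sum_congr rfl fun K _ => ?_ <;> rw [Finset.mul_sum] <;>
  refine Finset.sum_congr rfl fun K' _ => ?_ <;> simp only [endF, endLeft, endRight] <;> ring

/-- The charge whose asymptotic solution is used at time `T`. -/
def endCharge (Qm Qp : ℤ) (T : ℝ) : ℤ := if 0 ≤ T then Qp else Qm

lemma exists_matLip_endCharge (h : IsAsymptotic β Qm Qp p) (hβ : β ≠ 0) (m : ℝ) {δ : ℝ}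
    (hδ : 0 < δ) : ∃ B, ∀ T, MatLip δ B (endLeft m β (endCharge Qm Qp T) Qp p T)
      ∧ MatLip δ B (endRight m β (endCharge Qm Qp T) Qm p T) := by
  obtain ⟨B, h1, h2, -⟩ := exists_matLip h hβ m hδ
  refine ⟨B, fun T => ?_⟩
  unfold endCharge
  split_ifs with hT
  · exact h1 T hT
  · exact h2 T (not_le.1 hT).le

/-- Boundedness is immediate from the density; measurability in `(λ, μ)` is read off from the
boundary terms divided by `λ - μ`, valid off the diagonal. Since `T` and `T'` are arbitrary here,
the charge at each end follows the sign of the time, so that the Lipschitz bounds on that half-line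
apply. -/
lemma integrable_mul_integral_monDensity (h : IsAsymptotic β Qm Qp p) (hβ : β ≠ 0)
    {δ L : ℝ} (hδ : 0 < δ) {f : ℝ × ℝ → ℂ} (hf : TestLip δ L f) (i j k q : Fin 2) (T T' : ℝ) :
    Integrable fun z : ℝ × ℝ =>
      f z * ∫ s in T'..T, monDensity m β Qm Qp p i j k q z.1 z.2 s := by
  obtain ⟨C, hC⟩ := exists_bound_monDensity h hβ m hδ
  obtain ⟨B, hB⟩ := exists_matLip_endCharge h hβ m hδ
  obtain ⟨M, hM⟩ := exists_testLip_endF hδ B B hf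
  have hmeas : ∀ T K K', Measurable fun z => -gam β * (rhoKernel m (2 * T) K K' z
      * endF (endLeft m β (endCharge Qm Qp T) Qp p T) (endRight m β (endCharge Qm Qp T) Qm p T)
        f (i, k) (j, q) K K' z) := fun T K K' => by
    obtain ⟨C', hC'⟩ := (hM _ _ (hB T).1 (hB T).2 (i, k) (j, q) K K').exists_antiLip_rhoKernel hδ m
      (2 * T) K K'
    exact hC'.meas.const_mul _
  refine Integrable.mono' (g := fun z => ‖(C * |T - T'| : ℝ) * f z‖) ?_ ?_ ?_
  · have := hf.integrable_mul hδ (g := fun _ => 1) measurable_const (by simp)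
    simp only [one_mul] at this
    exact (this.const_mul _).norm
  · refine AEStronglyMeasurable.congr (f := fun z : ℝ × ℝ =>
      ((∑ K, ∑ K', -gam β * (rhoKernel m (2 * T') K K' z
          * endF (endLeft m β (endCharge Qm Qp T') Qp p T')
            (endRight m β (endCharge Qm Qp T') Qm p T') f (i, k) (j, q) K K' z))
        - ∑ K, ∑ K', -gam β * (rhoKernel m (2 * T) K K' z
          * endF (endLeft m β (endCharge Qm Qp T) Qp p T)
            (endRight m β (endCharge Qm Qp T) Qm p T) f (i, k) (j, q) K K' z))
        / ((z.1 - z.2 : ℝ) : ℂ)) ?_ ?_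
    · refine (((Finset.measurable_fun_sum _ fun K _ => Finset.measurable_fun_sum _ fun K' _ =>
        hmeas T' K K').sub (Finset.measurable_fun_sum _ fun K _ =>
          Finset.measurable_fun_sum _ fun K' _ => hmeas T K K')).div ?_).aestronglyMeasurable
      fun_prop
    · filter_upwards [ae_ne_diag] with z hz
      have h0 : ((z.1 - z.2 : ℝ) : ℂ) ≠ 0 := Complex.ofReal_ne_zero.2 (sub_ne_zero.2 hz)
      rw [← sub_mul_integral_monDensity h _ _ T T' hδ hf i j k q hz, mul_div_cancel_left₀ _ h0]
  · refine Eventually.of_forall fun z => ?_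
    by_cases hz : f z = 0
    · simp [hz]
    · obtain ⟨h1, h2, -⟩ := hf.supp z hz
      have hb : ‖∫ s in T'..T, monDensity m β Qm Qp p i j k q z.1 z.2 s‖ ≤ C * |T - T'| :=
        intervalIntegral.norm_integral_le_of_norm_le_const fun s _ =>
          hC i j k q z.1 h1 z.2 h2 s
      rw [norm_mul, norm_mul, mul_comm, Complex.norm_real, Real.norm_eq_abs]
      exact mul_le_mul_of_nonneg_right (hb.trans (le_abs_self _)) (norm_nonneg _)

lemma pvSym_double_sum (c : ℂ) {R : ℝ} {H : Fin 2 × Fin 2 → Fin 2 × Fin 2 → ℝ × ℝ → ℂ}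
    (hH : ∀ K K', ∃ C, AntiLip R C (H K K')) :
    Integrable (fun z : ℝ × ℝ => ((∑ K, ∑ K', c * H K K' z) - ∑ K, ∑ K', c * H K K' z.swap)
      / (2 * ((z.1 - z.2 : ℝ) : ℂ))) ∧
    pvSym (fun z => ∑ K, ∑ K', c * H K K' z) = ∑ K, ∑ K', c * pvSym (H K K') := by
  have hi : ∀ K K', Integrable fun z : ℝ × ℝ =>
      c * ((H K K' z - H K K' z.swap) / (2 * ((z.1 - z.2 : ℝ) : ℂ))) := fun K K' => by
    obtain ⟨C, hC⟩ := hH K K'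
    exact hC.integrable_quot.const_mul c
  have e : (fun z : ℝ × ℝ => ((∑ K, ∑ K', c * H K K' z) - ∑ K, ∑ K', c * H K K' z.swap)
      / (2 * ((z.1 - z.2 : ℝ) : ℂ))) = fun z => ∑ K, ∑ K',
        c * ((H K K' z - H K K' z.swap) / (2 * ((z.1 - z.2 : ℝ) : ℂ))) := by
    funext z
    simp only [← Finset.sum_sub_distrib, Finset.sum_div]
    refine Finset.sum_congr rfl fun K _ => Finset.sum_congr rfl fun K' _ => ?_
    ring
  constructor
  · rw [e]
    exact integrable_finsetSum _ fun K _ => integrable_finsetSum _ fun K' _ => hi K K'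
  · rw [pvSym, e, integral_finsetSum _ fun K _ => integrable_finsetSum _ fun K' _ => hi K K']
    refine Finset.sum_congr rfl fun K _ => ?_
    rw [integral_finsetSum _ fun K' _ => hi K K']
    refine Finset.sum_congr rfl fun K' _ => ?_
    rw [integral_const_mul, pvSym]

/-- Only the difference of the boundary terms is an integrable function. Passing through the
symmetrised principal value gives each end a meaning of its own, after which the two limits are
independent. -/
lemma integral_mul_integral_monDensity (h : IsAsymptotic β Qm Qp p) (hβ : β ≠ 0)
    {δ L : ℝ} (hδ : 0 < δ) {f : ℝ × ℝ → ℂ} (hf : TestLip δ L f) (i j k q : Fin 2) {T T' : ℝ}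
    (hT : 0 ≤ T) (hT' : T' ≤ 0) :
    ∫ z : ℝ × ℝ, f z * ∫ s in T'..T, monDensity m β Qm Qp p i j k q z.1 z.2 s
      = endSum m β (2 * T') (endLeft m β Qm Qp p T') (endRight m β Qm Qm p T') f (i, k) (j, q)
        - endSum m β (2 * T) (endLeft m β Qp Qp p T) (endRight m β Qp Qm p T) f (i, k) (j, q) := by
  obtain ⟨B, hB, hB', -⟩ := exists_matLip h hβ m hδ
  obtain ⟨M, hM⟩ := exists_testLip_endF hδ B B hf
  rw [← pvSym_sub_mul (integrable_mul_integral_monDensity h hβ hδ hf i j k q T T'),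
    pvSym_congr fun z hz => sub_mul_integral_monDensity h Qp Qm T T' hδ hf i j k q hz]
  have h1 := pvSym_double_sum (-gam β) (R := δ⁻¹) (H := fun K K' z => rhoKernel m (2 * T') K K' z
    * endF (endLeft m β Qm Qp p T') (endRight m β Qm Qm p T') f (i, k) (j, q) K K' z)
    fun K K' => (hM _ _ (hB' T' hT').1 (hB' T' hT').2 (i, k) (j, q) K K').exists_antiLip_rhoKernel
      hδ m (2 * T') K K'
  have h2 := pvSym_double_sum (-gam β) (R := δ⁻¹) (H := fun K K' z => rhoKernel m (2 * T) K K' z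
    * endF (endLeft m β Qp Qp p T) (endRight m β Qp Qm p T) f (i, k) (j, q) K K' z)
    fun K K' => (hM _ _ (hB T hT).1 (hB T hT).2 (i, k) (j, q) K K').exists_antiLip_rhoKernel
      hδ m (2 * T) K K'
  rw [endSum, endSum, ← h1.2, ← h2.2, pvSym, pvSym, pvSym, ← integral_sub h1.1 h2.1]
  refine integral_congr_ae (Eventually.of_forall fun z => ?_)
  ring

/-- As `T → +∞` the left factor tends to `1` and the right one to the monodromy matrix, and the
kernel to `r₊`; as `T' → -∞` the roles are exchanged and the kernel tends to `r₋`. -/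
lemma IsAsymptotic.tendsto_integral_monDensity (h : IsAsymptotic β Qm Qp p) (hm : 0 < m)
    (hβ : β ≠ 0) {f : ℝ × ℝ → ℂ} (hf : IsTestOn {z | 0 < z.1 * z.2} f) (i j k q : Fin 2) :
    (∀ T T' : ℝ, Integrable fun z : ℝ × ℝ =>
      f z * ∫ s in T'..T, monDensity m β Qm Qp p i j k q z.1 z.2 s) ∧
    Tendsto (fun w : ℝ × ℝ => ∫ z : ℝ × ℝ,
        f z * ∫ s in w.2..w.1, monDensity m β Qm Qp p i j k q z.1 z.2 s)
      (atTop ×ˢ atBot) (𝓝 (monodromyBracket m β Qm Qp p (i, k) (j, q) f)) := by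
  obtain ⟨δ, L, hδ, hL⟩ := hf.exists_testLip
  refine ⟨fun T T' => integrable_mul_integral_monDensity h hβ hδ hL i j k q T T', ?_⟩
  obtain ⟨B, hB, hB', -⟩ := exists_matLip h hβ m hδ
  have hP : ∀ x ∈ annulus δ, Tendsto (fun T => endLeft m β Qp Qp p T x) atTop (𝓝 1) := by
    intro x hx
    have hx0 := annulus_ne_zero hδ hx
    have := (tendsto_inv_of_unitary (h.tendsto_dressed_atTop (m := m) hβ hx0)
      (dressed_unitary h.cont_phi h.cont_Pi x)).const_mul (jostP m β Qp p x)
    rwa [mul_inv_self_of_isUnit (isUnit_of_unitary (h.jostP_unitary hβ hx0))] at this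
  have hP' : ∀ x ∈ annulus δ, Tendsto (fun T => endRight m β Qp Qm p T x) atTop
      (𝓝 (monodromy m β Qm Qp p x)) := by
    intro x hx
    have hx0 := annulus_ne_zero hδ hx
    rw [h.monodromy_eq hβ hx0]
    exact (h.tendsto_dressed_atTop (m := m) hβ hx0).mul_const _
  have hM : ∀ x ∈ annulus δ, Tendsto (fun T => endLeft m β Qm Qp p T x) atBot
      (𝓝 (monodromy m β Qm Qp p x)) := by
    intro x hx
    have hx0 := annulus_ne_zero hδ hx
    rw [h.monodromy_eq hβ hx0]
    exact (tendsto_inv_of_unitary (h.tendsto_dressed_atBot (m := m) hβ hx0)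
      (dressed_unitary h.cont_phi h.cont_Pi x)).const_mul (jostP m β Qp p x)
  have hM' : ∀ x ∈ annulus δ, Tendsto (fun T => endRight m β Qm Qm p T x) atBot (𝓝 1) := by
    intro x hx
    have hx0 := annulus_ne_zero hδ hx
    have := (h.tendsto_dressed_atBot (m := m) hβ hx0).mul_const (jostM m β Qm p x)⁻¹
    rwa [mul_inv_self_of_isUnit (isUnit_of_unitary (h.jostM_unitary hβ hx0))] at this
  have t1 := tendsto_endSum β hm hδ (l := atTop) (s := 1) (θ := fun T => 2 * T)
    (Or.inl ⟨tendsto_id.const_mul_atTop two_pos, rfl⟩)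
    (A := endLeft m β Qp Qp p) (A' := endRight m β Qp Qm p)
    ((eventually_ge_atTop 0).mono fun T hT => (hB T hT).1)
    ((eventually_ge_atTop 0).mono fun T hT => (hB T hT).2) hP hP' hL (i, k) (j, q)
  have t2 := tendsto_endSum β hm hδ (l := atBot) (s := -1) (θ := fun T => 2 * T)
    (Or.inr ⟨tendsto_id.const_mul_atBot two_pos, rfl⟩)
    (A := endLeft m β Qm Qp p) (A' := endRight m β Qm Qm p)
    ((eventually_le_atBot 0).mono fun T hT => (hB' T hT).1)
    ((eventually_le_atBot 0).mono fun T hT => (hB' T hT).2) hM hM' hL (i, k) (j, q)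
  rw [sum_rInf_endF_one_left] at t1
  rw [sum_rInf_endF_one_right] at t2
  have t3 := (t2.comp (tendsto_snd (f := (atTop : Filter ℝ)))).sub
    (t1.comp (tendsto_fst (g := (atBot : Filter ℝ))))
  refine t3.congr' ?_
  filter_upwards [tendsto_fst.eventually (eventually_ge_atTop (0 : ℝ)),
    tendsto_snd.eventually (eventually_le_atBot (0 : ℝ))] with w h1 h2
  rw [integral_mul_integral_monDensity h hβ hδ hL i j k q h1 h2]
  rfl

/-- The infinite-volume bracket of the monodromy matrix. -/
lemma IsAsymptotic.hasPoissonBracketDistrib_monodromy (h : IsAsymptotic β Qm Qp p) (hm : 0 < m)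
    (hβ : β ≠ 0) (i j k q : Fin 2) : HasPoissonBracketDistrib
      (fun x f => monodromy m β Qm Qp f x i j) (fun y f => monodromy m β Qm Qp f y k q) p
      {z | 0 < z.1 * z.2} (monodromyBracket m β Qm Qp p (i, k) (j, q)) :=
  ⟨_, _, _, _, fun _ hx => h.hasFunctionalDeriv_monodromy hβ hx i j,
    fun _ hy => h.hasFunctionalDeriv_monodromy hβ hy k q,
    fun x y _ _ => (continuous_monDensity h i j k q x y).locallyIntegrable,
    fun _ hf => h.tendsto_integral_monDensity hm hβ hf i j k q⟩

end SineGordon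
end


noncomputable section

open scoped Matrix.Norms.Operator

namespace SineGordon

/-! ### The symmetry `λ ↦ -λ` -/

variable {m β : ℝ} {Q Qm Qp : ℤ} {p : Fields}

lemma σ₃_mul_self : σ₃ * σ₃ = 1 := by
  ext i j; fin_cases i <;> fin_cases j <;> simp [σ₃]

lemma σ₂_mul_self : σ₂ * σ₂ = 1 := by
  ext i j; fin_cases i <;> fin_cases j <;> simp [σ₂]

/-- `k₀` and `k₁` are odd in `λ`, and conjugation by `σ₃` reverses exactly `σ₁` and `σ₂`. -/
lemma laxV_neg (l : ℂ) (t : ℝ) : laxV m β p (-l) t = σ₃ * laxV m β p l t * σ₃ := by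
  ext i j
  fin_cases i <;> fin_cases j <;>
  simp [laxV, k₀, k₁, σ₁, σ₂, σ₃, Matrix.mul_apply, div_neg] <;> ring

lemma dVphi_neg (l : ℂ) (t : ℝ) : dVphi m β p (-l) t = σ₃ * dVphi m β p l t * σ₃ := by
  ext i j
  fin_cases i <;> fin_cases j <;>
  simp [dVphi, k₀, k₁, σ₁, σ₂, σ₃, Matrix.mul_apply, div_neg] <;> ring

lemma dVPi_conj (β : ℝ) : dVPi β = σ₃ * dVPi β * σ₃ := by
  ext i j
  fin_cases i <;> fin_cases j <;> simp [dVPi, σ₃, Matrix.mul_apply]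

lemma fund_neg (h1 : Continuous p.1) (h2 : Continuous p.2) (l : ℂ) (t : ℝ) :
    fund m β p (-l) t = σ₃ * fund m β p l t * σ₃ := by
  have hd : ∀ s, HasDerivAt (fun s => σ₃ * fund m β p l s * σ₃)
      (laxV m β p (-l) s * (σ₃ * fund m β p l s * σ₃)) s := by
    intro s
    refine (((hasDerivAt_fund h1 h2 l s).const_mul σ₃).mul_const σ₃).congr_deriv ?_
    rw [laxV_neg]
    simp only [mul_assoc]
    rw [← mul_assoc σ₃ σ₃, σ₃_mul_self, one_mul]
  have e := eq_mul_inv_of_hasDerivAt (hasDerivAt_fund h1 h2 (-l)) (isUnit_fund h1 h2 (-l)) hd t 0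
  rw [fund_zero h1 h2, fund_zero h1 h2, inv_one, mul_one, mul_one, σ₃_mul_self, mul_one] at e
  exact e.symm

/-- Reversing `k₀` exchanges the two exponentials, which is conjugation by `σ₂`; moving `σ₂` across
`N` turns it into `-σ₃`. -/
lemma asymE_neg (t x : ℝ) : asymE m Q t ((-x : ℝ) : ℂ) = -(σ₃ * asymE m Q t x * σ₂) := by
  rw [asymE_eq, asymE_eq]
  have e : m / 4 * (-x + 1 / -x) * t = -(m / 4 * (x + 1 / x) * t) := by
    rw [div_neg]; ring
  rw [e, neg_neg]
  have h1 : ∀ c : ℝ, expσ₃ (Complex.I * (c : ℝ)) = σ₂ * expσ₃ (Complex.I * (-c : ℝ)) * σ₂ := by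
    intro c
    ext i j
    fin_cases i <;> fin_cases j <;> simp [expσ₃, σ₂, Matrix.mul_apply]
    · linear_combination Complex.exp (Complex.I * c) * Complex.I_mul_I
    · linear_combination Complex.exp (-(Complex.I * c)) * Complex.I_mul_I
  have h2 : matN * σ₂ = -(σ₃ * matN) := by
    rw [matN_eq]
    ext i j
    fin_cases i <;> fin_cases j <;> simp [σ₂, σ₃, Matrix.mul_apply]
    · linear_combination ((Real.sqrt 2 : ℝ) : ℂ)⁻¹ * Complex.I_mul_I
    · linear_combination (-((Real.sqrt 2 : ℝ) : ℂ)⁻¹) * Complex.I_mul_I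
  have h3 : ∀ c, expσ₃ c * σ₃ = σ₃ * expσ₃ c := by
    intro c
    ext i j
    fin_cases i <;> fin_cases j <;> simp [expσ₃, σ₃, Matrix.mul_apply]
  rw [h1 (m / 4 * (x + 1 / x) * t), ← mul_assoc, ← mul_assoc, mul_assoc _ matN σ₂, h2, mul_neg,
    ← mul_assoc, h3]
  simp only [neg_mul, mul_assoc]

lemma dressed_neg (h1 : Continuous p.1) (h2 : Continuous p.2) (x t : ℝ) :
    dressed m β Q p (-x) t = -(σ₂ * dressed m β Q p x t * σ₃) := by
  rw [dressed, dressed, asymE_neg, Complex.ofReal_neg, fund_neg h1 h2]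
  have : (-(σ₃ * asymE m Q t x * σ₂))⁻¹ = -(σ₂ * (asymE m Q t x)⁻¹ * σ₃) := by
    refine Matrix.inv_eq_left_inv ?_
    rw [neg_mul_neg]
    calc _ = σ₂ * ((asymE m Q t x)⁻¹ * (σ₃ * σ₃) * asymE m Q t x) * σ₂ := by simp only [mul_assoc]
      _ = 1 := by
        rw [σ₃_mul_self, mul_one,
          inv_mul_self_of_isUnit (isUnit_of_unitary (asymE_unitary m Q t x)), mul_one, σ₂_mul_self]
  rw [this, neg_mul]
  congr 1
  calc _ = σ₂ * (asymE m Q t x)⁻¹ * (σ₃ * σ₃) * fund m β p x t * σ₃ := by simp only [mul_assoc]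
    _ = _ := by rw [σ₃_mul_self, mul_one]; simp only [mul_assoc]

lemma IsAsymptotic.jostP_neg (h : IsAsymptotic β Qm Qp p) (hβ : β ≠ 0) {x : ℝ} (hx : x ≠ 0) :
    jostP m β Qp p (-x) = -(σ₂ * jostP m β Qp p x * σ₃) := by
  refine tendsto_nhds_unique (h.tendsto_dressed_atTop (m := m) hβ (neg_ne_zero.2 hx)) ?_
  rw [show dressed m β Qp p (-x) = fun t => -(σ₂ * dressed m β Qp p x t * σ₃) from
    funext (dressed_neg h.cont_phi h.cont_Pi x)]
  exact (((h.tendsto_dressed_atTop hβ hx).const_mul _).mul_const _).neg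

lemma IsAsymptotic.jostM_neg (h : IsAsymptotic β Qm Qp p) (hβ : β ≠ 0) {x : ℝ} (hx : x ≠ 0) :
    jostM m β Qm p (-x) = -(σ₂ * jostM m β Qm p x * σ₃) := by
  refine tendsto_nhds_unique (h.tendsto_dressed_atBot (m := m) hβ (neg_ne_zero.2 hx)) ?_
  rw [show dressed m β Qm p (-x) = fun t => -(σ₂ * dressed m β Qm p x t * σ₃) from
    funext (dressed_neg h.cont_phi h.cont_Pi x)]
  exact (((h.tendsto_dressed_atBot hβ hx).const_mul _).mul_const _).neg

lemma sandwich_neg (P M U V : Mat2) (hM : IsUnit M) (hU : IsUnit U) :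
    (-(σ₂ * P * σ₃)) * (σ₃ * U * σ₃)⁻¹ * (σ₃ * V * σ₃)
      * ((σ₃ * U * σ₃) * (-(σ₂ * M * σ₃))⁻¹) = σ₂ * (P * U⁻¹ * V * (U * M⁻¹)) * σ₂ := by
  have e1 : (-(σ₂ * M * σ₃))⁻¹ = -(σ₃ * M⁻¹ * σ₂) := by
    refine Matrix.inv_eq_left_inv ?_
    rw [neg_mul_neg]
    calc _ = σ₃ * (M⁻¹ * (σ₂ * σ₂) * M) * σ₃ := by simp only [mul_assoc]
      _ = 1 := by
        rw [σ₂_mul_self, mul_one, inv_mul_self_of_isUnit hM, mul_one, σ₃_mul_self]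
  have e2 : (σ₃ * U * σ₃)⁻¹ = σ₃ * U⁻¹ * σ₃ := by
    refine Matrix.inv_eq_left_inv ?_
    calc _ = σ₃ * (U⁻¹ * (σ₃ * σ₃) * U) * σ₃ := by simp only [mul_assoc]
      _ = 1 := by
        rw [σ₃_mul_self, mul_one, inv_mul_self_of_isUnit hU, mul_one, σ₃_mul_self]
  rw [e1, e2]
  calc _ = σ₂ * P * (σ₃ * σ₃) * U⁻¹ * (σ₃ * σ₃) * V * (σ₃ * σ₃) * U * (σ₃ * σ₃) * M⁻¹ * σ₂ := by
        simp only [neg_mul, mul_neg, neg_neg, mul_assoc]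
    _ = _ := by simp only [σ₃_mul_self, mul_one, mul_assoc]

lemma σ₂_conj_apply_zero (A : Mat2) : (σ₂ * A * σ₂) 0 0 = A 1 1 := by
  rw [Matrix.mul_apply, Fin.sum_univ_two, Matrix.mul_apply, Matrix.mul_apply, Fin.sum_univ_two,
    Fin.sum_univ_two]
  simp only [σ₂, Matrix.of_apply, Matrix.cons_val_zero, Matrix.cons_val_one, Matrix.cons_val']
  simp
  linear_combination (-A 1 1) * Complex.I_mul_I

lemma IsAsymptotic.varPhi_neg (h : IsAsymptotic β Qm Qp p) (hβ : β ≠ 0) {x : ℝ} (hx : x ≠ 0)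
    (s : ℝ) : varPhi m β p ((-x : ℝ) : ℂ) (jostP m β Qp p (-x)) (jostM m β Qm p (-x))⁻¹ s 0 0
      = varPhi m β p x (jostP m β Qp p x) (jostM m β Qm p x)⁻¹ s 1 1 := by
  rw [← σ₂_conj_apply_zero (varPhi m β p x _ _ s), varPhi, varPhi, h.jostP_neg hβ hx, h.jostM_neg hβ hx,
    Complex.ofReal_neg, fund_neg h.cont_phi h.cont_Pi, dVphi_neg,
    sandwich_neg _ _ _ _ (isUnit_of_unitary (h.jostM_unitary hβ hx))
      (isUnit_fund h.cont_phi h.cont_Pi _ _)]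

lemma IsAsymptotic.varPi_neg (h : IsAsymptotic β Qm Qp p) (hβ : β ≠ 0) {x : ℝ} (hx : x ≠ 0)
    (s : ℝ) : varPi m β p ((-x : ℝ) : ℂ) (jostP m β Qp p (-x)) (jostM m β Qm p (-x))⁻¹ s 0 0
      = varPi m β p x (jostP m β Qp p x) (jostM m β Qm p x)⁻¹ s 1 1 := by
  rw [← σ₂_conj_apply_zero (varPi m β p x _ _ s), varPi, varPi, h.jostP_neg hβ hx, h.jostM_neg hβ hx,
    Complex.ofReal_neg, fund_neg h.cont_phi h.cont_Pi]
  conv_lhs => rw [dVPi_conj]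
  rw [sandwich_neg _ _ _ _ (isUnit_of_unitary (h.jostM_unitary hβ hx))
      (isUnit_fund h.cont_phi h.cont_Pi _ _)]

/-- Trades a negative spectral parameter for a positive multiple of the other sign class: `𝒯(-μ) =
σ₂ 𝒯(μ) σ₂`, so `𝔞(-μ)` becomes the lower diagonal entry and `λμ < 0` is reduced to `λμ > 0`. -/
lemma IsAsymptotic.monDensity_neg (h : IsAsymptotic β Qm Qp p) (hβ : β ≠ 0) (x : ℝ) {y : ℝ}
    (hy : y ≠ 0) (s : ℝ) :
    monDensity m β Qm Qp p 0 0 0 0 x (-y) s = monDensity m β Qm Qp p 0 0 1 1 x y s := by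
  rw [monDensity, h.varPhi_neg hβ hy, h.varPi_neg hβ hy, monDensity]

/-! ### Involution of `𝔞` -/

/-- The restriction of `h` to `λ μ > 0`. -/
def posPart (h : ℝ × ℝ → ℂ) (z : ℝ × ℝ) : ℂ := if 0 < z.1 * z.2 then h z else 0

/-- Cutting along the axes preserves smoothness since the test function vanishes in a neighbourhood
of every point of them. -/
lemma IsTestOn.posPart {h : ℝ × ℝ → ℂ} (hh : IsTestOn {z | z.1 ≠ 0 ∧ z.2 ≠ 0} h) :
    IsTestOn {z | 0 < z.1 * z.2} (posPart h) := by
  obtain ⟨h1, h2, h3⟩ := hh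
  have hcont : Continuous fun z : ℝ × ℝ => z.1 * z.2 := by fun_prop
  have hsub : Function.support (SineGordon.posPart h) ⊆ Function.support h := by
    intro z hz
    simp only [SineGordon.posPart, Function.mem_support] at hz ⊢
    intro h0
    simp [h0] at hz
  have hts : tsupport (SineGordon.posPart h) ⊆ tsupport h := closure_mono hsub
  refine ⟨?_, h2.mono' (hsub.trans (subset_tsupport h)), ?_⟩
  · rw [contDiff_iff_contDiffAt]
    intro z
    rcases lt_trichotomy (z.1 * z.2) 0 with hz | hz | hz
    · refine contDiffAt_const (c := (0 : ℂ)).congr_of_eventuallyEq ?_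
      filter_upwards [hcont.continuousAt.eventually_lt_const hz] with w hw
      simp [SineGordon.posPart, not_lt.2 hw.le]
    · have hnot : z ∉ tsupport h := fun hmem => by
        rcases mul_eq_zero.1 hz with h0 | h0
        · exact (h3 hmem).1 h0
        · exact (h3 hmem).2 h0
      refine contDiffAt_const (c := (0 : ℂ)).congr_of_eventuallyEq ?_
      filter_upwards [(isClosed_tsupport h).isOpen_compl.mem_nhds hnot] with w hw
      have : h w = 0 := image_eq_zero_of_notMem_tsupport hw
      simp [SineGordon.posPart, this]
    · refine (h1.contDiffAt (x := z)).congr_of_eventuallyEq ?_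
      filter_upwards [hcont.continuousAt.eventually_const_lt hz] with w hw
      simp [SineGordon.posPart, hw]
  · intro z hz
    have hge : 0 ≤ z.1 * z.2 := by
      have hc : IsClosed {z : ℝ × ℝ | 0 ≤ z.1 * z.2} := isClosed_le continuous_const hcont
      refine closure_minimal (fun w hw => ?_) hc hz
      by_contra hneg
      have hneg : w.1 * w.2 < 0 := not_le.1 hneg
      exact hw (by simp [SineGordon.posPart, not_lt.2 hneg.le])
    have hne := h3 (hts hz)
    exact lt_of_le_of_ne hge (mul_ne_zero hne.1 hne.2).symm

/-- `(λ, μ) ↦ (λ, -μ)`. -/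
def negSnd : ℝ × ℝ ≃ᵐ ℝ × ℝ := (MeasurableEquiv.refl ℝ).prodCongr (MeasurableEquiv.neg ℝ)

lemma negSnd_apply (z : ℝ × ℝ) : negSnd z = (z.1, -z.2) := rfl

lemma measurePreserving_negSnd : MeasurePreserving negSnd := by
  rw [Measure.volume_eq_prod]
  exact (MeasurePreserving.id volume).prod (Measure.measurePreserving_neg volume)

lemma IsTestOn.comp_negSnd {h : ℝ × ℝ → ℂ} (hh : IsTestOn {z | z.1 ≠ 0 ∧ z.2 ≠ 0} h) :
    IsTestOn {z | z.1 ≠ 0 ∧ z.2 ≠ 0} (fun z => h (z.1, -z.2)) := by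
  obtain ⟨h1, h2, h3⟩ := hh
  set e : ℝ × ℝ ≃ₜ ℝ × ℝ := (Homeomorph.refl ℝ).prodCongr (Homeomorph.neg ℝ) with he
  refine ⟨h1.comp (by fun_prop), h2.comp_homeomorph e, ?_⟩
  intro z hz
  have : tsupport (fun z : ℝ × ℝ => h (z.1, -z.2)) = e ⁻¹' tsupport h :=
    tsupport_comp_eq_preimage h e
  rw [this] at hz
  have := h3 hz
  exact ⟨this.1, fun h0 => this.2 (by simp [he, h0])⟩

lemma posPart_add_posPart {h : ℝ × ℝ → ℂ} (hh : IsTestOn {z | z.1 ≠ 0 ∧ z.2 ≠ 0} h) (z : ℝ × ℝ) :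
    h z = posPart h z + posPart (fun z => h (z.1, -z.2)) (negSnd z) := by
  rw [negSnd_apply]
  simp only [posPart, mul_neg, neg_neg, Prod.mk.eta]
  rcases lt_trichotomy (z.1 * z.2) 0 with hz | hz | hz
  · rw [if_neg hz.not_gt, if_pos (neg_pos.2 hz), zero_add]
  · have : h z = 0 := by
      by_contra hne
      have := hh.2.2 (subset_tsupport h hne)
      exact mul_ne_zero this.1 this.2 hz
    simp [hz, this]
  · rw [if_pos hz, if_neg (by linarith), add_zero]

lemma monodromyBracket_zero_zero (f : ℝ × ℝ → ℂ) :
    monodromyBracket m β Qm Qp p (0, 0) (0, 0) f = 0 := by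
  simp [monodromyBracket, rInf]

/-- The principal values are the same in `r₊` and `r₋` and cancel. Each delta term carries the
product `𝒯₁₂ 𝒯₂₁`, with the arguments `λ`, `μ` distributed differently; on the diagonal the two
agree and cancel as well. -/
lemma monodromyBracket_zero_one (f : ℝ × ℝ → ℂ) :
    monodromyBracket m β Qm Qp p (0, 1) (0, 1) f = 0 := by
  simp [monodromyBracket, Fintype.sum_prod_type, rInf, diagDelta]
  simp only [mul_comm (monodromy m β Qm Qp p _ 1 0), sub_self]

/-- `𝔞(λ)` and `𝔞(μ)` Poisson commute. -/
lemma IsAsymptotic.hasPoissonBracketDistrib_entryA (h : IsAsymptotic β Qm Qp p) (hm : 0 < m)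
    (hβ : β ≠ 0) : HasPoissonBracketDistrib (fun x f => entryA m β Qm Qp f x)
      (fun y f => entryA m β Qm Qp f y) p {z | z.1 ≠ 0 ∧ z.2 ≠ 0} (fun _ => 0) := by
  refine ⟨_, _, _, _, fun _ hx => h.hasFunctionalDeriv_monodromy hβ hx 0 0,
    fun _ hy => h.hasFunctionalDeriv_monodromy hβ hy 0 0,
    fun x y _ _ => (continuous_monDensity h 0 0 0 0 x y).locallyIntegrable, fun f hf => ?_⟩
  change (∀ T T' : ℝ, Integrable fun z : ℝ × ℝ =>
      f z * ∫ s in T'..T, monDensity m β Qm Qp p 0 0 0 0 z.1 z.2 s) ∧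
    Tendsto (fun w : ℝ × ℝ => ∫ z : ℝ × ℝ,
        f z * ∫ s in w.2..w.1, monDensity m β Qm Qp p 0 0 0 0 z.1 z.2 s)
      (atTop ×ˢ atBot) (𝓝 0)
  set g : ℝ × ℝ → ℂ := fun z => f (z.1, -z.2) with hg
  obtain ⟨i1, t1⟩ := h.tendsto_integral_monDensity hm hβ hf.posPart 0 0 0 0
  obtain ⟨i2, t2⟩ := h.tendsto_integral_monDensity hm hβ hf.comp_negSnd.posPart 0 0 1 1
  -- The test function is the sum of its part on `λμ > 0` and its part on `λμ < 0`, the latter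
  -- reflected by `μ ↦ -μ` so that both pieces live where the infinite-volume bracket is known.
  have e : ∀ T T' : ℝ, (fun z : ℝ × ℝ =>
      f z * ∫ s in T'..T, monDensity m β Qm Qp p 0 0 0 0 z.1 z.2 s) = fun z =>
      posPart f z * (∫ s in T'..T, monDensity m β Qm Qp p 0 0 0 0 z.1 z.2 s)
      + posPart g (negSnd z) * ∫ s in T'..T,
        monDensity m β Qm Qp p 0 0 1 1 (negSnd z).1 (negSnd z).2 s := by
    intro T T'
    funext z
    rw [posPart_add_posPart hf z, add_mul]
    refine congrArg₂ (· + ·) rfl ?_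
    by_cases hz : z.2 = 0
    · simp [posPart, negSnd_apply, hz]
    · refine congrArg₂ (· * ·) rfl (intervalIntegral.integral_congr fun s _ => ?_)
      rw [negSnd_apply]
      have := h.monDensity_neg (m := m) hβ z.1 (neg_ne_zero.2 hz) s
      rw [neg_neg] at this
      exact this
  have i2' : ∀ T T' : ℝ, Integrable fun z : ℝ × ℝ => posPart g (negSnd z) * ∫ s in T'..T,
        monDensity m β Qm Qp p 0 0 1 1 (negSnd z).1 (negSnd z).2 s := fun T T' =>
    (measurePreserving_negSnd.integrable_comp_emb negSnd.measurableEmbedding).2 (i2 T T')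
  refine ⟨fun T T' => ?_, ?_⟩
  · rw [e]
    exact (i1 T T').add (i2' T T')
  · rw [monodromyBracket_zero_zero] at t1
    rw [monodromyBracket_zero_one] at t2
    have := t1.add t2
    rw [add_zero] at this
    refine this.congr fun w => ?_
    rw [e, integral_add (i1 w.1 w.2) (i2' w.1 w.2)]
    refine congrArg₂ (· + ·) rfl ?_
    exact (measurePreserving_negSnd.integral_comp' (fun z : ℝ × ℝ => posPart g z * ∫ s in w.2..w.1,
        monDensity m β Qm Qp p 0 0 1 1 z.1 z.2 s)).symm

end SineGordon
end


/-! ### Schwartz decay implies the asymptotic hypotheses -/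

noncomputable section

open scoped Matrix.Norms.Operator

namespace SineGordon

/-- `(1 + |t|)(1 + t²)` expands into the powers of `|t|` from `0` to `3`. -/
lemma le_inv_of_moments {t a : ℝ} {C : ℕ → ℝ} (h : ∀ k, |t| ^ k * a ≤ C k) :
    (1 + |t|) * a ≤ (C 0 + C 1 + C 2 + C 3) * (1 + t ^ 2)⁻¹ := by
  have h2 : 0 < 1 + t ^ 2 := by positivity
  rw [← div_eq_mul_inv, le_div_iff₀ h2, ← sq_abs]
  have := h 0
  have := h 1
  have := h 2
  have := h 3
  nlinarith

lemma IsPhasePoint.decayOn_aux {β : ℝ} {Q : ℤ} {p : Fields} {I : Set ℝ}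
    (h1 : ∀ k : ℕ, ∃ C : ℝ, ∀ t ∈ I, |t| ^ k * |p.1 t - 2 * Real.pi * Q / β| ≤ C)
    (h2 : ∀ k : ℕ, ∃ C : ℝ, ∀ t ∈ I, |t| ^ k * |p.2 t| ≤ C) : DecayOn β Q p I := by
  choose C hC using h1
  choose D hD using h2
  refine ⟨(D 0 + D 1 + D 2 + D 3) + (C 0 + C 1 + C 2 + C 3), fun t ht => ?_⟩
  rw [vacDist, mul_add (1 + |t|), add_mul (D 0 + D 1 + D 2 + D 3)]
  exact add_le_add (le_inv_of_moments fun k => hD k t ht)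
    (le_inv_of_moments fun k => hC k t ht)

lemma IsPhasePoint.isAsymptotic {β : ℝ} {Qm Qp : ℤ} {p : Fields} (h : IsPhasePoint β Qm Qp p) :
    IsAsymptotic β Qm Qp p where
  cont_phi := h.smooth_phi.continuous
  cont_Pi := h.smooth_Pi.continuous
  right := by
    refine IsPhasePoint.decayOn_aux (fun k => ?_) fun k => ?_
    · obtain ⟨C, hC⟩ := h.decay_phi_right k 0
      exact ⟨C, fun t ht => by simpa using hC t ht⟩
    · obtain ⟨C, hC⟩ := h.decay_Pi k 0
      exact ⟨C, fun t ht => by simpa using hC t⟩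
  left := by
    refine IsPhasePoint.decayOn_aux (fun k => ?_) fun k => ?_
    · obtain ⟨C, hC⟩ := h.decay_phi_left k 0
      exact ⟨C, fun t ht => by simpa using hC t ht⟩
    · obtain ⟨C, hC⟩ := h.decay_Pi k 0
      exact ⟨C, fun t ht => by simpa using hC t⟩

end SineGordon
end


noncomputable section

open scoped Matrix.Norms.Operator

namespace SineGordon

/-! ### Smooth functions all of whose derivatives are dominated by a weight -/

/-- The derivatives of `g` of order at most `N` are `O(W)`. -/
def DecN (W : ℝ → ℝ) : ℕ → (ℝ → ℂ) → Prop
  | 0, g => ∃ C, ∀ t, ‖g t‖ ≤ C * W t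
  | N + 1, g => Differentiable ℝ g ∧ (∃ C, ∀ t, ‖g t‖ ≤ C * W t) ∧ DecN W N (deriv g)

/-- All derivatives of `g` are `O(W)`. -/
def DecAll (W : ℝ → ℝ) (g : ℝ → ℂ) : Prop := ∀ N, DecN W N g

/-- The weight `(1 + t²)⁻¹`. -/
def wt (t : ℝ) : ℝ := (1 + t ^ 2)⁻¹

/-- The weight `1`. -/
def wone (_ : ℝ) : ℝ := 1

lemma wt_pos (t : ℝ) : 0 < wt t := by unfold wt; positivity

lemma wt_le_one (t : ℝ) : wt t ≤ 1 := inv_le_one_of_one_le₀ (by nlinarith [sq_nonneg t])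

section

variable {W : ℝ → ℝ} {N : ℕ} {a b g : ℝ → ℂ}

lemma DecN.of_succ (h : DecN W (N + 1) g) : DecN W N g := by
  induction N generalizing g with
  | zero => exact h.2.1
  | succ N ih => exact ⟨h.1, h.2.1, ih h.2.2⟩

lemma bound_add (ha : ∃ C, ∀ t, ‖a t‖ ≤ C * W t) (hb : ∃ C, ∀ t, ‖b t‖ ≤ C * W t) :
    ∃ C, ∀ t, ‖a t + b t‖ ≤ C * W t := by
  obtain ⟨C, hC⟩ := ha
  obtain ⟨D, hD⟩ := hb
  refine ⟨C + D, fun t => (norm_add_le _ _).trans ?_⟩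
  rw [add_mul]
  exact add_le_add (hC t) (hD t)

lemma bound_mul (ha : ∃ C, ∀ t, ‖a t‖ ≤ C * wone t) (hb : ∃ C, ∀ t, ‖b t‖ ≤ C * W t) :
    ∃ C, ∀ t, ‖a t * b t‖ ≤ C * W t := by
  obtain ⟨C, hC⟩ := ha
  obtain ⟨D, hD⟩ := hb
  have hC0 : 0 ≤ C := by
    have := (norm_nonneg _).trans (hC 0)
    simpa [wone] using this
  refine ⟨C * D, fun t => ?_⟩
  rw [norm_mul, mul_assoc]
  have := hC t
  rw [wone, mul_one] at this
  exact mul_le_mul this (hD t) (norm_nonneg _) hC0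

lemma DecN.add (ha : DecN W N a) (hb : DecN W N b) : DecN W N fun t => a t + b t := by
  induction N generalizing a b with
  | zero => exact bound_add ha hb
  | succ N ih =>
    refine ⟨ha.1.add hb.1, bound_add ha.2.1 hb.2.1, ?_⟩
    have : deriv (fun t => a t + b t) = fun t => deriv a t + deriv b t :=
      funext fun t => deriv_fun_add (ha.1 t) (hb.1 t)
    rw [this]
    exact ih ha.2.2 hb.2.2

lemma DecN.mul (ha : DecN wone N a) (hb : DecN W N b) : DecN W N fun t => a t * b t := by
  induction N generalizing a b with
  | zero => exact bound_mul ha hb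
  | succ N ih =>
    refine ⟨ha.1.mul hb.1, bound_mul ha.2.1 hb.2.1, ?_⟩
    have : deriv (fun t => a t * b t) = fun t => deriv a t * b t + a t * deriv b t :=
      funext fun t => deriv_fun_mul (ha.1 t) (hb.1 t)
    rw [this]
    exact (ih ha.2.2 hb.of_succ).add (ih ha.of_succ hb.2.2)

lemma DecN.zero : DecN W N fun _ => 0 := by
  induction N with
  | zero => exact ⟨0, by simp⟩
  | succ N ih =>
    refine ⟨differentiable_const _, ⟨0, by simp⟩, ?_⟩
    have : deriv (fun _ : ℝ => (0 : ℂ)) = fun _ => 0 := funext fun t => deriv_const t 0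
    rw [this]
    exact ih

lemma DecN.const (c : ℂ) : DecN wone N fun _ => c := by
  cases N with
  | zero => exact ⟨‖c‖, by simp [wone]⟩
  | succ N =>
    refine ⟨differentiable_const _, ⟨‖c‖, by simp [wone]⟩, ?_⟩
    have : deriv (fun _ : ℝ => c) = fun _ => 0 := funext fun t => deriv_const t c
    rw [this]
    exact DecN.zero

lemma DecN.to_wone (h : DecN wt N g) : DecN wone N g := by
  have hb : ∀ {g : ℝ → ℂ}, (∃ C, ∀ t, ‖g t‖ ≤ C * wt t) → ∃ C, ∀ t, ‖g t‖ ≤ C * wone t := by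
    rintro g ⟨C, hC⟩
    refine ⟨C, fun t => (hC t).trans ?_⟩
    have hC0 : 0 ≤ C := by
      have := (norm_nonneg _).trans (hC t)
      exact nonneg_of_mul_nonneg_left this (wt_pos t)
    exact mul_le_mul_of_nonneg_left (wt_le_one t) hC0
  induction N generalizing g with
  | zero => exact hb h
  | succ N ih => exact ⟨h.1, hb h.2.1, ih h.2.2⟩

lemma DecAll.add (ha : DecAll W a) (hb : DecAll W b) : DecAll W fun t => a t + b t :=
  fun N => (ha N).add (hb N)

lemma DecAll.mul (ha : DecAll wone a) (hb : DecAll W b) : DecAll W fun t => a t * b t :=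
  fun N => (ha N).mul (hb N)

lemma DecAll.zero : DecAll W fun _ => 0 := fun _ => DecN.zero

lemma DecAll.const (c : ℂ) : DecAll wone fun _ => c := fun _ => DecN.const c

lemma DecAll.const_mul (c : ℂ) (hb : DecAll W b) : DecAll W fun t => c * b t :=
  (DecAll.const c).mul hb

lemma DecAll.to_wone (h : DecAll wt g) : DecAll wone g := fun N => (h N).to_wone

lemma DecAll.sum {ι : Type*} (s : Finset ι) {g : ι → ℝ → ℂ} (h : ∀ i ∈ s, DecAll W (g i)) :
    DecAll W fun t => ∑ i ∈ s, g i t := by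
  classical
  induction s using Finset.induction_on with
  | empty => simpa using DecAll.zero
  | insert i s hi ih =>
    simp only [Finset.sum_insert hi]
    exact (h i (Finset.mem_insert_self i s)).add
      (ih fun j hj => h j (Finset.mem_insert_of_mem hj))

lemma DecAll.deriv (h : DecAll W g) : DecAll W (deriv g) := fun N => (h (N + 1)).2.2

lemma DecAll.differentiable (h : DecAll W g) : Differentiable ℝ g := (h 1).1

lemma DecAll.continuous (h : DecAll W g) : Continuous g := h.differentiable.continuous

lemma DecAll.of_deriv (hd : Differentiable ℝ g) (hb : ∃ C, ∀ t, ‖g t‖ ≤ C * W t)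
    (h : DecAll W (_root_.deriv g)) : DecAll W g
  | 0 => hb
  | N + 1 => ⟨hd, hb, h N⟩

lemma integrable_wt : Integrable wt := integrable_inv_one_add_sq

lemma DecAll.integrable (h : DecAll wt g) : Integrable g := by
  obtain ⟨C, hC⟩ := h 0
  exact (integrable_wt.const_mul C).mono' h.continuous.aestronglyMeasurable
    (Eventually.of_forall hC)

lemma tendsto_wt_atTop : Tendsto wt atTop (𝓝 0) :=
  tendsto_inv_atTop_zero.comp (tendsto_atTop_add_const_left _ _ (tendsto_pow_atTop two_ne_zero))

lemma tendsto_wt_atBot : Tendsto wt atBot (𝓝 0) := by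
  have := tendsto_wt_atTop.comp tendsto_neg_atBot_atTop
  refine this.congr fun t => ?_
  simp [wt]

lemma DecAll.tendsto (h : DecAll wt g) : Tendsto g atTop (𝓝 0) ∧ Tendsto g atBot (𝓝 0) := by
  obtain ⟨C, hC⟩ := h 0
  refine ⟨squeeze_zero_norm hC ?_, squeeze_zero_norm hC ?_⟩
  · simpa using tendsto_wt_atTop.const_mul C
  · simpa using tendsto_wt_atBot.const_mul C

lemma DecAll.ofReal {r : ℝ → ℝ} (hr : ContDiff ℝ ∞ r)
    (h : ∀ n, ∃ C, ∀ t, |iteratedDeriv n r t| ≤ C * W t) : DecAll W fun t => (r t : ℂ) := by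
  intro N
  induction N generalizing r with
  | zero =>
    obtain ⟨C, hC⟩ := h 0
    refine ⟨C, fun t => ?_⟩
    simpa using hC t
  | succ N ih =>
    have hd : Differentiable ℝ r := hr.differentiable (by simp)
    refine ⟨fun t => (hd t).hasDerivAt.ofReal_comp.differentiableAt, ?_, ?_⟩
    · obtain ⟨C, hC⟩ := h 0
      refine ⟨C, fun t => ?_⟩
      simpa using hC t
    · have : _root_.deriv (fun t => (r t : ℂ)) = fun t => ((_root_.deriv r t : ℝ) : ℂ) :=
        funext fun t => (hd t).hasDerivAt.ofReal_comp.deriv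
      rw [this]
      refine ih (contDiff_infty_iff_deriv.1 hr).2 fun n => ?_
      obtain ⟨C, hC⟩ := h (n + 1)
      refine ⟨C, fun t => ?_⟩
      rw [← iteratedDeriv_succ']
      exact hC t

end

/-! ### Decay of the fields -/

lemma le_wt_of_moments {t a C₀ C₂ : ℝ} (h0 : |t| ^ 0 * a ≤ C₀) (h2 : |t| ^ 2 * a ≤ C₂) :
    a ≤ (C₀ + C₂) * wt t := by
  rw [wt, ← div_eq_mul_inv, le_div_iff₀ (by positivity), ← sq_abs]
  linarith

namespace IsPhasePoint

variable {β : ℝ} {Qm Qp : ℤ} {p : Fields}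

lemma dec_Pi (h : IsPhasePoint β Qm Qp p) : DecAll wt fun t => (p.2 t : ℂ) := by
  refine DecAll.ofReal h.smooth_Pi fun n => ?_
  obtain ⟨C₀, h0⟩ := h.decay_Pi 0 n
  obtain ⟨C₂, h2⟩ := h.decay_Pi 2 n
  exact ⟨C₀ + C₂, fun t => le_wt_of_moments (h0 t) (h2 t)⟩

lemma exists_bound_halves {r : ℝ → ℝ} (hr : ∃ C, ∀ t, 0 ≤ t → |r t| ≤ C * wt t)
    (hl : ∃ C, ∀ t, t ≤ 0 → |r t| ≤ C * wt t) : ∃ C, ∀ t, |r t| ≤ C * wt t := by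
  obtain ⟨C, hC⟩ := hr
  obtain ⟨D, hD⟩ := hl
  refine ⟨max C D, fun t => ?_⟩
  rcases le_total 0 t with ht | ht
  · exact (hC t ht).trans (mul_le_mul_of_nonneg_right (le_max_left _ _) (wt_pos t).le)
  · exact (hD t ht).trans (mul_le_mul_of_nonneg_right (le_max_right _ _) (wt_pos t).le)

lemma dec_deriv_phi (h : IsPhasePoint β Qm Qp p) : DecAll wt fun t => ((deriv p.1 t : ℝ) : ℂ) := by
  refine DecAll.ofReal (contDiff_infty_iff_deriv.1 h.smooth_phi).2 fun n => ?_
  have e : ∀ c : ℝ, iteratedDeriv (n + 1) (fun s => p.1 s - c) = iteratedDeriv n (deriv p.1) := by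
    intro c
    rw [iteratedDeriv_succ']
    congr 1
    funext t
    exact deriv_sub_const c
  refine exists_bound_halves ?_ ?_
  · obtain ⟨C₀, h0⟩ := h.decay_phi_right 0 (n + 1)
    obtain ⟨C₂, h2⟩ := h.decay_phi_right 2 (n + 1)
    rw [e] at h0 h2
    exact ⟨C₀ + C₂, fun t ht => le_wt_of_moments (h0 t ht) (h2 t ht)⟩
  · obtain ⟨C₀, h0⟩ := h.decay_phi_left 0 (n + 1)
    obtain ⟨C₂, h2⟩ := h.decay_phi_left 2 (n + 1)
    rw [e] at h0 h2
    exact ⟨C₀ + C₂, fun t ht => le_wt_of_moments (h0 t ht) (h2 t ht)⟩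

end IsPhasePoint

/-- `exp (i s φ)`. -/
def expI (s : ℝ) (p : Fields) (t : ℝ) : ℂ := Complex.exp (Complex.I * (s * p.1 t : ℝ))

lemma hasDerivAt_expI {p : Fields} (h : Differentiable ℝ p.1) (s t : ℝ) :
    HasDerivAt (expI s p) (Complex.I * s * (deriv p.1 t : ℝ) * expI s p t) t := by
  have h1 := ((((h t).hasDerivAt.const_mul s).ofReal_comp).const_mul Complex.I).cexp
  refine h1.congr_deriv ?_
  rw [expI]
  push_cast
  ring

lemma norm_expI (s : ℝ) (p : Fields) (t : ℝ) : ‖expI s p t‖ = 1 := norm_exp_I_mul _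

lemma expI_mul_expI_neg (s : ℝ) (p : Fields) (t : ℝ) : expI s p t * expI (-s) p t = 1 := by
  rw [expI, expI, ← Complex.exp_add, ← Complex.exp_zero]
  congr 1
  push_cast
  ring

namespace IsPhasePoint

variable {β : ℝ} {Qm Qp : ℤ} {p : Fields}

lemma deriv_expI (h : IsPhasePoint β Qm Qp p) (s : ℝ) :
    deriv (expI s p) = fun t => (Complex.I * s) * (((deriv p.1 t : ℝ) : ℂ) * expI s p t) := by
  funext t
  rw [(hasDerivAt_expI (h.smooth_phi.differentiable (by simp)) s t).deriv]
  ring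

lemma bdd_expI (h : IsPhasePoint β Qm Qp p) (s : ℝ) : DecAll wone (expI s p) := by
  have hd : Differentiable ℝ (expI s p) := fun t =>
    (hasDerivAt_expI (h.smooth_phi.differentiable (by simp)) s t).differentiableAt
  have hb : ∃ C, ∀ t, ‖expI s p t‖ ≤ C * wone t := ⟨1, fun t => by simp [norm_expI, wone]⟩
  intro N
  induction N with
  | zero => exact hb
  | succ N ih =>
    refine ⟨hd, hb, ?_⟩
    rw [h.deriv_expI]
    exact (DecN.const _).mul ((h.dec_deriv_phi.to_wone N).mul ih)

/-- At a vacuum `exp(±iβφ) = exp(±2πiQ) = 1` whatever the charge, so the same constant is subtracted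
at both ends even when the charges differ. -/
lemma dec_expI_sub_one (hβ : β ≠ 0) (h : IsPhasePoint β Qm Qp p) {s : ℝ}
    (hs : s = β ∨ s = -β) : DecAll wt fun t => expI s p t - 1 := by
  have hd : Differentiable ℝ (expI s p) := (h.bdd_expI s).differentiable
  refine DecAll.of_deriv (hd.sub_const 1) ?_ ?_
  · have key : ∀ (Q : ℤ) (t : ℝ), ‖expI s p t - 1‖ ≤ |s| * |p.1 t - 2 * Real.pi * Q / β| := by
      intro Q t
      have e1 : (1 : ℂ) = Complex.exp (Complex.I * (s * (2 * Real.pi * Q / β) : ℝ)) := by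
        symm
        rw [Complex.exp_eq_one_iff]
        rcases hs with rfl | rfl
        · refine ⟨Q, ?_⟩
          rw [mul_div_cancel₀ _ hβ]
          push_cast; ring
        · refine ⟨-Q, ?_⟩
          rw [neg_mul, mul_div_cancel₀ _ hβ]
          push_cast; ring
      rw [e1, expI]
      refine (norm_exp_I_sub_le _ _).trans ?_
      rw [← mul_sub, abs_mul]
    have hr : ∀ {r : ℝ → ℝ}, (∃ C, ∀ t, |r t| ≤ C * wt t) → (∀ t, ‖expI s p t - 1‖ ≤ r t) →
        ∃ C, ∀ t, ‖expI s p t - 1‖ ≤ C * wt t := by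
      rintro r ⟨C, hC⟩ hr
      exact ⟨C, fun t => ((hr t).trans (le_abs_self _)).trans (hC t)⟩
    refine hr (r := fun t => ‖expI s p t - 1‖) (exists_bound_halves ?_ ?_) fun t => le_rfl
    · obtain ⟨C₀, h0⟩ := h.decay_phi_right 0 0
      obtain ⟨C₂, h2⟩ := h.decay_phi_right 2 0
      simp only [iteratedDeriv_zero] at h0 h2
      refine ⟨|s| * (C₀ + C₂), fun t ht => ?_⟩
      rw [abs_norm, mul_assoc]
      exact (key Qp t).trans (mul_le_mul_of_nonneg_left (le_wt_of_moments (h0 t ht) (h2 t ht))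
        (abs_nonneg s))
    · obtain ⟨C₀, h0⟩ := h.decay_phi_left 0 0
      obtain ⟨C₂, h2⟩ := h.decay_phi_left 2 0
      simp only [iteratedDeriv_zero] at h0 h2
      refine ⟨|s| * (C₀ + C₂), fun t ht => ?_⟩
      rw [abs_norm, mul_assoc]
      exact (key Qm t).trans (mul_le_mul_of_nonneg_left (le_wt_of_moments (h0 t ht) (h2 t ht))
        (abs_nonneg s))
  · have : deriv (fun t => expI s p t - 1) = deriv (expI s p) := funext fun t => deriv_sub_const 1
    rw [this, h.deriv_expI]
    refine DecAll.const_mul _ ?_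
    have := (h.bdd_expI s).mul h.dec_deriv_phi
    simpa only [mul_comm] using this

end IsPhasePoint

end SineGordon
end


noncomputable section

open scoped Matrix.Norms.Operator

namespace SineGordon

/-! ### Scalar form of the Riccati recursion -/

/-- The lower left entry of `γ_n`. -/
def ricc (m β : ℝ) (p : Fields) (n : ℕ) (t : ℝ) : ℂ := riccati m β p n t 1 0

lemma riccati_zero (m β : ℝ) (p : Fields) (t : ℝ) : riccati m β p 0 t = Complex.I • σ₁ := by
  rw [riccati]

lemma riccati_succ (m β : ℝ) (p : Fields) (n : ℕ) (t : ℝ) : riccati m β p (n + 1) t =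
      (-(2 * Complex.I / m)) • ((Matrix.of fun i j => deriv (fun s => riccati m β p n s i j) t) * σ₃)
      - ((β / m * (deriv p.1 t - p.2 t) : ℝ) : ℂ) • riccati m β p n t
      + (if n = 1 then (Complex.I / 2) • (σ₁ * expPhi β p t) else 0)
      + (Complex.I / 2) •
        ((∑ q : Fin n, riccati m β p (q + 1) t * σ₁ * riccati m β p (n - q) t)
          + ∑ q : Fin n, riccati m β p q t * σ₁ * expPhi β p t * riccati m β p (n - 1 - q) t) := by
  conv_lhs => rw [riccati]

lemma riccati_apply_zero_zero (m β : ℝ) (p : Fields) (n : ℕ) (t : ℝ) :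
    riccati m β p n t 0 0 = 0 := by
  induction n using Nat.strong_induction_on generalizing t with
  | _ n ih =>
    cases n with
    | zero => simp [riccati_zero, σ₁]
    | succ n =>
      have hd : deriv (fun s => riccati m β p n s 0 0) t = 0 := by
        have : (fun s => riccati m β p n s 0 0) = fun _ => 0 := funext fun s => ih n (by omega) s
        rw [this, deriv_const]
      rw [riccati_succ]
      have h1 : ∀ q : Fin n, (riccati m β p (q + 1) t * σ₁ * riccati m β p (n - q) t) 0 0 = 0 := by
        intro q
        simp [Matrix.mul_apply, σ₁, ih (q + 1) (by omega) t, ih (n - q) (by omega) t]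
      have h2 : ∀ q : Fin n, (riccati m β p q t * σ₁ * expPhi β p t
          * riccati m β p (n - 1 - q) t) 0 0 = 0 := by
        intro q
        simp [Matrix.mul_apply, σ₁, expPhi, expσ₃, ih q (by omega) t, ih (n - 1 - q) (by omega) t]
      have h3 : (σ₁ * expPhi β p t) 0 0 = 0 := by simp [σ₁, expPhi, expσ₃]
      simp only [Matrix.add_apply, Matrix.sub_apply, Matrix.smul_apply, Matrix.sum_apply, h1, h2,
        Finset.sum_const_zero, ih n (by omega) t]
      split_ifs <;> simp [Matrix.mul_apply, σ₃, hd, h3]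

lemma expPhi_eq (β : ℝ) (p : Fields) (t : ℝ) :
    expPhi β p t = !![expI β p t, 0; 0, expI (-β) p t] := by
  simp [expPhi, expσ₃, expI]

lemma ricc_zero (m β : ℝ) (p : Fields) (t : ℝ) : ricc m β p 0 t = Complex.I := by
  simp [ricc, riccati_zero, σ₁]

/-- All `γ_n` are off-diagonal, so the matrix recursion closes on one entry. -/
lemma ricc_succ (m β : ℝ) (p : Fields) (n : ℕ) (t : ℝ) : ricc m β p (n + 1) t =
    -(2 * Complex.I / m) * deriv (ricc m β p n) t
      - ((β / m * (deriv p.1 t - p.2 t) : ℝ) : ℂ) * ricc m β p n t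
      + (if n = 1 then Complex.I / 2 * expI β p t else 0)
      + Complex.I / 2 * ((∑ q ∈ Finset.range n, ricc m β p (q + 1) t * ricc m β p (n - q) t)
          + expI (-β) p t * ∑ q ∈ Finset.range n, ricc m β p q t * ricc m β p (n - 1 - q) t) := by
  have h1 : ∀ q : Fin n, (riccati m β p (q + 1) t * σ₁ * riccati m β p (n - q) t) 1 0
      = ricc m β p (q + 1) t * ricc m β p (n - q) t := by
    intro q
    simp [Matrix.mul_apply, σ₁, riccati_apply_zero_zero, ricc]
  have h2 : ∀ q : Fin n, (riccati m β p q t * σ₁ * expPhi β p t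
      * riccati m β p (n - 1 - q) t) 1 0
      = expI (-β) p t * (ricc m β p q t * ricc m β p (n - 1 - q) t) := by
    intro q
    simp [Matrix.mul_apply, σ₁, expPhi_eq, riccati_apply_zero_zero, ricc]
    ring
  have h3 : (σ₁ * expPhi β p t) 1 0 = expI β p t := by simp [σ₁, expPhi_eq]
  rw [ricc, riccati_succ]
  simp only [Matrix.add_apply, Matrix.sub_apply, Matrix.smul_apply, Matrix.sum_apply, h1, h2]
  rw [Fin.sum_univ_eq_sum_range (fun q => ricc m β p (q + 1) t * ricc m β p (n - q) t),
    Fin.sum_univ_eq_sum_range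
      (fun q => expI (-β) p t * (ricc m β p q t * ricc m β p (n - 1 - q) t)), ← Finset.mul_sum]
  have h4 : deriv (fun s => riccati m β p n s 1 0) t = deriv (ricc m β p n) t := rfl
  split_ifs <;> simp [Matrix.mul_apply, σ₃, h3, h4, ricc]

lemma posDensity_succ (m β : ℝ) (n : ℕ) (p : Fields) (t : ℝ) : posDensity m β (n + 1) p t =
    Complex.I * m / 4 * (ricc m β p (n + 2) t + expI (-β) p t * ricc m β p n t
      - if n = 0 then Complex.I else 0) := by
  have e : (expPhi β p t * riccati m β p n t) 1 0 = expI (-β) p t * riccati m β p n t 1 0 := by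
    simp only [Matrix.mul_apply, expPhi_eq, Fin.sum_univ_two]
    simp
  rw [posDensity, Nat.add_sub_cancel]
  simp only [Matrix.mul_apply (M := σ₂), Fin.sum_univ_two, Matrix.sub_apply, Matrix.add_apply, e,
    ricc]
  by_cases h : n = 0
  · subst h
    simp [σ₂, σ₁]
    ring
  · simp [σ₂, h]
    ring

/-! ### Decay of the Riccati coefficients -/

namespace IsPhasePoint

variable {β : ℝ} {Qm Qp : ℤ} {p : Fields}

/-- The coefficients `γ_n`, `n ≥ 1`, and their derivatives decay. -/
lemma dec_ricc (hβ : β ≠ 0) (h : IsPhasePoint β Qm Qp p) (m : ℝ) (n : ℕ) :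
    DecAll wt (ricc m β p (n + 1)) := by
  induction n using Nat.strong_induction_on with
  | _ n ih =>
    have hw : DecAll wt fun t => ((β / m * (deriv p.1 t - p.2 t) : ℝ) : ℂ) := by
      have := (h.dec_deriv_phi.add (h.dec_Pi.const_mul (-1))).const_mul ((β / m : ℝ) : ℂ)
      refine (congrArg (DecAll wt) (funext fun t => ?_)).mp this
      push_cast; ring
    have hb : ∀ k, k ≤ n → DecAll wone (ricc m β p k) := by
      intro k hk
      cases k with
      | zero => exact (congrArg (DecAll wone) (funext fun t => ricc_zero m β p t)).mpr (DecAll.const _)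
      | succ k => exact (ih k (by omega)).to_wone
    have hd : DecAll wt (deriv (ricc m β p n)) := by
      cases n with
      | zero =>
        have : ricc m β p 0 = fun _ => Complex.I := funext fun t => ricc_zero m β p t
        rw [this]
        have : deriv (fun _ : ℝ => Complex.I) = fun _ => 0 := funext fun t => deriv_const t _
        rw [this]
        exact DecAll.zero
      | succ k => exact (ih k (by omega)).deriv
    have hs : DecAll wt fun t => ∑ q ∈ Finset.range n, ricc m β p (q + 1) t * ricc m β p (n - q) t := by
      refine DecAll.sum _ fun q hq => ?_
      have hq' := Finset.mem_range.1 hq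
      have : DecAll wt (ricc m β p (n - q)) := by
        obtain ⟨k, hk⟩ : ∃ k, n - q = k + 1 := ⟨n - q - 1, by omega⟩
        rw [hk]
        exact ih k (by omega)
      exact (hb (q + 1) (by omega)).mul this
    have hr : DecAll wt fun t => (if n = 1 then Complex.I / 2 * expI β p t else 0)
        + Complex.I / 2 * (expI (-β) p t
          * ∑ q ∈ Finset.range n, ricc m β p q t * ricc m β p (n - 1 - q) t) := by
      -- Only at this order do terms without a decaying factor appear. They combine to
      -- `(i/2)(exp(iβφ) - exp(-iβφ))`, because `γ₀` contributes `i² = -1`, and this decays.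
      by_cases hn : n = 1
      · subst hn
        have := ((h.dec_expI_sub_one hβ (Or.inl rfl)).add
          ((h.dec_expI_sub_one hβ (Or.inr rfl)).const_mul (-1))).const_mul (Complex.I / 2)
        refine (congrArg (DecAll wt) (funext fun t => ?_)).mp this
        simp only [Finset.sum_range_one, Nat.sub_self, ricc_zero, if_true]
        linear_combination (-Complex.I / 2 * expI (-β) p t) * Complex.I_mul_I
      · simp only [if_neg hn, zero_add]
        refine DecAll.const_mul _ ((h.bdd_expI (-β)).mul (DecAll.sum _ fun q hq => ?_))
        have hq' := Finset.mem_range.1 hq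
        by_cases hq0 : q = 0
        · obtain ⟨k, hk⟩ : ∃ k, n - 1 - q = k + 1 := ⟨n - 1 - q - 1, by omega⟩
          rw [hk]
          exact (hb q (by omega)).mul (ih k (by omega))
        · obtain ⟨k, hk⟩ : ∃ k, q = k + 1 := ⟨q - 1, by omega⟩
          rw [hk]
          simpa only [mul_comm] using (hb (n - 1 - (k + 1)) (by omega)).mul (ih k (by omega))
    have key := ((hd.const_mul (-(2 * Complex.I / m))).add
      (((hb n le_rfl).mul hw).const_mul (-1))).add ((hs.const_mul (Complex.I / 2)).add hr)
    refine (congrArg (DecAll wt) (funext fun t => ?_)).mp key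
    rw [ricc_succ]
    ring

/-- The subtraction for `n = 0` removes the limit `i` of `exp(-iβφ) γ₀`; in all other degrees a
decaying coefficient is present. -/
lemma dec_posDensity (hβ : β ≠ 0) (h : IsPhasePoint β Qm Qp p) (m : ℝ) (n : ℕ) :
    DecAll wt (posDensity m β (n + 1) p) := by
  have h2 : DecAll wt fun t => expI (-β) p t * ricc m β p n t - if n = 0 then Complex.I else 0 := by
    cases n with
    | zero =>
      have := (h.dec_expI_sub_one hβ (Or.inr rfl)).const_mul Complex.I
      refine (congrArg (DecAll wt) (funext fun t => ?_)).mp this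
      rw [ricc_zero, if_pos rfl]
      ring
    | succ n =>
      simpa using (h.bdd_expI (-β)).mul (h.dec_ricc hβ m n)
  have := ((h.dec_ricc hβ m (n + 1)).add h2).const_mul (Complex.I * m / 4)
  refine (congrArg (DecAll wt) (funext fun t => ?_)).mp this
  rw [posDensity_succ]
  ring

/-- The reflection `φ ↦ -φ` preserves the phase space up to the sign of the charges. -/
lemma neg_phi (h : IsPhasePoint β Qm Qp p) :
    IsPhasePoint β (-Qm) (-Qp) (fun s => -p.1 s, p.2) := by
  have e : ∀ (Q : ℤ) (n : ℕ) (t : ℝ),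
      |iteratedDeriv n (fun s => -p.1 s - 2 * Real.pi * ((-Q : ℤ) : ℝ) / β) t|
        = |iteratedDeriv n (fun s => p.1 s - 2 * Real.pi * Q / β) t| := by
    intro Q n t
    have : (fun s => -p.1 s - 2 * Real.pi * ((-Q : ℤ) : ℝ) / β)
        = fun s => -(p.1 s - 2 * Real.pi * Q / β) := by
      funext s; push_cast; ring
    rw [this, iteratedDeriv_fun_neg, abs_neg]
  refine ⟨h.smooth_phi.neg, h.smooth_Pi, fun k n => ?_, fun k n => ?_, h.decay_Pi⟩
  · obtain ⟨C, hC⟩ := h.decay_phi_right k n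
    exact ⟨C, fun t ht => by simpa only [e] using hC t ht⟩
  · obtain ⟨C, hC⟩ := h.decay_phi_left k n
    exact ⟨C, fun t ht => by simpa only [e] using hC t ht⟩

lemma integrable_chargeDensity (hβ : β ≠ 0) (h : IsPhasePoint β Qm Qp p) (m : ℝ) :
    ∀ n : ℤ, Integrable (chargeDensity m β n p)
  | Int.ofNat 0 => by
    have := (h.dec_deriv_phi.const_mul ((-(β / 2) : ℝ) : ℂ)).integrable
    refine this.congr (Eventually.of_forall fun t => ?_)
    simp [chargeDensity]
  | Int.ofNat (n + 1) => (h.dec_posDensity hβ m n).integrable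
  | Int.negSucc n => (h.neg_phi.dec_posDensity hβ m n).integrable

end IsPhasePoint

/-! ### Power series depending on a parameter -/

open PowerSeries in
/-- `F' ` is the coefficientwise derivative of `F` at `t`. -/
def HasPSDeriv (F : ℝ → PowerSeries ℂ) (F' : PowerSeries ℂ) (t : ℝ) : Prop :=
  ∀ n, HasDerivAt (fun s => coeff n (F s)) (coeff n F') t

namespace HasPSDeriv

open PowerSeries

variable {F G : ℝ → PowerSeries ℂ} {F' G' : PowerSeries ℂ} {t : ℝ}

lemma add (hF : HasPSDeriv F F' t) (hG : HasPSDeriv G G' t) :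
    HasPSDeriv (fun s => F s + G s) (F' + G') t := fun n => by
  simpa only [map_add] using (hF n).fun_add (hG n)

lemma sub (hF : HasPSDeriv F F' t) (hG : HasPSDeriv G G' t) :
    HasPSDeriv (fun s => F s - G s) (F' - G') t := fun n => by
  simpa only [map_sub] using (hF n).fun_sub (hG n)

lemma const (A : PowerSeries ℂ) : HasPSDeriv (fun _ => A) 0 t := fun n => by
  simpa only [map_zero] using hasDerivAt_const t (coeff n A)

lemma mul (hF : HasPSDeriv F F' t) (hG : HasPSDeriv G G' t) :
    HasPSDeriv (fun s => F s * G s) (F' * G t + F t * G') t := fun n => by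
  simp only [map_add, coeff_mul, ← Finset.sum_add_distrib]
  exact HasDerivAt.fun_sum fun x _ => (hF x.1).fun_mul (hG x.2)

lemma C {a : ℝ → ℂ} {a' : ℂ} (ha : HasDerivAt a a' t) :
    HasPSDeriv (fun s => PowerSeries.C (a s)) (PowerSeries.C a') t := fun n => by
  simp only [coeff_C]
  split_ifs
  · exact ha
  · exact hasDerivAt_const _ _

lemma unique {F'' : PowerSeries ℂ} (h : HasPSDeriv F F' t) (h' : HasPSDeriv F F'' t) : F' = F'' :=
  PowerSeries.ext fun n => (h n).unique (h' n)

end HasPSDeriv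

open PowerSeries in
/-- The coefficientwise derivative. -/
def psDeriv (F : ℝ → PowerSeries ℂ) (t : ℝ) : PowerSeries ℂ :=
  PowerSeries.mk fun n => deriv (fun s => coeff n (F s)) t

/-- The generating series `∑ γ_n λ⁻ⁿ` of the lower left entries. -/
def riccS (m β : ℝ) (p : Fields) (t : ℝ) : PowerSeries ℂ := PowerSeries.mk fun n => ricc m β p n t

/-- `-i (β/4) (φ_t - Π)`. -/
def wCoef (β : ℝ) (p : Fields) (t : ℝ) : ℂ :=
  -Complex.I * ((β / 4 * (deriv p.1 t - p.2 t) : ℝ) : ℂ)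

/-- Isolates the two terms containing `γ₀`; they supply the highest coefficient of the square, for
which the recursion is solved. -/
lemma sum_antidiagonal_split (a b : ℕ → ℂ) (n : ℕ) :
    ∑ x ∈ Finset.HasAntidiagonal.antidiagonal (n + 1), a x.1 * b x.2
      = a 0 * b (n + 1) + (∑ q ∈ Finset.range n, a (q + 1) * b (n - q)) + a (n + 1) * b 0 := by
  rw [Finset.Nat.sum_antidiagonal_eq_sum_range_succ (fun i j => a i * b j), Finset.sum_range_succ,
    Finset.sum_range_succ']
  have : ∀ q ∈ Finset.range n, a (q + 1) * b (n + 1 - (q + 1)) = a (q + 1) * b (n - q) := by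
    intro q _
    rw [Nat.add_sub_add_right]
  rw [Finset.sum_congr rfl this]
  simp
  ring

open PowerSeries in
/-- The Riccati equation for the generating series. -/
lemma riccS_riccati {m : ℝ} (hm : m ≠ 0) (β : ℝ) (p : Fields) (t : ℝ) :
    X * psDeriv (riccS m β p) t = C (-2 * wCoef β p t) * (X * riccS m β p t)
      + C ((m : ℂ) / 4) * (1 + riccS m β p t ^ 2
        + X ^ 2 * (C (expI β p t) + C (expI (-β) p t) * riccS m β p t ^ 2)) := by
  have hm' : (m : ℂ) ≠ 0 := by exact_mod_cast hm
  have hsq : ∀ n, coeff n (riccS m β p t ^ 2)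
      = ∑ x ∈ Finset.HasAntidiagonal.antidiagonal n, ricc m β p x.1 t * ricc m β p x.2 t := by
    intro n
    rw [sq, coeff_mul]
    simp [riccS]
  ext n
  cases n with
  | zero =>
    simp [riccS, ricc_zero]
  | succ n =>
    have hX2 : coeff (n + 1) (X ^ 2 * (C (expI β p t) + C (expI (-β) p t) * riccS m β p t ^ 2))
        = (if n = 1 then expI β p t else 0)
          + expI (-β) p t * ∑ q ∈ Finset.range n, ricc m β p q t * ricc m β p (n - 1 - q) t := by
      cases n with
      | zero => simp [sq, mul_assoc, coeff_succ_X_mul]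
      | succ k =>
        rw [sq, mul_assoc, coeff_succ_X_mul, coeff_succ_X_mul, map_add, coeff_C_mul, hsq,
          Finset.Nat.sum_antidiagonal_eq_sum_range_succ (fun i j => ricc m β p i t * ricc m β p j t),
          coeff_C]
        simp
    rw [coeff_succ_X_mul, map_add, coeff_C_mul, coeff_succ_X_mul, coeff_C_mul, map_add, map_add,
      hX2, hsq, sum_antidiagonal_split (fun k => ricc m β p k t) (fun k => ricc m β p k t)]
    have h := ricc_succ m β p n t
    have e1 : coeff n (psDeriv (riccS m β p) t) = deriv (ricc m β p n) t := by
      simp [psDeriv, riccS]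
    have e2 : coeff n (riccS m β p t) = ricc m β p n t := by simp [riccS]
    have e3 : coeff (n + 1) (1 : PowerSeries ℂ) = 0 := by simp [coeff_one]
    rw [e1, e2, e3, ricc_zero, wCoef]
    set Sa := ∑ q ∈ Finset.range n, ricc m β p (q + 1) t * ricc m β p (n - q) t
    set Sb := ∑ q ∈ Finset.range n, ricc m β p q t * ricc m β p (n - 1 - q) t
    have hI := Complex.I_mul_I
    push_cast at h ⊢
    -- The recursion cleared of denominators; multiplied by `-i/2` it becomes the coefficient
    -- identity, up to replacing `i²` by `-1`.
    have h' : ricc m β p (n + 1) t * m = -(2 * Complex.I) * deriv (ricc m β p n) t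
        - β * ((deriv p.1 t : ℝ) - p.2 t) * ricc m β p n t
        + Complex.I / 2 * m * ((if n = 1 then expI β p t else 0) + Sa + expI (-β) p t * Sb) := by
      rw [h]
      split_ifs <;> field_simp <;> ring
    linear_combination (-Complex.I / 2) * h'
      + (deriv (ricc m β p n) t - (m : ℂ) / 4 * ((if n = 1 then expI β p t else 0) + Sa
        + expI (-β) p t * Sb)) * hI

end SineGordon
end


noncomputable section

open scoped Matrix.Norms.Operator

namespace SineGordon

open PowerSeries

/-! ### Power series with decaying coefficients -/

/-- The constant coefficient is constant, and the others decay with all derivatives. -/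
def PSDec (F : ℝ → PowerSeries ℂ) : Prop :=
  (∃ c, ∀ t, coeff 0 (F t) = c) ∧ ∀ n, DecAll wt fun t => coeff (n + 1) (F t)

namespace PSDec

variable {F G : ℝ → PowerSeries ℂ}

lemma bdd (hF : PSDec F) (n : ℕ) : DecAll wone fun t => coeff n (F t) := by
  cases n with
  | zero =>
    obtain ⟨c, hc⟩ := hF.1
    simpa only [hc] using DecAll.const c
  | succ n => exact (hF.2 n).to_wone

lemma add (hF : PSDec F) (hG : PSDec G) : PSDec fun t => F t + G t := by
  obtain ⟨c, hc⟩ := hF.1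
  obtain ⟨d, hd⟩ := hG.1
  refine ⟨⟨c + d, fun t => by rw [map_add, hc, hd]⟩, fun n => ?_⟩
  simpa only [map_add] using (hF.2 n).add (hG.2 n)

lemma const_mul (c : ℂ) (hF : PSDec F) : PSDec fun t => C c * F t := by
  obtain ⟨d, hd⟩ := hF.1
  refine ⟨⟨c * d, fun t => by rw [coeff_C_mul, hd]⟩, fun n => ?_⟩
  simpa only [coeff_C_mul] using (hF.2 n).const_mul c

lemma neg (hF : PSDec F) : PSDec fun t => -F t := by
  refine (congrArg PSDec (funext fun t => ?_)).mp (hF.const_mul (-1))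
  simp

lemma sub (hF : PSDec F) (hG : PSDec G) : PSDec fun t => F t - G t := by
  simpa only [sub_eq_add_neg] using hF.add hG.neg

lemma mul (hF : PSDec F) (hG : PSDec G) : PSDec fun t => F t * G t := by
  obtain ⟨c, hc⟩ := hF.1
  obtain ⟨d, hd⟩ := hG.1
  refine ⟨⟨c * d, fun t => ?_⟩, fun n => ?_⟩
  · rw [coeff_mul, Finset.Nat.antidiagonal_zero, Finset.sum_singleton, hc, hd]
  · simp only [coeff_mul]
    refine DecAll.sum _ fun x hx => ?_
    have hx := Finset.HasAntidiagonal.mem_antidiagonal.1 hx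
    obtain ⟨i, j⟩ := x
    cases j with
    | succ j => exact (hF.bdd i).mul (hG.2 j)
    | zero =>
      have hi : i = n + 1 := hx
      subst hi
      simpa only [mul_comm] using (hG.bdd 0).mul (hF.2 n)

lemma rescale (hF : PSDec F) (a : ℂ) : PSDec fun t => PowerSeries.rescale a (F t) := by
  obtain ⟨c, hc⟩ := hF.1
  refine ⟨⟨c, fun t => by rw [coeff_rescale, hc, pow_zero, one_mul]⟩, fun n => ?_⟩
  simpa only [coeff_rescale] using (hF.2 n).const_mul (a ^ (n + 1))

/-- The coefficients of the inverse are given by a triangular recursion in which every term with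
positive total degree has a decaying factor. -/
lemma inv (hF : PSDec F) : PSDec fun t => (F t)⁻¹ := by
  obtain ⟨c, hc⟩ := hF.1
  have hcc : ∀ t, constantCoeff (F t) = c := fun t => by rw [← coeff_zero_eq_constantCoeff_apply, hc]
  have h0 : ∀ t, coeff 0 (F t)⁻¹ = c⁻¹ := fun t => by rw [coeff_inv, if_pos rfl, hcc]
  refine ⟨⟨c⁻¹, h0⟩, fun n => ?_⟩
  induction n using Nat.strong_induction_on with
  | _ n ih =>
    simp only [coeff_inv (n + 1), if_neg (Nat.succ_ne_zero n), hcc]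
    refine DecAll.const_mul _ (DecAll.sum _ fun x hx => ?_)
    have hx := Finset.HasAntidiagonal.mem_antidiagonal.1 hx
    obtain ⟨i, j⟩ := x
    simp only at hx
    by_cases hj : j < n + 1
    · simp only [if_pos hj]
      cases j with
      | succ j => exact (hF.bdd i).mul (ih j (by omega))
      | zero =>
        have hi : i = n + 1 := hx
        subst hi
        simp only [h0]
        simpa only [mul_comm] using (DecAll.const c⁻¹).mul (hF.2 n)
    · simp only [if_neg hj]
      exact DecAll.zero

lemma hasPSDeriv (hF : PSDec F) (t : ℝ) : HasPSDeriv F (psDeriv F t) t := fun n => by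
  rw [psDeriv, coeff_mk]
  exact ((hF.bdd n).differentiable t).hasDerivAt

end PSDec

/-! ### The squared eigenfunctions -/

variable (m β : ℝ) (p : Fields)

/-- The second formal solution `-Γ(-λ)` of the Riccati equation. -/
def riccSneg (t : ℝ) : PowerSeries ℂ := -rescale (-1) (riccS m β p t)

/-- `1 / (f₋ - f)` for the two formal solutions `f`, `f₋` of the Riccati equation. -/
def sqH (t : ℝ) : PowerSeries ℂ := (riccSneg m β p t - riccS m β p t)⁻¹

/-- `f f₋ / (f₋ - f)`. -/
def sqK (t : ℝ) : PowerSeries ℂ := sqH m β p t * riccS m β p t * riccSneg m β p t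

/-- `(f + f₋) / (f₋ - f)`. -/
def sqS (t : ℝ) : PowerSeries ℂ := sqH m β p t * (riccS m β p t + riccSneg m β p t)

variable {m β p}

lemma sqH_mul (t : ℝ) : sqH m β p t * (riccSneg m β p t - riccS m β p t) = 1 := by
  rw [sqH, PowerSeries.inv_mul_cancel]
  -- The two formal solutions start with `i` and `-i`, so their difference has the nonzero constant
  -- term `-2i` and is invertible.
  have : constantCoeff (riccS m β p t) = Complex.I := by
    rw [← coeff_zero_eq_constantCoeff_apply, riccS, coeff_mk, ricc_zero]
  have h2 : constantCoeff (rescale (-1) (riccS m β p t)) = Complex.I := by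
    rw [← coeff_zero_eq_constantCoeff_apply, coeff_rescale, coeff_zero_eq_constantCoeff_apply, this]
    simp
  rw [riccSneg, map_sub, map_neg, this, h2]
  intro h
  have : (-2 : ℂ) * Complex.I = 0 := by linear_combination h
  simp at this

lemma sqS_eq (t : ℝ) : sqS m β p t = 1 + 2 * (sqH m β p t * riccS m β p t) := by
  rw [sqS]
  linear_combination sqH_mul (m := m) (β := β) (p := p) t

lemma sqK_eq (t : ℝ) :
    sqK m β p t = riccS m β p t + sqH m β p t * riccS m β p t ^ 2 := by
  rw [sqK]
  linear_combination riccS m β p t * sqH_mul (m := m) (β := β) (p := p) t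

lemma psDeriv_riccSneg (t : ℝ) :
    psDeriv (riccSneg m β p) t = -rescale (-1) (psDeriv (riccS m β p) t) := by
  ext n
  simp only [psDeriv, riccSneg, coeff_mk, map_neg, coeff_rescale]
  rw [deriv.fun_neg, deriv_const_mul_field]

/-- Changing the sign of `λ` reverses the terms odd in `X`, and the overall sign of the solution
compensates. -/
lemma riccSneg_riccati (hm : m ≠ 0) (t : ℝ) :
    X * psDeriv (riccSneg m β p) t = C (-2 * wCoef β p t) * (X * riccSneg m β p t)
      + C ((m : ℂ) / 4) * (1 + riccSneg m β p t ^ 2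
        + X ^ 2 * (C (expI β p t) + C (expI (-β) p t) * riccSneg m β p t ^ 2)) := by
  have hC : ∀ a : ℂ, rescale (-1 : ℂ) (C a) = C a := by
    intro a
    ext n
    rw [coeff_rescale, coeff_C]
    split_ifs with h
    · simp [h]
    · simp
  have h := congrArg (rescale (-1 : ℂ)) (riccS_riccati hm β p t)
  simp only [map_mul, map_add, map_pow, map_one, rescale_neg_one_X, hC] at h
  rw [psDeriv_riccSneg, riccSneg, map_mul C]
  linear_combination h

namespace IsPhasePoint

variable {Qm Qp : ℤ}

lemma psDec_riccS (hβ : β ≠ 0) (h : IsPhasePoint β Qm Qp p) : PSDec (riccS m β p) := by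
  refine ⟨⟨Complex.I, fun t => by rw [riccS, coeff_mk, ricc_zero]⟩, fun n => ?_⟩
  simpa only [riccS, coeff_mk] using h.dec_ricc hβ m n

lemma psDec_riccSneg (hβ : β ≠ 0) (h : IsPhasePoint β Qm Qp p) : PSDec (riccSneg m β p) :=
  ((h.psDec_riccS hβ).rescale (-1)).neg

lemma psDec_sqH (hβ : β ≠ 0) (h : IsPhasePoint β Qm Qp p) : PSDec (sqH m β p) :=
  ((h.psDec_riccSneg hβ).sub (h.psDec_riccS hβ)).inv

lemma psDec_sqK (hβ : β ≠ 0) (h : IsPhasePoint β Qm Qp p) : PSDec (sqK m β p) :=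
  ((h.psDec_sqH hβ).mul (h.psDec_riccS hβ)).mul (h.psDec_riccSneg hβ)

lemma psDec_sqS (hβ : β ≠ 0) (h : IsPhasePoint β Qm Qp p) : PSDec (sqS m β p) :=
  (h.psDec_sqH hβ).mul ((h.psDec_riccS hβ).add (h.psDec_riccSneg hβ))

/-- Differentiate `h (f₋ - f) = 1`. The difference of the two Riccati equations is divisible by `f₋
- f`, and the quotient involves only `f + f₋`. -/
lemma psDeriv_sqH (hm : m ≠ 0) (hβ : β ≠ 0) (h : IsPhasePoint β Qm Qp p) (t : ℝ) :
    X * psDeriv (sqH m β p) t = C (2 * wCoef β p t) * (X * sqH m β p t)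
      - C ((m : ℂ) / 4) * ((1 + X ^ 2 * C (expI (-β) p t)) * sqS m β p t) := by
  have h1 := ((h.psDec_sqH (m := m) hβ).hasPSDeriv t).mul
    (((h.psDec_riccSneg (m := m) hβ).hasPSDeriv t).sub ((h.psDec_riccS (m := m) hβ).hasPSDeriv t))
  have h2 : HasPSDeriv (fun s => sqH m β p s * (riccSneg m β p s - riccS m β p s)) 0 t := by
    simp only [sqH_mul]
    exact HasPSDeriv.const 1
  have e := h1.unique h2
  have r1 := riccS_riccati hm β p t
  have r2 := riccSneg_riccati (β := β) (p := p) hm t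
  have hh := sqH_mul (m := m) (β := β) (p := p) t
  rw [sqS]
  simp only [map_mul, map_neg, map_ofNat] at r1 r2 ⊢
  set d := psDeriv (sqH m β p) t
  set H := sqH m β p t
  set f := riccS m β p t
  set g := riccSneg m β p t
  linear_combination X * H * e - X * d * hh - H ^ 2 * (r2 - r1)
    - (C ((m : ℂ) / 4) * (1 + X ^ 2 * C (expI (-β) p t)) * H * (f + g)
      - 2 * C (wCoef β p t) * X * H) * hh

lemma psDeriv_sqS (hm : m ≠ 0) (hβ : β ≠ 0) (h : IsPhasePoint β Qm Qp p) (t : ℝ) :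
    X * psDeriv (sqS m β p) t = C ((m : ℂ) / 2) * ((1 + X ^ 2 * C (expI β p t)) * sqH m β p t
      - (1 + X ^ 2 * C (expI (-β) p t)) * sqK m β p t) := by
  have h1 := ((h.psDec_sqH (m := m) hβ).hasPSDeriv t).mul
    (((h.psDec_riccS (m := m) hβ).hasPSDeriv t).add ((h.psDec_riccSneg (m := m) hβ).hasPSDeriv t))
  have e := h1.unique ((h.psDec_sqS (m := m) hβ).hasPSDeriv t)
  have r1 := riccS_riccati hm β p t
  have r2 := riccSneg_riccati (β := β) (p := p) hm t
  have r3 := h.psDeriv_sqH hm hβ t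
  have hm2 : C ((m : ℂ) / 2) = 2 * C ((m : ℂ) / 4) := by
    rw [← map_ofNat C 2, ← map_mul]; congr 1; ring
  rw [← e, sqK, hm2]
  rw [sqS] at r3
  simp only [map_mul, map_neg, map_ofNat] at r1 r2 r3 ⊢
  linear_combination (riccS m β p t + riccSneg m β p t) * r3 + sqH m β p t * (r1 + r2)

lemma psDeriv_sqK (hm : m ≠ 0) (hβ : β ≠ 0) (h : IsPhasePoint β Qm Qp p) (t : ℝ) :
    X * psDeriv (sqK m β p) t = C (-2 * wCoef β p t) * (X * sqK m β p t)
      + C ((m : ℂ) / 4) * ((1 + X ^ 2 * C (expI β p t)) * sqS m β p t) := by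
  have h1 := (((h.psDec_sqH (m := m) hβ).hasPSDeriv t).mul
    ((h.psDec_riccS (m := m) hβ).hasPSDeriv t)).mul ((h.psDec_riccSneg (m := m) hβ).hasPSDeriv t)
  have e := h1.unique ((h.psDec_sqK (m := m) hβ).hasPSDeriv t)
  have r1 := riccS_riccati hm β p t
  have r2 := riccSneg_riccati (β := β) (p := p) hm t
  have r3 := h.psDeriv_sqH hm hβ t
  rw [← e, sqK, sqS]
  rw [sqS] at r3
  simp only [map_mul, map_neg, map_ofNat] at r1 r2 r3 ⊢
  linear_combination riccS m β p t * riccSneg m β p t * r3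
    + sqH m β p t * riccSneg m β p t * r1 + sqH m β p t * riccS m β p t * r2

end IsPhasePoint

/-! ### The recursion for the squared eigenfunctions -/

/-- Sequences `h_n`, `K_n`, `S_n`, `n ∈ ℤ`, of functions with constant limits that solve
`h_n' = 2 w h_n - (m/4) (S_{n+1} + E₋ S_{n-1})`, `K_n' = -2 w K_n + (m/4) (S_{n+1} + E₊ S_{n-1})`,
`S_n' = (m/2) (h_{n+1} - K_{n+1} + E₊ h_{n-1} - E₋ K_{n-1})`. -/
structure SquaredSystem (m β : ℝ) (p : Fields) (h K S : ℤ → ℝ → ℂ) : Prop where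
  deriv_h : ∀ n t, HasDerivAt (h n)
    (2 * wCoef β p t * h n t - m / 4 * (S (n + 1) t + expI (-β) p t * S (n - 1) t)) t
  deriv_K : ∀ n t, HasDerivAt (K n)
    (-2 * wCoef β p t * K n t + m / 4 * (S (n + 1) t + expI β p t * S (n - 1) t)) t
  deriv_S : ∀ n t, HasDerivAt (S n)
    (m / 2 * (h (n + 1) t - K (n + 1) t + (expI β p t * h (n - 1) t
      - expI (-β) p t * K (n - 1) t))) t
  dec_h : ∀ n, ∃ c, DecAll wt fun t => h n t - c
  dec_K : ∀ n, ∃ c, DecAll wt fun t => K n t - c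
  dec_S : ∀ n, DecAll wt (S n)

/-- `h_{n+1} - K_{n+1} - (E₊ h_{n-1} - E₋ K_{n-1})`. -/
def gradPhi (β : ℝ) (p : Fields) (h K : ℤ → ℝ → ℂ) (n : ℤ) (t : ℝ) : ℂ :=
  h (n + 1) t - K (n + 1) t - (expI β p t * h (n - 1) t - expI (-β) p t * K (n - 1) t)

lemma DecAll.bdd_of_sub {g : ℝ → ℂ} {c : ℂ} (h : DecAll wt fun t => g t - c) : DecAll wone g := by
  refine (congrArg (DecAll wone) (funext fun t => ?_)).mp (h.to_wone.add (DecAll.const c))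
  ring

lemma DecAll.tendsto_of_sub {g : ℝ → ℂ} {c : ℂ} (h : DecAll wt fun t => g t - c) :
    Tendsto g atTop (𝓝 c) ∧ Tendsto g atBot (𝓝 c) :=
  ⟨tendsto_sub_nhds_zero_iff.1 h.tendsto.1, tendsto_sub_nhds_zero_iff.1 h.tendsto.2⟩

namespace SquaredSystem

variable {Qm Qp : ℤ} {h K S h' K' S' : ℤ → ℝ → ℂ}

lemma bdd_gradPhi (hp : IsPhasePoint β Qm Qp p) (L : SquaredSystem m β p h K S) (n : ℤ) :
    DecAll wone (gradPhi β p h K n) := by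
  obtain ⟨_, h1⟩ := L.dec_h (n + 1)
  obtain ⟨_, h2⟩ := L.dec_K (n + 1)
  obtain ⟨_, h3⟩ := L.dec_h (n - 1)
  obtain ⟨_, h4⟩ := L.dec_K (n - 1)
  have := (h1.bdd_of_sub.add (h2.bdd_of_sub.const_mul (-1))).add
    ((((hp.bdd_expI β).mul h3.bdd_of_sub).add
      (((hp.bdd_expI (-β)).mul h4.bdd_of_sub).const_mul (-1))).const_mul (-1))
  refine (congrArg (DecAll wone) (funext fun t => ?_)).mp this
  rw [gradPhi]
  ring

lemma dec_pairing (hp : IsPhasePoint β Qm Qp p) (L : SquaredSystem m β p h K S)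
    (L' : SquaredSystem m β p h' K' S') (n k : ℤ) :
    DecAll wt fun t => gradPhi β p h K n t * S' k t - S n t * gradPhi β p h' K' k t := by
  have := ((L.bdd_gradPhi hp n).mul (L'.dec_S k)).add
    (((L'.bdd_gradPhi hp k).mul (L.dec_S n)).const_mul (-1))
  refine (congrArg (DecAll wt) (funext fun t => ?_)).mp this
  ring

/-- Shifting the grading between the two factors of the bracket density changes it by a total
derivative. -/
lemma integral_pairing_shift (hm : m ≠ 0) (hp : IsPhasePoint β Qm Qp p)
    (L : SquaredSystem m β p h K S) (L' : SquaredSystem m β p h' K' S') (n k : ℤ) :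
    ∫ t, (gradPhi β p h K (n + 2) t * S' k t - S (n + 2) t * gradPhi β p h' K' k t)
      = ∫ t, (gradPhi β p h K n t * S' (k + 2) t - S n t * gradPhi β p h' K' (k + 2) t) := by
  have hm' : (m : ℂ) ≠ 0 := by exact_mod_cast hm
  have i1 := (L.dec_pairing hp L' (n + 2) k).integrable
  have i2 := (L.dec_pairing hp L' n (k + 2)).integrable
  rw [← sub_eq_zero, ← integral_sub i1 i2]
  obtain ⟨a, ha⟩ := L.dec_h (n + 1)
  obtain ⟨b, hb⟩ := L.dec_K (n + 1)
  obtain ⟨c, hc⟩ := L'.dec_h (k + 1)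
  obtain ⟨d, hd⟩ := L'.dec_K (k + 1)
  have s1 := L.dec_S (n + 2)
  have s2 := L'.dec_S k
  have s3 := L.dec_S n
  have s4 := L'.dec_S (k + 2)
  -- The candidate is symmetric between the two systems. Its derivative cancels all terms with `w`,
  -- and those with `h`, `K` in the inner degrees combine with the products of `S` into the two
  -- pairings.
  have hder : ∀ t, HasDerivAt (fun t => 2 / (m : ℂ) * (S (n + 2) t * S' k t + S n t * S' (k + 2) t
      - 4 * (h (n + 1) t * K' (k + 1) t + K (n + 1) t * h' (k + 1) t)))
      ((gradPhi β p h K (n + 2) t * S' k t - S (n + 2) t * gradPhi β p h' K' k t)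
        - (gradPhi β p h K n t * S' (k + 2) t - S n t * gradPhi β p h' K' (k + 2) t)) t := by
    intro t
    have := (((((L.deriv_S (n + 2) t).fun_mul (L'.deriv_S k t)).fun_add
      ((L.deriv_S n t).fun_mul (L'.deriv_S (k + 2) t))).fun_sub
      ((((L.deriv_h (n + 1) t).fun_mul (L'.deriv_K (k + 1) t)).fun_add
      ((L.deriv_K (n + 1) t).fun_mul (L'.deriv_h (k + 1) t))).const_mul 4)).const_mul (2 / (m : ℂ)))
    refine this.congr_deriv ?_
    have e1 : ∀ j : ℤ, j + 2 - 1 = j + 1 := fun j => by ring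
    have e2 : ∀ j : ℤ, j + 1 + 1 = j + 2 := fun j => by ring
    have e3 : ∀ j : ℤ, j + 1 - 1 = j := fun j => by ring
    have e4 : ∀ j : ℤ, j + 2 + 1 = j + 3 := fun j => by ring
    simp only [gradPhi, e1, e2, e3, e4]
    field_simp
    ring
  -- Each `h_j` and `K_j` has the same limit at both ends and each `S_j` tends to zero, so the
  -- boundary values are equal although not zero.
  have htop := ((((s1.tendsto.1.mul s2.tendsto.1).add (s3.tendsto.1.mul s4.tendsto.1)).sub
    (((ha.tendsto_of_sub.1.mul hd.tendsto_of_sub.1).add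
      (hb.tendsto_of_sub.1.mul hc.tendsto_of_sub.1)).const_mul 4)).const_mul (2 / (m : ℂ)))
  have hbot := ((((s1.tendsto.2.mul s2.tendsto.2).add (s3.tendsto.2.mul s4.tendsto.2)).sub
    (((ha.tendsto_of_sub.2.mul hd.tendsto_of_sub.2).add
      (hb.tendsto_of_sub.2.mul hc.tendsto_of_sub.2)).const_mul 4)).const_mul (2 / (m : ℂ)))
  rw [integral_of_hasDerivAt_of_tendsto hder (i1.sub i2) hbot htop, sub_self]

lemma integral_pairing_shift_iterate (hm : m ≠ 0) (hp : IsPhasePoint β Qm Qp p)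
    (L : SquaredSystem m β p h K S) (L' : SquaredSystem m β p h' K' S') (j : ℕ) (n k : ℤ) :
    ∫ t, (gradPhi β p h K (n + 2 * j) t * S' k t - S (n + 2 * j) t * gradPhi β p h' K' k t)
      = ∫ t, (gradPhi β p h K n t * S' (k + 2 * j) t
        - S n t * gradPhi β p h' K' (k + 2 * j) t) := by
  induction j generalizing k with
  | zero => simp
  | succ j ih =>
    have e : ∀ i : ℤ, i + 2 * ((j + 1 : ℕ) : ℤ) = i + 2 * j + 2 := fun i => by push_cast; ring
    have hk : k + 2 * (j : ℤ) + 2 = k + 2 + 2 * j := by ring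
    rw [e, L.integral_pairing_shift hm hp L', ih (k + 2), e, hk]

/-- The pairing vanishes if one of the systems is bounded below or above in the grading. -/
lemma integral_pairing_eq_zero (hm : m ≠ 0) (hp : IsPhasePoint β Qm Qp p)
    (L : SquaredSystem m β p h K S) (L' : SquaredSystem m β p h' K' S')
    (hz : (∀ n ≤ 0, ∀ t, S n t = 0 ∧ gradPhi β p h K n t = 0) ∨
      ∀ n, 0 ≤ n → ∀ t, S n t = 0 ∧ gradPhi β p h K n t = 0) (n k : ℤ) :
    ∫ t, (gradPhi β p h K n t * S' k t - S n t * gradPhi β p h' K' k t) = 0 := by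
  have hc : ∀ n : ℤ, (∀ t, S n t = 0 ∧ gradPhi β p h K n t = 0) → ∀ k : ℤ,
      ∫ t, (gradPhi β p h K n t * S' k t - S n t * gradPhi β p h' K' k t) = 0 := by
    intro n hn k
    simp [fun t => (hn t).1, fun t => (hn t).2]
  rcases hz with hz | hz
  -- For `n ≥ 0`, lowering the degree by two `n` times reaches `-n ≤ 0`, where this system vanishes;
  -- for `n < 0` it already does.
  · have := L.integral_pairing_shift_iterate hm hp L' n.toNat (n - 2 * (n.toNat : ℤ)) k
    rw [sub_add_cancel] at this
    rw [this]
    exact hc _ (hz _ (by omega)) _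
  · have := L.integral_pairing_shift_iterate hm hp L' (-n).toNat n (k - 2 * ((-n).toNat : ℤ))
    rw [sub_add_cancel] at this
    rw [← this]
    exact hc _ (hz _ (by omega)) _

end SquaredSystem

/-! ### The two squared eigenfunction systems -/

/-- The coefficients of a power series, extended by zero to negative indices. -/
def zcoeff (n : ℤ) (F : PowerSeries ℂ) : ℂ := if n < 0 then 0 else coeff n.toNat F

lemma zcoeff_of_neg {n : ℤ} (hn : n < 0) (F : PowerSeries ℂ) : zcoeff n F = 0 := if_pos hn

lemma zcoeff_natCast (n : ℕ) (F : PowerSeries ℂ) : zcoeff n F = coeff n F := by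
  simp [zcoeff]

lemma zcoeff_add (n : ℤ) (F G : PowerSeries ℂ) : zcoeff n (F + G) = zcoeff n F + zcoeff n G := by
  unfold zcoeff; split_ifs <;> simp

lemma zcoeff_sub (n : ℤ) (F G : PowerSeries ℂ) : zcoeff n (F - G) = zcoeff n F - zcoeff n G := by
  unfold zcoeff; split_ifs <;> simp

lemma zcoeff_C_mul (n : ℤ) (c : ℂ) (F : PowerSeries ℂ) : zcoeff n (C c * F) = c * zcoeff n F := by
  unfold zcoeff; split_ifs <;> simp

lemma zcoeff_X_mul (n : ℤ) (F : PowerSeries ℂ) : zcoeff n (X * F) = zcoeff (n - 1) F := by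
  rcases lt_trichotomy n 0 with hn | rfl | hn
  · rw [zcoeff_of_neg hn, zcoeff_of_neg (by omega)]
  · rw [zcoeff_of_neg (by omega : (0 : ℤ) - 1 < 0)]
    simp [zcoeff]
  · obtain ⟨k, rfl⟩ : ∃ k : ℕ, n = ((k + 1 : ℕ) : ℤ) := ⟨(n - 1).toNat, by omega⟩
    rw [zcoeff_natCast, coeff_succ_X_mul, show ((k + 1 : ℕ) : ℤ) - 1 = (k : ℕ) by omega,
      zcoeff_natCast]

lemma zcoeff_one_add_mul (n : ℤ) (c : ℂ) (F : PowerSeries ℂ) :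
    zcoeff (n + 1) ((1 + X ^ 2 * C c) * F) = zcoeff (n + 1) F + c * zcoeff (n - 1) F := by
  have : (1 + X ^ 2 * C c) * F = F + C c * (X * (X * F)) := by ring
  rw [this, zcoeff_add, zcoeff_C_mul, zcoeff_X_mul, zcoeff_X_mul]
  congr 3
  ring

lemma PSDec.hasDerivAt_zcoeff {F : ℝ → PowerSeries ℂ} (hF : PSDec F) (n : ℤ) (t : ℝ) :
    HasDerivAt (fun s => zcoeff n (F s)) (zcoeff (n + 1) (X * psDeriv F t)) t := by
  rw [zcoeff_X_mul, add_sub_cancel_right]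
  unfold zcoeff
  split_ifs
  · exact hasDerivAt_const _ _
  · exact hF.hasPSDeriv t _

lemma PSDec.dec_zcoeff {F : ℝ → PowerSeries ℂ} (hF : PSDec F) (n : ℤ) :
    ∃ c, DecAll wt fun t => zcoeff n (F t) - c := by
  rcases lt_trichotomy n 0 with hn | rfl | hn
  · exact ⟨0, by simpa [zcoeff_of_neg hn] using DecAll.zero⟩
  · obtain ⟨c, hc⟩ := hF.1
    refine ⟨c, ?_⟩
    have : ∀ t, zcoeff 0 (F t) = c := fun t => (zcoeff_natCast 0 (F t)).trans (hc t)
    simpa [this] using DecAll.zero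
  · obtain ⟨k, rfl⟩ : ∃ k : ℕ, n = ((k + 1 : ℕ) : ℤ) := ⟨(n - 1).toNat, by omega⟩
    refine ⟨0, ?_⟩
    simpa only [zcoeff_natCast, sub_zero] using hF.2 k

namespace IsPhasePoint

variable {Qm Qp : ℤ}

/-- In degree zero the equation for `h` contains nothing but `S₀`, because the other terms carry a
factor `X`. -/
lemma zcoeff_sqS_of_nonpos (hm : m ≠ 0) (hβ : β ≠ 0) (hp : IsPhasePoint β Qm Qp p) {n : ℤ}
    (hn : n ≤ 0) (t : ℝ) : zcoeff n (sqS m β p t) = 0 := by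
  rcases hn.lt_or_eq with hn | rfl
  · exact zcoeff_of_neg hn _
  · have hm' : (m : ℂ) ≠ 0 := by exact_mod_cast hm
    have h := congrArg (zcoeff (-1 + 1)) (hp.psDeriv_sqH hm hβ t)
    have hz : ∀ F, zcoeff (-1 + 1 - 1) F = 0 := fun F => zcoeff_of_neg (by norm_num) F
    have hz' : ∀ F, zcoeff (-1 - 1) F = 0 := fun F => zcoeff_of_neg (by norm_num) F
    rw [zcoeff_sub, zcoeff_C_mul, zcoeff_C_mul, zcoeff_one_add_mul, zcoeff_X_mul, zcoeff_X_mul,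
      hz, hz, hz'] at h
    simpa [hm'] using h

/-- The squared eigenfunctions of the expansion at `λ = ∞`. -/
lemma squaredSystem_pos (hm : m ≠ 0) (hβ : β ≠ 0) (hp : IsPhasePoint β Qm Qp p) :
    SquaredSystem m β p (fun n t => zcoeff n (sqH m β p t)) (fun n t => zcoeff n (sqK m β p t))
      (fun n t => zcoeff n (sqS m β p t)) where
  deriv_h n t := by
    refine ((hp.psDec_sqH hβ).hasDerivAt_zcoeff n t).congr_deriv ?_
    rw [hp.psDeriv_sqH hm hβ, zcoeff_sub, zcoeff_C_mul, zcoeff_C_mul, zcoeff_one_add_mul,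
      zcoeff_X_mul, add_sub_cancel_right]
  deriv_K n t := by
    refine ((hp.psDec_sqK hβ).hasDerivAt_zcoeff n t).congr_deriv ?_
    rw [hp.psDeriv_sqK hm hβ, zcoeff_add, zcoeff_C_mul, zcoeff_C_mul, zcoeff_one_add_mul,
      zcoeff_X_mul, add_sub_cancel_right]
  deriv_S n t := by
    refine ((hp.psDec_sqS hβ).hasDerivAt_zcoeff n t).congr_deriv ?_
    rw [hp.psDeriv_sqS hm hβ, zcoeff_C_mul, zcoeff_sub, zcoeff_one_add_mul, zcoeff_one_add_mul]
    ring
  dec_h := (hp.psDec_sqH hβ).dec_zcoeff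
  dec_K := (hp.psDec_sqK hβ).dec_zcoeff
  dec_S n := by
    rcases le_or_gt n 0 with hn | hn
    · simpa only [hp.zcoeff_sqS_of_nonpos hm hβ hn] using DecAll.zero
    · obtain ⟨k, rfl⟩ : ∃ k : ℕ, n = ((k + 1 : ℕ) : ℤ) := ⟨(n - 1).toNat, by omega⟩
      simpa only [zcoeff_natCast] using (hp.psDec_sqS hβ).2 k

/-- `S_n` is identically zero, hence so is its derivative; in these degrees `h_{n-1}` and `K_{n-1}`
are absent, and the two expressions coincide up to the factor `m/2`. -/
lemma gradPhi_pos_of_nonpos (hm : m ≠ 0) (hβ : β ≠ 0) (hp : IsPhasePoint β Qm Qp p) {n : ℤ}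
    (hn : n ≤ 0) (t : ℝ) : gradPhi β p (fun n t => zcoeff n (sqH m β p t))
      (fun n t => zcoeff n (sqK m β p t)) n t = 0 := by
  have hm' : (m : ℂ) ≠ 0 := by exact_mod_cast hm
  have hz : ∀ F, zcoeff (n - 1) F = 0 := fun F => zcoeff_of_neg (by omega) F
  have h1 := (hp.squaredSystem_pos hm hβ).deriv_S n t
  have h0 : (fun t => zcoeff n (sqS m β p t)) = fun _ => 0 :=
    funext fun t => hp.zcoeff_sqS_of_nonpos hm hβ hn t
  rw [h0] at h1
  have := h1.unique (hasDerivAt_const t 0)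
  simp only [hz, mul_zero, sub_zero, add_zero] at this
  simp only [gradPhi, hz, mul_zero, sub_zero]
  simpa [hm'] using this

/-- The squared eigenfunctions of the expansion at `λ = 0`. -/
lemma squaredSystem_neg (hm : m ≠ 0) (hβ : β ≠ 0) (hp : IsPhasePoint β Qm Qp p) :
    SquaredSystem m β p
      (fun n t => expI (-β) p t * zcoeff (-n) (sqH m β (fun s => -p.1 s, p.2) t))
      (fun n t => expI β p t * zcoeff (-n) (sqK m β (fun s => -p.1 s, p.2) t))
      (fun n t => zcoeff (-n) (sqS m β (fun s => -p.1 s, p.2) t)) := by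
  have L := hp.neg_phi.squaredSystem_pos hm hβ
  have hE : ∀ s t, expI s ((fun s => -p.1 s, p.2) : Fields) t = expI (-s) p t := by
    intro s t; simp [expI]
  have hd := hp.smooth_phi.differentiable (by simp)
  have hw : ∀ t, wCoef β ((fun s => -p.1 s, p.2) : Fields) t
      = -Complex.I * ((β / 4 * (-deriv p.1 t - p.2 t) : ℝ) : ℂ) := by
    intro t
    simp only [wCoef]
    rw [deriv.fun_neg]
  have hEE : ∀ t, expI β p t * expI (-β) p t = 1 := expI_mul_expI_neg β p
  have i1 : ∀ n : ℤ, -n + 1 = -(n - 1) := fun n => by ring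
  have i2 : ∀ n : ℤ, -n - 1 = -(n + 1) := fun n => by ring
  -- The exponential gauge factors tend to `1`, so they do not alter limits. Their role is to shift
  -- `w`: for the reflected field it contains `-φ_t - Π`, and differentiating `exp(∓iβφ)` restores
  -- `φ_t - Π`, while `n ↦ -n` exchanges the neighbouring degrees.
  have hlim : ∀ {s : ℝ} {g : ℝ → ℂ}, s = β ∨ s = -β → (∃ c, DecAll wt fun t => g t - c) →
      ∃ c, DecAll wt fun t => expI s p t * g t - c := by
    rintro s g hs ⟨c, hc⟩
    refine ⟨c, ?_⟩
    have := ((hp.bdd_expI s).mul hc).add ((hp.dec_expI_sub_one hβ hs).const_mul c)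
    refine (congrArg (DecAll wt) (funext fun t => ?_)).mp this
    ring
  refine ⟨fun n t => ?_, fun n t => ?_, fun n t => ?_, fun n => ?_, fun n => ?_, fun n => ?_⟩
  · refine ((hasDerivAt_expI hd (-β) t).fun_mul (L.deriv_h (-n) t)).congr_deriv ?_
    simp only [hE, neg_neg, i1, i2, hw]
    simp only [wCoef]
    push_cast
    linear_combination (-(m : ℂ) / 4 * zcoeff (-(n + 1)) (sqS m β (fun s => -p.1 s, p.2) t)) * hEE t
  · refine ((hasDerivAt_expI hd β t).fun_mul (L.deriv_K (-n) t)).congr_deriv ?_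
    simp only [hE, i1, i2, hw]
    simp only [wCoef]
    push_cast
    linear_combination ((m : ℂ) / 4 * zcoeff (-(n + 1)) (sqS m β (fun s => -p.1 s, p.2) t)) * hEE t
  · refine (L.deriv_S (-n) t).congr_deriv ?_
    simp only [hE, neg_neg, i1, i2]
    linear_combination (-(m : ℂ) / 2 * (zcoeff (-(n - 1)) (sqH m β (fun s => -p.1 s, p.2) t)
      - zcoeff (-(n - 1)) (sqK m β (fun s => -p.1 s, p.2) t))) * hEE t
  · exact hlim (Or.inr rfl) (L.dec_h (-n))
  · exact hlim (Or.inl rfl) (L.dec_K (-n))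
  · exact L.dec_S (-n)

end IsPhasePoint

/-- The minus sign is the one that the chain rule for `φ ↦ -φ` puts on the variation with respect to
`φ`. -/
lemma gradPhi_neg (n : ℤ) (t : ℝ) :
    gradPhi β p (fun n t => expI (-β) p t * zcoeff (-n) (sqH m β (fun s => -p.1 s, p.2) t))
      (fun n t => expI β p t * zcoeff (-n) (sqK m β (fun s => -p.1 s, p.2) t)) n t
    = -gradPhi β (fun s => -p.1 s, p.2) (fun n t => zcoeff n (sqH m β (fun s => -p.1 s, p.2) t))
      (fun n t => zcoeff n (sqK m β (fun s => -p.1 s, p.2) t)) (-n) t := by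
  have hE : ∀ s t, expI s ((fun s => -p.1 s, p.2) : Fields) t = expI (-s) p t := by
    intro s t; simp [expI]
  have hEE : ∀ t, expI β p t * expI (-β) p t = 1 := expI_mul_expI_neg β p
  have i1 : ∀ n : ℤ, -n + 1 = -(n - 1) := fun n => by ring
  have i2 : ∀ n : ℤ, -n - 1 = -(n + 1) := fun n => by ring
  simp only [gradPhi, hE, neg_neg, i1, i2]
  linear_combination (-zcoeff (-(n - 1)) (sqH m β (fun s => -p.1 s, p.2) t)
    + zcoeff (-(n - 1)) (sqK m β (fun s => -p.1 s, p.2) t)) * hEE t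

end SineGordon
end


noncomputable section

open scoped Matrix.Norms.Operator

namespace SineGordon

open PowerSeries

/-! ### Partial derivatives of smooth functions of two real variables -/

section

variable {E : Type*} [NormedAddCommGroup E] [NormedSpace ℝ E] {F : ℝ × ℝ → E}

lemma hasDerivAt_snd_of_contDiff (hF : ContDiff ℝ ∞ F) (a b : ℝ) :
    HasDerivAt (fun s => F (a, s)) (fderiv ℝ F (a, b) (0, 1)) b :=
  ((hF.differentiable (by simp)) (a, b)).hasFDerivAt.comp_hasDerivAt b
    ((hasDerivAt_const b a).prodMk (hasDerivAt_id b))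

lemma hasDerivAt_fst_of_contDiff (hF : ContDiff ℝ ∞ F) (a b : ℝ) :
    HasDerivAt (fun s => F (s, b)) (fderiv ℝ F (a, b) (1, 0)) a :=
  ((hF.differentiable (by simp)) (a, b)).hasFDerivAt.comp_hasDerivAt a
    ((hasDerivAt_id a).prodMk (hasDerivAt_const a b))

lemma contDiff_fderiv_apply (hF : ContDiff ℝ ∞ F) (w : ℝ × ℝ) :
    ContDiff ℝ ∞ fun z => fderiv ℝ F z w :=
  (hF.fderiv_right (by simp)).clm_apply contDiff_const

lemma contDiff_deriv_snd (hF : ContDiff ℝ ∞ F) :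
    ContDiff ℝ ∞ fun z : ℝ × ℝ => deriv (fun s => F (z.1, s)) z.2 := by
  have : (fun z : ℝ × ℝ => deriv (fun s => F (z.1, s)) z.2) = fun z => fderiv ℝ F z (0, 1) :=
    funext fun z => (hasDerivAt_snd_of_contDiff hF z.1 z.2).deriv
  rw [this]
  exact contDiff_fderiv_apply hF _

lemma contDiff_deriv_fst (hF : ContDiff ℝ ∞ F) :
    ContDiff ℝ ∞ fun z : ℝ × ℝ => deriv (fun s => F (s, z.2)) z.1 := by
  have : (fun z : ℝ × ℝ => deriv (fun s => F (s, z.2)) z.1) = fun z => fderiv ℝ F z (1, 0) :=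
    funext fun z => (hasDerivAt_fst_of_contDiff hF z.1 z.2).deriv
  rw [this]
  exact contDiff_fderiv_apply hF _

/-- The mixed partial derivatives agree. -/
lemma deriv_deriv_comm_of_contDiff (hF : ContDiff ℝ ∞ F) (a b : ℝ) :
    deriv (fun s => deriv (fun x => F (x, s)) a) b
      = deriv (fun x => deriv (fun s => F (x, s)) b) a := by
  have h1 : (fun s => deriv (fun x => F (x, s)) a) = fun s => fderiv ℝ F (a, s) (1, 0) :=
    funext fun s => (hasDerivAt_fst_of_contDiff hF a s).deriv
  have h2 : (fun x => deriv (fun s => F (x, s)) b) = fun x => fderiv ℝ F (x, b) (0, 1) :=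
    funext fun x => (hasDerivAt_snd_of_contDiff hF x b).deriv
  rw [h1, h2, (hasDerivAt_snd_of_contDiff (contDiff_fderiv_apply hF (1, 0)) a b).deriv,
    (hasDerivAt_fst_of_contDiff (contDiff_fderiv_apply hF (0, 1)) a b).deriv]
  have hd : DifferentiableAt ℝ (fderiv ℝ F) (a, b) :=
    (hF.fderiv_right (m := ∞) (by simp)).differentiable (by simp) (a, b)
  have hs : IsSymmSndFDerivAt ℝ F (a, b) := hF.contDiffAt.isSymmSndFDerivAt
    (by rw [minSmoothness_of_isRCLikeNormedField]; exact WithTop.coe_le_coe.2 le_top)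
  have e : ∀ w, fderiv ℝ (fun z => fderiv ℝ F z w) (a, b)
      = (fderiv ℝ (fderiv ℝ F) (a, b)).flip w := by
    intro w
    rw [fderiv_clm_apply hd (differentiableAt_const w)]
    simp
  rw [e, e, ContinuousLinearMap.flip_apply, ContinuousLinearMap.flip_apply]
  exact hs.eq _ _

end

/-- Differentiation under the integral sign when the integrand depends on the parameter only over
a compact set. -/
lemma hasDerivAt_integral_of_contDiff {F : ℝ × ℝ → ℂ} (hF : ContDiff ℝ ∞ F) {K : Set ℝ}
    (hK : IsCompact K) (hc : ∀ t ∉ K, ∀ ε, F (ε, t) = F (0, t))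
    (hint : Integrable fun t => F (0, t)) :
    Integrable (fun t => deriv (fun ε => F (ε, t)) 0) ∧
      HasDerivAt (fun ε => ∫ t, F (ε, t)) (∫ t, deriv (fun ε => F (ε, t)) 0) 0 := by
  have hcont := (contDiff_deriv_fst hF).continuous
  obtain ⟨C, hC⟩ := ((isCompact_Icc (a := (-1 : ℝ)) (b := 1)).prod hK).exists_bound_of_continuousOn
    hcont.continuousOn
  refine hasDerivAt_integral_of_dominated_loc_of_deriv_le (s := Set.Icc (-1) 1)
    (F' := fun ε t => deriv (fun ε => F (ε, t)) ε) (bound := K.indicator fun _ => C)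
    (Icc_mem_nhds (by norm_num) (by norm_num)) ?_ hint ?_ ?_ ?_ ?_
  · exact Eventually.of_forall fun ε =>
      (hF.continuous.comp (Continuous.prodMk_right ε)).aestronglyMeasurable
  · exact (hcont.comp (Continuous.prodMk_right 0)).aestronglyMeasurable
  · refine Eventually.of_forall fun t ε hε => ?_
    by_cases ht : t ∈ K
    · rw [Set.indicator_of_mem ht]
      exact hC (ε, t) ⟨hε, ht⟩
    · rw [Set.indicator_of_notMem ht]
      have : (fun ε => F (ε, t)) = fun _ => F (0, t) := funext fun ε => hc t ht ε
      rw [this, deriv_const, norm_zero]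
  · rw [integrable_indicator_iff hK.measurableSet]
    exact integrableOn_const hK.measure_lt_top.ne
  · exact Eventually.of_forall fun t ε _ =>
      (hasDerivAt_fst_of_contDiff hF ε t).differentiableAt.hasDerivAt

/-! ### Dependence of the Riccati coefficients on the fields -/

variable {m β : ℝ} {p : Fields}

lemma expI_congr {q : Fields} {t : ℝ} (h : p.1 =ᶠ[𝓝 t] q.1) (s : ℝ) :
    expI s p =ᶠ[𝓝 t] expI s q := by
  filter_upwards [h] with x hx
  rw [expI, expI, hx]

/-- The coefficients `γ_n` are local functions of the fields. -/
lemma ricc_congr {q : Fields} {t : ℝ} (h1 : p.1 =ᶠ[𝓝 t] q.1) (h2 : p.2 =ᶠ[𝓝 t] q.2) (n : ℕ) :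
    ricc m β p n =ᶠ[𝓝 t] ricc m β q n := by
  induction n using Nat.strong_induction_on with
  | _ n ih =>
    cases n with
    | zero => exact Eventually.of_forall fun s => by rw [ricc_zero, ricc_zero]
    | succ n =>
      have hall : ∀ᶠ x in 𝓝 t, ∀ k ∈ Finset.range (n + 1), ricc m β p k x = ricc m β q k x :=
        (Filter.eventually_all_finset _).2 fun k hk => ih k (Finset.mem_range.1 hk)
      filter_upwards [hall, (ih n (Nat.lt_succ_self n)).deriv, h1.deriv, h2, expI_congr h1 β,
        expI_congr h1 (-β)] with x hx hd hφ hP hE hE'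
      have hx' : ∀ k, k ≤ n → ricc m β p k x = ricc m β q k x :=
        fun k hk => hx k (Finset.mem_range.2 (by omega))
      rw [ricc_succ, ricc_succ, hd, hφ, hP, hE, hE', hx' n le_rfl]
      congr 3
      · refine Finset.sum_congr rfl fun k hk => ?_
        have := Finset.mem_range.1 hk
        rw [hx' _ (by omega), hx' _ (by omega)]
      · congr 1
        refine Finset.sum_congr rfl fun k hk => ?_
        have := Finset.mem_range.1 hk
        rw [hx' _ (by omega), hx' _ (by omega)]

section

variable {u v : ℝ → ℝ}

lemma contDiff_expI_perturb (h1 : ContDiff ℝ ∞ p.1) (hu : ContDiff ℝ ∞ u) (s : ℝ) :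
    ContDiff ℝ ∞ fun z : ℝ × ℝ => expI s (perturb p u v z.1) z.2 := by
  have : ContDiff ℝ ∞ fun z : ℝ × ℝ => s * (p.1 z.2 + z.1 * u z.2) :=
    contDiff_const.mul ((h1.comp contDiff_snd).add (contDiff_fst.mul (hu.comp contDiff_snd)))
  exact (contDiff_const.mul (Complex.ofRealCLM.contDiff.comp this)).cexp

/-- Smoothness jointly in the parameter and in time is the statement that propagates, since each
step of the recursion differentiates in time. -/
lemma contDiff_ricc_perturb (h1 : ContDiff ℝ ∞ p.1) (h2 : ContDiff ℝ ∞ p.2)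
    (hu : ContDiff ℝ ∞ u) (hv : ContDiff ℝ ∞ v) (n : ℕ) :
    ContDiff ℝ ∞ fun z : ℝ × ℝ => ricc m β (perturb p u v z.1) n z.2 := by
  induction n using Nat.strong_induction_on with
  | _ n ih =>
    cases n with
    | zero => simpa only [ricc_zero] using contDiff_const
    | succ n =>
      have hφ : ContDiff ℝ ∞ fun z : ℝ × ℝ => deriv (perturb p u v z.1).1 z.2 :=
        contDiff_deriv_snd (F := fun z : ℝ × ℝ => p.1 z.2 + z.1 * u z.2)
          ((h1.comp contDiff_snd).add (contDiff_fst.mul (hu.comp contDiff_snd)))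
      have hP : ContDiff ℝ ∞ fun z : ℝ × ℝ => (perturb p u v z.1).2 z.2 :=
        (h2.comp contDiff_snd).add (contDiff_fst.mul (hv.comp contDiff_snd))
      have hw : ContDiff ℝ ∞ fun z : ℝ × ℝ =>
          ((β / m * (deriv (perturb p u v z.1).1 z.2 - (perturb p u v z.1).2 z.2) : ℝ) : ℂ) :=
        Complex.ofRealCLM.contDiff.comp (contDiff_const.mul (hφ.sub hP))
      have hd := contDiff_deriv_snd (ih n (Nat.lt_succ_self n))
      rw [funext fun z : ℝ × ℝ => ricc_succ m β (perturb p u v z.1) n z.2]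
      refine (((contDiff_const.mul hd).sub (hw.mul (ih n (Nat.lt_succ_self n)))).add ?_).add
        (contDiff_const.mul ((ContDiff.sum fun k hk => ?_).add
          ((contDiff_expI_perturb h1 hu (-β)).mul (ContDiff.sum fun k hk => ?_))))
      · split_ifs
        · exact contDiff_const.mul (contDiff_expI_perturb h1 hu β)
        · exact contDiff_const
      · have := Finset.mem_range.1 hk
        exact (ih (k + 1) (by omega)).mul (ih (n - k) (by omega))
      · have := Finset.mem_range.1 hk
        exact (ih k (by omega)).mul (ih (n - 1 - k) (by omega))

lemma contDiff_posDensity_perturb (h1 : ContDiff ℝ ∞ p.1) (h2 : ContDiff ℝ ∞ p.2)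
    (hu : ContDiff ℝ ∞ u) (hv : ContDiff ℝ ∞ v) (n : ℕ) :
    ContDiff ℝ ∞ fun z : ℝ × ℝ => posDensity m β (n + 1) (perturb p u v z.1) z.2 := by
  simp only [posDensity_succ]
  exact contDiff_const.mul (((contDiff_ricc_perturb h1 h2 hu hv (n + 2)).add
    ((contDiff_expI_perturb h1 hu (-β)).mul (contDiff_ricc_perturb h1 h2 hu hv n))).sub
    contDiff_const)

lemma perturb_eventuallyEq {t : ℝ} (ht : t ∉ tsupport u ∪ tsupport v) (ε : ℝ) :
    (perturb p u v ε).1 =ᶠ[𝓝 t] p.1 ∧ (perturb p u v ε).2 =ᶠ[𝓝 t] p.2 := by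
  rw [Set.mem_union, not_or] at ht
  constructor
  · filter_upwards [notMem_tsupport_iff_eventuallyEq.1 ht.1] with x hx
    simp [perturb, hx]
  · filter_upwards [notMem_tsupport_iff_eventuallyEq.1 ht.2] with x hx
    simp [perturb, hx]

lemma ricc_perturb_of_notMem {t : ℝ} (ht : t ∉ tsupport u ∪ tsupport v) (ε : ℝ) (n : ℕ) :
    ricc m β (perturb p u v ε) n t = ricc m β p n t :=
  (ricc_congr (perturb_eventuallyEq ht ε).1 (perturb_eventuallyEq ht ε).2 n).self_of_nhds

lemma posDensity_perturb_of_notMem {t : ℝ} (ht : t ∉ tsupport u ∪ tsupport v) (ε : ℝ) (n : ℕ) :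
    posDensity m β (n + 1) (perturb p u v ε) t = posDensity m β (n + 1) p t := by
  rw [posDensity_succ, posDensity_succ, ricc_perturb_of_notMem ht, ricc_perturb_of_notMem ht,
    (expI_congr (perturb_eventuallyEq ht ε).1 (-β)).self_of_nhds]

/-- The first variation of the generating series. -/
def riccVar (m β : ℝ) (p : Fields) (u v : ℝ → ℝ) (t : ℝ) : PowerSeries ℂ :=
  psDeriv (fun ε => riccS m β (perturb p u v ε) t) 0

lemma coeff_riccVar (n : ℕ) (t : ℝ) : coeff n (riccVar m β p u v t)
    = deriv (fun ε => ricc m β (perturb p u v ε) n t) 0 := by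
  simp [riccVar, psDeriv, riccS]

lemma coeff_riccVar_of_notMem {t : ℝ} (ht : t ∉ tsupport u ∪ tsupport v) (n : ℕ) :
    coeff n (riccVar m β p u v t) = 0 := by
  rw [coeff_riccVar]
  simp only [ricc_perturb_of_notMem ht, deriv_const]

lemma hasPSDeriv_riccS_perturb (h1 : ContDiff ℝ ∞ p.1) (h2 : ContDiff ℝ ∞ p.2)
    (hu : ContDiff ℝ ∞ u) (hv : ContDiff ℝ ∞ v) (t : ℝ) :
    HasPSDeriv (fun ε => riccS m β (perturb p u v ε) t) (riccVar m β p u v t) 0 := fun n => by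
  rw [coeff_riccVar]
  simp only [riccS, coeff_mk]
  exact (hasDerivAt_fst_of_contDiff
    (contDiff_ricc_perturb h1 h2 hu hv n) 0 t).differentiableAt.hasDerivAt

lemma hasPSDeriv_riccVar (h1 : ContDiff ℝ ∞ p.1) (h2 : ContDiff ℝ ∞ p.2)
    (hu : ContDiff ℝ ∞ u) (hv : ContDiff ℝ ∞ v) (t : ℝ) :
    HasPSDeriv (riccVar m β p u v) (psDeriv (riccVar m β p u v) t) t := fun n => by
  simp only [psDeriv, coeff_mk, coeff_riccVar]
  exact (((contDiff_deriv_fst (contDiff_ricc_perturb h1 h2 hu hv n)).comp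
    (contDiff_prodMk_right (0 : ℝ))).differentiable (by simp) t).hasDerivAt

/-- Mixed partial derivatives commute coefficientwise; this is what allows the Riccati equation
itself to be varied. -/
lemma hasPSDeriv_psDeriv_riccS (h1 : ContDiff ℝ ∞ p.1) (h2 : ContDiff ℝ ∞ p.2)
    (hu : ContDiff ℝ ∞ u) (hv : ContDiff ℝ ∞ v) (t : ℝ) :
    HasPSDeriv (fun ε => psDeriv (riccS m β (perturb p u v ε)) t)
      (psDeriv (riccVar m β p u v) t) 0 := fun n => by
  have hF := contDiff_ricc_perturb (m := m) (β := β) h1 h2 hu hv n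
  simp only [psDeriv, coeff_mk, coeff_riccVar, riccS]
  have e := deriv_deriv_comm_of_contDiff hF 0 t
  simp only at e
  rw [e]
  exact (hasDerivAt_fst_of_contDiff (contDiff_deriv_snd hF) 0 t).differentiableAt.hasDerivAt

lemma hasDerivAt_expI_perturb (s t : ℝ) :
    HasDerivAt (fun ε => expI s (perturb p u v ε) t) (Complex.I * s * u t * expI s p t) 0 := by
  have h0 : HasDerivAt (fun ε : ℝ => s * (p.1 t + ε * u t)) (s * u t) 0 := by
    simpa using (((hasDerivAt_id (0 : ℝ)).mul_const (u t)).const_add (p.1 t)).const_mul s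
  have := (h0.ofReal_comp.const_mul Complex.I).cexp
  refine this.congr_deriv ?_
  simp [expI]
  ring

lemma hasDerivAt_wCoef_perturb (h1 : Differentiable ℝ p.1) (hu : Differentiable ℝ u) (t : ℝ) :
    HasDerivAt (fun ε => wCoef β (perturb p u v ε) t)
      (-Complex.I * ((β / 4 * (deriv u t - v t) : ℝ) : ℂ)) 0 := by
  have e : ∀ ε, wCoef β (perturb p u v ε) t = -Complex.I *
      ((β / 4 * ((deriv p.1 t + ε * deriv u t) - (p.2 t + ε * v t)) : ℝ) : ℂ) := by
    intro ε
    have : deriv (perturb p u v ε).1 t = deriv p.1 t + ε * deriv u t :=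
      ((h1 t).hasDerivAt.fun_add ((hu t).hasDerivAt.const_mul ε)).deriv
    rw [wCoef, this]
    rfl
  simp only [e]
  have h0 : HasDerivAt (fun ε : ℝ => β / 4 * ((deriv p.1 t + ε * deriv u t) - (p.2 t + ε * v t)))
      (β / 4 * (deriv u t - v t)) 0 := by
    simpa using ((((hasDerivAt_id (0 : ℝ)).mul_const (deriv u t)).const_add (deriv p.1 t)).fun_sub
      (((hasDerivAt_id (0 : ℝ)).mul_const (v t)).const_add (p.2 t))).const_mul (β / 4)
  exact h0.ofReal_comp.const_mul _

/-- The linearised Riccati equation. -/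
lemma riccVar_riccati (hm : m ≠ 0) (h1 : ContDiff ℝ ∞ p.1) (h2 : ContDiff ℝ ∞ p.2)
    (hu : ContDiff ℝ ∞ u) (hv : ContDiff ℝ ∞ v) (t : ℝ) :
    X * psDeriv (riccVar m β p u v) t =
      -2 * C (-Complex.I * ((β / 4 * (deriv u t - v t) : ℝ) : ℂ)) * (X * riccS m β p t)
      - 2 * C (wCoef β p t) * (X * riccVar m β p u v t)
      + C ((m : ℂ) / 4) * (2 * riccS m β p t * riccVar m β p u v t
        + X ^ 2 * (C (Complex.I * β * u t * expI β p t)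
          - C (Complex.I * β * u t * expI (-β) p t) * riccS m β p t ^ 2
          + 2 * C (expI (-β) p t) * riccS m β p t * riccVar m β p u v t)) := by
  have hf := hasPSDeriv_riccS_perturb (m := m) (β := β) h1 h2 hu hv t
  have hl := (HasPSDeriv.const (t := 0) X).mul
    (hasPSDeriv_psDeriv_riccS (m := m) (β := β) h1 h2 hu hv t)
  have hE := HasPSDeriv.C (hasDerivAt_expI_perturb (p := p) (u := u) (v := v) β t)
  have hE' := HasPSDeriv.C (hasDerivAt_expI_perturb (p := p) (u := u) (v := v) (-β) t)
  have hw := HasPSDeriv.C ((hasDerivAt_wCoef_perturb (β := β) (p := p) (u := u) (v := v)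
    (h1.differentiable (by simp)) (hu.differentiable (by simp)) t).const_mul (-2 : ℂ))
  have hr := (hw.mul ((HasPSDeriv.const X).mul hf)).add
    ((HasPSDeriv.const (C ((m : ℂ) / 4))).mul (((HasPSDeriv.const 1).add (hf.mul hf)).add
      ((HasPSDeriv.const (X ^ 2)).mul (hE.add (hE'.mul (hf.mul hf))))))
  have hfun : (fun ε => X * psDeriv (riccS m β (perturb p u v ε)) t) = _ :=
    funext fun ε => riccS_riccati hm β (perturb p u v ε) t
  simp only [sq (riccS m β _ t)] at hfun
  rw [hfun] at hl
  have e := hl.unique hr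
  simp only [perturb_zero] at e
  have hneg : C (Complex.I * ((-β : ℝ) : ℂ) * u t * expI (-β) p t)
      = -C (Complex.I * β * u t * expI (-β) p t) := by
    rw [← map_neg]; congr 1; push_cast; ring
  rw [hneg] at e
  have h2' : ∀ a : ℂ, C (-2 * a) = -2 * C a := fun a => by
    rw [map_mul, map_neg, map_ofNat]
  rw [h2', h2'] at e
  linear_combination e

end

end SineGordon
end


noncomputable section

open scoped Matrix.Norms.Operator

namespace SineGordon

open PowerSeries

variable {m β : ℝ} {p : Fields}

/-! ### Functional derivatives of the conserved quantities -/

section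

variable {u v : ℝ → ℝ}

lemma deriv_posDensity_perturb (h1 : ContDiff ℝ ∞ p.1) (h2 : ContDiff ℝ ∞ p.2)
    (hu : ContDiff ℝ ∞ u) (hv : ContDiff ℝ ∞ v) (n : ℕ) (t : ℝ) :
    deriv (fun ε => posDensity m β (n + 1) (perturb p u v ε) t) 0
      = Complex.I * m / 4 * (coeff (n + 2) (riccVar m β p u v t)
        + expI (-β) p t * coeff n (riccVar m β p u v t)
        - Complex.I * β * u t * expI (-β) p t * ricc m β p n t) := by
  have hf := hasPSDeriv_riccS_perturb (m := m) (β := β) h1 h2 hu hv t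
  have hf' : ∀ k, HasDerivAt (fun ε => ricc m β (perturb p u v ε) k t)
      (coeff k (riccVar m β p u v t)) 0 := by
    intro k
    simpa only [riccS, coeff_mk] using hf k
  have := ((((hf' (n + 2)).fun_add ((hasDerivAt_expI_perturb (p := p) (u := u) (v := v) (-β) t).fun_mul
    (hf' n))).sub_const (if n = 0 then Complex.I else 0)).const_mul (Complex.I * m / 4))
  simp only [posDensity_succ]
  rw [this.deriv, perturb_zero]
  push_cast
  ring

namespace IsPhasePoint

variable {Qm Qp : ℤ}

/-- The variation of the density of `J_{n+1}`, up to a total derivative. -/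
lemma hasDerivAt_variation (hm : m ≠ 0) (hβ : β ≠ 0) (h : IsPhasePoint β Qm Qp p)
    (hu : ContDiff ℝ ∞ u) (hv : ContDiff ℝ ∞ v) (n : ℕ) (t : ℝ) :
    HasDerivAt (fun s => -Complex.I * coeff (n + 1) (sqH m β p s * riccVar m β p u v s)
        - (β : ℂ) / 4 * (coeff (n + 1) (sqS m β p s) * (u s : ℂ)))
      (deriv (fun ε => posDensity m β (n + 1) (perturb p u v ε) t) 0
        - ((β : ℂ) * m / 8 * gradPhi β p (fun n t => zcoeff n (sqH m β p t))
              (fun n t => zcoeff n (sqK m β p t)) ((n + 1 : ℕ) : ℤ) t * (u t : ℂ)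
            + (β : ℂ) / 4 * zcoeff ((n + 1 : ℕ) : ℤ) (sqS m β p t) * (v t : ℂ))) t := by
  have hg := ((h.psDec_sqH (m := m) hβ).hasPSDeriv t).mul
    (hasPSDeriv_riccVar (m := m) (β := β) h.smooth_phi h.smooth_Pi hu hv t) (n + 1)
  have hS := (h.squaredSystem_pos hm hβ).deriv_S ((n + 1 : ℕ) : ℤ) t
  have hu' := ((hu.differentiable (by simp)) t).hasDerivAt.ofReal_comp
  have i1 : ((n + 1 : ℕ) : ℤ) - 1 = (n : ℕ) := by omega
  rw [i1] at hS
  have r1 := h.psDeriv_sqH hm hβ t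
  have r2 := riccVar_riccati (β := β) hm h.smooth_phi h.smooth_Pi hu hv t
  -- `h` is an integrating factor: in `(h δf)'` the terms quadratic in the unperturbed solutions
  -- cancel because `S = 1 + 2hf`, and of `δf` there remains only `-(m/4)(1 + X² exp(-iβφ)) δf`, the
  -- combination occurring in the variation of the density. The rest is explicit in `u` and `v`.
  have key : X * (psDeriv (sqH m β p) t * riccVar m β p u v t
        + sqH m β p t * psDeriv (riccVar m β p u v) t)
      = X * (X * (C ((m : ℂ) / 4) * (C (Complex.I * β * u t * expI β p t) * sqH m β p t
          - C (Complex.I * β * u t * expI (-β) p t) * sqK m β p t)))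
        - C ((m : ℂ) / 4) * riccVar m β p u v t
        - X * (X * (C ((m : ℂ) / 4) * (C (expI (-β) p t) * riccVar m β p u v t
          - C (Complex.I * β * u t * expI (-β) p t) * riccS m β p t)))
        - X * (C (-Complex.I * ((β / 4 * (deriv u t - v t) : ℝ) : ℂ)) * (sqS m β p t - 1)) := by
    rw [sqS_eq] at r1
    rw [map_mul C, map_ofNat] at r1
    rw [sqS_eq, sqK_eq]
    linear_combination riccVar m β p u v t * r1 + sqH m β p t * r2
  have key' := congrArg (coeff (n + 2)) key
  simp only [map_add, map_sub, coeff_succ_X_mul, coeff_C_mul] at key'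
  rw [show coeff (n + 1) (1 : PowerSeries ℂ) = 0 by simp [coeff_one], sub_zero] at key'
  have hz : ∀ F, zcoeff ((n + 1 : ℕ) : ℤ) F = coeff (n + 1) F := fun F => zcoeff_natCast _ F
  simp only [hz] at hS
  -- The second term of the primitive integrates by parts the derivative of `u`, which enters
  -- through `φ_t` in `w`.
  refine ((hg.const_mul (-Complex.I)).fun_sub ((hS.fun_mul hu').const_mul ((β : ℂ) / 4))).congr_deriv ?_
  rw [deriv_posDensity_perturb h.smooth_phi h.smooth_Pi hu hv, gradPhi, i1, map_add, key', hz,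
    zcoeff_natCast, zcoeff_natCast]
  rw [show coeff n (riccS m β p t) = ricc m β p n t by simp [riccS]]
  push_cast
  have hI := Complex.I_mul_I
  generalize zcoeff ((n : ℤ) + 1 + 1) (sqH m β p t) = a1
  generalize zcoeff ((n : ℤ) + 1 + 1) (sqK m β p t) = a2
  generalize coeff n (sqH m β p t) = a3
  generalize coeff n (sqK m β p t) = a4
  generalize coeff (n + 1) (sqS m β p t) = a5
  linear_combination (-((m : ℂ) / 4 * β * u t * (expI β p t * a3 - expI (-β) p t * a4))
    - (β : ℂ) / 4 * ((deriv u t : ℝ) - v t) * a5) * hI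

lemma integrable_mul_test {a : ℝ → ℂ} (ha : Continuous a) (hu : Continuous u)
    (hc : HasCompactSupport u) : Integrable fun t => a t * (u t : ℂ) := by
  have hc' : HasCompactSupport fun t => (u t : ℂ) := hc.comp_left (g := fun x : ℝ => (x : ℂ)) rfl
  exact (ha.mul (Complex.continuous_ofReal.comp hu)).integrable_of_hasCompactSupport hc'.mul_left

/-- The density is a local function of the fields, so its variation is supported where the test
functions are. One may differentiate under the integral, and the total derivative found in
`hasDerivAt_variation` integrates to zero. -/
lemma hasFunctionalDeriv_charge_pos (hm : m ≠ 0) (hβ : β ≠ 0) (h : IsPhasePoint β Qm Qp p)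
    (n : ℕ) : HasFunctionalDeriv (fun q => ∫ t, posDensity m β (n + 1) q t) p
      (fun t => (β : ℂ) * m / 8 * gradPhi β p (fun n t => zcoeff n (sqH m β p t))
              (fun n t => zcoeff n (sqK m β p t)) ((n + 1 : ℕ) : ℤ) t)
      (fun t => (β : ℂ) / 4 * zcoeff ((n + 1 : ℕ) : ℤ) (sqS m β p t)) := by
  have L := h.squaredSystem_pos hm hβ
  have ca := ((L.bdd_gradPhi h ((n + 1 : ℕ) : ℤ)).const_mul ((β : ℂ) * m / 8)).continuous
  have cb := ((L.dec_S ((n + 1 : ℕ) : ℤ)).const_mul ((β : ℂ) / 4)).continuous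
  refine ⟨ca.locallyIntegrable, cb.locallyIntegrable, fun u v hu hu' hv hv' => ?_⟩
  have hK : IsCompact (tsupport u ∪ tsupport v) :=
    hu'.isCompact.union hv'.isCompact
  obtain ⟨hi, hd⟩ := hasDerivAt_integral_of_contDiff
    (contDiff_posDensity_perturb (m := m) (β := β) h.smooth_phi h.smooth_Pi hu hv n) hK
    (fun t ht ε => by
      rw [posDensity_perturb_of_notMem ht, posDensity_perturb_of_notMem ht])
    (by simpa only [perturb_zero] using (h.dec_posDensity hβ m n).integrable)
  refine hd.congr_deriv ?_
  have i1 := integrable_mul_test ca hu.continuous hu'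
  have i2 := integrable_mul_test cb hv.continuous hv'
  have hv1 := h.hasDerivAt_variation hm hβ hu hv n
  refine sub_eq_zero.1 ((integral_sub hi (i1.add i2)).symm.trans ?_)
  refine integral_eq_zero_of_hasDerivAt_of_integrable hv1 (hi.sub (i1.add i2)) ?_
  have hcont : Continuous fun s => -Complex.I * coeff (n + 1) (sqH m β p s * riccVar m β p u v s)
        - (β : ℂ) / 4 * (coeff (n + 1) (sqS m β p s) * (u s : ℂ)) :=
    continuous_iff_continuousAt.2 fun t => (hv1 t).continuousAt
  refine hcont.integrable_of_hasCompactSupport (HasCompactSupport.intro hK fun t ht => ?_)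
  have : u t = 0 := by
    by_contra hne
    exact ht (Or.inl (subset_tsupport u hne))
  rw [this, coeff_mul, Finset.sum_eq_zero]
  · simp
  · intro x _
    rw [coeff_riccVar_of_notMem ht, mul_zero]

end IsPhasePoint

end

lemma HasFunctionalDeriv.comp_neg_phi {F : Fields → ℂ} {a b : ℝ → ℂ}
    (h : HasFunctionalDeriv F (fun s => -p.1 s, p.2) a b) :
    HasFunctionalDeriv (fun q => F (fun s => -q.1 s, q.2)) p (fun t => -a t) b := by
  refine ⟨h.1.neg, h.2.1, fun u v hu hu' hv hv' => ?_⟩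
  have := h.2.2 (fun s => -u s) v hu.neg (hu'.comp_left (g := fun x : ℝ => -x) neg_zero) hv hv'
  have e1 : (fun ε : ℝ => F (fun s => -p.1 s + ε * -u s, fun s => p.2 s + ε * v s))
      = fun ε : ℝ => F (fun s => -(p.1 s + ε * u s), fun s => p.2 s + ε * v s) := by
    funext ε
    congr 2
    funext s
    ring
  have e2 : (fun s => -a s * (u s : ℂ) + b s * (v s : ℂ))
      = fun s => a s * ((-u s : ℝ) : ℂ) + b s * (v s : ℂ) := by
    funext s
    push_cast
    ring
  simp only at this
  rw [e1] at this
  rw [e2]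
  exact this

namespace IsPhasePoint

variable {Qm Qp : ℤ}

/-- The charge is topological: a compactly supported change of `φ` has a derivative of integral
zero. -/
lemma hasFunctionalDeriv_charge_zero (h : IsPhasePoint β Qm Qp p) :
    HasFunctionalDeriv (charge m β 0) p (fun _ => 0) (fun _ => 0) := by
  have l0 : LocallyIntegrable (fun _ : ℝ => (0 : ℂ)) := continuous_const.locallyIntegrable
  refine ⟨l0, l0, fun u v hu hu' hv hv' => ?_⟩
  have hud := hu.differentiable (by simp)
  have iu : Integrable (deriv u) :=
    ((contDiff_infty_iff_deriv.1 hu).2.continuous).integrable_of_hasCompactSupport hu'.deriv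
  have zu : ∫ t, deriv u t = 0 :=
    integral_eq_zero_of_hasDerivAt_of_integrable (fun t => (hud t).hasDerivAt) iu
      (hu.continuous.integrable_of_hasCompactSupport hu')
  have ip : Integrable (deriv p.1) := by
    simpa using h.dec_deriv_phi.integrable.re
  have e : ∀ ε : ℝ, charge m β 0 (fun s => p.1 s + ε * u s, fun s => p.2 s + ε * v s)
      = ((-(β / 2) * ∫ t, deriv p.1 t : ℝ) : ℂ) := by
    intro ε
    have hd : ∀ t, deriv (fun s => p.1 s + ε * u s) t = deriv p.1 t + ε * deriv u t := fun t =>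
      (((h.smooth_phi.differentiable (by simp)) t).hasDerivAt.fun_add
        ((hud t).hasDerivAt.const_mul ε)).deriv
    have : ∀ t, chargeDensity m β 0 (fun s => p.1 s + ε * u s, fun s => p.2 s + ε * v s) t
        = ((-(β / 2) * (deriv p.1 t + ε * deriv u t) : ℝ) : ℂ) := fun t => by
      rw [← hd]; rfl
    rw [charge]
    simp only [this]
    rw [integral_complex_ofReal, integral_const_mul, integral_add ip (iu.const_mul ε),
      integral_const_mul, zu, mul_zero, add_zero]
  simp only [e]
  simpa using hasDerivAt_const (0 : ℝ) ((-(β / 2) * ∫ t, deriv p.1 t : ℝ) : ℂ)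

/-- The gradient of every `J_n`, `n ≠ 0`, is built from a system of squared eigenfunctions whose
grading is bounded on one side. -/
lemma exists_squaredSystem (hm : m ≠ 0) (hβ : β ≠ 0) (h : IsPhasePoint β Qm Qp p) (n : ℤ)
    (hn : n ≠ 0) : ∃ H K S : ℤ → ℝ → ℂ, SquaredSystem m β p H K S ∧
      ((∀ n ≤ 0, ∀ t, S n t = 0 ∧ gradPhi β p H K n t = 0) ∨
        ∀ n, 0 ≤ n → ∀ t, S n t = 0 ∧ gradPhi β p H K n t = 0) ∧
      HasFunctionalDeriv (charge m β n) p (fun t => (β : ℂ) * m / 8 * gradPhi β p H K n t)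
        (fun t => (β : ℂ) / 4 * S n t) := by
  match n, hn with
  | Int.ofNat (n + 1), _ =>
    exact ⟨_, _, _, h.squaredSystem_pos hm hβ, Or.inl fun k hk t =>
      ⟨h.zcoeff_sqS_of_nonpos hm hβ hk t, h.gradPhi_pos_of_nonpos hm hβ hk t⟩,
      h.hasFunctionalDeriv_charge_pos hm hβ n⟩
  | Int.negSucc n, _ =>
    refine ⟨_, _, _, h.squaredSystem_neg hm hβ, Or.inr fun k hk t =>
      ⟨h.neg_phi.zcoeff_sqS_of_nonpos hm hβ (by omega) t, ?_⟩, ?_⟩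
    · rw [gradPhi_neg, h.neg_phi.gradPhi_pos_of_nonpos hm hβ (by omega), neg_zero]
    · have := (h.neg_phi.hasFunctionalDeriv_charge_pos hm hβ n).comp_neg_phi
      simp only [gradPhi_neg]
      have e : -Int.negSucc n = ((n + 1 : ℕ) : ℤ) := Int.neg_negSucc n
      simp only [e, mul_neg]
      exact this

/-- The conserved quantities are in involution. -/
lemma hasPoissonBracket_charge (hm : m ≠ 0) (hβ : β ≠ 0) (h : IsPhasePoint β Qm Qp p)
    (n n' : ℤ) : HasPoissonBracket (charge m β n) (charge m β n') p 0 := by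
  have hex : ∀ k : ℤ, ∃ a b, HasFunctionalDeriv (charge m β k) p a b := by
    intro k
    by_cases hk : k = 0
    · subst hk
      exact ⟨_, _, h.hasFunctionalDeriv_charge_zero⟩
    · obtain ⟨_, _, _, _, _, hd⟩ := h.exists_squaredSystem hm hβ k hk
      exact ⟨_, _, hd⟩
  by_cases hn : n = 0
  · subst hn
    obtain ⟨a, b, hd⟩ := hex n'
    exact ⟨_, _, a, b, h.hasFunctionalDeriv_charge_zero, hd, by simp, by simp⟩
  by_cases hn' : n' = 0
  · subst hn'
    obtain ⟨a, b, hd⟩ := hex n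
    exact ⟨a, b, _, _, hd, h.hasFunctionalDeriv_charge_zero, by simp, by simp⟩
  obtain ⟨H, K, S, L, hz, hd⟩ := h.exists_squaredSystem hm hβ n hn
  obtain ⟨H', K', S', L', -, hd'⟩ := h.exists_squaredSystem hm hβ n' hn'
  -- Up to a constant the bracket density is the pairing of two squared-eigenfunction systems; it
  -- suffices that the first of them is bounded on one side in degree.
  have e : (fun s => (β : ℂ) * m / 8 * gradPhi β p H K n s * ((β : ℂ) / 4 * S' n' s)
      - (β : ℂ) / 4 * S n s * ((β : ℂ) * m / 8 * gradPhi β p H' K' n' s))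
      = fun s => ((β : ℂ) ^ 2 * m / 32) * (gradPhi β p H K n s * S' n' s
        - S n s * gradPhi β p H' K' n' s) := by
    funext s
    ring
  refine ⟨_, _, _, _, hd, hd', ?_, ?_⟩
  · rw [e]
    exact (L.dec_pairing h L' n n').integrable.const_mul _
  · rw [e, integral_const_mul, L.integral_pairing_eq_zero hm h L' hz, mul_zero]

end IsPhasePoint

end SineGordon
end

theorem mainTheorem2 (m β : ℝ) (hm : 0 < m) (hβ : β ≠ 0) (Qm Qp : ℤ)
    (p : Fields) (hp : IsPhasePoint β Qm Qp p) :
    -- the transition matrix is the normalised solution of the auxiliary problem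
    (∀ (l : ℂ), l ≠ 0 → ∀ τ : ℝ, IsTransition m β p l τ (fun t => transition m β p t τ l)) ∧
    -- finite-volume bracket
    (∀ (l n : ℂ), l ≠ 0 → n ≠ 0 → l ^ 2 ≠ n ^ 2 → ∀ (τ t : ℝ), τ < t → ∀ i j k q : Fin 2,
      HasPoissonBracket (fun f => transition m β f t τ l i j) (fun f => transition m β f t τ n k q) p
        ((-(rMatrix β l n * (transition m β p t τ l ⊗ₖ transition m β p t τ n)
          - (transition m β p t τ l ⊗ₖ transition m β p t τ n) * rMatrix β l n)) (i, k) (j, q))) ∧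
    -- the monodromy matrix exists for real nonzero spectral parameter
    (∀ x : ℝ, x ≠ 0 → Tendsto (preMonodromy m β Qm Qp p (x : ℂ)) (atTop ×ˢ atBot)
      (𝓝 (monodromy m β Qm Qp p x))) ∧
    -- the principal values in the infinite-volume bracket exist
    (∀ h : ℝ × ℝ → ℂ, IsTestOn {z | 0 < z.1 * z.2} h → ∀ I J : Fin 2 × Fin 2,
      ∃ c : ℂ, Tendsto (pvCut fun z =>
        (monodromy m β Qm Qp p z.1 ⊗ₖ monodromy m β Qm Qp p z.2) I J * h z) (𝓝[>] 0) (𝓝 c)) ∧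
    -- infinite-volume bracket
    (∀ i j k q : Fin 2, HasPoissonBracketDistrib
      (fun x f => monodromy m β Qm Qp f x i j) (fun y f => monodromy m β Qm Qp f y k q) p
      {z | 0 < z.1 * z.2} (monodromyBracket m β Qm Qp p (i, k) (j, q))) ∧
    -- involution of `𝔞`
    HasPoissonBracketDistrib (fun x f => entryA m β Qm Qp f x) (fun y f => entryA m β Qm Qp f y) p
      {z | z.1 ≠ 0 ∧ z.2 ≠ 0} (fun _ => 0) ∧
    -- involution of the conserved quantities
    (∀ n : ℤ, Integrable (chargeDensity m β n p)) ∧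
    (∀ n n' : ℤ, HasPoissonBracket (charge m β n) (charge m β n') p 0) := by
  have hA := hp.isAsymptotic
  refine ⟨fun l _ τ => isTransition_transition hA.cont_phi hA.cont_Pi l τ,
    fun l n hl hn hln τ t hτ i j k q =>
      hasPoissonBracket_transition hA.cont_phi hA.cont_Pi hl hn hln hτ.le i j k q,
    fun x hx => hA.tendsto_preMonodromy hβ hx,
    fun h hh I J => exists_tendsto_pvCut hA hβ hh I J,
    fun i j k q => hA.hasPoissonBracketDistrib_monodromy hm hβ i j k q,
    hA.hasPoissonBracketDistrib_entryA hm hβ, hp.integrable_chargeDensity hβ m,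
    hp.hasPoissonBracket_charge hm.ne' hβ⟩
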